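/- Conventions. For $0<\alpha<1$, let $D^\alpha$ be the operator with $(D^\alpha f)^\wedge(\xi)=|\xi|^\alpha\hat f(\xi)$, where $\hat f(\xi)=\int_{\mathbb R} f(x)e^{-ix\xi}\,dx$. It is taken in the sense of tempered distributions on complex-valued functions $f$ on $\mathbb R$ with $\int |f(x)|(1+|x|)^{-1-\alpha}\,dx<\infty$ (this includes every $L^q$, $1\le q\le\infty$), that is, $\langle D^\alpha f,\varphi\rangle=\int f\,D^\alpha\varphi\,dx$ for all Schwartz $\varphi$. We say that $D^\alpha f$ is a function if this distribution is given by a measurable function $v$ with $\int|v(x)|(1+|x|)^{-k}\,dx<\infty$ for some $k\in\mathbb N$. Fix $\eta\in C_0^\infty(\mathbb R)$ with $\operatorname{supp}\eta\subset[\frac12,2]$ and $\sum_{N\in\mathbb Z}\left(\eta(2^{-N}x)+\eta(-2^{-N}x)\right)=1$ for all $x\neq0$. Let $Q_N$ be the operator with $(Q_Nf)^\wedge(\xi)=\left(\eta(2^{-N}\xi)+\eta(-2^{-N}\xi)\right)\hat f(\xi)$, and put $$\|Q_Nf\|_{L^\infty l^r_N}=\Big\|\Big(\sum_{N\in\mathbb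 Z}|Q_Nf|^r\Big)^{1/r}\Big\|_{L^\infty(\mathbb R)}.$$ Lemma 4.2. Let $0<\alpha<1$ and $1<p<\infty$. There is a constant $C$, depending only on $\alpha$, $p$ and $\eta$, such that for all $f\in L^p(\mathbb R)$ and all $g$ with $\int|g(x)|(1+|x|)^{-1-\alpha}\,dx<\infty$ for which $D^\alpha f$ and $D^\alpha g$ are functions and $\|Q_ND^\alpha g\|_{L^\infty l^2_N}+\|D^\alpha g\|_{L^\infty}<\infty$, also $D^\alpha(fg)$ is defined and is a function, and $$\|D^\alpha(fg)-gD^\alpha f-fD^\alpha g\|_{L^p}\le C\left(\|Q_ND^\alpha g\|_{L^\infty l^2_N}+\|D^\alpha g\|_{L^\infty}\right)\|f\|_{L^p}.$$ In particular, there is a constant $C$, depending only on $\alpha$ and $\eta$, such that for all $f\in L^2(\mathbb R)$ and all $g$ with $\int|g(x)|(1+|x|)^{-1-\alpha}\,dx<\infty$ for which $D^\alpha f$ and $D^\alpha g$ are functions and $\|Q_ND^\alpha g\|_{L^\infty l^1_N}<\infty$, also $D^\alpha(fg)$ is defined and is a function, and $$\|D^\alpha(fg)-gD^\alpha f\|_{L^2}\le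 C\,\|Q_ND^\alpha g\|_{L^\infty l^1_N}\,\|f\|_{L^2}.$$ -/

import Mathlib

open MeasureTheory
open scoped ENNReal NNReal FourierTransform SchwartzMap

noncomputable section

/-- `D^α φ` for a Schwartz function `φ`: the inverse Fourier transform of `|ξ|^α φ^(ξ)`.
Frequencies are angular (`∂ₓ` has symbol `iξ`), while Mathlib's `𝓕` has kernel `exp (-2πixζ)`;
hence the symbol is taken at `ξ = 2πζ`. -/
def fracDerivSchwartz (α : ℝ) (φ : 𝓢(ℝ, ℂ)) : ℝ → ℂ :=
  𝓕⁻ (fun ζ : ℝ => ((|2 * Real.pi * ζ| ^ α : ℝ) : ℂ) * 𝓕 (φ : ℝ → ℂ) ζ)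

/-- `v = D^α f` in the sense of tempered distributions, i.e. `(D^α f)^ = |ξ|^α f^`, where `f` and
`v` are functions: `⟨v, φ⟩ = ⟨f, D^α φ⟩` for all Schwartz functions `φ`.
As `D^α φ` is bounded by a multiple of `(1 + |x|)^(-1-α)` for `0 < α < 1`, the natural domain
consists of the `f` that are integrable against this weight (it contains every `L^q`,
`1 ≤ q ≤ ∞`); `v` is required to have at most polynomial growth in the mean, so that it is a
tempered distribution. The function `v` is determined by `f` up to a null set. -/
structure IsFracDeriv (α : ℝ) (f v : ℝ → ℂ) : Prop where
  integrable_weight : Integrable (fun x : ℝ => ((1 + |x|) ^ (-(1 + α)) : ℝ) • f x)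
  tempered : ∃ k : ℕ, Integrable (fun x : ℝ => ((1 + |x|) ^ k)⁻¹ • v x)
  pairing : ∀ φ : 𝓢(ℝ, ℂ), ∫ x, v x * φ x = ∫ x, f x * fracDerivSchwartz α φ x

/-- The functions `η` that may be used to build a Littlewood-Paley decomposition. -/
structure IsDyadicBump (η : ℝ → ℂ) : Prop where
  contDiff : ContDiff ℝ (⊤ : ℕ∞) η
  support_subset : tsupport η ⊆ Set.Icc (1 / 2) 2
  hasSum_one : ∀ x : ℝ, x ≠ 0 →
    HasSum (fun N : ℤ => η (x / (2 : ℝ) ^ N) + η (-(x / (2 : ℝ) ^ N))) 1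

/-- The convolution kernel of `Q_N`: the inverse Fourier transform of
`η(ξ/2^N) + η(-ξ/2^N)`, where `ξ = 2πζ` is the angular frequency. -/
def lpKernel (η : ℝ → ℂ) (N : ℤ) : ℝ → ℂ :=
  𝓕⁻ (fun ζ : ℝ =>
    η (2 * Real.pi * ζ / (2 : ℝ) ^ N) + η (-(2 * Real.pi * ζ / (2 : ℝ) ^ N)))

/-- The Littlewood-Paley operator `Q_N`, with symbol `η(ξ/2^N) + η(-ξ/2^N)`, on (tempered)
functions: convolution with the Schwartz function `lpKernel η N`. -/
def lpProj (η : ℝ → ℂ) (N : ℤ) (v : ℝ → ℂ) (x : ℝ) : ℂ :=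
  ∫ y, lpKernel η N (x - y) * v y

/-- The norm `‖F_N‖_{L^∞ l^r_N} = ‖(∑_N |F_N|^r)^(1/r)‖_{L^∞}`, with values in `[0, ∞]`. -/
def normLinftyLr (r : ℝ) (F : ℤ → ℝ → ℂ) : ℝ≥0∞ :=
  essSup (fun x : ℝ => (∑' N : ℤ, ‖F N x‖ₑ ^ r) ^ (1 / r)) volume

end

/-! Everything rests on the heat semigroup. Write v_s for the heat extension of v at time s. Since
|ξ|^α is a multiple of ∫_0^∞ r^(-1-α/2) (1 - exp(-rξ²)) dr, the function D^α φ is a multiple of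
∫_0^∞ r^(-1-α/2) (φ - φ_r) dr (`fracConst_smul_fracDeriv`). Tested against u, the commutator of D^α
with g is therefore a multiple of ∫_0^∞ r^(-1-α/2) ∫ g (f_r u - f u_r) dx dr. The heart of the
matter is to bound this form by C A ‖f‖_p ‖u‖_q when |D^α g| ≤ A and q is dual to p. Both
inequalities follow from it: f D^α g is trivially bounded in L^p by A ‖f‖_p, and the L^∞ l^1 norm of
the Littlewood-Paley pieces dominates ‖D^α g‖_∞ (`IsFracDeriv.ae_norm_le_normLinftyLr`).

For p = 2, the inner form is written as an integral over all later heat times s, and then over the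
transfer q of heat time between f and u. Integrations by parts leave exactly one derivative on g_s
and three derivatives on one of the other factors (`enorm_heat_commutator_le`). The derivative of
g_s is a Riesz potential in time of the derivatives of h_s, where h = D^α g (`heat1_rep`). After all
times are measured in units of s, Cauchy-Schwarz in (s, x) separates s f'''_s, which is square
integrable by Plancherel, from h'_s u_s, which is square integrable by a Carleson embedding for the
bounded function h (`carleson_embedding`). The embedding has a short energy proof: differentiate ∫
|h_s|² |u_s|² dx in s. The outcome is `exists_commutator_sq_bound`, with absolute values inside the
r-integral, so that it is uniform under truncation in r.

For p < 2, the truncated commutators are integral operators with kernel (g(x) - g(y)) k(x - y),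
where k and its derivative are bounded by |z|^(-1-α) and |z|^(-2-α) uniformly in the truncation.
Bounded D^α g makes g Hölder continuous of order α (`exists_regularity_bound`), hence the Hörmander
condition holds, and the Calderón-Zygmund decomposition and interpolation give L^p
(`exists_isCZKernel`, `IsCZKernel.lintegral_rpow_le`). For p > 2 the antisymmetry of the form in f
and u exchanges p and q (`exists_form_bound`).

For general f in L^p the function g is first mollified, so that g u is again a Schwartz function and
duality applies (`exists_commutator_bound_memLp`). The functional u ↦ ⟨D^α(fg) - g D^α f, u⟩ is then
represented by an L^p function: by Riesz' theorem for Schwartz f, and by completeness of L^p in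
general (`exists_commutator`). -/

open Real Set Filter Topology
open ENNReal (ofReal ofReal_ne_top ofReal_mul ofReal_le_ofReal ofReal_add mul_ne_top ofReal_toReal ofReal_rpow_of_nonneg ofReal_ofNat ofReal_le_ofReal_iff toReal_ofReal ofReal_pow mul_lt_top toReal_mono ofReal_lt_top ofReal_le_one tendsto_ofReal)
open Function (uncurry uncurry_def uncurry_apply_pair)
open Metric (ball mem_ball ball_mem_nhds mem_ball_self)
open Complex (I norm_real real_smul ofRealCLM ofReal_one norm_exp_ofReal_mul_I continuous_ofReal)

local notation "𝒮" => SchwartzMap ℝ ℂ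
local notation "ℝ₊" => Ioi (0 : ℝ)
local notation "𝒟" => fracDerivSchwartz

/-! ### The heat kernel: derivatives and Gaussian bounds. -/

/-- The heat kernel on the line. -/
noncomputable def hk (s x : ℝ) : ℝ := (√(4 * π * s))⁻¹ * rexp (-(x ^ 2 / (4 * s)))

/-- The space derivative of the heat kernel. -/
noncomputable def hk1 (s x : ℝ) : ℝ := -(x / (2 * s)) * hk s x

/-- The second space derivative of the heat kernel. -/
noncomputable def hk2 (s x : ℝ) : ℝ := (x ^ 2 / (4 * s ^ 2) - 1 / (2 * s)) * hk s x

lemma hk_nonneg (s x : ℝ) : 0 ≤ hk s x := by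
  unfold hk; positivity

lemma hk_neg (s x : ℝ) : hk s (-x) = hk s x := by simp [hk]

lemma hasDerivAt_hk {s : ℝ} (hs : 0 < s) (x : ℝ) : HasDerivAt (hk s) (hk1 s x) x := by
  have h : HasDerivAt (fun x : ℝ => -(x ^ 2 / (4 * s))) (-(x / (2 * s))) x := by
    have := ((hasDerivAt_pow 2 x).div_const (4 * s)).neg
    refine this.congr_deriv ?_
    push_cast; field_simp; ring
  have := (h.exp).const_mul (√(4 * π * s))⁻¹
  refine this.congr_deriv ?_
  unfold hk1 hk; ring

lemma hasDerivAt_hk1 {s : ℝ} (hs : 0 < s) (x : ℝ) : HasDerivAt (hk1 s) (hk2 s x) x := by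
  have h := (((hasDerivAt_id x).div_const (2 * s)).neg).mul (hasDerivAt_hk hs x)
  refine h.congr_deriv ?_
  simp only [hk2, hk1, Pi.neg_apply, id]; field_simp; ring

/-- The heat equation for the kernel: the time derivative is the same `hk2` as the second space
derivative. Later this trades integrals in time for integrations by parts in space. -/
lemma hasDerivAt_hk_time {s : ℝ} (hs : 0 < s) (x : ℝ) : HasDerivAt (fun s => hk s x) (hk2 s x) s := by
  have h0 : (4 * π * s) ≠ 0 := by positivity
  have hq : √(4 * π * s) ≠ 0 := by positivity
  have h1 : HasDerivAt (fun s : ℝ => √(4 * π * s)) (4 * π / (2 * √(4 * π * s))) s := by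
    have := ((hasDerivAt_id s).const_mul (4 * π)).sqrt h0
    simpa using this
  have h2 : HasDerivAt (fun s : ℝ => -(x ^ 2 / (4 * s))) (x ^ 2 / (4 * s ^ 2)) s := by
    have := ((hasDerivAt_const s (x ^ 2)).div ((hasDerivAt_id s).const_mul 4)
      (by simp only [id]; positivity)).neg
    refine this.congr_deriv ?_
    simp only [id]; field_simp; try ring
  have h := (h1.inv hq).mul h2.exp
  refine h.congr_deriv ?_
  have hsq : √(4 * π * s) ^ 2 = 4 * π * s := sq_sqrt (by positivity)
  simp only [hk2, hk, Pi.inv_apply]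
  have : 4 * π / (2 * √(4 * π * s)) / √(4 * π * s) ^ 2 = (√(4 * π * s))⁻¹ * (1 / (2 * s)) := by
    rw [hsq]; field_simp
  rw [neg_div, this]
  ring

/-- Half of the Gaussian exponent is set aside to absorb polynomial factors; the other half is the
kernel at the doubled time. -/
lemma hk_double {s : ℝ} (hs : 0 < s) (x : ℝ) : hk s x = √2 * rexp (-(x ^ 2 / (8 * s))) * hk (2 * s) x := by
  have h1 : √(4 * π * (2 * s)) = √2 * √(4 * π * s) := by
    rw [← sqrt_mul (by norm_num)]; congr 1; ring
  have h2 : rexp (-(x ^ 2 / (4 * s))) = rexp (-(x ^ 2 / (8 * s))) * rexp (-(x ^ 2 / (4 * (2 * s)))) := by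
    rw [← exp_add]; congr 1; field_simp; ring
  have h3 : √(4 * π * s) ≠ 0 := by positivity
  simp only [hk, h1, h2]
  field_simp

lemma sqrt_two_le : √2 ≤ 3 / 2 := by
  rw [sqrt_le_left (by norm_num)]; norm_num

/-- The factor |x|/s is absorbed by exp(-x²/(8s)) through 1 + t ≤ exp t. The price is a doubling of
the time, but the majorant is still a multiple of a probability density. -/
lemma abs_hk1_le {s : ℝ} (hs : 0 < s) (x : ℝ) : |hk1 s x| ≤ 3 * (√s)⁻¹ * hk (2 * s) x := by
  have hq : 0 < √s := sqrt_pos.2 hs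
  have hsq : √s ^ 2 = s := sq_sqrt hs.le
  rw [hk1, abs_mul, abs_neg, abs_of_nonneg (hk_nonneg _ _), hk_double hs, ← mul_assoc]
  refine mul_le_mul_of_nonneg_right ?_ (hk_nonneg _ _)
  have h1 : 1 + x ^ 2 / (8 * s) ≤ rexp (x ^ 2 / (8 * s)) := by
    linarith [Real.add_one_le_exp (x ^ 2 / (8 * s))]
  have h2 : |x / (2 * s)| ≤ 2 * (√s)⁻¹ * (1 + x ^ 2 / (8 * s)) := by
    rw [abs_div, abs_of_pos (by positivity : 0 < 2 * s)]
    have : |x| ≤ 4 * √s * (1 + x ^ 2 / (8 * s)) := by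
      have h3 : x ^ 2 / (8 * s) * (8 * √s ^ 2) = |x| ^ 2 := by rw [hsq, sq_abs]; field_simp
      by_contra hcon
      push Not at hcon
      have : |x| * (2 * √s) ≤ |x| ^ 2 / 4 + 4 * √s ^ 2 := by nlinarith [sq_nonneg (|x| / 2 - 2 * √s)]
      nlinarith [abs_nonneg x]
    calc |x| / (2 * s) ≤ (4 * √s * (1 + x ^ 2 / (8 * s))) / (2 * s) := by gcongr
      _ = 2 * (√s)⁻¹ * (1 + x ^ 2 / (8 * s)) := by
        have : 2 * s = 2 * √s ^ 2 := by rw [hsq]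
        rw [this]; field_simp; norm_num
  calc |x / (2 * s)| * (√2 * rexp (-(x ^ 2 / (8 * s))))
      ≤ (2 * (√s)⁻¹ * rexp (x ^ 2 / (8 * s))) * (3 / 2 * rexp (-(x ^ 2 / (8 * s)))) := by
        gcongr
        · exact h2.trans (by gcongr)
        · exact sqrt_two_le
    _ = 3 * (√s)⁻¹ * (rexp (x ^ 2 / (8 * s)) * rexp (-(x ^ 2 / (8 * s)))) := by ring
    _ = 3 * (√s)⁻¹ := by rw [← exp_add]; simp

lemma abs_hk2_le {s : ℝ} (hs : 0 < s) (x : ℝ) : |hk2 s x| ≤ 3 * s⁻¹ * hk (2 * s) x := by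
  rw [hk2, abs_mul, abs_of_nonneg (hk_nonneg _ _), hk_double hs, ← mul_assoc]
  refine mul_le_mul_of_nonneg_right ?_ (hk_nonneg _ _)
  have h1 : 1 + x ^ 2 / (8 * s) ≤ rexp (x ^ 2 / (8 * s)) := by
    linarith [Real.add_one_le_exp (x ^ 2 / (8 * s))]
  have h2 : |x ^ 2 / (4 * s ^ 2) - 1 / (2 * s)| ≤ 2 * s⁻¹ * (1 + x ^ 2 / (8 * s)) := by
    have e : 2 * s⁻¹ * (1 + x ^ 2 / (8 * s)) = x ^ 2 / (4 * s ^ 2) + 2 / s := by field_simp; ring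
    rw [e, abs_le]
    have p1 : 0 ≤ x ^ 2 / (4 * s ^ 2) := by positivity
    have p2 : 0 < 1 / s := by positivity
    have p3 : 1 / (2 * s) = 1 / s / 2 := by field_simp
    have p4 : 2 / s = 2 * (1 / s) := by ring
    constructor <;> linarith
  calc |x ^ 2 / (4 * s ^ 2) - 1 / (2 * s)| * (√2 * rexp (-(x ^ 2 / (8 * s))))
      ≤ (2 * s⁻¹ * rexp (x ^ 2 / (8 * s))) * (3 / 2 * rexp (-(x ^ 2 / (8 * s)))) := by
        gcongr
        · exact h2.trans (by gcongr)
        · exact sqrt_two_le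
    _ = 3 * s⁻¹ * (rexp (x ^ 2 / (8 * s)) * rexp (-(x ^ 2 / (8 * s)))) := by ring
    _ = 3 * s⁻¹ := by rw [← exp_add]; simp

lemma hk_eq_gaussian (s : ℝ) : hk s = fun x => (√(4 * π * s))⁻¹ * rexp (-(4 * s)⁻¹ * x ^ 2) := by
  ext x; simp only [hk]; congr 2; ring

lemma integrable_hk {s : ℝ} (hs : 0 < s) : Integrable (hk s) := by
  rw [hk_eq_gaussian]
  exact (integrable_exp_neg_mul_sq (by positivity)).const_mul _

lemma integral_hk {s : ℝ} (hs : 0 < s) : ∫ x, hk s x = 1 := by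
  rw [hk_eq_gaussian, integral_const_mul, integral_gaussian]
  have : π / (4 * s)⁻¹ = 4 * π * s := by field_simp
  rw [this]
  exact inv_mul_cancel₀ (by positivity)

lemma hk_le_of_mem (k : ℕ) {a b : ℝ} (ha : 0 < a) : ∃ C : ℝ, 0 ≤ C ∧ ∀ s ∈ Icc a b, ∀ z, hk s z ≤ C * ((1 + |z|) ^ k)⁻¹ := by
  -- The factorial comes from t^k ≤ k! exp t at t = 1 + |z|, and exp(1 + b) from -z²/(4s) ≤ b - |z|.
  refine ⟨(√(4 * π * a))⁻¹ * (k.factorial * rexp (1 + b)), by positivity, fun s hs z => ?_⟩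
  have hs0 : 0 < s := ha.trans_le hs.1
  have hb0 : 0 < b := hs0.trans_le hs.2
  have hz : 0 < 1 + |z| := by positivity
  rw [← div_eq_mul_inv, le_div_iff₀ (by positivity)]
  have h1 : (1 + |z|) ^ k ≤ k.factorial * rexp (1 + |z|) := by
    have := Real.pow_div_factorial_le_exp (1 + |z|) hz.le k
    rwa [div_le_iff₀' (by positivity)] at this
  have h2 : rexp (-(z ^ 2 / (4 * s))) ≤ rexp (b - |z|) := by
    apply exp_le_exp.2
    have : |z| ≤ z ^ 2 / (4 * b) + b := by
      rw [div_add' _ _ _ (by positivity), le_div_iff₀ (by positivity), ← sq_abs]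
      nlinarith [sq_nonneg (|z| - 2 * b)]
    have h3 : z ^ 2 / (4 * b) ≤ z ^ 2 / (4 * s) := by
      gcongr; exact hs.2
    linarith
  have h3 : (√(4 * π * s))⁻¹ ≤ (√(4 * π * a))⁻¹ := by
    gcongr; exact hs.1
  calc hk s z * (1 + |z|) ^ k
      ≤ ((√(4 * π * a))⁻¹ * rexp (b - |z|)) * (k.factorial * rexp (1 + |z|)) := by
        unfold hk; gcongr
    _ = (√(4 * π * a))⁻¹ * (k.factorial * (rexp (b - |z|) * rexp (1 + |z|))) := by ring
    _ = _ := by rw [← exp_add]; congr 3; ring_nf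

lemma hkernels_le (k : ℕ) {a b : ℝ} (ha : 0 < a) : ∃ C : ℝ, 0 ≤ C ∧ ∀ s ∈ Icc a b, ∀ z,
    |hk s z| ≤ C * ((1 + |z|) ^ k)⁻¹ ∧ |hk1 s z| ≤ C * ((1 + |z|) ^ k)⁻¹ ∧
      |hk2 s z| ≤ C * ((1 + |z|) ^ k)⁻¹ := by
  obtain ⟨C₀, hC₀, h₀⟩ := hk_le_of_mem k (a := a) (b := b) ha
  obtain ⟨C₁, hC₁, h₁⟩ := hk_le_of_mem k (a := 2 * a) (b := 2 * b) (by positivity)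
  refine ⟨C₀ + 3 * (√a)⁻¹ * C₁ + 3 * a⁻¹ * C₁, by positivity, fun s hs z => ?_⟩
  have hs0 : 0 < s := ha.trans_le hs.1
  have hw : 0 ≤ ((1 + |z|) ^ k)⁻¹ := by positivity
  have hd := h₁ (2 * s) ⟨by linarith [hs.1], by linarith [hs.2]⟩ z
  have e1 : 0 ≤ C₀ * ((1 + |z|) ^ k)⁻¹ := by positivity
  have e2 : 0 ≤ 3 * (√a)⁻¹ * (C₁ * ((1 + |z|) ^ k)⁻¹) := by positivity
  have e3 : 0 ≤ 3 * a⁻¹ * (C₁ * ((1 + |z|) ^ k)⁻¹) := by positivity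
  refine ⟨?_, ?_, ?_⟩
  · rw [abs_of_nonneg (hk_nonneg _ _)]
    have := h₀ s hs z
    linarith
  · have : |hk1 s z| ≤ 3 * (√a)⁻¹ * (C₁ * ((1 + |z|) ^ k)⁻¹) := by
      refine (abs_hk1_le hs0 z).trans ?_
      gcongr
      · exact hk_nonneg _ _
      · exact hs.1
    linarith
  · have : |hk2 s z| ≤ 3 * a⁻¹ * (C₁ * ((1 + |z|) ^ k)⁻¹) := by
      refine (abs_hk2_le hs0 z).trans ?_
      gcongr
      · exact hk_nonneg _ _
      · exact hs.1
    linarith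

/-! ### Tempered functions and their heat extensions. -/

/-- Functions of at most polynomial growth in the mean. -/
def Tempered (v : ℝ → ℂ) : Prop := ∃ k : ℕ, Integrable (fun x : ℝ => ((1 + |x|) ^ k)⁻¹ • v x)

lemma continuous_weight (k : ℕ) : Continuous fun x : ℝ => ((1 + |x|) ^ k)⁻¹ := Continuous.inv₀ (by fun_prop) (fun x => by positivity)

lemma aestronglyMeasurable_of_weight {v : ℝ → ℂ} {k : ℕ}
    (h : Integrable (fun x : ℝ => ((1 + |x|) ^ k)⁻¹ • v x)) : AEStronglyMeasurable v := by
  have h1 : v = fun x => ((1 + |x|) ^ k) • (((1 + |x|) ^ k)⁻¹ • v x) := by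
    ext x; rw [smul_smul, mul_inv_cancel₀ (by positivity), one_smul]
  rw [h1]
  exact (by fun_prop : Continuous fun x : ℝ => (1 + |x|) ^ k).aestronglyMeasurable.smul h.1

lemma Tempered.aestronglyMeasurable {v : ℝ → ℂ} (h : Tempered v) : AEStronglyMeasurable v := by
  obtain ⟨k, hk⟩ := h
  exact aestronglyMeasurable_of_weight hk

/-- Peetre's inequality: a polynomial weight moves from x - y to y at the price of a power of 1 +
|x|. -/
lemma one_add_abs_sub (x y : ℝ) (k : ℕ) : ((1 + |x - y|) ^ k)⁻¹ ≤ (1 + |x|) ^ k * ((1 + |y|) ^ k)⁻¹ := by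
  rw [← div_eq_mul_inv, le_div_iff₀ (by positivity), inv_mul_le_iff₀ (by positivity), ← mul_pow]
  gcongr
  have : |y| ≤ |x| + |x - y| := by
    have := abs_sub_abs_le_abs_sub y x
    rw [abs_sub_comm] at this; linarith
  nlinarith [abs_nonneg x, abs_nonneg (x - y)]

/-- Integration of a rapidly decreasing kernel against a tempered function. -/
lemma integrable_smul_of_weight {v : ℝ → ℂ} {k : ℕ} {F : ℝ → ℝ} {C : ℝ}
    (hv : Integrable (fun x : ℝ => ((1 + |x|) ^ k)⁻¹ • v x)) (hF : AEStronglyMeasurable F)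
    (hb : ∀ y, |F y| ≤ C * ((1 + |y|) ^ k)⁻¹) : Integrable fun y => F y • v y := by
  refine (hv.norm.const_mul C).mono (hF.smul (aestronglyMeasurable_of_weight hv)) ?_
  refine .of_forall fun y => ?_
  have hw : 0 ≤ ((1 + |y|) ^ k)⁻¹ := by positivity
  rw [norm_smul, norm_mul, norm_norm, norm_smul, norm_eq_abs, norm_eq_abs, norm_eq_abs, abs_of_nonneg hw, ← mul_assoc]
  gcongr
  exact (hb y).trans (by gcongr; exact le_abs_self C)

lemma hasDerivAt_integral_smul {v : ℝ → ℂ} {k : ℕ} {F F' : ℝ → ℝ → ℝ} {C ε t₀ : ℝ}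
    (hε : 0 < ε) (hv : Integrable (fun x : ℝ => ((1 + |x|) ^ k)⁻¹ • v x))
    (hF : ∀ t, AEStronglyMeasurable (F t)) (hF' : AEStronglyMeasurable (F' t₀))
    (hb : ∀ t ∈ ball t₀ ε, ∀ y, |F t y| ≤ C * ((1 + |y|) ^ k)⁻¹)
    (hb' : ∀ t ∈ ball t₀ ε, ∀ y, |F' t y| ≤ C * ((1 + |y|) ^ k)⁻¹)
    (hd : ∀ t ∈ ball t₀ ε, ∀ y, HasDerivAt (fun t => F t y) (F' t y) t) :
    HasDerivAt (fun t => ∫ y, F t y • v y) (∫ y, F' t₀ y • v y) t₀ := by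
  have hvm := aestronglyMeasurable_of_weight hv
  refine (hasDerivAt_integral_of_dominated_loc_of_deriv_le (F' := fun t y => F' t y • v y)
    (bound := fun y => |C| * ‖((1 + |y|) ^ k)⁻¹ • v y‖) (ball_mem_nhds t₀ hε)
    (.of_forall fun t => (hF t).smul hvm)
    (integrable_smul_of_weight hv (hF t₀) (hb t₀ (mem_ball_self hε)))
    (hF'.smul hvm) ?_ (hv.norm.const_mul _) ?_).2
  · refine .of_forall fun y t ht => ?_
    have hw : 0 ≤ ((1 + |y|) ^ k)⁻¹ := by positivity
    rw [norm_smul, norm_smul, norm_eq_abs, norm_eq_abs, abs_of_nonneg hw, ← mul_assoc]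
    gcongr
    exact (hb' t ht y).trans (by gcongr; exact le_abs_self C)
  · exact .of_forall fun y t ht => (hd t ht y).smul_const (v y)

/-- The heat extension of a function, `e^{s∂²} v`. -/
noncomputable def heat (s : ℝ) (v : ℝ → ℂ) (x : ℝ) : ℂ := ∫ y, hk s (x - y) • v y

/-- The space derivative of the heat extension. -/
noncomputable def heat1 (s : ℝ) (v : ℝ → ℂ) (x : ℝ) : ℂ := ∫ y, hk1 s (x - y) • v y

/-- The second space derivative of the heat extension. -/
noncomputable def heat2 (s : ℝ) (v : ℝ → ℂ) (x : ℝ) : ℂ := ∫ y, hk2 s (x - y) • v y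

lemma measurable_hk_prod : Measurable fun p : ℝ × ℝ => hk p.1 p.2 := by
  unfold hk; fun_prop

lemma measurable_hk1_prod : Measurable fun p : ℝ × ℝ => hk1 p.1 p.2 := by
  unfold hk1 hk; fun_prop

lemma measurable_hk2_prod : Measurable fun p : ℝ × ℝ => hk2 p.1 p.2 := by
  unfold hk2 hk; fun_prop

/-- The integral does not change when `v` is replaced by a strongly measurable representative, after
which the integrand is jointly measurable. Measurability in time and space together is what the
later uses of Tonelli's theorem require. -/
lemma measurable_kernel_integral {K : ℝ × ℝ → ℝ} (hK : Measurable K) {v : ℝ → ℂ}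
    (hv : AEStronglyMeasurable v) :
    Measurable fun p : ℝ × ℝ => ∫ y, K (p.1, p.2 - y) • v y := by
  have h : (fun p : ℝ × ℝ => ∫ y, K (p.1, p.2 - y) • v y) = fun p : ℝ × ℝ => ∫ y, K (p.1, p.2 - y) • hv.mk v y := by
    ext p
    refine integral_congr_ae ?_
    filter_upwards [hv.ae_eq_mk] with y hy
    rw [hy]
  rw [h]
  have h2 : StronglyMeasurable fun q : (ℝ × ℝ) × ℝ => K (q.1.1, q.1.2 - q.2) • hv.mk v q.2 := by
    refine StronglyMeasurable.smul (f := fun q : (ℝ × ℝ) × ℝ => K (q.1.1, q.1.2 - q.2))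
      (g := fun q : (ℝ × ℝ) × ℝ => hv.mk v q.2) ?_ ?_
    · exact (hK.comp (by fun_prop)).stronglyMeasurable
    · exact hv.stronglyMeasurable_mk.comp_measurable measurable_snd
  exact (h2.integral_prod_right (ν := volume)).measurable

lemma measurable_heat {v : ℝ → ℂ} (hv : AEStronglyMeasurable v) :
    Measurable fun p : ℝ × ℝ => heat p.1 v p.2 := measurable_kernel_integral measurable_hk_prod hv

lemma measurable_heat1 {v : ℝ → ℂ} (hv : AEStronglyMeasurable v) :
    Measurable fun p : ℝ × ℝ => heat1 p.1 v p.2 := measurable_kernel_integral measurable_hk1_prod hv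

lemma measurable_heat2 {v : ℝ → ℂ} (hv : AEStronglyMeasurable v) :
    Measurable fun p : ℝ × ℝ => heat2 p.1 v p.2 := measurable_kernel_integral measurable_hk2_prod hv

lemma continuous_hk {s : ℝ} (hs : 0 < s) : Continuous (hk s) := continuous_iff_continuousAt.2 fun x => (hasDerivAt_hk hs x).continuousAt

lemma measurable_hk (s : ℝ) : Measurable (hk s) := by unfold hk; fun_prop
lemma measurable_hk1 (s : ℝ) : Measurable (hk1 s) := by unfold hk1 hk; fun_prop
lemma measurable_hk2 (s : ℝ) : Measurable (hk2 s) := by unfold hk2 hk; fun_prop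

/-- Kernel bounds that are uniform in compact sets of times and points. -/
lemma hkernels_sub_le (k : ℕ) {a b : ℝ} (ha : 0 < a) (R : ℝ) : ∃ C : ℝ, 0 ≤ C ∧ ∀ s ∈ Icc a b,
    ∀ x, |x| ≤ R → ∀ y, |hk s (x - y)| ≤ C * ((1 + |y|) ^ k)⁻¹ ∧
      |hk1 s (x - y)| ≤ C * ((1 + |y|) ^ k)⁻¹ ∧ |hk2 s (x - y)| ≤ C * ((1 + |y|) ^ k)⁻¹ := by
  obtain ⟨C, hC, h⟩ := hkernels_le k (a := a) (b := b) ha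
  refine ⟨C * (1 + |R|) ^ k, by positivity, fun s hs x hx y => ?_⟩
  have key : C * ((1 + |x - y|) ^ k)⁻¹ ≤ C * (1 + |R|) ^ k * ((1 + |y|) ^ k)⁻¹ := by
    rw [mul_assoc]
    refine mul_le_mul_of_nonneg_left ((one_add_abs_sub x y k).trans ?_) hC
    exact mul_le_mul_of_nonneg_right (pow_le_pow_left₀ (by positivity)
      (by linarith [hx.trans (le_abs_self R)]) k) (by positivity)
  obtain ⟨h0, h1, h2⟩ := h s hs (x - y)
  exact ⟨h0.trans key, h1.trans key, h2.trans key⟩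

lemma integrable_hkernels_smul {v : ℝ → ℂ} (hv : Tempered v) {s : ℝ} (hs : 0 < s) (x : ℝ) :
    Integrable (fun y => hk s (x - y) • v y) ∧ Integrable (fun y => hk1 s (x - y) • v y) ∧ Integrable (fun y => hk2 s (x - y) • v y) := by
  obtain ⟨k, hk'⟩ := hv
  obtain ⟨C, hC, h⟩ := hkernels_sub_le k (a := s) (b := s) hs |x|
  have := h s ⟨le_rfl, le_rfl⟩ x le_rfl
  refine ⟨integrable_smul_of_weight hk' ?_ fun y => (this y).1, integrable_smul_of_weight hk' ?_ fun y => (this y).2.1,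
    integrable_smul_of_weight hk' ?_ fun y => (this y).2.2⟩
  · exact ((measurable_hk s).comp (by fun_prop)).aestronglyMeasurable
  · exact ((measurable_hk1 s).comp (by fun_prop)).aestronglyMeasurable
  · exact ((measurable_hk2 s).comp (by fun_prop)).aestronglyMeasurable

lemma hasDerivAt_heat {v : ℝ → ℂ} (hv : Tempered v) {s : ℝ} (hs : 0 < s) (x : ℝ) : HasDerivAt (heat s v) (heat1 s v x) x := by
  obtain ⟨k, hk'⟩ := hv
  obtain ⟨C, hC, h⟩ := hkernels_sub_le k (a := s) (b := s) hs (|x| + 1)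
  have hx : ∀ t ∈ ball x 1, |t| ≤ |x| + 1 := fun t ht => by
    rw [mem_ball, dist_eq] at ht
    have := abs_sub_abs_le_abs_sub t x
    linarith
  refine hasDerivAt_integral_smul (F := fun t y => hk s (t - y)) (F' := fun t y => hk1 s (t - y))
    one_pos hk' (fun t => ?_) ?_
    (fun t ht y => (h s ⟨le_rfl, le_rfl⟩ t (hx t ht) y).1)
    (fun t ht y => (h s ⟨le_rfl, le_rfl⟩ t (hx t ht) y).2.1) fun t ht y => ?_
  · exact ((measurable_hk s).comp (by fun_prop)).aestronglyMeasurable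
  · exact ((measurable_hk1 s).comp (by fun_prop)).aestronglyMeasurable
  · exact (hasDerivAt_hk hs (t - y)).comp_sub_const t y

lemma hasDerivAt_heat1 {v : ℝ → ℂ} (hv : Tempered v) {s : ℝ} (hs : 0 < s) (x : ℝ) : HasDerivAt (heat1 s v) (heat2 s v x) x := by
  obtain ⟨k, hk'⟩ := hv
  obtain ⟨C, hC, h⟩ := hkernels_sub_le k (a := s) (b := s) hs (|x| + 1)
  have hx : ∀ t ∈ ball x 1, |t| ≤ |x| + 1 := fun t ht => by
    rw [mem_ball, dist_eq] at ht
    have := abs_sub_abs_le_abs_sub t x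
    linarith
  refine hasDerivAt_integral_smul (F := fun t y => hk1 s (t - y)) (F' := fun t y => hk2 s (t - y))
    one_pos hk' (fun t => ?_) ?_
    (fun t ht y => (h s ⟨le_rfl, le_rfl⟩ t (hx t ht) y).2.1)
    (fun t ht y => (h s ⟨le_rfl, le_rfl⟩ t (hx t ht) y).2.2) fun t ht y => ?_
  · exact ((measurable_hk1 s).comp (by fun_prop)).aestronglyMeasurable
  · exact ((measurable_hk2 s).comp (by fun_prop)).aestronglyMeasurable
  · exact (hasDerivAt_hk1 hs (t - y)).comp_sub_const t y

/-- The heat equation. -/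
lemma hasDerivAt_heat_time {v : ℝ → ℂ} (hv : Tempered v) {s : ℝ} (hs : 0 < s) (x : ℝ) :
    HasDerivAt (fun s => heat s v x) (heat2 s v x) s := by
  obtain ⟨k, hk'⟩ := hv
  obtain ⟨C, hC, h⟩ := hkernels_sub_le k (a := s / 2) (b := 2 * s) (by positivity) |x|
  have hx : ∀ t ∈ ball s (s / 2), t ∈ Icc (s / 2) (2 * s) := fun t ht => by
    rw [mem_ball, dist_eq, abs_lt] at ht
    constructor <;> linarith
  refine hasDerivAt_integral_smul (F := fun t y => hk t (x - y)) (F' := fun t y => hk2 t (x - y))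
    (half_pos hs) hk' (fun t => ?_) ?_
    (fun t ht y => (h t (hx t ht) x le_rfl y).1)
    (fun t ht y => (h t (hx t ht) x le_rfl y).2.2) fun t ht y => ?_
  · exact ((measurable_hk t).comp (by fun_prop)).aestronglyMeasurable
  · exact ((measurable_hk2 s).comp (by fun_prop)).aestronglyMeasurable
  · have := (hx t ht).1
    exact hasDerivAt_hk_time (by linarith) (x - y)

/-- The heat kernel has mass one, so a convolution kernel dominated by c times it acts on L^∞ with
norm at most c. -/
lemma integral_kernel_bound {v : ℝ → ℂ} {A : ℝ} (hA : ∀ᵐ y, ‖v y‖ ≤ A) {F : ℝ → ℝ} {c s : ℝ}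
    (hs : 0 < s) (hc : 0 ≤ c) (hF : ∀ z, |F z| ≤ c * hk s z) (x : ℝ) :
    ‖∫ y, F (x - y) • v y‖ ≤ c * A := by
  have hi : Integrable fun y => c * hk s (x - y) * A := (((integrable_hk hs).comp_sub_left x).const_mul c).mul_const A
  refine (norm_integral_le_of_norm_le hi ?_).trans (le_of_eq ?_)
  · filter_upwards [hA] with y hy
    rw [norm_smul, norm_eq_abs]
    have := hk_nonneg s (x - y)
    gcongr
    exact hF _
  · rw [integral_mul_const, integral_const_mul, integral_sub_left_eq_self (hk s), integral_hk hs, mul_one]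

lemma norm_heat_le {v : ℝ → ℂ} {A : ℝ} (hA : ∀ᵐ y, ‖v y‖ ≤ A) {s : ℝ} (hs : 0 < s) (x : ℝ) : ‖heat s v x‖ ≤ A := by
  have := integral_kernel_bound hA (F := hk s) hs zero_le_one
    (fun z => by rw [abs_of_nonneg (hk_nonneg _ _), one_mul]) x
  rwa [one_mul] at this

lemma norm_heat1_le {v : ℝ → ℂ} {A : ℝ} (hA : ∀ᵐ y, ‖v y‖ ≤ A) {s : ℝ} (hs : 0 < s) (x : ℝ) : ‖heat1 s v x‖ ≤ 3 * (√s)⁻¹ * A :=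
  integral_kernel_bound hA (F := hk1 s) (by positivity : 0 < 2 * s) (by positivity)
    (fun z => abs_hk1_le hs z) x

lemma norm_heat2_le {v : ℝ → ℂ} {A : ℝ} (hA : ∀ᵐ y, ‖v y‖ ≤ A) {s : ℝ} (hs : 0 < s) (x : ℝ) : ‖heat2 s v x‖ ≤ 3 * s⁻¹ * A :=
  integral_kernel_bound hA (F := hk2 s) (by positivity : 0 < 2 * s) (by positivity)
    (fun z => abs_hk2_le hs z) x

/-! ### Heat flow on Schwartz functions: derivatives and uniform decay. -/

/-- Derivative of a complex Schwartz function on the line. -/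
noncomputable def sderiv (f : 𝒮) : 𝒮 := SchwartzMap.derivCLM ℂ ℂ f

lemma hasDerivAt_schwartz (f : 𝒮) (x : ℝ) : HasDerivAt f (sderiv f x) x := f.hasDerivAt x

lemma schwartz_decay (f : 𝒮) (k : ℕ) : ∃ C : ℝ, 0 ≤ C ∧ ∀ x, ‖f x‖ ≤ C * ((1 + |x|) ^ k)⁻¹ := by
  refine ⟨2 ^ k * ((Finset.Iic (k, 0)).sup fun m => SchwartzMap.seminorm ℝ m.1 m.2) f, by positivity, fun x => ?_⟩
  have := SchwartzMap.one_add_le_sup_seminorm_apply (𝕜 := ℝ) (m := (k, 0)) le_rfl le_rfl f x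
  rw [norm_iteratedFDeriv_zero, norm_eq_abs] at this
  rw [← div_eq_mul_inv, le_div_iff₀ (by positivity), mul_comm]
  exact this

lemma schwartz_tempered (f : 𝒮) : Tempered f := ⟨0, by simpa using f.integrable⟩

lemma integrable_weight_two : Integrable fun x : ℝ => ((1 + |x|) ^ 2)⁻¹ := by
  refine integrable_inv_one_add_sq.mono (continuous_weight 2).aestronglyMeasurable
    (.of_forall fun x => ?_)
  rw [norm_of_nonneg (by positivity), norm_of_nonneg (by positivity)]
  gcongr
  rw [← sq_abs x]
  nlinarith [abs_nonneg x]

lemma tempered_of_bounded {v : ℝ → ℂ} {A : ℝ} (hm : AEStronglyMeasurable v)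
    (hA : ∀ᵐ y, ‖v y‖ ≤ A) : Tempered v := by
  refine ⟨2, (integrable_weight_two.mul_const A).mono ((continuous_weight 2).aestronglyMeasurable.smul hm) ?_⟩
  filter_upwards [hA] with y hy
  rw [norm_smul, norm_mul]
  gcongr
  exact hy.trans (le_abs_self A)

lemma heat_eq_sub (s : ℝ) (v : ℝ → ℂ) (x : ℝ) : heat s v x = ∫ z, hk s z • v (x - z) := by
  rw [heat, ← integral_sub_left_eq_self (fun y => hk s y • v (x - y)) volume x]
  simp

/-- Integration by parts moves the derivative from the kernel to the function. -/
lemma heat1_schwartz (f : 𝒮) {s : ℝ} (hs : 0 < s) (x : ℝ) : heat1 s f x = heat s (sderiv f) x := by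
  have h := integral_bilinear_hasDerivAt_right_eq_neg_left_of_integrable
    (L := ContinuousLinearMap.lsmul ℝ ℝ) (u := fun y => hk s (x - y)) (u' := fun y => -hk1 s (x - y))
    (v := f) (v' := sderiv f)
    (fun y _ => (hasDerivAt_hk hs (x - y)).comp_const_sub x y) (fun y _ => hasDerivAt_schwartz f y)
    (integrable_hkernels_smul (schwartz_tempered _) hs x).1
    (by simpa using (integrable_hkernels_smul (schwartz_tempered f) hs x).2.1.neg)
    (integrable_hkernels_smul (schwartz_tempered f) hs x).1
  simp only [ContinuousLinearMap.lsmul_apply, neg_smul, integral_neg, neg_neg] at h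
  exact h.symm

lemma heat2_schwartz (f : 𝒮) {s : ℝ} (hs : 0 < s) (x : ℝ) : heat2 s f x = heat s (sderiv (sderiv f)) x := by
  have h1 := hasDerivAt_heat1 (schwartz_tempered f) hs x
  have h2 := hasDerivAt_heat (schwartz_tempered (sderiv f)) hs x
  have : heat1 s f = heat s (sderiv f) := funext fun y => heat1_schwartz f hs y
  rw [this] at h1
  rw [h1.unique h2, heat1_schwartz _ hs]

lemma hk_scale {s : ℝ} (hs : 0 < s) (z : ℝ) : hk s z = (√s)⁻¹ * hk 1 (z / √s) := by
  have h : √(4 * π * s) = √s * √(4 * π * 1) := by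
    rw [← sqrt_mul hs.le]; congr 1; ring
  simp only [hk, h, div_pow, sq_sqrt hs.le]
  rw [mul_inv, mul_assoc]
  congr 4
  field_simp

lemma integrable_hk_moment (k : ℕ) : Integrable fun t => hk 1 t * (1 + |t|) ^ k := by
  obtain ⟨C, hC, h⟩ := hk_le_of_mem (k + 2) (a := 1) (b := 1) one_pos
  refine (integrable_weight_two.const_mul C).mono
    ((continuous_hk one_pos).mul (by fun_prop)).aestronglyMeasurable (.of_forall fun t => ?_)
  have h1 := h 1 (by simp) t
  rw [norm_of_nonneg (mul_nonneg (hk_nonneg _ _) (by positivity)), norm_of_nonneg (by positivity)]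
  calc hk 1 t * (1 + |t|) ^ k ≤ C * ((1 + |t|) ^ (k + 2))⁻¹ * (1 + |t|) ^ k := by gcongr
    _ = C * ((1 + |t|) ^ 2)⁻¹ := by
      rw [pow_add]; field_simp

lemma integral_hk_scale {s : ℝ} (hs : 0 < s) (w : ℝ → ℝ) : ∫ z, hk s z * w (z / √s) = ∫ t, hk 1 t * w t := by
  have hq : 0 < √s := sqrt_pos.2 hs
  have : (fun z => hk s z * w (z / √s)) = fun z => (√s)⁻¹ * (fun t => hk 1 t * w t) (z / √s) := by
    ext z; simp only [hk_scale hs z]; ring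
  rw [this, integral_const_mul, Measure.integral_comp_div (fun t => hk 1 t * w t), abs_of_pos hq,
    smul_eq_mul, ← mul_assoc, inv_mul_cancel₀ hq.ne', one_mul]

lemma integrable_hk_scale {s : ℝ} (hs : 0 < s) {w : ℝ → ℝ} (hw : Integrable fun t => hk 1 t * w t) :
    Integrable fun z => hk s z * w (z / √s) := by
  have hq : 0 < √s := sqrt_pos.2 hs
  have : (fun z => hk s z * w (z / √s)) = fun z => (√s)⁻¹ * (fun t => hk 1 t * w t) (z / √s) := by
    ext z; simp only [hk_scale hs z]; ring
  rw [this]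
  exact (hw.comp_div hq.ne').const_mul _

/-- Rescale to time one: with t = z/√s the weight is at most (1 + √b)^k (1 + |t|)^k, so the moments
stay bounded as s tends to zero. -/
lemma hk_moment_bound (k : ℕ) (b : ℝ) : ∃ C : ℝ, 0 ≤ C ∧ ∀ s, 0 < s → s ≤ b →
    Integrable (fun z => hk s z * (1 + |z|) ^ k) ∧ ∫ z, hk s z * (1 + |z|) ^ k ≤ C := by
  have hi := (integrable_hk_moment k).const_mul ((1 + √b) ^ k)
  have h0 : ∀ t, 0 ≤ (1 + √b) ^ k * (hk 1 t * (1 + |t|) ^ k) := fun t =>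
    mul_nonneg (by positivity) (mul_nonneg (hk_nonneg _ _) (by positivity))
  refine ⟨∫ t, (1 + √b) ^ k * (hk 1 t * (1 + |t|) ^ k), integral_nonneg h0, fun s hs hsb => ?_⟩
  have e : ∀ t, (1 + √b) ^ k * (hk 1 t * (1 + |t|) ^ k) = hk 1 t * ((1 + √b) ^ k * (1 + |t|) ^ k) := fun t => by ring
  simp only [e] at hi ⊢
  have hq : 0 < √s := sqrt_pos.2 hs
  have hle : ∀ z, hk s z * (1 + |z|) ^ k ≤ hk s z * ((1 + √b) ^ k * (1 + |z / √s|) ^ k) := fun z => by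
    refine mul_le_mul_of_nonneg_left ?_ (hk_nonneg _ _)
    rw [← mul_pow]
    gcongr
    have h1 : |z| = √s * |z / √s| := by
      rw [abs_div, abs_of_pos hq]; field_simp
    have h2 : √s ≤ √b := sqrt_le_sqrt hsb
    have h3 := abs_nonneg (z / √s)
    rw [h1]
    nlinarith [sqrt_nonneg b]
  have hi2 := integrable_hk_scale hs (w := fun t => (1 + √b) ^ k * (1 + |t|) ^ k) hi
  have hi3 : Integrable (fun z => hk s z * (1 + |z|) ^ k) := by
    refine hi2.mono ((continuous_hk hs).mul (by fun_prop)).aestronglyMeasurable (.of_forall fun z => ?_)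
    rw [norm_eq_abs, norm_eq_abs, abs_of_nonneg (mul_nonneg (hk_nonneg _ _) (by positivity))]
    exact (hle z).trans (le_abs_self _)
  refine ⟨hi3, (integral_mono hi3 hi2 hle).trans (le_of_eq ?_)⟩
  exact integral_hk_scale hs (fun t => (1 + √b) ^ k * (1 + |t|) ^ k)

/-- Heat evolution preserves polynomial decay, locally uniformly in time. -/
lemma heat_decay_of_decay (k : ℕ) (b : ℝ) : ∃ C : ℝ, 0 ≤ C ∧ ∀ (v : ℝ → ℂ) (D : ℝ), 0 ≤ D →
    (∀ x, ‖v x‖ ≤ D * ((1 + |x|) ^ k)⁻¹) → ∀ s, 0 < s → s ≤ b → ∀ x,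
    ‖heat s v x‖ ≤ C * D * ((1 + |x|) ^ k)⁻¹ := by
  obtain ⟨C, hC, h⟩ := hk_moment_bound k b
  refine ⟨C, hC, fun v D hD hv s hs hsb x => ?_⟩
  obtain ⟨hi, hb⟩ := h s hs hsb
  rw [heat_eq_sub]
  refine (norm_integral_le_of_norm_le ((hi.mul_const D).mul_const ((1 + |x|) ^ k)⁻¹)
    (.of_forall fun z => ?_)).trans ?_
  · rw [norm_smul, norm_eq_abs, abs_of_nonneg (hk_nonneg _ _)]
    have h1 := one_add_abs_sub z (z - x) k
    have e : z - (z - x) = x := by ring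
    rw [e] at h1
    have h2 := hv (x - z)
    rw [abs_sub_comm] at h2
    have h3 : ((1 + |z - x|) ^ k)⁻¹ ≤ (1 + |z|) ^ k * ((1 + |x|) ^ k)⁻¹ := one_add_abs_sub z x k
    calc hk s z * ‖v (x - z)‖ ≤ hk s z * (D * ((1 + |z|) ^ k * ((1 + |x|) ^ k)⁻¹)) := by
          refine mul_le_mul_of_nonneg_left (h2.trans ?_) (hk_nonneg _ _)
          gcongr
      _ = _ := by ring
  · rw [integral_mul_const, integral_mul_const]
    gcongr

lemma heat_schwartz_decay (f : 𝒮) (k : ℕ) (b : ℝ) : ∃ C : ℝ, 0 ≤ C ∧ ∀ s, 0 < s → s ≤ b → ∀ x, ‖heat s f x‖ ≤ C * ((1 + |x|) ^ k)⁻¹ := by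
  obtain ⟨C, hC, h⟩ := heat_decay_of_decay k b
  obtain ⟨D, hD, hf⟩ := schwartz_decay f k
  exact ⟨C * D, by positivity, fun s hs hsb x => h f D hD hf s hs hsb x⟩

lemma hk_le {s : ℝ} (hs : 0 < s) (x : ℝ) : hk s x ≤ (√(4 * π * s))⁻¹ := by
  unfold hk
  refine mul_le_of_le_one_right (by positivity) ?_
  rw [exp_le_one_iff]
  simp only [Left.neg_nonpos_iff]; positivity

lemma norm_heat_le_sqrt {v : ℝ → ℂ} (hv : Integrable v) {s : ℝ} (hs : 0 < s) (x : ℝ) : ‖heat s v x‖ ≤ (√(4 * π * s))⁻¹ * ∫ y, ‖v y‖ := by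
  rw [← integral_const_mul]
  refine norm_integral_le_of_norm_le (hv.norm.const_mul _) (.of_forall fun y => ?_)
  rw [norm_smul, norm_eq_abs, abs_of_nonneg (hk_nonneg _ _)]
  gcongr
  exact hk_le hs _

/-! ### Gaussians and heat extensions as Schwartz functions; behaviour as the time tends to zero. -/

/-- The standard Gaussian as a Schwartz function. -/
lemma gaussian_poly_bound (P : Polynomial ℝ) (k : ℕ) : ∃ C : ℝ, ∀ x : ℝ,
    |x| ^ k * |P.eval x * rexp (-(x ^ 2 / 2))| ≤ C := by
  induction P using Polynomial.induction_on' with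
  | add p q hp hq =>
    obtain ⟨C, hC⟩ := hp
    obtain ⟨D, hD⟩ := hq
    refine ⟨C + D, fun x => (le_trans ?_ (add_le_add (hC x) (hD x)))⟩
    rw [Polynomial.eval_add, ← mul_add, add_mul]
    gcongr
    exact abs_add_le _ _
  | monomial n a =>
    obtain ⟨C, hC, h⟩ := hk_le_of_mem (k + n) (a := 1 / 2) (b := 1 / 2) (by norm_num)
    refine ⟨√(4 * π * (1 / 2)) * (|a| * C), fun x => ?_⟩
    have h1 := h (1 / 2) (by simp) x
    have hq : 0 < √(4 * π * (1 / 2)) := by positivity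
    have e : rexp (-(x ^ 2 / 2)) = √(4 * π * (1 / 2)) * hk (1 / 2) x := by
      rw [hk, ← mul_assoc, mul_inv_cancel₀ hq.ne', one_mul]; norm_num
    rw [Polynomial.eval_monomial, abs_mul, abs_mul, abs_pow, e, abs_mul, abs_of_pos hq, abs_of_nonneg (hk_nonneg _ _)]
    have h2 : hk (1 / 2) x * |x| ^ (k + n) ≤ C := by
      calc hk (1 / 2) x * |x| ^ (k + n) ≤ C * ((1 + |x|) ^ (k + n))⁻¹ * (1 + |x|) ^ (k + n) := by
            gcongr; linarith [abs_nonneg x]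
        _ = C := by field_simp
    calc |x| ^ k * (|a| * |x| ^ n * (√(4 * π * (1 / 2)) * hk (1 / 2) x))
        = √(4 * π * (1 / 2)) * (|a| * (hk (1 / 2) x * |x| ^ (k + n))) := by rw [pow_add]; ring
      _ ≤ _ := by gcongr

/-- The derivatives of the Gaussian are Hermite polynomials times the Gaussian, so the decay reduces
to `gaussian_poly_bound`. -/
noncomputable def gaussianReal0 : 𝓢(ℝ, ℝ) where
  toFun x := rexp (-(x ^ 2 / 2))
  smooth' := by fun_prop
  decay' k n := by
    obtain ⟨C, hC⟩ := gaussian_poly_bound ((Polynomial.hermite n).map (algebraMap ℤ ℝ)) k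
    refine ⟨C, fun x => ?_⟩
    rw [norm_iteratedFDeriv_eq_norm_iteratedDeriv, iteratedDeriv_eq_iterate, Polynomial.deriv_gaussian_eq_hermite_mul_gaussian]
    have := hC x
    rw [Polynomial.eval_map_algebraMap] at this
    simpa [abs_mul] using this

/-- The heat kernel as a Schwartz function. -/
noncomputable def hkS (s : ℝ) (hs : 0 < s) : 𝒮 := ((√(4 * π * s))⁻¹ : ℂ) • SchwartzMap.compCLMOfContinuousLinearEquiv ℂ
    (ContinuousLinearEquiv.unitsEquivAut ℝ (Units.mk0 (√(2 * s))⁻¹ (by positivity)))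
    (SchwartzMap.postcompCLM ofRealCLM gaussianReal0)

lemma hkS_apply (s : ℝ) (hs : 0 < s) (x : ℝ) : hkS s hs x = hk s x := by
  have h1 : hkS s hs x = ((√(4 * π * s))⁻¹ : ℂ) * (rexp (-((x * (√(2 * s))⁻¹) ^ 2 / 2)) : ℝ) := by
    rfl
  rw [h1, hk]
  push_cast
  congr 2
  have : (x * (√(2 * s))⁻¹) ^ 2 / 2 = x ^ 2 / (4 * s) := by
    rw [mul_pow, inv_pow, sq_sqrt (by positivity)]
    field_simp; norm_num
  have h2 := congrArg (fun t : ℝ => (t : ℂ)) this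
  push_cast at h2
  rw [h2]

lemma fourier_hkS (s : ℝ) (hs : 0 < s) (ζ : ℝ) : 𝓕 (hkS s hs) ζ = (rexp (-(s * (2 * π * ζ) ^ 2)) : ℝ) := by
  have hb : (0 : ℝ) < (4 * π * s)⁻¹ := by positivity
  -- The parameter b = 1/(4πs) makes π b x² equal to x²/(4s); the transform exp(-πζ²/b) is then
  -- exp(-s(2πζ)²).
  have h := congrFun (fourier_gaussian_pi (b := (((4 * π * s)⁻¹ : ℝ) : ℂ)) (by simpa using hb)) ζ
  have e1 : (hkS s hs : ℝ → ℂ) = fun x : ℝ => ((√(4 * π * s))⁻¹ : ℂ) * 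
      Complex.exp (-π * (((4 * π * s)⁻¹ : ℝ) : ℂ) * x ^ 2) := by
    ext x
    rw [hkS_apply, hk]
    push_cast
    congr 2
    field_simp
  rw [SchwartzMap.fourier_coe, e1]
  have e2 : 𝓕 (fun x : ℝ => ((√(4 * π * s))⁻¹ : ℂ) * 
      Complex.exp (-π * (((4 * π * s)⁻¹ : ℝ) : ℂ) * x ^ 2)) ζ = ((√(4 * π * s))⁻¹ : ℂ) * 
      𝓕 (fun x : ℝ => Complex.exp (-π * (((4 * π * s)⁻¹ : ℝ) : ℂ) * x ^ 2)) ζ := by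
    simp only [Real.fourier_eq', smul_eq_mul, ← integral_const_mul]
    congr 1; ext x; ring
  rw [e2, h]
  have e3 : ((((4 * π * s)⁻¹ : ℝ) : ℂ)) ^ (1 / 2 : ℂ) = ((√(4 * π * s))⁻¹ : ℝ) := by
    rw [← sqrt_inv, sqrt_eq_rpow, Complex.ofReal_cpow hb.le]; norm_num
  rw [e3]
  have hq : ((√(4 * π * s) : ℝ) : ℂ) ≠ 0 := by
    have : 0 < √(4 * π * s) := by positivity
    exact_mod_cast this.ne'
  push_cast
  rw [one_div, inv_inv, ← mul_assoc, inv_mul_cancel₀ hq, one_mul]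
  congr 1
  field_simp; try ring

/-- The heat extension of a Schwartz function, as a Schwartz function. -/
noncomputable def heatS (s : ℝ) (hs : 0 < s) (f : 𝒮) : 𝒮 := SchwartzMap.convolution (ContinuousLinearMap.mul ℂ ℂ) (hkS s hs) f

lemma heatS_apply (s : ℝ) (hs : 0 < s) (f : 𝒮) (x : ℝ) : heatS s hs f x = heat s f x := by
  rw [heatS, SchwartzMap.convolution_apply, heat_eq_sub, convolution]
  congr 1; ext z
  simp [hkS_apply]

lemma heatS_coe (s : ℝ) (hs : 0 < s) (f : 𝒮) : (heatS s hs f : ℝ → ℂ) = heat s f := funext fun x => heatS_apply s hs f x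

lemma fourier_heatS (s : ℝ) (hs : 0 < s) (f : 𝒮) (ζ : ℝ) : 𝓕 (heatS s hs f) ζ = (rexp (-(s * (2 * π * ζ) ^ 2)) : ℝ) * 𝓕 f ζ := by
  rw [heatS, SchwartzMap.fourier_convolution, SchwartzMap.pairing_apply_apply, fourier_hkS]
  rfl

lemma fourier_sderiv (f : 𝒮) (ζ : ℝ) : 𝓕 (sderiv f) ζ = (2 * π * I * ζ) * 𝓕 f ζ := by
  have h := congrFun (Real.fourier_deriv f.integrable f.differentiable
    (sderiv f).integrable) ζ
  rw [SchwartzMap.fourier_coe, SchwartzMap.fourier_coe]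
  have e : (sderiv f : ℝ → ℂ) = deriv f := rfl
  rw [e, h]; simp

lemma lintegral_Ioi_scale {c : ℝ} (hc : 0 < c) (F : ℝ → ℝ≥0∞) : ∫⁻ r in Ioi 0, F r = ofReal c * ∫⁻ r in Ioi 0, F (c * r) := by
  have h := lintegral_image_eq_lintegral_abs_deriv_mul (s := Ioi 0) (f := fun x => c * x)
    (f' := fun _ => c) measurableSet_Ioi
    (fun x _ => by simpa using ((hasDerivAt_id x).const_mul c).hasDerivWithinAt)
    (fun x _ y _ hxy => by simpa [hc.ne'] using hxy) F
  have e : (fun x => c * x) '' Ioi 0 = Ioi 0 := by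
    ext y; constructor
    · rintro ⟨x, hx, rfl⟩; exact mul_pos hc hx
    · intro hy; exact ⟨y / c, div_pos hy hc, by field_simp⟩
  rw [e] at h
  rw [h, lintegral_const_mul' _ _ ofReal_ne_top, abs_of_pos hc]

lemma integral_smul_hk_scale {s : ℝ} (hs : 0 < s) (w : ℝ → ℂ) : ∫ z, hk s z • w (z / √s) = ∫ t, hk 1 t • w t := by
  have hq : 0 < √s := sqrt_pos.2 hs
  have : (fun z => hk s z • w (z / √s)) = fun z => (√s)⁻¹ • (fun t => hk 1 t • w t) (z / √s) := by
    ext z; simp only [hk_scale hs z, smul_smul]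
  rw [this, integral_smul, Measure.integral_comp_div (fun t => hk 1 t • w t), abs_of_pos hq, smul_smul, inv_mul_cancel₀ hq.ne', one_smul]

lemma heat_eq_scale {s : ℝ} (hs : 0 < s) (v : ℝ → ℂ) (x : ℝ) : heat s v x = ∫ t, hk 1 t • v (x - √s * t) := by
  have hq : 0 < √s := sqrt_pos.2 hs
  rw [heat_eq_sub, ← integral_smul_hk_scale hs]
  congr 1; ext z
  rw [mul_div_cancel₀ _ hq.ne']

/-- In scaled form the Gaussian no longer depends on s; only the argument x - √s t moves, and
dominated convergence applies. -/
lemma tendsto_heat {v : ℝ → ℂ} (hv : Continuous v) {B : ℝ} (hB : ∀ y, ‖v y‖ ≤ B) (x : ℝ) :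
    Tendsto (fun s => heat s v x) (𝓝[>] 0) (𝓝 (v x)) := by
  have h1 : Tendsto (fun s => ∫ t, hk 1 t • v (x - √s * t)) (𝓝[>] 0) (𝓝 (∫ t, hk 1 t • v x)) := by
    refine tendsto_integral_filter_of_dominated_convergence (fun t => hk 1 t * B) ?_ ?_
      ((integrable_hk one_pos).mul_const B) ?_
    · exact .of_forall fun s =>
        ((continuous_hk one_pos).smul (by fun_prop)).aestronglyMeasurable
    · refine .of_forall fun s => .of_forall fun t => ?_
      rw [norm_smul, norm_of_nonneg (hk_nonneg _ _)]
      exact mul_le_mul_of_nonneg_left (hB _) (hk_nonneg _ _)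
    · refine .of_forall fun t => ?_
      refine Tendsto.const_smul ?_ _
      have : Continuous fun s : ℝ => v (x - √s * t) := by fun_prop
      simpa using (this.tendsto 0).mono_left nhdsWithin_le_nhds
  rw [integral_smul_const, integral_hk one_pos, one_smul] at h1
  refine h1.congr' ?_
  filter_upwards [self_mem_nhdsWithin] with s hs
  rw [heat_eq_scale hs]

/-! ### The heat representation of the fractional derivative. -/

lemma one_sub_exp_le {r : ℝ} : 1 - rexp (-r) ≤ r := by
  linarith [Real.add_one_le_exp (-r)]

/-- The normalising constant in the heat representation of `|ξ|^α`. -/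
noncomputable def fracConst (α : ℝ) : ℝ := ∫ r in ℝ₊, r ^ (-(1 + α / 2)) * (1 - rexp (-r))

lemma integrableOn_Ioc_rpow {a : ℝ} (ha : -1 < a) (b : ℝ) : IntegrableOn (fun x : ℝ => x ^ a) (Ioc 0 b) := by
  by_cases hb : 0 ≤ b
  · have := intervalIntegral.intervalIntegrable_rpow' (a := 0) (b := b) ha
    rwa [intervalIntegrable_iff_integrableOn_Ioc_of_le hb] at this
  · rw [Ioc_eq_empty (by linarith)]; exact integrableOn_empty

/-- Near zero 1 - exp(-r) ≤ r improves the exponent to -α/2 > -1; at infinity r^(-1-α/2) is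
integrable by itself. -/
lemma integrableOn_symbol_one {α : ℝ} (h0 : 0 < α) (h1 : α < 1) :
    IntegrableOn (fun r : ℝ => r ^ (-(1 + α / 2)) * (1 - rexp (-r))) (Ioi 0) := by
  have hm : Measurable fun r : ℝ => r ^ (-(1 + α / 2)) * (1 - rexp (-r)) := by fun_prop
  rw [← Ioc_union_Ioi_eq_Ioi (zero_le_one' ℝ)]
  refine IntegrableOn.union ?_ ?_
  · refine Integrable.mono (integrableOn_Ioc_rpow (a := -(α / 2)) (by linarith) 1)
      hm.aestronglyMeasurable ?_
    rw [ae_restrict_iff' measurableSet_Ioc]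
    refine .of_forall fun r hr => ?_
    have he : 0 ≤ 1 - rexp (-r) := by
      have := exp_le_one_iff.2 (by linarith [hr.1] : -r ≤ 0); linarith
    have hp := rpow_nonneg hr.1.le (-(1 + α / 2))
    rw [norm_of_nonneg (mul_nonneg hp he), norm_of_nonneg (rpow_nonneg hr.1.le _)]
    calc r ^ (-(1 + α / 2)) * (1 - rexp (-r)) ≤ r ^ (-(1 + α / 2)) * r := by
          gcongr; exact one_sub_exp_le
      _ = r ^ (-(α / 2)) := by
          rw [← rpow_add_one hr.1.ne']; congr 1; ring
  · refine Integrable.mono (integrableOn_Ioi_rpow_of_lt (a := -(1 + α / 2)) (by linarith) one_pos)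
      hm.aestronglyMeasurable ?_
    rw [ae_restrict_iff' measurableSet_Ioi]
    refine .of_forall fun r (hr : 1 < r) => ?_
    have hr0 : 0 < r := by linarith
    have he : 0 ≤ 1 - rexp (-r) := by
      have := exp_le_one_iff.2 (by linarith : -r ≤ 0); linarith
    have hp := rpow_nonneg hr0.le (-(1 + α / 2))
    rw [norm_of_nonneg (mul_nonneg hp he), norm_of_nonneg hp]
    refine mul_le_of_le_one_right hp ?_
    linarith [exp_pos (-r)]

lemma fracConst_pos {α : ℝ} (h0 : 0 < α) (h1 : α < 1) : 0 < fracConst α := by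
  have hpos : ∀ r ∈ ℝ₊, 0 < r ^ (-(1 + α / 2)) * (1 - rexp (-r)) := fun r (hr : 0 < r) => by
    refine mul_pos (rpow_pos_of_pos hr _) ?_
    have : rexp (-r) < rexp 0 := exp_lt_exp.2 (by linarith)
    rw [exp_zero] at this; linarith
  rw [fracConst, setIntegral_pos_iff_support_of_nonneg_ae _ (integrableOn_symbol_one h0 h1)]
  · have : (Function.support fun r : ℝ => r ^ (-(1 + α / 2)) * (1 - rexp (-r))) ∩ Ioi 0 = Ioi 0 :=
      inter_eq_right.2 fun r hr => (hpos r hr).ne'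
    rw [this]; simp
  · rw [EventuallyLE, ae_restrict_iff' measurableSet_Ioi]
    exact .of_forall fun r hr => (hpos r hr).le

lemma symbol_scale {α ξ : ℝ} (hξ : ξ ≠ 0) {r : ℝ} (hr : 0 < r) : r ^ (-(1 + α / 2)) * (1 - rexp (-(r * ξ ^ 2))) = (ξ ^ 2) ^ (1 + α / 2) *
      ((fun r => r ^ (-(1 + α / 2)) * (1 - rexp (-r))) (ξ ^ 2 * r)) := by
  have hb : 0 < ξ ^ 2 := by positivity
  simp only
  rw [mul_rpow hb.le hr.le, mul_comm r, ← mul_assoc, ← mul_assoc, ← rpow_add hb]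
  simp

lemma integrableOn_symbol {α : ℝ} (h0 : 0 < α) (h1 : α < 1) (ξ : ℝ) :
    IntegrableOn (fun r : ℝ => r ^ (-(1 + α / 2)) * (1 - rexp (-(r * ξ ^ 2)))) (Ioi 0) := by
  by_cases hξ : ξ = 0
  · subst hξ; simp
  have hb : 0 < ξ ^ 2 := by positivity
  have h := (integrableOn_Ioi_comp_mul_left_iff
    (fun r : ℝ => r ^ (-(1 + α / 2)) * (1 - rexp (-r))) 0 hb).2
    (by simpa using integrableOn_symbol_one h0 h1)
  refine IntegrableOn.congr_fun (h.const_mul ((ξ ^ 2) ^ (1 + α / 2))) (fun r hr => ?_) measurableSet_Ioi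
  exact (symbol_scale hξ hr).symm

lemma sq_rpow_half (ξ a : ℝ) : (ξ ^ 2) ^ (a / 2) = |ξ| ^ a := by
  rw [← sq_abs, ← Real.rpow_natCast, ← rpow_mul (abs_nonneg _)]
  congr 1; push_cast; ring

/-- The substitution r ↦ r/ξ² turns the dependence on ξ into the factor (ξ²)^(α/2) = |ξ|^α; this is
why α/2 is the exponent of heat time. -/
lemma integral_symbol {α : ℝ} (h0 : 0 < α) (ξ : ℝ) :
    ∫ r in ℝ₊, r ^ (-(1 + α / 2)) * (1 - rexp (-(r * ξ ^ 2))) = |ξ| ^ α * fracConst α := by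
  by_cases hξ : ξ = 0
  · subst hξ; simp [zero_rpow h0.ne']
  have hb : 0 < ξ ^ 2 := by positivity
  rw [setIntegral_congr_fun measurableSet_Ioi (fun r hr => symbol_scale hξ hr), integral_const_mul,
    integral_comp_mul_left_Ioi (fun r => r ^ (-(1 + α / 2)) * (1 - rexp (-r))) 0 hb, mul_zero,
    smul_eq_mul, fracConst, ← mul_assoc]
  congr 1
  rw [rpow_add hb, rpow_one, sq_rpow_half]
  field_simp

lemma fourierInv_real (f : ℝ → ℂ) (x : ℝ) : 𝓕⁻ f x = ∫ ζ, Complex.exp ((2 * π * (ζ * x) : ℝ) * I) * f ζ := by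
  rw [Real.fourierInv_eq']
  simp [mul_comm x]

lemma rpow_le_one_add {x a : ℝ} (hx : 0 ≤ x) (h0 : 0 ≤ a) (h1 : a ≤ 1) : x ^ a ≤ 1 + x := by
  rcases le_total x 1 with h | h
  · linarith [rpow_le_one hx h h0]
  · have := rpow_le_rpow_of_exponent_le h h1
    rw [rpow_one] at this; linarith

lemma integrable_mul_schwartz {m : ℝ → ℝ} (hm : Continuous m) {C : ℝ} (k : ℕ)
    (hb : ∀ ζ, |m ζ| ≤ C * (1 + |ζ|) ^ k) (f : 𝒮) : Integrable fun ζ => m ζ * ‖f ζ‖ := by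
  obtain ⟨D, hD, hf⟩ := schwartz_decay f (k + 2)
  refine (integrable_weight_two.const_mul (C * D)).mono (hm.mul f.continuous.norm).aestronglyMeasurable
    (.of_forall fun ζ => ?_)
  have hC : 0 ≤ C * (1 + |ζ|) ^ k := (abs_nonneg _).trans (hb ζ)
  rw [norm_mul, norm_norm, norm_eq_abs]
  calc |m ζ| * ‖f ζ‖ ≤ (C * (1 + |ζ|) ^ k) * (D * ((1 + |ζ|) ^ (k + 2))⁻¹) := mul_le_mul (hb ζ) (hf ζ) (norm_nonneg _) hC
    _ = C * D * ((1 + |ζ|) ^ 2)⁻¹ := by rw [pow_add]; field_simp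
    _ ≤ _ := le_abs_self _

lemma abs_two_pi_rpow_le {α : ℝ} (h0 : 0 < α) (h1 : α < 1) (ζ : ℝ) :
    |(|2 * π * ζ| ^ α)| ≤ (2 * π) * (1 + |ζ|) ^ 1 := by
  rw [abs_of_nonneg (by positivity)]
  refine (rpow_le_one_add (abs_nonneg _) h0.le h1.le).trans ?_
  rw [abs_mul, abs_of_pos (by positivity : 0 < 2 * π)]
  nlinarith [Real.pi_gt_three, abs_nonneg ζ]

lemma continuous_symbol {α : ℝ} (h0 : 0 < α) : Continuous fun ζ : ℝ => |2 * π * ζ| ^ α :=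
  Continuous.rpow_const (by fun_prop) fun _ => Or.inr h0.le

lemma sub_heat_eq (φ : 𝒮) {r : ℝ} (hr : 0 < r) (x : ℝ) : φ x - heat r φ x = ∫ ζ, Complex.exp ((2 * π * (ζ * x) : ℝ) * I) *
      (((1 - rexp (-(r * (2 * π * ζ) ^ 2)) : ℝ) : ℂ) * 𝓕 φ ζ) := by
  have key : ∀ ψ : 𝒮, ψ x = ∫ ζ, Complex.exp ((2 * π * (ζ * x) : ℝ) * I) * 𝓕 ψ ζ := fun ψ => by
      rw [← fourierInv_real, ← SchwartzMap.fourierInv_coe, FourierTransform.fourierInv_fourier_eq]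
  have hint : ∀ ψ : 𝒮, Integrable fun ζ : ℝ =>
      Complex.exp ((2 * π * (ζ * x) : ℝ) * I) * 𝓕 ψ ζ := fun ψ => by
    refine (𝓕 ψ).integrable.mono (Continuous.aestronglyMeasurable (by fun_prop))
      (.of_forall fun ζ => ?_)
    rw [norm_mul, norm_exp_ofReal_mul_I, one_mul]
  rw [← heatS_apply r hr, key φ, key (heatS r hr φ), ← integral_sub (hint _) (hint _)]
  congr 1; ext ζ
  rw [fourier_heatS]
  push_cast; ring

/-- The heat representation of the fractional derivative. -/
lemma fracConst_smul_fracDeriv {α : ℝ} (h0 : 0 < α) (h1 : α < 1) (φ : 𝒮) (x : ℝ) :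
    ∫ r in ℝ₊, (r ^ (-(1 + α / 2)) : ℝ) • (φ x - heat r φ x) = fracConst α • 𝒟 α φ x := by
  set e : ℝ → ℂ := fun ζ => Complex.exp ((2 * π * (ζ * x) : ℝ) * I) with he
  have hen : ∀ ζ, ‖e ζ‖ = 1 := fun ζ => norm_exp_ofReal_mul_I _
  have hint : Integrable (uncurry fun r ζ : ℝ => (r ^ (-(1 + α / 2)) : ℝ) •
      (e ζ * (((1 - rexp (-(r * (2 * π * ζ) ^ 2)) : ℝ) : ℂ) * 𝓕 φ ζ)))
      ((volume.restrict (Ioi 0)).prod volume) := by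
    have hmeas : Measurable (uncurry fun r ζ : ℝ => (r ^ (-(1 + α / 2)) : ℝ) •
      (e ζ * (((1 - rexp (-(r * (2 * π * ζ) ^ 2)) : ℝ) : ℂ) * 𝓕 φ ζ))) := by
      have hF : Measurable (⇑(𝓕 φ : 𝒮)) := (𝓕 φ).continuous.measurable
      have : Measurable fun p : ℝ × ℝ => 𝓕 φ p.2 := hF.comp measurable_snd
      simp only [uncurry_def, he]
      fun_prop
    have hnorm : ∀ ζ, ∀ r ∈ ℝ₊, ‖(r ^ (-(1 + α / 2)) : ℝ) • (e ζ * (((1 - rexp (-(r * (2 * π * ζ) ^ 2)) : ℝ) : ℂ) * 𝓕 φ ζ))‖ =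
        (r ^ (-(1 + α / 2)) * (1 - rexp (-(r * (2 * π * ζ) ^ 2)))) * ‖𝓕 φ ζ‖ := fun ζ r hr => by
      have h2 : 0 ≤ 1 - rexp (-(r * (2 * π * ζ) ^ 2)) := by
        have : rexp (-(r * (2 * π * ζ) ^ 2)) ≤ 1 := by
          rw [exp_le_one_iff]
          have : 0 < r := hr
          have : 0 ≤ r * (2 * π * ζ) ^ 2 := by positivity
          linarith
        linarith
      rw [norm_smul, norm_mul, norm_mul, hen, one_mul, norm_real, norm_of_nonneg (rpow_nonneg (le_of_lt hr) _), norm_of_nonneg h2]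
      ring
    -- For Fubini, integrate absolute values in r first: this returns the symbol |2πζ|^α, of at most
    -- linear growth, against a rapidly decreasing transform.
    rw [integrable_prod_iff' hmeas.aestronglyMeasurable]
    constructor
    · refine .of_forall fun ζ => ?_
      refine ((integrableOn_symbol h0 h1 (2 * π * ζ)).mul_const ‖𝓕 φ ζ‖).mono
        (hmeas.comp (measurable_id.prodMk measurable_const)).aestronglyMeasurable ?_
      rw [ae_restrict_iff' measurableSet_Ioi]
      refine .of_forall fun r hr => ?_
      have := hnorm ζ r hr
      simp only [uncurry_apply_pair]
      rw [this]; exact le_abs_self _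
    · have : (fun ζ => ∫ r in ℝ₊, ‖uncurry (fun r ζ : ℝ => (r ^ (-(1 + α / 2)) : ℝ) •
        (e ζ * (((1 - rexp (-(r * (2 * π * ζ) ^ 2)) : ℝ) : ℂ) * 𝓕 φ ζ))) (r, ζ)‖) = fun ζ => fracConst α * (|2 * π * ζ| ^ α * ‖𝓕 φ ζ‖) := by
        ext ζ
        simp only [uncurry_apply_pair]
        rw [setIntegral_congr_fun measurableSet_Ioi (hnorm ζ), integral_mul_const, integral_symbol h0]
        ring
      rw [this]
      exact (integrable_mul_schwartz (continuous_symbol h0) 1 (abs_two_pi_rpow_le h0 h1) _).const_mul _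
  calc ∫ r in ℝ₊, (r ^ (-(1 + α / 2)) : ℝ) • (φ x - heat r φ x)
      = ∫ r in ℝ₊, ∫ ζ, (r ^ (-(1 + α / 2)) : ℝ) • (e ζ * (((1 - rexp (-(r * (2 * π * ζ) ^ 2)) : ℝ) : ℂ) * 𝓕 φ ζ)) := by
        refine setIntegral_congr_fun measurableSet_Ioi fun r hr => ?_
        rw [sub_heat_eq φ hr, integral_smul]
    _ = ∫ ζ, ∫ r in ℝ₊, (r ^ (-(1 + α / 2)) : ℝ) •
        (e ζ * (((1 - rexp (-(r * (2 * π * ζ) ^ 2)) : ℝ) : ℂ) * 𝓕 φ ζ)) := integral_integral_swap hint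
    _ = ∫ ζ, fracConst α • (e ζ * (((|2 * π * ζ| ^ α : ℝ) : ℂ) * 𝓕 φ ζ)) := by
        congr 1; ext ζ
        have e1 : ∀ r : ℝ, (r ^ (-(1 + α / 2)) : ℝ) • (e ζ * (((1 - rexp (-(r * (2 * π * ζ) ^ 2)) : ℝ) : ℂ) * 𝓕 φ ζ)) =
          (r ^ (-(1 + α / 2)) * (1 - rexp (-(r * (2 * π * ζ) ^ 2)))) • (e ζ * 𝓕 φ ζ) := fun r => by
          simp only [real_smul]; push_cast; ring
        simp only [e1]
        rw [integral_smul_const, integral_symbol h0]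
        simp only [real_smul]; push_cast; ring
    _ = fracConst α • 𝒟 α φ x := by
        rw [integral_smul, fracDerivSchwartz, fourierInv_real]
        rfl

/-! ### The kernel of D^α off the diagonal, and the decay of D^α φ. -/

lemma hk_dilate {c : ℝ} (hc : 0 < c) {r : ℝ} (z : ℝ) : hk (c ^ 2 * r) (c * z) = c⁻¹ * hk r z := by
  have h : √(4 * π * (c ^ 2 * r)) = c * √(4 * π * r) := by
    rw [show 4 * π * (c ^ 2 * r) = c ^ 2 * (4 * π * r) by ring, sqrt_mul (by positivity), sqrt_sq hc.le]
  have h2 : (c * z) ^ 2 / (4 * (c ^ 2 * r)) = z ^ 2 / (4 * r) := by field_simp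
  rw [hk, hk, h, h2, mul_inv]; ring

/-- The integral of the heat kernel against a power of time. -/
noncomputable def hkPowConst (a : ℝ) : ℝ≥0∞ := ∫⁻ r in ℝ₊, ofReal (r ^ (-a) * hk r 1)

lemma hk_abs (s x : ℝ) : hk s |x| = hk s x := by simp [hk]

/-- Parabolic scaling r ↦ z² r reduces to |z| = 1. For a = 1 + α/2 the power is |z|^(-1-α), the
kernel of D^α off the diagonal. -/
lemma lintegral_hk_rpow (a : ℝ) {z : ℝ} (hz : z ≠ 0) : ∫⁻ r in ℝ₊, ofReal (r ^ (-a) * hk r z) =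
      ofReal (|z| ^ (1 - 2 * a)) * hkPowConst a := by
  have hz' : 0 < |z| := abs_pos.2 hz
  rw [lintegral_Ioi_scale (c := |z| ^ 2) (by positivity), hkPowConst,
    ← lintegral_const_mul' _ _ ofReal_ne_top, ← lintegral_const_mul' _ _ ofReal_ne_top]
  refine setLIntegral_congr_fun measurableSet_Ioi fun r (hr : 0 < r) => ?_
  rw [← ofReal_mul (by positivity), ← ofReal_mul (by positivity)]
  congr 1
  have := hk_dilate hz' (r := r) 1
  rw [mul_one, hk_abs] at this
  rw [this, mul_rpow (by positivity) hr.le, ← Real.rpow_natCast |z| 2, ← rpow_mul hz'.le, sub_eq_add_neg, rpow_add hz', rpow_one]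
  have e1 : |z| ^ ((2 : ℕ) : ℝ) = |z| * |z| := by rw [Real.rpow_natCast, sq]
  have e2 : ((2 : ℕ) : ℝ) * -a = -(2 * a) := by push_cast; ring
  rw [e1, e2]
  field_simp

lemma hkPowConst_ne_top {a : ℝ} (ha : 1 < a) : hkPowConst a ≠ ∞ := by
  have hm : Measurable fun r : ℝ => r ^ (-a) * hk r 1 := by unfold hk; fun_prop
  have hi : IntegrableOn (fun r : ℝ => r ^ (-a) * hk r 1) (Ioi 0) := by
    rw [← Ioc_union_Ioi_eq_Ioi (zero_le_one' ℝ)]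
    refine IntegrableOn.union ?_ ?_
    -- Since k is at least a + 1, the bound exp(-1/(4r)) ≤ k! (4r)^k compensates r^(-a) and r^(-1/2)
    -- together.
    · set k : ℕ := ⌈a⌉₊ + 1
      refine Integrable.mono (integrableOn_const (μ := volume) (s := Ioc (0 : ℝ) 1)
        (C := (k.factorial * 4 ^ k : ℝ)) (by simp) enorm_ne_top)
        hm.aestronglyMeasurable ?_
      rw [ae_restrict_iff' measurableSet_Ioc]
      refine .of_forall fun r hr => ?_
      have hr0 := hr.1
      rw [norm_of_nonneg (mul_nonneg (rpow_nonneg hr0.le _) (hk_nonneg _ _)), norm_of_nonneg (by positivity)]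
      have h1 : rexp (-(1 ^ 2 / (4 * r))) ≤ k.factorial * (4 * r) ^ k := by
        have h := Real.pow_div_factorial_le_exp (1 ^ 2 / (4 * r)) (by positivity) k
        rw [exp_neg]
        rw [inv_le_comm₀ (exp_pos _) (by positivity)]
        refine le_trans (le_of_eq ?_) h
        rw [one_pow, div_pow, one_pow, mul_inv]; field_simp
      have h2 : (√(4 * π * r))⁻¹ ≤ r ^ (-(1 / 2) : ℝ) := by
        rw [rpow_neg hr0.le, ← sqrt_eq_rpow]
        gcongr
        nlinarith [Real.pi_gt_three]
      have h3 : r ^ (-a) * (r ^ (-(1 / 2) : ℝ) * r ^ k) ≤ 1 := by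
        rw [← Real.rpow_natCast, ← rpow_add hr0, ← rpow_add hr0]
        refine rpow_le_one hr0.le hr.2 ?_
        have := Nat.le_ceil a
        push_cast [k]; linarith
      calc r ^ (-a) * hk r 1 ≤ r ^ (-a) * (r ^ (-(1 / 2) : ℝ) * (k.factorial * (4 * r) ^ k)) := by
            unfold hk; gcongr
        _ = (r ^ (-a) * (r ^ (-(1 / 2) : ℝ) * r ^ k)) * (k.factorial * 4 ^ k) := by
            rw [mul_pow]; ring
        _ ≤ 1 * (k.factorial * 4 ^ k) := by gcongr
        _ = _ := one_mul _
    · refine Integrable.mono (integrableOn_Ioi_rpow_of_lt (a := -a) (by linarith) one_pos)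
        hm.aestronglyMeasurable ?_
      rw [ae_restrict_iff' measurableSet_Ioi]
      refine .of_forall fun r (hr : 1 < r) => ?_
      have hr0 : 0 < r := by linarith
      have hp := rpow_nonneg hr0.le (-a)
      rw [norm_of_nonneg (mul_nonneg hp (hk_nonneg _ _)), norm_of_nonneg hp]
      refine mul_le_of_le_one_right hp ((hk_le hr0 1).trans (inv_le_one_of_one_le₀ ?_))
      rw [one_le_sqrt]
      nlinarith [Real.pi_gt_three]
  have := hi.lintegral_lt_top
  exact this.ne

/-- The weight `(1 + |x|)^(-(1+α))`. -/
noncomputable def wt (α x : ℝ) : ℝ := (1 + |x|) ^ (-(1 + α))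

lemma wt_pos (α x : ℝ) : 0 < wt α x := by unfold wt; positivity

lemma continuous_wt (α : ℝ) : Continuous (wt α) := by
  unfold wt
  exact Continuous.rpow_const (by fun_prop) fun x => Or.inl (by positivity)

lemma wt_ge {α : ℝ} (h1 : α < 1) (x : ℝ) : ((1 + |x|) ^ 2)⁻¹ ≤ wt α x := by
  unfold wt
  rw [← Real.rpow_natCast, ← rpow_neg (by positivity)]
  refine rpow_le_rpow_of_exponent_le (by linarith [abs_nonneg x]) ?_
  push_cast; linarith

lemma inv_wt_le {α : ℝ} (h1 : α < 1) (x : ℝ) : (wt α x)⁻¹ ≤ (1 + |x|) ^ 2 := by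
  rw [inv_le_comm₀ (wt_pos _ _) (by positivity)]; exact wt_ge h1 x

lemma wt_sub {α : ℝ} (h0 : 0 < α) (x y : ℝ) : wt α (x - y) ≤ (wt α x)⁻¹ * wt α y := by
  unfold wt
  rw [← rpow_neg (by positivity), neg_neg, ← div_inv_eq_mul, ← rpow_neg (by positivity),
    neg_neg, ← div_rpow (by positivity) (by positivity), rpow_neg (by positivity),
    ← inv_rpow (by positivity)]
  refine rpow_le_rpow (by positivity) ?_ (by linarith)
  have h := one_add_abs_sub x y 1
  simpa [div_eq_mul_inv] using h

lemma wt_sub' {α : ℝ} (h0 : 0 < α) (x y : ℝ) : wt α (x - y) ≤ (wt α y)⁻¹ * wt α x := by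
  have : wt α (x - y) = wt α (y - x) := by simp [wt, abs_sub_comm]
  rw [this]; exact wt_sub h0 y x

/-- By the heat equation the time derivative is the heat extension of φ'', which decays uniformly
for times up to one; the mean value inequality gives the factor r. It is applied on [s, r] with s >
0, and s tends to zero afterwards. -/
lemma norm_sub_heat_le (φ : 𝒮) : ∃ C : ℝ, 0 ≤ C ∧ ∀ r, 0 < r → r ≤ 1 → ∀ x, ‖φ x - heat r φ x‖ ≤ C * r * ((1 + |x|) ^ 2)⁻¹ := by
  obtain ⟨C, hC, h⟩ := heat_schwartz_decay (sderiv (sderiv φ)) 2 1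
  refine ⟨C, hC, fun r hr hr1 x => ?_⟩
  obtain ⟨B, -, hB⟩ := schwartz_decay φ 0
  have ht := tendsto_heat φ.continuous (B := B) (by simpa using hB) x
  have hsub : Tendsto (fun s => ‖heat s φ x - heat r φ x‖) (𝓝[>] 0) (𝓝 ‖φ x - heat r φ x‖) := (ht.sub_const _).norm
  refine le_of_tendsto hsub ?_
  filter_upwards [Ioo_mem_nhdsGT hr] with s hs
  have hmv := (convex_Icc s r).norm_image_sub_le_of_norm_hasDerivWithin_le
    (f := fun s => heat s φ x) (f' := fun s => heat2 s φ x) (C := C * ((1 + |x|) ^ 2)⁻¹)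
    (fun t ht => (hasDerivAt_heat_time (schwartz_tempered φ) (hs.1.trans_le ht.1) x).hasDerivWithinAt)
    (fun t ht => by
      rw [heat2_schwartz φ (hs.1.trans_le ht.1)]
      exact h t (hs.1.trans_le ht.1) (ht.2.trans hr1) x)
    (right_mem_Icc.2 hs.2.le) (left_mem_Icc.2 hs.2.le)
  refine hmv.trans ?_
  rw [Real.norm_of_nonpos (by linarith [hs.2] : s - r ≤ 0)]
  have : 0 ≤ C * ((1 + |x|) ^ 2)⁻¹ := by positivity
  nlinarith [hs.1]

/-- For |z| ≥ 1 the integral over all times already gives |z|^(-1-α); for |z| ≤ 1 the restriction to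
r > 1 keeps the integral bounded. -/
lemma lintegral_Ioi_one_hk_le {α : ℝ} (h0 : 0 < α) (h1 : α < 1) : ∃ C : ℝ, 0 ≤ C ∧ ∀ z : ℝ,
    ∫⁻ r in Ioi (1 : ℝ), ofReal (r ^ (-(1 + α / 2)) * hk r z) ≤ ofReal (C * wt α z) := by
  set D : ℝ := (hkPowConst (1 + α / 2)).toReal
  have hD : hkPowConst (1 + α / 2) = ofReal D := (ofReal_toReal (hkPowConst_ne_top (by linarith))).symm
  have hI := integrableOn_Ioi_rpow_of_lt (a := -(1 + α / 2)) (by linarith) one_pos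
  set E : ℝ := ∫ r in Ioi (1 : ℝ), r ^ (-(1 + α / 2))
  have hE : 0 ≤ E := setIntegral_nonneg measurableSet_Ioi fun r (hr : 1 < r) =>
    rpow_nonneg (by linarith) _
  refine ⟨4 * D + 4 * E, by positivity, fun z => ?_⟩
  have hD0 : 0 ≤ D := ENNReal.toReal_nonneg
  rcases le_total |z| 1 with hz | hz
  · calc ∫⁻ r in Ioi (1 : ℝ), ofReal (r ^ (-(1 + α / 2)) * hk r z)
        ≤ ∫⁻ r in Ioi (1 : ℝ), ofReal (r ^ (-(1 + α / 2))) := by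
          refine setLIntegral_mono' measurableSet_Ioi fun r (hr : 1 < r) => ofReal_le_ofReal ?_
          have hr0 : 0 < r := by linarith
          refine mul_le_of_le_one_right (rpow_nonneg hr0.le _)
            ((hk_le hr0 z).trans (inv_le_one_of_one_le₀ ?_))
          rw [one_le_sqrt]
          nlinarith [Real.pi_gt_three]
      _ = ofReal E := by
          rw [← ofReal_integral_eq_lintegral_ofReal hI]
          rw [EventuallyLE, ae_restrict_iff' measurableSet_Ioi]
          exact .of_forall fun r (hr : 1 < r) => rpow_nonneg (by linarith) _
      _ ≤ _ := by
          refine ofReal_le_ofReal ?_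
          have : 1 / 4 ≤ wt α z := by
            refine le_trans ?_ (wt_ge h1 z)
            rw [one_div]
            refine inv_anti₀ (by positivity) ?_
            nlinarith [abs_nonneg z]
          nlinarith
  · have hz0 : z ≠ 0 := by rintro rfl; simp at hz; linarith
    have hzp : 0 < |z| := by linarith
    calc ∫⁻ r in Ioi (1 : ℝ), ofReal (r ^ (-(1 + α / 2)) * hk r z)
        ≤ ∫⁻ r in ℝ₊, ofReal (r ^ (-(1 + α / 2)) * hk r z) := lintegral_mono_set (Ioi_subset_Ioi zero_le_one)
      _ = ofReal (|z| ^ (1 - 2 * (1 + α / 2)) * D) := by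
          rw [lintegral_hk_rpow _ hz0, hD, ofReal_mul (by positivity)]
      _ ≤ _ := by
          refine ofReal_le_ofReal ?_
          have e : 1 - 2 * (1 + α / 2) = -(1 + α) := by ring
          have : |z| ^ (-(1 + α)) ≤ 4 * wt α z := by
            unfold wt
            have h2 : ((1 + |z|) / 2) ^ (-(1 + α)) = 2 ^ (1 + α) * (1 + |z|) ^ (-(1 + α)) := by
              rw [div_rpow (by positivity) (by positivity), rpow_neg (by norm_num : (0:ℝ) ≤ 2)]
              field_simp
            have h3 : (2 : ℝ) ^ (1 + α) ≤ 4 := by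
              calc (2 : ℝ) ^ (1 + α) ≤ 2 ^ (2 : ℝ) := rpow_le_rpow_of_exponent_le (by norm_num) (by linarith)
                _ = 4 := by norm_num
            calc |z| ^ (-(1 + α)) ≤ ((1 + |z|) / 2) ^ (-(1 + α)) := rpow_le_rpow_of_nonpos (by positivity) (by linarith) (by linarith)
              _ ≤ _ := by rw [h2]; gcongr
          rw [e]
          have := wt_pos α z
          nlinarith

/-- Split at r = 1. For short times the difference is O(r) with decay of order two, better than the
weight. For long times φ itself decays fast, and its heat extension carries the tail |x|^(-1-α) of
the kernel; this tail accounts for the weight in the domain of D^α. -/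
lemma lintegral_frac_le {α : ℝ} (h0 : 0 < α) (h1 : α < 1) (φ : 𝒮) : ∃ C : ℝ, 0 ≤ C ∧ ∀ x : ℝ,
    ∫⁻ r in ℝ₊, ‖(r ^ (-(1 + α / 2)) : ℝ) • (φ x - heat r φ x)‖ₑ ≤ ofReal (C * wt α x) := by
  obtain ⟨C₁, hC₁, hs⟩ := norm_sub_heat_le φ
  obtain ⟨C₂, hC₂, hl⟩ := lintegral_Ioi_one_hk_le h0 h1
  obtain ⟨C₃, hC₃, hd⟩ := schwartz_decay φ 2
  have hI := integrableOn_Ioi_rpow_of_lt (a := -(1 + α / 2)) (by linarith) one_pos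
  set E : ℝ := ∫ r in Ioi (1 : ℝ), r ^ (-(1 + α / 2))
  have hE : 0 ≤ E := setIntegral_nonneg measurableSet_Ioi fun r (hr : 1 < r) =>
    rpow_nonneg (by linarith) _
  have hI' := integrableOn_Ioc_rpow (a := -(α / 2)) (by linarith) 1
  set E' : ℝ := ∫ r in Ioc (0 : ℝ) 1, r ^ (-(α / 2))
  have hE' : 0 ≤ E' := setIntegral_nonneg measurableSet_Ioc fun r hr => rpow_nonneg hr.1.le _
  have hM : Integrable fun y => (1 + |y|) ^ 2 * ‖φ y‖ := integrable_mul_schwartz (by fun_prop) 2 (C := 1) (fun ζ => by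
      rw [one_mul, abs_of_nonneg (by positivity)]) φ
  set M : ℝ := ∫ y, (1 + |y|) ^ 2 * ‖φ y‖
  have hM0 : 0 ≤ M := integral_nonneg fun y => by positivity
  refine ⟨C₁ * E' + (C₃ * E + C₂ * M), by positivity, fun x => ?_⟩
  have hw := wt_pos α x
  rw [← Ioc_union_Ioi_eq_Ioi (zero_le_one' ℝ), lintegral_union measurableSet_Ioi
    (by rw [disjoint_left]; intro r hr hr'; exact absurd hr.2 (not_le.2 hr')), add_mul, add_mul,
    ofReal_add (by positivity) (by positivity), ofReal_add (by positivity) (by positivity)]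
  refine add_le_add ?_ ?_
  · calc ∫⁻ r in Ioc (0 : ℝ) 1, ‖(r ^ (-(1 + α / 2)) : ℝ) • (φ x - heat r φ x)‖ₑ
        ≤ ∫⁻ r in Ioc (0 : ℝ) 1, ofReal (r ^ (-(α / 2)) * (C₁ * wt α x)) := by
          refine setLIntegral_mono' measurableSet_Ioc fun r hr => ?_
          rw [← ofReal_norm]
          refine ofReal_le_ofReal ?_
          rw [norm_smul, norm_of_nonneg (rpow_nonneg hr.1.le _)]
          calc r ^ (-(1 + α / 2)) * ‖φ x - heat r φ x‖
              ≤ r ^ (-(1 + α / 2)) * (C₁ * r * wt α x) := by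
                refine mul_le_mul_of_nonneg_left ((hs r hr.1 hr.2 x).trans ?_) (rpow_nonneg hr.1.le _)
                exact mul_le_mul_of_nonneg_left (wt_ge h1 x) (mul_nonneg hC₁ hr.1.le)
            _ = (r ^ (-(1 + α / 2)) * r) * (C₁ * wt α x) := by ring
            _ = _ := by rw [← rpow_add_one hr.1.ne']; congr 2; ring
      _ = ofReal (E' * (C₁ * wt α x)) := by
          rw [← ofReal_integral_eq_lintegral_ofReal (hI'.mul_const _), integral_mul_const]
          rw [EventuallyLE, ae_restrict_iff' measurableSet_Ioc]
          exact .of_forall fun r hr => mul_nonneg (rpow_nonneg hr.1.le _) (by positivity)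
      _ = _ := by congr 1; ring
  · calc ∫⁻ r in Ioi (1 : ℝ), ‖(r ^ (-(1 + α / 2)) : ℝ) • (φ x - heat r φ x)‖ₑ
        ≤ ∫⁻ r in Ioi (1 : ℝ), (ofReal (r ^ (-(1 + α / 2)) * ‖φ x‖) + ∫⁻ y, ofReal (r ^ (-(1 + α / 2)) * hk r (x - y)) * ‖φ y‖ₑ) := by
          refine setLIntegral_mono' measurableSet_Ioi fun r (hr : 1 < r) => ?_
          have hp : 0 ≤ r ^ (-(1 + α / 2)) := rpow_nonneg (by linarith) _
          rw [smul_sub]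
          refine (enorm_sub_le).trans (add_le_add ?_ ?_)
          · rw [← ofReal_norm, norm_smul, norm_of_nonneg hp]
          · rw [heat, ← integral_smul]
            refine (enorm_integral_le_lintegral_enorm _).trans (lintegral_mono fun y => ?_)
            rw [smul_smul, enorm_smul, ← ofReal_norm (_ * _), norm_of_nonneg
              (mul_nonneg hp (hk_nonneg _ _))]
      _ = ofReal (E * ‖φ x‖) + ∫⁻ y, (∫⁻ r in Ioi (1 : ℝ), ofReal (r ^ (-(1 + α / 2)) * hk r (x - y))) * ‖φ y‖ₑ := by
          have hm0 : Measurable fun p : ℝ × ℝ => hk p.1 (x - p.2) :=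
            measurable_hk_prod.comp (measurable_fst.prodMk (measurable_const.sub measurable_snd))
          have hm1 : Measurable fun y => ‖φ y‖ₑ := φ.continuous.enorm.measurable
          rw [lintegral_add_left (by fun_prop : Measurable fun r : ℝ =>
            ofReal (r ^ (-(1 + α / 2)) * ‖φ x‖))]
          congr 1
          · rw [← ofReal_integral_eq_lintegral_ofReal (hI.mul_const _), integral_mul_const]
            rw [EventuallyLE, ae_restrict_iff' measurableSet_Ioi]
            exact .of_forall fun r (hr : 1 < r) =>
              mul_nonneg (rpow_nonneg (by linarith) _) (norm_nonneg _)
          · rw [lintegral_lintegral_swap]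
            · refine lintegral_congr fun y => ?_
              rw [lintegral_mul_const]
              have : Measurable fun r => hk r (x - y) := hm0.comp (measurable_id.prodMk measurable_const)
              fun_prop
            · refine Measurable.aemeasurable ?_
              have : Measurable fun p : ℝ × ℝ => ‖φ p.2‖ₑ := hm1.comp measurable_snd
              simp only [uncurry_def]
              fun_prop
      _ ≤ ofReal (C₃ * E * wt α x) + ofReal (C₂ * M * wt α x) := by
          refine add_le_add (ofReal_le_ofReal ?_) ?_
          · have : ‖φ x‖ ≤ C₃ * wt α x := (hd x).trans (mul_le_mul_of_nonneg_left (wt_ge h1 x) hC₃)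
            nlinarith
          · calc ∫⁻ y, (∫⁻ r in Ioi (1 : ℝ), ofReal (r ^ (-(1 + α / 2)) * hk r (x - y))) * ‖φ y‖ₑ
                ≤ ∫⁻ y, ofReal (C₂ * wt α x * ((1 + |y|) ^ 2 * ‖φ y‖)) := by
                  refine lintegral_mono fun y => ?_
                  refine (mul_le_mul_left (hl (x - y)) _).trans ?_
                  rw [← ofReal_norm, ← ofReal_mul (mul_nonneg hC₂ (wt_pos _ _).le)]
                  refine ofReal_le_ofReal ?_
                  have h2 : wt α (x - y) ≤ (1 + |y|) ^ 2 * wt α x :=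
                    (wt_sub' h0 x y).trans (mul_le_mul_of_nonneg_right (inv_wt_le h1 y) hw.le)
                  calc C₂ * wt α (x - y) * ‖φ y‖ ≤ C₂ * ((1 + |y|) ^ 2 * wt α x) * ‖φ y‖ := by gcongr
                    _ = _ := by ring
              _ = ofReal (C₂ * wt α x * M) := by
                  rw [← ofReal_integral_eq_lintegral_ofReal (hM.const_mul _)
                    (.of_forall fun y => by positivity), integral_const_mul]
              _ = _ := by congr 1; ring

lemma norm_fracDeriv_le {α : ℝ} (h0 : 0 < α) (h1 : α < 1) (φ : 𝒮) : ∃ C : ℝ, 0 ≤ C ∧ ∀ x : ℝ, ‖𝒟 α φ x‖ ≤ C * wt α x := by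
  obtain ⟨C, hC, h⟩ := lintegral_frac_le h0 h1 φ
  have hc := fracConst_pos h0 h1
  refine ⟨(fracConst α)⁻¹ * C, by positivity, fun x => ?_⟩
  have h2 : ‖fracConst α • 𝒟 α φ x‖ ≤ C * wt α x := by
    rw [← fracConst_smul_fracDeriv h0 h1]
    have := (enorm_integral_le_lintegral_enorm _).trans (h x)
    rw [← ofReal_norm] at this
    exact (ofReal_le_ofReal_iff (mul_nonneg hC (wt_pos _ _).le)).1 this
  rw [norm_smul, norm_of_nonneg hc.le] at h2
  rw [mul_assoc, ← div_eq_inv_mul, le_div_iff₀' hc]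
  exact h2

lemma continuous_fracDeriv {α : ℝ} (h0 : 0 < α) (h1 : α < 1) (φ : 𝒮) : Continuous (𝒟 α φ) := by
  have e : 𝒟 α φ = fun x => ∫ ζ, Complex.exp ((2 * π * (ζ * x) : ℝ) * I) * (((|2 * π * ζ| ^ α : ℝ) : ℂ) * 𝓕 φ ζ) := by
    ext x; rw [fracDerivSchwartz, fourierInv_real]; rfl
  rw [e]
  have hc : Continuous fun ζ : ℝ => (((|2 * π * ζ| ^ α : ℝ) : ℂ)) := continuous_ofReal.comp (continuous_symbol h0)
  refine continuous_of_dominated (bound := fun ζ => |2 * π * ζ| ^ α * ‖𝓕 φ ζ‖) ?_ ?_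
    (integrable_mul_schwartz (continuous_symbol h0) 1 (abs_two_pi_rpow_le h0 h1) _) ?_
  · intro x
    exact Continuous.aestronglyMeasurable
      ((by fun_prop : Continuous fun ζ : ℝ => Complex.exp ((2 * π * (ζ * x) : ℝ) * I)).mul
        (hc.mul (𝓕 φ).continuous))
  · refine fun x => .of_forall fun ζ => ?_
    rw [norm_mul, norm_exp_ofReal_mul_I, one_mul, norm_mul, norm_real, norm_of_nonneg (by positivity)]
  · exact .of_forall fun ζ => by fun_prop

/-! ### Covariance of D^α under reflection, translation and dilation. -/

/-- The Schwartz function `y ↦ φ (x - y)`. -/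
noncomputable def reflS (x : ℝ) (φ : 𝒮) : 𝒮 := SchwartzMap.compSubConstCLM ℂ x
    (SchwartzMap.compCLMOfContinuousLinearEquiv ℂ (ContinuousLinearEquiv.neg ℝ) φ)

lemma reflS_apply (x : ℝ) (φ : 𝒮) (y : ℝ) : reflS x φ y = φ (x - y) := by
  have : reflS x φ y = φ (-(y - x)) := rfl
  rw [this]; congr 1; ring

lemma heat_reflS (x : ℝ) (φ : 𝒮) (r y : ℝ) : heat r (reflS x φ) y = heat r φ (x - y) := by
  rw [heat_eq_sub, heat_eq_sub, ← integral_neg_eq_self]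
  congr 1; ext z
  rw [reflS_apply, hk_neg]
  congr 2; ring

/-- The heat representation reduces the covariance of D^α to that of the even, translation invariant
heat kernel. -/
lemma fracDeriv_reflS {α : ℝ} (h0 : 0 < α) (h1 : α < 1) (x : ℝ) (φ : 𝒮) (y : ℝ) : 𝒟 α (reflS x φ) y = 𝒟 α φ (x - y) := by
  have hc := fracConst_pos h0 h1
  refine smul_right_injective ℂ hc.ne' ?_
  simp only
  rw [← fracConst_smul_fracDeriv h0 h1, ← fracConst_smul_fracDeriv h0 h1]
  simp only [heat_reflS, reflS_apply]

lemma heat_dilate {c a : ℝ} (hc : 0 < c) {φ ψ : ℝ → ℂ} (h : ∀ z, ψ z = a • φ (z / c)) (r z : ℝ) :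
    heat (c ^ 2 * r) ψ z = a • heat r φ (z / c) := by
  have e : (fun y => hk (c ^ 2 * r) y • ψ (z - y)) = fun y => c⁻¹ • (fun t => a • (hk r t • φ (z / c - t))) (y / c) := by
    ext y
    have h2 := hk_dilate hc (r := r) (y / c)
    rw [mul_div_cancel₀ _ hc.ne'] at h2
    simp only [h2, h, smul_smul, sub_div]
    congr 1; ring
  rw [heat_eq_sub, e, integral_smul, Measure.integral_comp_div (fun t => a • (hk r t • φ (z / c - t))),
    abs_of_pos hc, smul_smul, inv_mul_cancel₀ hc.ne', one_smul, integral_smul, ← heat_eq_sub]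

/-- Substitute r ↦ c² r in the heat representation: c² from dr and (c²)^(-1-α/2) from the weight
combine to c^(-α). -/
lemma fracDeriv_dilate {α : ℝ} (h0 : 0 < α) (h1 : α < 1) {c a : ℝ} (hc : 0 < c) {φ ψ : 𝒮}
    (h : ∀ z, ψ z = a • φ (z / c)) (z : ℝ) :
    𝒟 α ψ z = (c ^ (-α) * a) • 𝒟 α φ (z / c) := by
  have hk := fracConst_pos h0 h1
  refine smul_right_injective ℂ hk.ne' ?_
  simp only
  rw [smul_comm, ← fracConst_smul_fracDeriv h0 h1, ← fracConst_smul_fracDeriv h0 h1]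
  have hc2 : 0 < c ^ 2 := by positivity
  have h3 := integral_comp_mul_left_Ioi
    (fun r => (r ^ (-(1 + α / 2)) : ℝ) • (ψ z - heat r ψ z)) 0 hc2
  rw [mul_zero] at h3
  have h4 : ∫ r in ℝ₊, (r ^ (-(1 + α / 2)) : ℝ) • (ψ z - heat r ψ z) =
      c ^ 2 • ∫ r in ℝ₊, ((c ^ 2 * r) ^ (-(1 + α / 2)) : ℝ) • (ψ z - heat (c ^ 2 * r) ψ z) := by
    rw [h3, smul_smul, mul_inv_cancel₀ hc2.ne', one_smul]
  rw [h4, ← integral_smul, ← integral_smul]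
  refine setIntegral_congr_fun measurableSet_Ioi fun r (hr : 0 < r) => ?_
  rw [heat_dilate hc h, h z, ← smul_sub, smul_smul, smul_smul, smul_smul]
  congr 1
  rw [mul_rpow hc2.le hr.le]
  have : c ^ 2 * (c ^ 2) ^ (-(1 + α / 2)) = c ^ (-α) := by
    rw [← Real.rpow_natCast, ← rpow_mul hc.le, ← rpow_add hc]
    congr 1; push_cast; ring
  rw [← this]; ring

/-! ### Riesz potentials: heat derivatives of g recovered from D^α g. -/

lemma schwartz_eq_integral_fourier (ψ : 𝒮) (x : ℝ) : ψ x = ∫ ζ, Complex.exp ((2 * π * (ζ * x) : ℝ) * I) * 𝓕 ψ ζ := by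
  rw [← fourierInv_real, ← SchwartzMap.fourierInv_coe, FourierTransform.fourierInv_fourier_eq]

lemma schwartz_ext_fourier {φ ψ : 𝒮} (h : ∀ ζ, 𝓕 φ ζ = 𝓕 ψ ζ) : φ = ψ := by
  ext x
  rw [schwartz_eq_integral_fourier φ, schwartz_eq_integral_fourier ψ]
  simp only [h]

lemma integrableOn_rpow_exp {a c : ℝ} (ha : 0 < a) (hc : 0 < c) : IntegrableOn (fun ρ : ℝ => ρ ^ (a - 1) * rexp (-(c * ρ))) (Ioi 0) := by
  have := integrableOn_rpow_mul_exp_neg_mul_rpow (p := 1) (s := a - 1) (b := c) (by linarith)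
    one_pos hc
  simpa using this

/-- The Riesz potential of the heat semigroup inverts the fractional derivative. -/
lemma integral_fracDeriv_heatS {α : ℝ} (h0 : 0 < α) (φ : 𝒮) (x : ℝ) {F : ℝ → ℂ}
    (hF : ∀ ρ (hρ : 0 < ρ), F ρ = 𝒟 α (heatS ρ hρ φ) x) :
    ∫ ρ in ℝ₊, (ρ ^ (α / 2 - 1) : ℝ) • F ρ = Gamma (α / 2) • φ x := by
  set e : ℝ → ℂ := fun ζ => Complex.exp ((2 * π * (ζ * x) : ℝ) * I) with he
  have hen : ∀ ζ, ‖e ζ‖ = 1 := fun ζ => norm_exp_ofReal_mul_I _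
  have hz : ∀ᵐ ζ : ℝ, ζ ≠ 0 := by simp [ae_iff]
  set H : ℝ → ℝ → ℂ := fun ρ ζ => (ρ ^ (α / 2 - 1) : ℝ) • (e ζ * (((|2 * π * ζ| ^ α : ℝ) : ℂ) *
        ((rexp (-(ρ * (2 * π * ζ) ^ 2)) : ℝ) * 𝓕 φ ζ))) with hH
  -- The Gamma integral ∫ ρ^(α/2-1) exp(-ρξ²) dρ = Γ(α/2) |ξ|^(-α) cancels the symbol of D^α,
  -- frequency by frequency.
  have hsc : ∀ ζ : ℝ, ζ ≠ 0 → |2 * π * ζ| ^ α * ∫ ρ in ℝ₊, ρ ^ (α / 2 - 1) * rexp (-((2 * π * ζ) ^ 2 * ρ)) = Gamma (α / 2) := by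
    intro ζ hζ
    have hp : 0 < (2 * π * ζ) ^ 2 := by positivity
    rw [Real.integral_rpow_mul_exp_neg_mul_Ioi (by positivity) hp, one_div, inv_rpow hp.le,
      sq_rpow_half, ← mul_assoc, mul_inv_cancel₀, one_mul]
    have : (0 : ℝ) < |2 * π * ζ| := by positivity
    positivity
  have hint : Integrable (uncurry H) ((volume.restrict (Ioi 0)).prod volume) := by
    have hmeas : Measurable (uncurry H) := by
      have hF : Measurable (⇑(𝓕 φ : 𝒮)) := (𝓕 φ).continuous.measurable
      have : Measurable fun p : ℝ × ℝ => 𝓕 φ p.2 := hF.comp measurable_snd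
      simp only [uncurry_def, hH, he]
      fun_prop
    have hnorm : ∀ ζ, ∀ r ∈ ℝ₊, ‖H r ζ‖ =
        r ^ (α / 2 - 1) * rexp (-((2 * π * ζ) ^ 2 * r)) * (|2 * π * ζ| ^ α * ‖𝓕 φ ζ‖) := fun ζ r hr => by
      rw [hH]
      simp only
      rw [norm_smul, norm_mul, norm_mul, norm_mul, hen, one_mul, norm_real, norm_real,
        norm_of_nonneg (rpow_nonneg (le_of_lt hr) _), norm_of_nonneg (exp_pos _).le,
        norm_of_nonneg (rpow_nonneg (abs_nonneg _) _), mul_comm r]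
      ring
    rw [integrable_prod_iff' hmeas.aestronglyMeasurable]
    constructor
    · filter_upwards [hz] with ζ hζ
      refine ((integrableOn_rpow_exp (a := α / 2) (by positivity)
        (by positivity : 0 < (2 * π * ζ) ^ 2)).mul_const (|2 * π * ζ| ^ α * ‖𝓕 φ ζ‖)).mono
        (hmeas.comp (measurable_id.prodMk measurable_const)).aestronglyMeasurable ?_
      rw [ae_restrict_iff' measurableSet_Ioi]
      refine .of_forall fun r hr => ?_
      have := hnorm ζ r hr
      simp only [uncurry_apply_pair]
      rw [this]; exact le_abs_self _
    · refine (((𝓕 φ).integrable (μ := volume)).norm.const_mul (Gamma (α / 2))).congr ?_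
      filter_upwards [hz] with ζ hζ
      simp only [uncurry_apply_pair]
      rw [setIntegral_congr_fun measurableSet_Ioi (hnorm ζ), integral_mul_const, ← hsc ζ hζ]
      ring
  calc ∫ ρ in ℝ₊, (ρ ^ (α / 2 - 1) : ℝ) • F ρ
      = ∫ ρ in ℝ₊, ∫ ζ, H ρ ζ := by
        refine setIntegral_congr_fun measurableSet_Ioi fun r (hr : 0 < r) => ?_
        simp only [hH]
        rw [integral_smul, hF r hr, fracDerivSchwartz, fourierInv_real]
        congr 2; ext ζ
        rw [← SchwartzMap.fourier_coe, fourier_heatS]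
    _ = ∫ ζ, ∫ ρ in ℝ₊, H ρ ζ := integral_integral_swap hint
    _ = ∫ ζ, Gamma (α / 2) • (e ζ * 𝓕 φ ζ) := by
        refine integral_congr_ae ?_
        filter_upwards [hz] with ζ hζ
        have e1 : ∀ ρ : ℝ, H ρ ζ = (ρ ^ (α / 2 - 1) * rexp (-((2 * π * ζ) ^ 2 * ρ))) •
          (((|2 * π * ζ| ^ α : ℝ) : ℂ) * (e ζ * 𝓕 φ ζ)) := fun ρ => by
          simp only [hH, real_smul, mul_comm ρ]; push_cast; ring
        simp only [e1]
        rw [integral_smul_const, ← hsc ζ hζ]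
        simp only [real_smul]; push_cast; ring
    _ = _ := by rw [integral_smul, schwartz_eq_integral_fourier φ x]

/-- The heat kernel at time `t` as a Schwartz function. -/
noncomputable def hkT (t : ℝ) : 𝒮 := if h : 0 < t then hkS t h else 0

/-- The `k`-th derivative of the heat kernel at time `t` as a Schwartz function. -/
noncomputable def hkD (k : ℕ) (t : ℝ) : 𝒮 := sderiv^[k] (hkT t)

lemma hkD_succ (k : ℕ) (t : ℝ) : hkD (k + 1) t = sderiv (hkD k t) := by
  rw [hkD, Function.iterate_succ_apply', hkD]

lemma hkD_zero_apply {t : ℝ} (ht : 0 < t) (x : ℝ) : hkD 0 t x = hk t x := by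
  simp [hkD, hkT, ht, hkS_apply]

lemma hkD_one_apply {t : ℝ} (ht : 0 < t) (x : ℝ) : hkD 1 t x = hk1 t x := by
  have h1 := hasDerivAt_schwartz (hkD 0 t) x
  rw [← hkD_succ] at h1
  have h2 : HasDerivAt (hkD 0 t) (hk1 t x : ℂ) x := by
    rw [show (hkD 0 t : ℝ → ℂ) = fun x => (hk t x : ℂ) from funext (hkD_zero_apply ht)]
    exact (hasDerivAt_hk ht x).ofReal_comp
  exact h1.unique h2

lemma hkD_two_apply {t : ℝ} (ht : 0 < t) (x : ℝ) : hkD 2 t x = hk2 t x := by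
  have h1 := hasDerivAt_schwartz (hkD 1 t) x
  rw [← hkD_succ] at h1
  have h2 : HasDerivAt (hkD 1 t) (hk2 t x : ℂ) x := by
    rw [show (hkD 1 t : ℝ → ℂ) = fun x => (hk1 t x : ℂ) from funext (hkD_one_apply ht)]
    exact (hasDerivAt_hk1 ht x).ofReal_comp
  exact h1.unique h2

lemma fourier_hkD (k : ℕ) {t : ℝ} (ht : 0 < t) (ζ : ℝ) : 𝓕 (hkD k t) ζ = (2 * π * I * ζ) ^ k * (rexp (-(t * (2 * π * ζ) ^ 2)) : ℝ) := by
  induction k with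
  | zero => simp [hkD, hkT, ht, fourier_hkS]
  | succ k ih => rw [hkD_succ, fourier_sderiv, ih]; ring

/-- The semigroup law, read off on the Fourier side where the Gaussians multiply. -/
lemma heatS_hkD (k : ℕ) {s ρ : ℝ} (hs : 0 < s) (hρ : 0 < ρ) : heatS ρ hρ (hkD k s) = hkD k (s + ρ) := by
  refine schwartz_ext_fourier fun ζ => ?_
  rw [fourier_heatS, fourier_hkD k hs, fourier_hkD k (by positivity), mul_left_comm, ← Complex.ofReal_mul, ← exp_add]
  congr 4; ring

lemma hkD_dilate (k : ℕ) {c : ℝ} (hc : 0 < c) (z : ℝ) : hkD k (c ^ 2) z = ((c ^ (k + 1))⁻¹ : ℝ) • hkD k 1 (z / c) := by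
  induction k generalizing z with
  | zero =>
    rw [hkD_zero_apply (by positivity), hkD_zero_apply one_pos]
    have := hk_dilate hc (r := 1) (z / c)
    rw [mul_div_cancel₀ _ hc.ne', mul_one] at this
    rw [this, real_smul]; push_cast; ring
  | succ k ih =>
    have h1 := hasDerivAt_schwartz (hkD k (c ^ 2)) z
    rw [← hkD_succ] at h1
    have h2 := (((hasDerivAt_schwartz (hkD k 1) (z / c)).scomp z
      ((hasDerivAt_id z).div_const c)).const_smul ((c ^ (k + 1))⁻¹ : ℝ))
    rw [← hkD_succ] at h2
    have h3 : (hkD k (c ^ 2) : ℝ → ℂ) = ((c ^ (k + 1))⁻¹ : ℝ) • (⇑(hkD k 1) ∘ fun x => id x / c) := funext fun y => ih y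
    rw [h3] at h1
    rw [h1.unique h2, smul_smul]
    congr 1
    rw [pow_succ c (k + 1), mul_inv, one_div]

lemma fracDeriv_hkD_eq {α : ℝ} (h0 : 0 < α) (h1 : α < 1) (k : ℕ) {t : ℝ} (ht : 0 < t) (z : ℝ) : 𝒟 α (hkD k t) z =
      ((√t) ^ (-α) * (√t ^ (k + 1))⁻¹ : ℝ) • 𝒟 α (hkD k 1) (z / √t) := by
  have hq : 0 < √t := sqrt_pos.2 ht
  have := fracDeriv_dilate h0 h1 hq (hkD_dilate k hq) z
  rwa [sq_sqrt ht.le] at this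

/-- By scaling, D^α of the k-th derivative at time t is t^(-(k+1+α)/2) times a fixed function of
z/√t. The tail of that function gives back t^((1+α)/2), so only t^(-k/2) remains, uniformly for t ≥
s. -/
lemma norm_fracDeriv_hkD_le {α : ℝ} (h0 : 0 < α) (h1 : α < 1) (k : ℕ) {s : ℝ} (hs : 0 < s) : ∃ C : ℝ, 0 ≤ C ∧ ∀ t, s ≤ t → ∀ z,
      ‖𝒟 α (hkD k t) z‖ ≤ C * (√t ^ k)⁻¹ * wt α z := by
  obtain ⟨C, hC, hb⟩ := norm_fracDeriv_le h0 h1 (hkD k 1)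
  have hqs : 0 < √s := sqrt_pos.2 hs
  -- This minimum compares the weight at scale √t with the weight at scale one: m(1 + |z|) ≤ √t +
  -- |z| for all t ≥ s.
  set m := min 1 √s with hm
  have hm0 : 0 < m := lt_min one_pos hqs
  refine ⟨C * m ^ (-(1 + α)), by positivity, fun t hst z => ?_⟩
  have ht : 0 < t := hs.trans_le hst
  have hq : 0 < √t := sqrt_pos.2 ht
  rw [fracDeriv_hkD_eq h0 h1 k ht, norm_smul, norm_of_nonneg (by positivity : 0 ≤ (√t) ^ (-α) * (√t ^ (k + 1))⁻¹)]
  have hw : wt α (z / √t) ≤ m ^ (-(1 + α)) * wt α z * √t ^ (1 + α) := by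
    have h2 : m * (1 + |z|) / √t ≤ 1 + |z / √t| := by
      rw [abs_div, abs_of_pos hq, div_le_iff₀ hq, add_mul, one_mul, div_mul_cancel₀ _ hq.ne', mul_add]
      have h3 : m ≤ √t := (min_le_right _ _).trans (sqrt_le_sqrt hst)
      have h4 : m * |z| ≤ 1 * |z| := mul_le_mul_of_nonneg_right (min_le_left _ _) (abs_nonneg _)
      linarith
    refine (rpow_le_rpow_of_nonpos (by positivity) h2 (by linarith)).trans_eq ?_
    rw [div_rpow (by positivity) hq.le, mul_rpow hm0.le (by positivity), rpow_neg hq.le, div_inv_eq_mul]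
    rfl
  calc (√t) ^ (-α) * (√t ^ (k + 1))⁻¹ * ‖𝒟 α (hkD k 1) (z / √t)‖
      ≤ (√t) ^ (-α) * (√t ^ (k + 1))⁻¹ * (C * (m ^ (-(1 + α)) * wt α z * √t ^ (1 + α))) := by
        gcongr; exact (hb _).trans (by gcongr)
    _ = (√t ^ (-α) * √t ^ (1 + α) * (√t ^ (k + 1))⁻¹) * (C * m ^ (-(1 + α)) * wt α z) := by ring
    _ = _ := by
        rw [← rpow_add hq]
        have : -α + (1 + α) = 1 := by ring
        rw [this, rpow_one, pow_succ]
        field_simp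

/-- At infinity a single derivative, k = 1, gives ρ^(α/2-3/2), integrable because α < 1; without a
derivative the integral would diverge. -/
lemma integrableOn_rpow_shift {α s : ℝ} (h0 : 0 < α) (h1 : α < 1) (hs : 0 < s) {k : ℕ} (hk : 1 ≤ k) :
    IntegrableOn (fun ρ : ℝ => ρ ^ (α / 2 - 1) * (√(s + ρ) ^ k)⁻¹) (Ioi 0) := by
  have hm : Measurable fun ρ : ℝ => ρ ^ (α / 2 - 1) * (√(s + ρ) ^ k)⁻¹ := by fun_prop
  rw [← Ioc_union_Ioi_eq_Ioi (zero_le_one' ℝ)]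
  refine IntegrableOn.union ?_ ?_
  · refine ((integrableOn_Ioc_rpow (a := α / 2 - 1) (by linarith) 1).mul_const (√s ^ k)⁻¹).mono
      hm.aestronglyMeasurable ?_
    rw [ae_restrict_iff' measurableSet_Ioc]
    refine .of_forall fun ρ hρ => ?_
    have hρ0 := hρ.1
    rw [norm_of_nonneg (by positivity), norm_of_nonneg (by positivity)]
    have : √s ≤ √(s + ρ) := sqrt_le_sqrt (by linarith)
    have : 0 < √s := sqrt_pos.2 hs
    gcongr
  · have hI : IntegrableOn (fun ρ : ℝ => ρ ^ (α / 2 - 1 - 1 / 2)) (Ioi 1) := integrableOn_Ioi_rpow_of_lt (by linarith) one_pos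
    refine Integrable.mono hI hm.aestronglyMeasurable ?_
    rw [ae_restrict_iff' measurableSet_Ioi]
    refine .of_forall fun ρ (hρ : 1 < ρ) => ?_
    have hρ0 : 0 < ρ := by linarith
    rw [norm_of_nonneg (by positivity), norm_of_nonneg (by positivity), rpow_sub hρ0 (α / 2 - 1) (1 / 2), ← sqrt_eq_rpow,
      div_eq_mul_inv (ρ ^ (α / 2 - 1))]
    have h2 : 1 ≤ √(s + ρ) := by rw [one_le_sqrt]; linarith
    have h3 : √ρ ≤ √(s + ρ) := sqrt_le_sqrt (by linarith)
    have h4 : 0 < √ρ := sqrt_pos.2 hρ0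
    gcongr
    exact h3.trans (le_self_pow₀ h2 (by omega))

/-- The k-th derivative of g_s is the Riesz potential in time of the k-th derivatives of h_(s+ρ).
The pairing that defines D^α moves everything to the kernels, where the weighted bound on D^α of the
kernels justifies Fubini; there the Riesz potential undoes D^α. -/
lemma integral_fracDeriv_rep {α : ℝ} {g h : ℝ → ℂ} (hg : IsFracDeriv α g h) (h0 : 0 < α) (h1 : α < 1)
    {k : ℕ} (hk : 1 ≤ k) {s : ℝ} (hs : 0 < s) (x : ℝ) :
    ∫ ρ in ℝ₊, (ρ ^ (α / 2 - 1) : ℝ) • ∫ y, h y * hkD k (s + ρ) (x - y) = Gamma (α / 2) • ∫ y, g y * hkD k s (x - y) := by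
  obtain ⟨C, hC, hb⟩ := norm_fracDeriv_hkD_le h0 h1 k hs
  -- The scaling formula makes joint measurability in (ρ, z) evident; for ρ > 0 it agrees with D^α
  -- of the kernel.
  set B : ℝ → ℝ → ℂ := fun ρ z => ((√(s + ρ)) ^ (-α) * (√(s + ρ) ^ (k + 1))⁻¹ : ℝ) • 𝒟 α (hkD k 1) (z / √(s + ρ)) with hB
  have hBe : ∀ ρ : ℝ, 0 < ρ → ∀ z, B ρ z = 𝒟 α (hkD k (s + ρ)) z := fun ρ hρ z =>
    (fracDeriv_hkD_eq h0 h1 k (by positivity) z).symm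
  have hgm : AEStronglyMeasurable g := by
    have e : g = fun x => ((1 + |x|) ^ (1 + α) : ℝ) • (((1 + |x|) ^ (-(1 + α)) : ℝ) • g x) := by
      ext x
      rw [smul_smul, ← rpow_add (by positivity), add_neg_cancel, rpow_zero, one_smul]
    rw [e]
    have : Measurable fun x : ℝ => (1 + |x|) ^ (1 + α) := by fun_prop
    exact this.aestronglyMeasurable.smul hg.integrable_weight.aestronglyMeasurable
  have hint : Integrable (uncurry fun ρ y : ℝ => (ρ ^ (α / 2 - 1) : ℝ) • (g y * B ρ (x - y)))
      ((volume.restrict (Ioi 0)).prod volume) := by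
    have hd : Integrable (fun p : ℝ × ℝ => (p.1 ^ (α / 2 - 1) * (√(s + p.1) ^ k)⁻¹) *
        (C * (wt α x)⁻¹ * ‖((1 + |p.2|) ^ (-(1 + α)) : ℝ) • g p.2‖))
        ((volume.restrict (Ioi 0)).prod volume) :=
      (integrableOn_rpow_shift h0 h1 hs hk).mul_prod (hg.integrable_weight.norm.const_mul _)
    refine hd.mono ?_ ?_
    · have hc : Measurable (𝒟 α (hkD k 1)) := (continuous_fracDeriv h0 h1 _).measurable
      have m1 : Measurable fun p : ℝ × ℝ => B p.1 (x - p.2) := by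
        have : Measurable fun p : ℝ × ℝ => 𝒟 α (hkD k 1) ((x - p.2) / √(s + p.1)) := hc.comp (by fun_prop)
        simp only [hB]
        fun_prop
      simp only [uncurry_def]
      have m2 : Measurable fun p : ℝ × ℝ => p.1 ^ (α / 2 - 1) := by fun_prop
      exact m2.aestronglyMeasurable.smul (hgm.comp_snd.mul m1.aestronglyMeasurable)
    · have hp : ∀ᵐ p ∂((volume.restrict (ℝ₊)).prod (volume : Measure ℝ)), 0 < p.1 := by
        rw [← Measure.restrict_univ (μ := (volume : Measure ℝ)), Measure.prod_restrict, Measure.restrict_univ,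
          ae_restrict_iff' (measurableSet_Ioi.prod MeasurableSet.univ)]
        exact .of_forall fun p hp => hp.1
      filter_upwards [hp] with p hp
      simp only [uncurry_def]
      rw [norm_smul, norm_mul, hBe _ hp, norm_mul, norm_of_nonneg (by positivity),
        norm_of_nonneg (by positivity : 0 ≤ p.1 ^ (α / 2 - 1) * (√(s + p.1) ^ k)⁻¹),
        norm_of_nonneg (mul_nonneg (mul_nonneg hC (inv_nonneg.2 (wt_pos _ _).le)) (norm_nonneg _)),
        norm_smul, norm_of_nonneg (by positivity)]
      have h3 := hb (s + p.1) (by linarith) (x - p.2)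
      have h4 := wt_sub h0 x p.2
      calc p.1 ^ (α / 2 - 1) * (‖g p.2‖ * ‖𝒟 α (hkD k (s + p.1)) (x - p.2)‖)
          ≤ p.1 ^ (α / 2 - 1) * (‖g p.2‖ * (C * (√(s + p.1) ^ k)⁻¹ * ((wt α x)⁻¹ * wt α p.2))) := by
            gcongr
            exact h3.trans (by gcongr)
        _ = _ := by simp only [wt]; ring
  calc ∫ ρ in ℝ₊, (ρ ^ (α / 2 - 1) : ℝ) • ∫ y, h y * hkD k (s + ρ) (x - y)
      = ∫ ρ in ℝ₊, ∫ y, (ρ ^ (α / 2 - 1) : ℝ) • (g y * B ρ (x - y)) := by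
        refine setIntegral_congr_fun measurableSet_Ioi fun ρ (hρ : 0 < ρ) => ?_
        have := hg.pairing (reflS x (hkD k (s + ρ)))
        simp only [reflS_apply, fracDeriv_reflS h0 h1] at this
        simp only [integral_smul, this, hBe ρ hρ]
    _ = ∫ y, ∫ ρ in ℝ₊, (ρ ^ (α / 2 - 1) : ℝ) • (g y * B ρ (x - y)) := integral_integral_swap hint
    _ = ∫ y, Gamma (α / 2) • (g y * hkD k s (x - y)) := by
        congr 1; ext y
        have h3 := integral_fracDeriv_heatS h0 (hkD k s) (x - y) (F := fun ρ => B ρ (x - y))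
          (fun ρ hρ => by rw [heatS_hkD k hs, hBe ρ hρ])
        rw [← mul_smul_comm, ← h3, ← integral_const_mul]
        congr 1; ext ρ; exact (mul_smul_comm (ρ ^ (α / 2 - 1)) (g y) (B ρ (x - y))).symm
    _ = _ := integral_smul _ _

lemma heat1_eq_hkD (v : ℝ → ℂ) {s : ℝ} (hs : 0 < s) (x : ℝ) : heat1 s v x = ∫ y, v y * hkD 1 s (x - y) := by
  rw [heat1]; congr 1; ext y
  rw [hkD_one_apply hs, real_smul, mul_comm]

lemma heat2_eq_hkD (v : ℝ → ℂ) {s : ℝ} (hs : 0 < s) (x : ℝ) : heat2 s v x = ∫ y, v y * hkD 2 s (x - y) := by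
  rw [heat2]; congr 1; ext y
  rw [hkD_two_apply hs, real_smul, mul_comm]

lemma Gamma_half_pos {α : ℝ} (h0 : 0 < α) : 0 < Gamma (α / 2) := Real.Gamma_pos_of_pos (by positivity)

lemma heat1_rep {α : ℝ} {g h : ℝ → ℂ} (hg : IsFracDeriv α g h) (h0 : 0 < α) (h1 : α < 1)
    {s : ℝ} (hs : 0 < s) (x : ℝ) :
    ∫ ρ in ℝ₊, (ρ ^ (α / 2 - 1) : ℝ) • heat1 (s + ρ) h x = Gamma (α / 2) • heat1 s g x := by
  rw [heat1_eq_hkD g hs, ← integral_fracDeriv_rep hg h0 h1 le_rfl hs]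
  refine setIntegral_congr_fun measurableSet_Ioi fun ρ (hρ : 0 < ρ) => ?_
  simp only [heat1_eq_hkD h (add_pos hs hρ)]

lemma heat2_rep {α : ℝ} {g h : ℝ → ℂ} (hg : IsFracDeriv α g h) (h0 : 0 < α) (h1 : α < 1)
    {s : ℝ} (hs : 0 < s) (x : ℝ) :
    ∫ ρ in ℝ₊, (ρ ^ (α / 2 - 1) : ℝ) • heat2 (s + ρ) h x = Gamma (α / 2) • heat2 s g x := by
  rw [heat2_eq_hkD g hs, ← integral_fracDeriv_rep hg h0 h1 one_le_two hs]
  refine setIntegral_congr_fun measurableSet_Ioi fun ρ (hρ : 0 < ρ) => ?_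
  simp only [heat2_eq_hkD h (add_pos hs hρ)]

/-! ### Regularity of functions with bounded fractional derivative. -/

lemma integral_rpow_shift {α s : ℝ} (hs : 0 < s) (k : ℕ) : ∫ ρ in ℝ₊, ρ ^ (α / 2 - 1) * (√(s + ρ) ^ k)⁻¹ =
      s ^ (α / 2 - k / 2) * ∫ ρ in ℝ₊, ρ ^ (α / 2 - 1) * (√(1 + ρ) ^ k)⁻¹ := by
  have h3 := integral_comp_mul_left_Ioi (fun ρ : ℝ => ρ ^ (α / 2 - 1) * (√(s + ρ) ^ k)⁻¹) 0 hs
  rw [mul_zero, smul_eq_mul] at h3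
  have h4 : ∫ ρ in ℝ₊, ρ ^ (α / 2 - 1) * (√(s + ρ) ^ k)⁻¹ =
      s * ∫ ρ in ℝ₊, (s * ρ) ^ (α / 2 - 1) * (√(s + s * ρ) ^ k)⁻¹ := by
    rw [h3, ← mul_assoc, mul_inv_cancel₀ hs.ne', one_mul]
  rw [h4, ← integral_const_mul, ← integral_const_mul]
  refine setIntegral_congr_fun measurableSet_Ioi fun ρ (hρ : 0 < ρ) => ?_
  have e1 : s ^ (α / 2 - k / 2) = s * s ^ (α / 2 - 1) * (√s ^ k)⁻¹ := by
    rw [sqrt_eq_rpow, ← Real.rpow_natCast, ← rpow_mul hs.le, ← rpow_neg hs.le]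
    nth_rewrite 2 [← rpow_one s]
    rw [← rpow_add hs, ← rpow_add hs]
    congr 1; ring
  have e2 : √(s + s * ρ) = √s * √(1 + ρ) := by
    rw [← sqrt_mul hs.le]; congr 1; ring
  rw [e1, e2, mul_rpow hs.le hρ.le, mul_pow, mul_inv]
  ring

/-- The k-th derivative of h_(s+ρ) is at most 3A (s+ρ)^(-k/2). Inserted into the Riesz potential,
with ρ rescaled by s, this gives s^(α/2-k/2). -/
lemma exists_heat_deriv_bound {α : ℝ} (h0 : 0 < α) (h1 : α < 1) : ∃ C : ℝ, 0 < C ∧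
    ∀ (g h : ℝ → ℂ) (A : ℝ), IsFracDeriv α g h → (∀ᵐ y, ‖h y‖ ≤ A) → ∀ s, 0 < s → ∀ x,
      ‖heat1 s g x‖ ≤ C * A * s ^ (α / 2 - 1 / 2) ∧ ‖heat2 s g x‖ ≤ C * A * s ^ (α / 2 - 1) := by
  have hG := Gamma_half_pos h0
  set J : ℕ → ℝ := fun k => ∫ ρ in ℝ₊, ρ ^ (α / 2 - 1) * (√(1 + ρ) ^ k)⁻¹ with hJ
  have hJ0 : ∀ k, 0 ≤ J k := fun k => setIntegral_nonneg measurableSet_Ioi fun ρ (hρ : 0 < ρ) => by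
    positivity
  refine ⟨(Gamma (α / 2))⁻¹ * 3 * (J 1 + J 2 + 1), by
    have := hJ0 1; have := hJ0 2; positivity, fun g h A hg hA s hs x => ?_⟩
  have hA0 : 0 ≤ A := by
    obtain ⟨y, hy⟩ := hA.exists
    exact (norm_nonneg _).trans hy
  have key : ∀ (k : ℕ) (_ : 1 ≤ k) (F : ℝ → ℂ) (v : ℂ), (∀ ρ, 0 < ρ → ‖F ρ‖ ≤ 3 * (√(s + ρ) ^ k)⁻¹ * A) →
      ∫ ρ in ℝ₊, (ρ ^ (α / 2 - 1) : ℝ) • F ρ = Gamma (α / 2) • v →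
      ‖v‖ ≤ (Gamma (α / 2))⁻¹ * 3 * J k * A * s ^ (α / 2 - k / 2) := by
    intro k hk F v hF hv
    have h2 : ‖Gamma (α / 2) • v‖ ≤ ∫ ρ in ℝ₊, (3 * A) * (ρ ^ (α / 2 - 1) * (√(s + ρ) ^ k)⁻¹) := by
      rw [← hv]
      refine norm_integral_le_of_norm_le ((integrableOn_rpow_shift h0 h1 hs hk).const_mul _) ?_
      rw [ae_restrict_iff' measurableSet_Ioi]
      refine .of_forall fun ρ (hρ : 0 < ρ) => ?_
      rw [norm_smul, norm_of_nonneg (by positivity)]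
      calc ρ ^ (α / 2 - 1) * ‖F ρ‖ ≤ ρ ^ (α / 2 - 1) * (3 * (√(s + ρ) ^ k)⁻¹ * A) := by
            gcongr; exact hF ρ hρ
        _ = _ := by ring
    rw [integral_const_mul, integral_rpow_shift hs, norm_smul, norm_of_nonneg hG.le, ← le_div_iff₀' hG] at h2
    refine h2.trans_eq ?_
    simp only [hJ]
    field_simp
  have m1 : J 1 ≤ J 1 + J 2 + 1 := by linarith [hJ0 2]
  have m2 : J 2 ≤ J 1 + J 2 + 1 := by linarith [hJ0 1]
  constructor
  · have := key 1 le_rfl _ _ (fun ρ hρ => by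
      rw [pow_one]; exact norm_heat1_le hA (add_pos hs hρ) x) (heat1_rep hg h0 h1 hs x)
    rw [Nat.cast_one] at this
    refine this.trans ?_
    have hs' := rpow_nonneg hs.le (α / 2 - 1 / 2)
    gcongr
  · have := key 2 one_le_two _ _ (fun ρ hρ => by
      rw [sq_sqrt (add_pos hs hρ).le]; exact norm_heat2_le hA (add_pos hs hρ) x)
      (heat2_rep hg h0 h1 hs x)
    rw [Nat.cast_ofNat, div_self two_ne_zero] at this
    refine this.trans ?_
    have hs' := rpow_nonneg hs.le (α / 2 - 1)
    gcongr

lemma IsFracDeriv.tempered_left {α : ℝ} {g h : ℝ → ℂ} (hg : IsFracDeriv α g h) (h1 : α < 1) : Tempered g := by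
  refine ⟨2, ?_⟩
  have e : (fun x : ℝ => ((1 + |x|) ^ 2)⁻¹ • g x) = fun x : ℝ =>
      (((1 + |x|) ^ 2)⁻¹ * (wt α x)⁻¹) • (((1 + |x|) ^ (-(1 + α)) : ℝ) • g x) := by
    ext x
    rw [smul_smul, mul_assoc, show ((1 + |x|) ^ (-(1 + α)) : ℝ) = wt α x from rfl, inv_mul_cancel₀ (wt_pos α x).ne', mul_one]
  rw [e]
  refine Integrable.bdd_smul (φ := fun x => ((1 + |x|) ^ 2)⁻¹ * (wt α x)⁻¹)
    hg.integrable_weight 1 ?_ ?_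
  · have : Continuous fun x => (wt α x)⁻¹ := (continuous_wt α).inv₀ fun x => (wt_pos α x).ne'
    exact ((continuous_weight 2).mul this).aestronglyMeasurable
  · refine .of_forall fun x => ?_
    have := wt_pos α x
    rw [norm_of_nonneg (by positivity), ← div_eq_mul_inv, div_le_one this]
    exact wt_ge h1 x

/-- The heat semigroup is symmetric. -/
lemma integral_heat_mul {v : ℝ → ℂ} (hv : Tempered v) (ψ : 𝒮) {s : ℝ} (hs : 0 < s) : ∫ x, heat s v x * ψ x = ∫ y, v y * heat s ψ y := by
  obtain ⟨k, hk'⟩ := hv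
  obtain ⟨C, hC, hb⟩ := hk_le_of_mem k (a := s) (b := s) hs
  have hvm := aestronglyMeasurable_of_weight hk'
  have hψ : Integrable fun x => (1 + |x|) ^ k * ‖ψ x‖ := integrable_mul_schwartz (m := fun x => (1 + |x|) ^ k) (by fun_prop) (C := 1) k
      (fun ζ => by rw [abs_of_nonneg (by positivity), one_mul]) ψ
  have hint : Integrable (uncurry fun x y : ℝ => (hk s (x - y) • v y) * ψ x)
      ((volume : Measure ℝ).prod volume) := by
    refine ((hψ.const_mul C).mul_prod hk'.norm).mono ?_ (.of_forall fun p => ?_)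
    · simp only [uncurry_def]
      have m1 : Measurable fun p : ℝ × ℝ => hk s (p.1 - p.2) := (measurable_hk s).comp (by fun_prop)
      have m2 : Measurable fun p : ℝ × ℝ => ψ p.1 := ψ.continuous.measurable.comp measurable_fst
      exact (m1.aestronglyMeasurable.smul hvm.comp_snd).mul m2.aestronglyMeasurable
    · simp only [uncurry_def]
      rw [norm_mul, norm_smul, norm_of_nonneg (hk_nonneg _ _), norm_of_nonneg (by positivity),
        norm_smul, norm_of_nonneg (by positivity : 0 ≤ ((1 + |p.2|) ^ k)⁻¹)]
      have h2 := (hb s (by simp) (p.1 - p.2)).trans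
        (mul_le_mul_of_nonneg_left (one_add_abs_sub p.1 p.2 k) hC)
      calc hk s (p.1 - p.2) * ‖v p.2‖ * ‖ψ p.1‖
          ≤ (C * ((1 + |p.1|) ^ k * ((1 + |p.2|) ^ k)⁻¹)) * ‖v p.2‖ * ‖ψ p.1‖ := by gcongr
        _ = _ := by ring
  calc ∫ x, heat s v x * ψ x = ∫ x, ∫ y, (hk s (x - y) • v y) * ψ x := by
        congr 1; ext x; rw [heat, integral_mul_const]
    _ = ∫ y, ∫ x, (hk s (x - y) • v y) * ψ x := integral_integral_swap hint
    _ = _ := by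
        congr 1; ext y
        rw [heat, ← integral_const_mul]
        congr 1; ext x
        rw [← neg_sub y x, hk_neg, smul_mul_assoc, mul_smul_comm]

lemma schwartz_bounded (ψ : 𝒮) : ∃ B : ℝ, 0 ≤ B ∧ ∀ x, ‖ψ x‖ ≤ B := by
  obtain ⟨C, hC, h⟩ := schwartz_decay ψ 0
  exact ⟨C, hC, fun x => by simpa using h x⟩

/-- By symmetry the heat flow acts on the test function, where it converges with uniform decay; for
`v` only weak convergence is claimed. -/
lemma tendsto_integral_heat_mul {v : ℝ → ℂ} (hv : Tempered v) (ψ : 𝒮) :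
    Tendsto (fun s => ∫ x, heat s v x * ψ x) (𝓝[>] 0) (𝓝 (∫ x, v x * ψ x)) := by
  have h1 : Tendsto (fun s => ∫ x, v x * heat s ψ x) (𝓝[>] 0) (𝓝 (∫ x, v x * ψ x)) := by
    have hv' := hv
    obtain ⟨k, hk'⟩ := hv
    obtain ⟨C, hC, hb⟩ := heat_schwartz_decay ψ k 1
    obtain ⟨B, hB, hψ⟩ := schwartz_bounded ψ
    refine tendsto_integral_filter_of_dominated_convergence
      (fun x => C * ‖((1 + |x|) ^ k)⁻¹ • v x‖) ?_ ?_ (hk'.norm.const_mul C) ?_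
    · filter_upwards with s
      exact hv'.aestronglyMeasurable.mul ((measurable_heat (schwartz_tempered ψ).aestronglyMeasurable).comp
        (measurable_const.prodMk measurable_id)).aestronglyMeasurable
    · filter_upwards [self_mem_nhdsWithin, mem_nhdsWithin_of_mem_nhds (Iio_mem_nhds one_pos)] with s hs hs1
      refine .of_forall fun x => ?_
      rw [norm_mul, norm_smul, norm_of_nonneg (by positivity)]
      calc ‖v x‖ * ‖heat s ψ x‖ ≤ ‖v x‖ * (C * ((1 + |x|) ^ k)⁻¹) := by
            gcongr; exact hb s hs (le_of_lt hs1) x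
        _ = _ := by ring
    · exact .of_forall fun x => (tendsto_heat ψ.continuous hψ x).const_mul _
  refine h1.congr' ?_
  filter_upwards [self_mem_nhdsWithin] with s hs using (integral_heat_mul hv ψ hs).symm

lemma Tempered.locallyIntegrable {v : ℝ → ℂ} (hv : Tempered v) : LocallyIntegrable v := by
  obtain ⟨k, hk'⟩ := hv
  have e : v = fun x => ((1 + |x|) ^ k) • (((1 + |x|) ^ k)⁻¹ • v x) := by
    ext x; rw [smul_smul, mul_inv_cancel₀ (by positivity), one_smul]
  have h2 := (locallyIntegrableOn_univ.2 hk'.locallyIntegrable).continuousOn_smul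
    isOpen_univ.isLocallyClosed (g := fun x : ℝ => (1 + |x|) ^ k)
    (Continuous.continuousOn (by fun_prop))
  rw [locallyIntegrableOn_univ] at h2
  rw [e]
  exact h2

lemma ae_eq_of_integral_schwartz {f v : ℝ → ℂ} (hf : LocallyIntegrable f) (hv : LocallyIntegrable v)
    (h : ∀ ψ : 𝒮, HasCompactSupport ψ → ∫ x, f x * ψ x = ∫ x, v x * ψ x) : f =ᵐ[volume] v := by
  refine ae_eq_of_integral_contDiff_smul_eq hf hv fun ψ hψ hc => ?_
  have hψ' : ContDiff ℝ (⊤ : ℕ∞) fun x => (ψ x : ℂ) := ofRealCLM.contDiff.comp hψ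
  have hc' : HasCompactSupport fun x => (ψ x : ℂ) := hc.comp_left (g := fun r : ℝ => (r : ℂ)) (by simp)
  have := h (hc'.toSchwartzMap hψ') hc'
  have e : ∀ x, (hc'.toSchwartzMap hψ') x = (ψ x : ℂ) := fun x => rfl
  simp only [e] at this
  simpa only [real_smul, mul_comm] using this

/-- The time derivative g''_s is O(s^(α/2-1)), integrable at s = 0 with primitive (2/α) s^(α/2). -/
lemma norm_heat_sub_heat_le {α C A : ℝ} (h0 : 0 < α) {g : ℝ → ℂ} (hg : Tempered g)
    (hb : ∀ s, 0 < s → ∀ x, ‖heat2 s g x‖ ≤ C * A * s ^ (α / 2 - 1)) {a b : ℝ} (ha : 0 < a)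
    (hab : a ≤ b) (x : ℝ) :
    ‖heat b g x - heat a g x‖ ≤ C * (2 / α) * A * (b ^ (α / 2) - a ^ (α / 2)) := by
  have hd : ∀ s ∈ Icc a b, HasDerivAt (fun s => heat s g x - heat a g x) (heat2 s g x) s :=
    fun s hs => (hasDerivAt_heat_time hg (ha.trans_le hs.1) x).sub_const _
  have hB : ∀ s ∈ Icc a b, HasDerivAt (fun s => C * (2 / α) * A * (s ^ (α / 2) - a ^ (α / 2)))
      (C * A * s ^ (α / 2 - 1)) s := fun s hs => by
    have h2 := ((Real.hasDerivAt_rpow_const (x := s) (p := α / 2) (Or.inl (ha.trans_le hs.1).ne')).sub_const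
      (a ^ (α / 2))).const_mul (C * (2 / α) * A)
    refine h2.congr_deriv ?_
    field_simp
  exact image_norm_le_of_norm_deriv_right_le_deriv_boundary'
    (f := fun s => heat s g x - heat a g x) (f' := fun s => heat2 s g x)
    (B := fun s => C * (2 / α) * A * (s ^ (α / 2) - a ^ (α / 2))) (B' := fun s => C * A * s ^ (α / 2 - 1))
    (fun s hs => (hd s hs).continuousAt.continuousWithinAt)
    (fun s hs => (hd s (Ico_subset_Icc_self hs)).hasDerivWithinAt) (by simp)
    (fun s hs => (hB s hs).continuousAt.continuousWithinAt)
    (fun s hs => (hB s (Ico_subset_Icc_self hs)).hasDerivWithinAt)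
    (fun s hs => hb s (ha.trans_le hs.1) x) (right_mem_Icc.2 hab)

/-- A function with bounded fractional derivative is, up to a null set, the uniform limit of its
heat extensions. -/
lemma exists_heat_limit {α C A : ℝ} (h0 : 0 < α) (hC : 0 ≤ C) (hA : 0 ≤ A) {g : ℝ → ℂ} (hg : Tempered g)
    (hb : ∀ s, 0 < s → ∀ x, ‖heat2 s g x‖ ≤ C * A * s ^ (α / 2 - 1)) :
    ∃ g₀ : ℝ → ℂ, g =ᵐ[volume] g₀ ∧ Continuous g₀ ∧ ∀ s, 0 < s → ∀ x, ‖heat s g x - g₀ x‖ ≤ C * (2 / α) * A * s ^ (α / 2) := by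
  set K := C * (2 / α) * A with hK
  have hK0 : 0 ≤ K := by positivity
  have hsub : ∀ a b, 0 < a → a ≤ b → ∀ x, ‖heat b g x - heat a g x‖ ≤ K * b ^ (α / 2) := fun a b ha hab x =>
    (norm_heat_sub_heat_le h0 hg hb ha hab x).trans (by
      have : 0 ≤ a ^ (α / 2) := by positivity
      gcongr; linarith)
  have hlim : ∀ x, ∃ z, Tendsto (fun s => heat s g x) (𝓝[>] 0) (𝓝 z) := by
    intro x
    refine cauchy_map_iff_exists_tendsto.1 (Metric.cauchy_iff.2 ⟨inferInstance, fun ε hε => ?_⟩)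
    have ht : Tendsto (fun b : ℝ => K * b ^ (α / 2)) (𝓝[>] 0) (𝓝 0) := by
      have : Tendsto (fun b : ℝ => K * b ^ (α / 2)) (𝓝 0) (𝓝 (K * 0 ^ (α / 2))) :=
        ((Real.continuousAt_rpow_const 0 (α / 2) (Or.inr (by positivity))).tendsto).const_mul K
      rw [zero_rpow (by positivity), mul_zero] at this
      exact this.mono_left nhdsWithin_le_nhds
    have hev : ∀ᶠ b in 𝓝[>] (0 : ℝ), 0 < b ∧ K * b ^ (α / 2) < ε := by
      filter_upwards [self_mem_nhdsWithin, ht.eventually (gt_mem_nhds hε)] with b hb1 hb2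
      exact ⟨hb1, hb2⟩
    refine ⟨(fun s => heat s g x) '' {b | 0 < b ∧ K * b ^ (α / 2) < ε}, image_mem_map hev, ?_⟩
    rintro _ ⟨a, ha, rfl⟩ _ ⟨b, hb', rfl⟩
    rw [dist_eq_norm]
    rcases le_total a b with hab | hab
    · rw [norm_sub_rev]; exact (hsub a b ha.1 hab x).trans_lt hb'.2
    · exact (hsub b a hb'.1 hab x).trans_lt ha.2
  choose g₀ hg₀ using hlim
  have hclose : ∀ s, 0 < s → ∀ x, ‖heat s g x - g₀ x‖ ≤ K * s ^ (α / 2) := fun s hs x => by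
    refine le_of_tendsto ((tendsto_const_nhds.sub (hg₀ x)).norm) ?_
    filter_upwards [self_mem_nhdsWithin, mem_nhdsWithin_of_mem_nhds (Iio_mem_nhds hs)] with a ha has
    exact hsub a s ha (le_of_lt has) x
  have hu : TendstoUniformly (fun s => heat s g) g₀ (𝓝[>] (0 : ℝ)) := by
    rw [Metric.tendstoUniformly_iff]
    intro ε hε
    have ht : Tendsto (fun b : ℝ => K * b ^ (α / 2)) (𝓝[>] 0) (𝓝 0) := by
      have : Tendsto (fun b : ℝ => K * b ^ (α / 2)) (𝓝 0) (𝓝 (K * 0 ^ (α / 2))) :=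
        ((Real.continuousAt_rpow_const 0 (α / 2) (Or.inr (by positivity))).tendsto).const_mul K
      rw [zero_rpow (by positivity), mul_zero] at this
      exact this.mono_left nhdsWithin_le_nhds
    filter_upwards [self_mem_nhdsWithin, ht.eventually (gt_mem_nhds hε)] with s hs h2 x
    rw [dist_comm, dist_eq_norm]
    exact (hclose s hs x).trans_lt h2
  have hcont : Continuous g₀ := by
    refine hu.continuous (Eventually.frequently ?_)
    filter_upwards [self_mem_nhdsWithin] with s hs
    exact continuous_iff_continuousAt.2 fun x => (hasDerivAt_heat hg hs x).continuousAt
  refine ⟨g₀, ?_, hcont, hclose⟩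
  refine ae_eq_of_integral_schwartz hg.locallyIntegrable hcont.locallyIntegrable fun ψ hψ => ?_
  -- Both functions are limits of the same heat extensions: `g` when tested against Schwartz
  -- functions, `g₀` uniformly.
  refine tendsto_nhds_unique (tendsto_integral_heat_mul hg ψ) ?_
  have hi1 : Integrable fun x => (‖g₀ x‖ + K) * ‖ψ x‖ :=
    ((hcont.norm.add continuous_const).mul ψ.continuous.norm).integrable_of_hasCompactSupport
      (hψ.norm.mul_left)
  refine tendsto_integral_filter_of_dominated_convergence _ ?_ ?_ hi1 ?_
  · filter_upwards with s
    exact ((measurable_heat hg.aestronglyMeasurable).comp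
        (measurable_const.prodMk measurable_id)).aestronglyMeasurable.mul ψ.continuous.aestronglyMeasurable
  · filter_upwards [self_mem_nhdsWithin, mem_nhdsWithin_of_mem_nhds (Iio_mem_nhds one_pos)] with s hs hs1
    refine .of_forall fun x => ?_
    rw [norm_mul]
    gcongr
    have h2 := hclose s hs x
    have h3 : s ^ (α / 2) ≤ 1 := rpow_le_one (le_of_lt hs) (le_of_lt hs1) (by positivity)
    calc ‖heat s g x‖ = ‖g₀ x + (heat s g x - g₀ x)‖ := by congr 1; ring
      _ ≤ ‖g₀ x‖ + ‖heat s g x - g₀ x‖ := norm_add_le _ _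
      _ ≤ ‖g₀ x‖ + K * 1 := by gcongr; exact h2.trans (by gcongr)
      _ = _ := by ring
  · exact .of_forall fun x => (hg₀ x).mul_const _

lemma IsFracDeriv.congr {α : ℝ} {g g' h : ℝ → ℂ} (hg : IsFracDeriv α g h) (e : g =ᵐ[volume] g') : IsFracDeriv α g' h where
  integrable_weight := hg.integrable_weight.congr (by filter_upwards [e] with x hx; rw [hx])
  tempered := hg.tempered
  pairing φ := by
    rw [hg.pairing φ]
    exact integral_congr_ae (by filter_upwards [e] with x hx; rw [hx])

/-- `g` is continuous and has a fractional derivative `h` that is bounded by `A`. -/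
structure BddFracDeriv (α A : ℝ) (g h : ℝ → ℂ) : Prop where
  fd : IsFracDeriv α g h
  bound : ∀ᵐ y, ‖h y‖ ≤ A
  cont : Continuous g

lemma BddFracDeriv.nonneg {α A : ℝ} {g h : ℝ → ℂ} (hg : BddFracDeriv α A g h) : 0 ≤ A := by
  obtain ⟨y, hy⟩ := hg.bound.exists
  exact (norm_nonneg _).trans hy

lemma IsFracDeriv.exists_bddFracDeriv {α A : ℝ} (h0 : 0 < α) (h1 : α < 1) {g h : ℝ → ℂ}
    (hg : IsFracDeriv α g h) (hA : ∀ᵐ y, ‖h y‖ ≤ A) :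
    ∃ g₀, g =ᵐ[volume] g₀ ∧ BddFracDeriv α A g₀ h := by
  obtain ⟨C, hC, hb⟩ := exists_heat_deriv_bound h0 h1
  have hA0 : 0 ≤ A := by
    obtain ⟨y, hy⟩ := hA.exists
    exact (norm_nonneg _).trans hy
  obtain ⟨g₀, h2, h3, -⟩ := exists_heat_limit h0 hC.le hA0 (hg.tempered_left h1)
    (fun s hs x => (hb g h A hg hA s hs x).2)
  exact ⟨g₀, h2, hg.congr h2, hA, h3⟩

/-- Regularity of functions with bounded fractional derivative. -/
lemma exists_regularity_bound {α : ℝ} (h0 : 0 < α) (h1 : α < 1) : ∃ C : ℝ, 0 < C ∧ ∀ (g h : ℝ → ℂ) (A : ℝ), BddFracDeriv α A g h →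
      (∀ s, 0 < s → ∀ x, ‖heat1 s g x‖ ≤ C * A * s ^ (α / 2 - 1 / 2)) ∧
      (∀ s, 0 < s → ∀ x, ‖heat2 s g x‖ ≤ C * A * s ^ (α / 2 - 1)) ∧
      (∀ s, 0 < s → ∀ x, ‖heat s g x - g x‖ ≤ C * A * s ^ (α / 2)) ∧
      ∀ x y, ‖g x - g y‖ ≤ C * A * |x - y| ^ α := by
  obtain ⟨C, hC, hb⟩ := exists_heat_deriv_bound h0 h1
  refine ⟨C + 2 * (C * (2 / α)), by positivity, fun g h A hg => ?_⟩
  have hA := hg.nonneg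
  have hT := hg.fd.tempered_left h1
  have hb1 := fun s hs x => (hb g h A hg.fd hg.bound s hs x).1
  have hb2 := fun s hs x => (hb g h A hg.fd hg.bound s hs x).2
  have hl : ∀ s, 0 < s → ∀ x, ‖heat s g x - g x‖ ≤ C * (2 / α) * A * s ^ (α / 2) := by
    obtain ⟨g₀, h2, h3, h4⟩ := exists_heat_limit h0 hC.le hA hT hb2
    have : g = g₀ := (Continuous.ae_eq_iff_eq volume hg.cont h3).1 h2
    rw [this] at h4 ⊢
    exact h4
  have hαp : 0 ≤ C * (2 / α) := by positivity
  have c1 : C ≤ C + 2 * (C * (2 / α)) := by linarith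
  have c2 : C * (2 / α) ≤ C + 2 * (C * (2 / α)) := by linarith
  refine ⟨fun s hs x => (hb1 s hs x).trans ?_, fun s hs x => (hb2 s hs x).trans ?_, fun s hs x => (hl s hs x).trans ?_, fun x y => ?_⟩
  · gcongr
  · gcongr
  · gcongr
  by_cases hxy : x = y
  · subst hxy; simp [zero_rpow h0.ne']
  set d := |x - y| with hd
  have hd0 : 0 < d := abs_pos.2 (sub_ne_zero.2 hxy)
  -- Hölder continuity: compare at heat time s = d². Passing from g to g_s costs s^(α/2) = d^α at
  -- each of the two points, and the mean value bound for g_s costs s^(α/2-1/2) d = d^α.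
  have hs : 0 < d ^ 2 := by positivity
  have e1 : (d ^ 2) ^ (α / 2) = d ^ α := by
    rw [← Real.rpow_natCast, ← rpow_mul hd0.le]; congr 1; push_cast; ring
  have e2 : (d ^ 2) ^ (α / 2 - 1 / 2) * d = d ^ α := by
    rw [← Real.rpow_natCast, ← rpow_mul hd0.le]
    nth_rewrite 2 [← rpow_one d]
    rw [← rpow_add hd0]; congr 1; push_cast; ring
  have h5 : ‖heat (d ^ 2) g x - heat (d ^ 2) g y‖ ≤ C * A * (d ^ 2) ^ (α / 2 - 1 / 2) * d := by
    have := Convex.norm_image_sub_le_of_norm_hasDerivWithin_le (f := heat (d ^ 2) g) (s := univ)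
      (fun z _ => (hasDerivAt_heat hT hs z).hasDerivWithinAt) (fun z _ => hb1 _ hs z) convex_univ
      (mem_univ y) (mem_univ x)
    rwa [norm_eq_abs] at this
  have h6 := hl _ hs x
  have h7 := hl _ hs y
  rw [e1] at h6 h7
  rw [mul_assoc, e2] at h5
  calc ‖g x - g y‖ = ‖(heat (d ^ 2) g x - heat (d ^ 2) g y) - (heat (d ^ 2) g x - g x) + (heat (d ^ 2) g y - g y)‖ := by congr 1; ring
    _ ≤ ‖heat (d ^ 2) g x - heat (d ^ 2) g y‖ + ‖heat (d ^ 2) g x - g x‖ + ‖heat (d ^ 2) g y - g y‖ :=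
        (norm_add_le _ _).trans (by gcongr; exact norm_sub_le _ _)
    _ ≤ C * A * d ^ α + C * (2 / α) * A * d ^ α + C * (2 / α) * A * d ^ α := by gcongr
    _ = _ := by ring

/-! ### Square functions of heat extensions through Plancherel. -/

lemma enorm_sq_eq_ofReal (z : ℂ) : ‖z‖ₑ ^ 2 = ofReal (‖z‖ ^ 2) := by
  rw [← ofReal_norm, ofReal_pow (norm_nonneg _)]

lemma schwartz_sq_integrable (φ : 𝒮) : Integrable fun x => ‖φ x‖ ^ 2 := (φ.memLp 2).integrable_norm_pow two_ne_zero

/-- Plancherel's identity for Schwartz functions. -/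
lemma lintegral_sq_fourier (φ : 𝒮) : ∫⁻ ζ, ‖𝓕 φ ζ‖ₑ ^ 2 = ∫⁻ x, ‖φ x‖ₑ ^ 2 := by
  simp only [enorm_sq_eq_ofReal]
  rw [← ofReal_integral_eq_lintegral_ofReal (schwartz_sq_integrable _)
      (.of_forall fun x => by positivity),
    ← ofReal_integral_eq_lintegral_ofReal (schwartz_sq_integrable _)
      (.of_forall fun x => by positivity), SchwartzMap.integral_norm_sq_fourier]

lemma lintegral_rpow_exp {a r : ℝ} (ha : 0 < a) (hr : 0 < r) : ∫⁻ s in ℝ₊, ofReal (s ^ (a - 1) * rexp (-(r * s))) =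
      ofReal ((1 / r) ^ a * Gamma a) := by
  rw [← ofReal_integral_eq_lintegral_ofReal (integrableOn_rpow_exp ha hr), Real.integral_rpow_mul_exp_neg_mul_Ioi ha hr]
  rw [EventuallyLE, ae_restrict_iff' measurableSet_Ioi]
  exact .of_forall fun s (hs : 0 < s) => by simp only [Pi.zero_apply]; positivity

/-- Plancherel in x and Tonelli reduce a square function to a bound, uniform in the frequency, for
the s-integral of the squared multiplier. Frequency zero is a null set. -/
lemma lintegral_sq_le_of_fourier (u : 𝒮) {w : ℝ → ℝ≥0∞} (hw : Measurable w)
    {m : ℝ → ℝ → ℝ≥0∞} (hm : Measurable (uncurry m)) {ψ : ℝ → ℝ → ℂ} {M : ℝ≥0∞}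
    (H : ∀ s, 0 < s → ∃ Ψ : 𝒮, (∀ x, Ψ x = ψ s x) ∧ ∀ ζ, ‖𝓕 Ψ ζ‖ₑ ^ 2 ≤ m s ζ * ‖𝓕 u ζ‖ₑ ^ 2)
    (hM : ∀ ζ, ζ ≠ 0 → ∫⁻ s in ℝ₊, w s * m s ζ ≤ M) :
    ∫⁻ s in ℝ₊, w s * ∫⁻ x, ‖ψ s x‖ₑ ^ 2 ≤ M * ∫⁻ x, ‖u x‖ₑ ^ 2 := by
  have hu : Measurable (⇑(𝓕 u : 𝒮)) := (𝓕 u).continuous.measurable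
  calc ∫⁻ s in ℝ₊, w s * ∫⁻ x, ‖ψ s x‖ₑ ^ 2
      ≤ ∫⁻ s in ℝ₊, ∫⁻ ζ, w s * m s ζ * ‖𝓕 u ζ‖ₑ ^ 2 := by
        refine setLIntegral_mono' measurableSet_Ioi fun s hs => ?_
        obtain ⟨Ψ, h1, h2⟩ := H s hs
        have e : ∫⁻ x, ‖ψ s x‖ₑ ^ 2 = ∫⁻ ζ, ‖𝓕 Ψ ζ‖ₑ ^ 2 := by
          rw [lintegral_sq_fourier]; simp only [h1]
        have hms : Measurable (m s) := hm.comp (measurable_const.prodMk measurable_id)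
        simp only [mul_assoc]
        rw [lintegral_const_mul _ (by fun_prop), e]
        gcongr with ζ
        exact h2 ζ
    _ = ∫⁻ ζ, ∫⁻ s in ℝ₊, w s * m s ζ * ‖𝓕 u ζ‖ₑ ^ 2 := by
        refine lintegral_lintegral_swap (Measurable.aemeasurable ?_)
        have h1 : Measurable fun p : ℝ × ℝ => w p.1 := hw.comp measurable_fst
        have h2 : Measurable fun p : ℝ × ℝ => ‖𝓕 u p.2‖ₑ := (hu.comp measurable_snd).enorm
        exact (h1.mul hm).mul (h2.pow_const 2)
    _ ≤ ∫⁻ ζ, M * ‖𝓕 u ζ‖ₑ ^ 2 := by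
        have hz : ∀ᵐ ζ : ℝ, ζ ≠ 0 := by simp [ae_iff]
        refine lintegral_mono_ae ?_
        filter_upwards [hz] with ζ hζ
        have hms : Measurable fun s => m s ζ := hm.comp (measurable_id.prodMk measurable_const)
        have hwm : Measurable fun s => w s * m s ζ := hw.mul hms
        rw [lintegral_mul_const _ hwm]
        gcongr
        exact hM ζ hζ
    _ = _ := by
        rw [lintegral_const_mul _ (by fun_prop), lintegral_sq_fourier]

lemma fourier_schwartz_sub (φ ψ : 𝒮) (ζ : ℝ) : 𝓕 (φ - ψ) ζ = 𝓕 φ ζ - 𝓕 ψ ζ := by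
  have := map_sub (FourierTransform.fourierCLM ℂ 𝒮) φ ψ
  exact DFunLike.congr_fun this ζ

/-- At frequency ξ the integral is ∫ s² ξ⁶ exp(-2cξ²s) ds = 1/(4c³): the measure s² ds balances
three derivatives exactly. -/
lemma lintegral_heat_third_le (f : 𝒮) {c : ℝ} (hc : 0 < c) : ∫⁻ s in ℝ₊, ofReal (s ^ 2) *
      ∫⁻ x, ‖heat (s * c) (sderiv (sderiv (sderiv f))) x‖ₑ ^ 2 ≤ ofReal ((c ^ 3)⁻¹) * ∫⁻ x, ‖f x‖ₑ ^ 2 := by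
  refine lintegral_sq_le_of_fourier f (w := fun s => ofReal (s ^ 2)) (by fun_prop)
    (m := fun s ζ => ofReal ((2 * π * ζ) ^ 6 * rexp (-(2 * c * (2 * π * ζ) ^ 2 * s)))) ?_ ?_ ?_
  · simp only [uncurry_def]; fun_prop
  · intro s hs
    refine ⟨heatS (s * c) (by positivity) (sderiv (sderiv (sderiv f))), fun x => heatS_apply _ _ _ _, fun ζ => le_of_eq ?_⟩
    rw [fourier_heatS, fourier_sderiv, fourier_sderiv, fourier_sderiv, enorm_sq_eq_ofReal, enorm_sq_eq_ofReal, ← ofReal_mul (by positivity)]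
    congr 1
    have e : ‖(2 * π * I * ζ : ℂ)‖ = |2 * π * ζ| := by
      simp [abs_mul, abs_of_pos Real.pi_pos]
    have hn : ∀ z : ℂ, ‖(2 * π * I * ζ : ℂ) * z‖ = |2 * π * ζ| * ‖z‖ := fun z => by
      rw [norm_mul, e]
    rw [norm_mul, hn, hn, hn, norm_real, norm_of_nonneg (exp_pos _).le]
    have e2 : rexp (-(2 * c * (2 * π * ζ) ^ 2 * s)) = rexp (-(s * c * (2 * π * ζ) ^ 2)) ^ 2 := by
      rw [← exp_nat_mul]; congr 1; push_cast; ring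
    rw [e2, ← (show Even 6 by decide).pow_abs (2 * π * ζ)]
    ring
  · intro ζ hζ
    have hp : 0 < (2 * π * ζ) ^ 2 := by positivity
    have h2 := lintegral_rpow_exp (a := 3) (r := 2 * c * (2 * π * ζ) ^ 2) (by norm_num) (by positivity)
    have e : ∀ s : ℝ, ofReal (s ^ 2) * ofReal ((2 * π * ζ) ^ 6 * rexp (-(2 * c * (2 * π * ζ) ^ 2 * s))) =
        ofReal ((2 * π * ζ) ^ 6) * ofReal (s ^ ((3 : ℝ) - 1) * rexp (-(2 * c * (2 * π * ζ) ^ 2 * s))) := fun s => by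
      rw [← ofReal_mul (by positivity), ← ofReal_mul (by positivity)]
      congr 1
      rw [show (3 : ℝ) - 1 = (2 : ℕ) by norm_num, Real.rpow_natCast]; ring
    simp only [e]
    rw [lintegral_const_mul _ (by fun_prop), h2, ← ofReal_mul (by positivity)]
    refine ofReal_le_ofReal ?_
    have hG : Gamma 3 = 2 := by
      rw [show (3 : ℝ) = (2 : ℕ) + 1 by norm_num, Real.Gamma_nat_eq_factorial]; simp
    rw [hG, show (3 : ℝ) = (3 : ℕ) by norm_num, Real.rpow_natCast]
    have e3 : (2 * π * ζ) ^ 6 * ((1 / (2 * c * (2 * π * ζ) ^ 2)) ^ 3 * 2) = (c ^ 3)⁻¹ * (1 / 4) := by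
      field_simp; norm_num
    rw [e3]
    have : 0 < (c ^ 3)⁻¹ := by positivity
    linarith

lemma lintegral_heat_deriv_le (u : 𝒮) : ∫⁻ s in ℝ₊, ∫⁻ x, ‖heat s (sderiv u) x‖ₑ ^ 2 ≤ ∫⁻ x, ‖u x‖ₑ ^ 2 := by
  have := lintegral_sq_le_of_fourier u (w := fun _ => 1) (by fun_prop)
    (m := fun s ζ => ofReal ((2 * π * ζ) ^ 2 * rexp (-(2 * (2 * π * ζ) ^ 2 * s))))
    (ψ := fun s => heat s (sderiv u)) (M := 1) ?_ ?_ ?_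
  · simpa using this
  · simp only [uncurry_def]; fun_prop
  · intro s hs
    refine ⟨heatS s hs (sderiv u), fun x => heatS_apply _ _ _ _, fun ζ => le_of_eq ?_⟩
    rw [fourier_heatS, fourier_sderiv, enorm_sq_eq_ofReal, enorm_sq_eq_ofReal, ← ofReal_mul (by positivity)]
    congr 1
    have e : ‖(2 * π * I * ζ : ℂ)‖ = |2 * π * ζ| := by
      simp [abs_mul, abs_of_pos Real.pi_pos]
    rw [norm_mul, norm_mul (_ * _), e, norm_real, norm_of_nonneg (exp_pos _).le]
    have e2 : rexp (-(2 * (2 * π * ζ) ^ 2 * s)) = rexp (-(s * (2 * π * ζ) ^ 2)) ^ 2 := by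
      rw [← exp_nat_mul]; congr 1; push_cast; ring
    rw [e2, ← sq_abs (2 * π * ζ)]
    ring
  · intro ζ hζ
    have hp : 0 < (2 * π * ζ) ^ 2 := by positivity
    have h2 := lintegral_rpow_exp (a := 1) (r := 2 * (2 * π * ζ) ^ 2) (by norm_num) (by positivity)
    simp only [sub_self, rpow_zero, one_mul, rpow_one, Real.Gamma_one, mul_one] at h2
    simp only [one_mul, ofReal_mul hp.le]
    rw [lintegral_const_mul _ (by fun_prop), h2, ← ofReal_mul (by positivity)]
    refine ofReal_le_one.2 ?_
    have e3 : (2 * π * ζ) ^ 2 * (1 / (2 * (2 * π * ζ) ^ 2)) = 1 / 2 := by field_simp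
    rw [e3]; norm_num

lemma one_sub_exp_le_rpow {x κ : ℝ} (hx : 0 ≤ x) (h0 : 0 ≤ κ) (h1 : κ ≤ 1) : 1 - rexp (-x) ≤ x ^ κ := by
  rcases le_total x 1 with h | h
  · refine one_sub_exp_le.trans ?_
    rcases hx.eq_or_lt with rfl | hx
    · exact rpow_nonneg le_rfl _
    · have := rpow_le_rpow_of_exponent_ge hx h h1
      rwa [rpow_one] at this
  · have h2 := one_le_rpow h h0
    have := exp_pos (-x)
    linarith

/-- Factor out the larger exponential, at most exp(-t) because a, b ≥ 1, and interpolate 1 - exp(-x)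
≤ x^κ between the bounds 1 and x. -/
lemma abs_exp_sub_exp_le {a b t κ : ℝ} (ha : 1 ≤ a) (hb : 1 ≤ b) (ht : 0 ≤ t) (h0 : 0 ≤ κ) (h1 : κ ≤ 1) :
    |rexp (-(a * t)) - rexp (-(b * t))| ≤ (t * |a - b|) ^ κ * rexp (-t) := by
  wlog hab : a ≤ b generalizing a b
  · have := this hb ha (le_of_not_ge hab)
    rwa [abs_sub_comm, abs_sub_comm b a] at this
  have e : rexp (-(a * t)) - rexp (-(b * t)) = rexp (-(a * t)) * (1 - rexp (-(t * (b - a)))) := by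
    rw [mul_sub, ← exp_add, mul_one]; congr 2; ring
  have hba : 0 ≤ b - a := by linarith
  have h3 : 0 ≤ 1 - rexp (-(t * (b - a))) := by
    have : rexp (-(t * (b - a))) ≤ 1 := exp_le_one_iff.2 (by
      have : 0 ≤ t * (b - a) := by positivity
      linarith)
    linarith
  rw [e, abs_of_nonneg (mul_nonneg (exp_pos _).le h3), mul_comm, abs_sub_comm, abs_of_nonneg hba]
  refine mul_le_mul (one_sub_exp_le_rpow (by positivity) h0 h1) (exp_le_exp.2 ?_) (exp_pos _).le
    (by positivity)
  nlinarith

/-- A difference of two heat times vanishes at low frequency, so its square function with respect to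
ds/s converges. A small κ keeps the growth in the ratio of the two times slow. -/
lemma lintegral_heat_sub_le (u : 𝒮) {a b κ : ℝ} (ha : 1 ≤ a) (hb : 1 ≤ b) (h0 : 0 < κ) (h1 : κ ≤ 1) :
    ∫⁻ s in ℝ₊, ofReal s⁻¹ * ∫⁻ x, ‖heat (s * a) u x - heat (s * b) u x‖ₑ ^ 2 ≤
      ofReal (Gamma (2 * κ) * |a - b| ^ (2 * κ)) * ∫⁻ x, ‖u x‖ₑ ^ 2 := by
  refine lintegral_sq_le_of_fourier u (w := fun s => ofReal s⁻¹) (by fun_prop)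
    (m := fun s ζ => ofReal (((s * (2 * π * ζ) ^ 2 * |a - b|) ^ κ * rexp (-(s * (2 * π * ζ) ^ 2))) ^ 2))
    (ψ := fun s x => heat (s * a) u x - heat (s * b) u x) ?_ ?_ ?_
  · simp only [uncurry_def]; fun_prop
  · intro s hs
    have hsa : 0 < s * a := by positivity
    have hsb : 0 < s * b := by positivity
    refine ⟨heatS (s * a) hsa u - heatS (s * b) hsb u, fun x => by
      rw [sub_apply, heatS_apply, heatS_apply], fun ζ => ?_⟩
    have e : 𝓕 (heatS (s * a) hsa u - heatS (s * b) hsb u) ζ =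
        ((rexp (-(a * (s * (2 * π * ζ) ^ 2))) - rexp (-(b * (s * (2 * π * ζ) ^ 2))) : ℝ) : ℂ) * 𝓕 u ζ := by
      rw [fourier_schwartz_sub, fourier_heatS, fourier_heatS, ← sub_mul, ← Complex.ofReal_sub]
      congr 4 <;> ring_nf
    rw [e, enorm_mul, mul_pow]
    gcongr
    rw [enorm_sq_eq_ofReal, norm_real, norm_eq_abs]
    refine ofReal_le_ofReal ?_
    gcongr
    exact abs_exp_sub_exp_le ha hb (by positivity) h0.le h1
  · intro ζ hζ
    have hp : 0 < (2 * π * ζ) ^ 2 := by positivity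
    have h2 := lintegral_rpow_exp (a := 2 * κ) (r := 2 * (2 * π * ζ) ^ 2) (by positivity) (by positivity)
    have e : ∀ s ∈ ℝ₊, ofReal s⁻¹ * ofReal (((s * (2 * π * ζ) ^ 2 * |a - b|) ^ κ * rexp (-(s * (2 * π * ζ) ^ 2))) ^ 2) =
        ofReal (((2 * π * ζ) ^ 2) ^ (2 * κ) * |a - b| ^ (2 * κ)) * ofReal (s ^ (2 * κ - 1) *
          rexp (-(2 * (2 * π * ζ) ^ 2 * s))) := fun s (hs : 0 < s) => by
      rw [← ofReal_mul (by positivity), ← ofReal_mul (by positivity)]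
      congr 1
      have e2 : rexp (-(2 * (2 * π * ζ) ^ 2 * s)) = rexp (-(s * (2 * π * ζ) ^ 2)) ^ 2 := by
        rw [← exp_nat_mul]; congr 1; push_cast; ring
      have e3 : ∀ y : ℝ, 0 ≤ y → y ^ (2 * κ) = (y ^ κ) ^ 2 := fun y hy => by
        rw [← Real.rpow_natCast, ← rpow_mul hy]; congr 1; push_cast; ring
      rw [e2, rpow_sub hs, rpow_one, e3 s hs.le, e3 _ hp.le, e3 _ (abs_nonneg _),
        mul_rpow (by positivity) (abs_nonneg _), mul_rpow hs.le hp.le]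
      field_simp
    rw [setLIntegral_congr_fun measurableSet_Ioi e, lintegral_const_mul _ (by fun_prop), h2, ← ofReal_mul (by positivity)]
    refine ofReal_le_ofReal ?_
    have h4 : (1 / (2 * (2 * π * ζ) ^ 2)) ^ (2 * κ) ≤ (((2 * π * ζ) ^ 2) ^ (2 * κ))⁻¹ := by
      rw [← inv_rpow hp.le]
      refine rpow_le_rpow (by positivity) ?_ (by positivity)
      rw [one_div]
      exact inv_anti₀ hp (by linarith)
    have hG : 0 < Gamma (2 * κ) := Real.Gamma_pos_of_pos (by positivity)
    have hq : 0 < ((2 * π * ζ) ^ 2) ^ (2 * κ) := by positivity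
    calc ((2 * π * ζ) ^ 2) ^ (2 * κ) * |a - b| ^ (2 * κ) * ((1 / (2 * (2 * π * ζ) ^ 2)) ^ (2 * κ) * Gamma (2 * κ))
        ≤ ((2 * π * ζ) ^ 2) ^ (2 * κ) * |a - b| ^ (2 * κ) * ((((2 * π * ζ) ^ 2) ^ (2 * κ))⁻¹ * Gamma (2 * κ)) := by gcongr
      _ = _ := by field_simp

lemma lintegral_heat_sq_le (u : 𝒮) {s : ℝ} (hs : 0 < s) : ∫⁻ x, ‖heat s u x‖ₑ ^ 2 ≤ ∫⁻ x, ‖u x‖ₑ ^ 2 := by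
  rw [← lintegral_sq_fourier u, ← heatS_coe s hs u, ← lintegral_sq_fourier (heatS s hs u)]
  refine lintegral_mono fun ζ => ?_
  rw [fourier_heatS, enorm_mul, mul_pow]
  refine mul_le_of_le_one_left (by positivity) (pow_le_one₀ (by positivity) ?_)
  rw [← ofReal_norm, norm_real, norm_of_nonneg (exp_pos _).le]
  refine ofReal_le_one.2 (exp_le_one_iff.2 ?_)
  have : 0 ≤ s * (2 * π * ζ) ^ 2 := by positivity
  linarith

/-! ### The Carleson embedding for heat extensions of bounded functions. -/

/-- Cauchy–Schwarz for iterated integrals. -/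
lemma lintegral_lintegral_mul_le {μ ν : Measure ℝ} [SFinite μ] [SFinite ν] {a b : ℝ → ℝ → ℝ≥0∞}
    (ha : Measurable (uncurry a)) (hb : Measurable (uncurry b)) :
    ∫⁻ s, ∫⁻ x, a s x * b s x ∂ν ∂μ ≤ (∫⁻ s, ∫⁻ x, a s x ^ 2 ∂ν ∂μ) ^ (1 / 2 : ℝ) * (∫⁻ s, ∫⁻ x, b s x ^ 2 ∂ν ∂μ) ^ (1 / 2 : ℝ) := by
  have h := ENNReal.lintegral_mul_le_Lp_mul_Lq (μ.prod ν) (p := 2) (q := 2)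
    HolderConjugate.two_two ha.aemeasurable hb.aemeasurable
  simp only [ENNReal.rpow_two, Pi.mul_apply] at h
  have hab : Measurable fun p => uncurry a p * uncurry b p := ha.mul hb
  rw [lintegral_prod _ hab.aemeasurable, lintegral_prod _ (ha.pow_const 2).aemeasurable,
    lintegral_prod _ (hb.pow_const 2).aemeasurable] at h
  exact h

lemma lintegral_Ioi_le_of_Icc {F : ℝ → ℝ≥0∞} {M : ℝ≥0∞}
    (h : ∀ a b : ℝ, 0 < a → a ≤ b → ∫⁻ s in Icc a b, F s ≤ M) : ∫⁻ s in ℝ₊, F s ≤ M := by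
  have e : ℝ₊ = ⋃ n : ℕ, Icc ((n : ℝ) + 1)⁻¹ (n + 1) := by
    ext x
    simp only [mem_Ioi, mem_iUnion, mem_Icc]
    constructor
    · intro hx
      obtain ⟨n, hn⟩ := exists_nat_ge (max x x⁻¹)
      refine ⟨n, ?_, ?_⟩
      · rw [inv_le_comm₀ (by positivity) hx]
        linarith [le_max_right x x⁻¹]
      · linarith [le_max_left x x⁻¹]
    · rintro ⟨n, hn, -⟩
      exact lt_of_lt_of_le (by positivity) hn
  rw [e, setLIntegral_iUnion_of_directed]
  · refine iSup_le fun n => h _ _ (by positivity) ?_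
    have : (1 : ℝ) ≤ n + 1 := by
      have : (0 : ℝ) ≤ n := Nat.cast_nonneg n
      linarith
    exact (inv_le_one_of_one_le₀ this).trans this
  · refine Monotone.directed_le (f := fun n : ℕ => Icc ((n : ℝ) + 1)⁻¹ ((n : ℝ) + 1)) fun m n hmn => ?_
    have : (m : ℝ) ≤ n := by exact_mod_cast hmn
    exact Icc_subset_Icc (inv_anti₀ (by positivity) (by linarith)) (by linarith)

lemma measurable_heat_space {v : ℝ → ℂ} (hv : AEStronglyMeasurable v) (s : ℝ) : Measurable (heat s v) :=
  Measurable.comp (g := fun p : ℝ × ℝ => heat p.1 v p.2) (f := fun x => (s, x)) (measurable_heat hv)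
    (measurable_const.prodMk measurable_id)

lemma measurable_heat1_space {v : ℝ → ℂ} (hv : AEStronglyMeasurable v) (s : ℝ) : Measurable (heat1 s v) :=
  Measurable.comp (g := fun p : ℝ × ℝ => heat1 p.1 v p.2) (f := fun x => (s, x)) (measurable_heat1 hv)
    (measurable_const.prodMk measurable_id)

lemma measurable_heat2_space {v : ℝ → ℂ} (hv : AEStronglyMeasurable v) (s : ℝ) : Measurable (heat2 s v) :=
  Measurable.comp (g := fun p : ℝ × ℝ => heat2 p.1 v p.2) (f := fun x => (s, x)) (measurable_heat2 hv)
    (measurable_const.prodMk measurable_id)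

/-- Uniform decay of the heat extension of a Schwartz function. -/
lemma heat_schwartz_weight_two (u : 𝒮) (b : ℝ) : ∃ C : ℝ, 0 ≤ C ∧ ∀ s, 0 < s → s ≤ b → ∀ x,
    ‖heat s u x‖ ≤ C * ((1 + |x|) ^ 2)⁻¹ ∧ ‖heat s u x‖ ≤ C := by
  obtain ⟨C, hC, h⟩ := heat_schwartz_decay u 2 b
  refine ⟨C, hC, fun s hs hb x => ⟨h s hs hb x, (h s hs hb x).trans ?_⟩⟩
  refine mul_le_of_le_one_right hC (inv_le_one_of_one_le₀ (one_le_pow₀ ?_))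
  linarith [abs_nonneg x]

/-- The cross term is at most 8|v||v1||w||w1| ≤ |v1|²|w|² + 16|v|²|w1|². One of the two copies of
|v1|²|w|² survives, and 14 = 16 - 2. -/
lemma carleson_pointwise (v v1 w w1 : ℂ) {A : ℝ} (hv : ‖v‖ ≤ A) :
    -(2 * ‖v1‖ ^ 2 * ‖w‖ ^ 2 + 2 * ‖v‖ ^ 2 * ‖w1‖ ^ 2 + 8 * inner ℝ v v1 * inner ℝ w w1) ≤
      -(‖v1‖ ^ 2 * ‖w‖ ^ 2) + 14 * A ^ 2 * ‖w1‖ ^ 2 := by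
  have h1 := abs_real_inner_le_norm v v1
  have h2 := abs_real_inner_le_norm w w1
  have h3 : |inner ℝ v v1 * inner ℝ w w1| ≤ (‖v‖ * ‖v1‖) * (‖w‖ * ‖w1‖) := by
    rw [abs_mul]; gcongr
  have h4 := neg_abs_le (inner ℝ v v1 * inner ℝ w w1)
  have h5 : ‖v‖ ^ 2 * ‖w1‖ ^ 2 ≤ A ^ 2 * ‖w1‖ ^ 2 := by gcongr
  nlinarith [sq_nonneg (‖v1‖ * ‖w‖ - 4 * (‖v‖ * ‖w1‖))]

/-- The heat extension of a bounded function defines a Carleson measure. -/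
lemma carleson_embedding {h : ℝ → ℂ} {A : ℝ} (hm : AEStronglyMeasurable h) (hA : ∀ᵐ y, ‖h y‖ ≤ A)
    (u : 𝒮) :
    ∫⁻ s in ℝ₊, ∫⁻ x, (‖heat1 s h x‖ₑ * ‖heat s u x‖ₑ) ^ 2 ≤ ofReal (15 * A ^ 2) * ∫⁻ x, ‖u x‖ₑ ^ 2 := by
  have hT := tempered_of_bounded hm hA
  have hA0 : 0 ≤ A := by
    obtain ⟨y, hy⟩ := hA.exists
    exact (norm_nonneg _).trans hy
  have hum := (schwartz_tempered u).aestronglyMeasurable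
  have hum1 := (schwartz_tempered (sderiv u)).aestronglyMeasurable
  have hum2 := (schwartz_tempered (sderiv (sderiv u))).aestronglyMeasurable
  refine lintegral_Ioi_le_of_Icc fun a b ha hab => ?_
  obtain ⟨C0, hC0, hw0⟩ := heat_schwartz_weight_two u (2 * b)
  obtain ⟨C1, hC1, hw1⟩ := heat_schwartz_weight_two (sderiv u) (2 * b)
  obtain ⟨C2, hC2, hw2⟩ := heat_schwartz_weight_two (sderiv (sderiv u)) (2 * b)
  set ω : ℝ → ℝ := fun x => ((1 + |x|) ^ 2)⁻¹ with hω
  have hω0 : ∀ x, 0 ≤ ω x := fun x => by simp only [hω]; positivity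
  have hωi : Integrable ω := integrable_weight_two
  set v : ℝ → ℝ → ℂ := fun s x => heat s h x with hv
  set v1 : ℝ → ℝ → ℂ := fun s x => heat1 s h x with hv1
  set v2 : ℝ → ℝ → ℂ := fun s x => heat2 s h x with hv2
  set w : ℝ → ℝ → ℂ := fun s x => heat s u x with hw
  set w1 : ℝ → ℝ → ℂ := fun s x => heat s (sderiv u) x with hw1'
  set w2 : ℝ → ℝ → ℂ := fun s x => heat s (sderiv (sderiv u)) x with hw2'
  have mv : ∀ s, Measurable (v s) := fun s => measurable_heat_space hm s
  have mv1 : ∀ s, Measurable (v1 s) := fun s => measurable_heat1_space hm s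
  have mv2 : ∀ s, Measurable (v2 s) := fun s => measurable_heat2_space hm s
  have mw : ∀ s, Measurable (w s) := fun s => measurable_heat_space hum s
  have mw1 : ∀ s, Measurable (w1 s) := fun s => measurable_heat_space hum1 s
  have mw2 : ∀ s, Measurable (w2 s) := fun s => measurable_heat_space hum2 s
  have bv : ∀ s, 0 < s → ∀ x, ‖v s x‖ ≤ A := fun s hs x => norm_heat_le hA hs x
  have bv1 : ∀ s, 0 < s → ∀ x, ‖v1 s x‖ ≤ 3 * (√s)⁻¹ * A := fun s hs x => norm_heat1_le hA hs x
  have bv2 : ∀ s, 0 < s → ∀ x, ‖v2 s x‖ ≤ 3 * s⁻¹ * A := fun s hs x => norm_heat2_le hA hs x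
  have dv : ∀ s, 0 < s → ∀ x, HasDerivAt (v s) (v1 s x) x := fun s hs x => hasDerivAt_heat hT hs x
  have dv1 : ∀ s, 0 < s → ∀ x, HasDerivAt (v1 s) (v2 s x) x := fun s hs x => hasDerivAt_heat1 hT hs x
  have dvt : ∀ s, 0 < s → ∀ x, HasDerivAt (fun s => v s x) (v2 s x) s := fun s hs x =>
    hasDerivAt_heat_time hT hs x
  have dw : ∀ s, 0 < s → ∀ x, HasDerivAt (w s) (w1 s x) x := fun s hs x =>
    (hasDerivAt_heat (schwartz_tempered u) hs x).congr_deriv (heat1_schwartz u hs x)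
  have dw1 : ∀ s, 0 < s → ∀ x, HasDerivAt (w1 s) (w2 s x) x := fun s hs x =>
    (hasDerivAt_heat (schwartz_tempered (sderiv u)) hs x).congr_deriv (heat1_schwartz (sderiv u) hs x)
  have dwt : ∀ s, 0 < s → ∀ x, HasDerivAt (fun s => w s x) (w2 s x) s := fun s hs x =>
    (hasDerivAt_heat_time (schwartz_tempered u) hs x).congr_deriv (heat2_schwartz u hs x)
  -- the energy and its derivative
  set E : ℝ → ℝ := fun s => ∫ x, ‖v s x‖ ^ 2 * ‖w s x‖ ^ 2 with hE
  set Et : ℝ → ℝ → ℝ := fun s x => (2 * inner ℝ (v s x) (v2 s x)) * ‖w s x‖ ^ 2 + ‖v s x‖ ^ 2 * (2 * inner ℝ (w s x) (w2 s x)) with hEt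
  -- The sum Et + Q is the second space derivative of |v|²|w|², whose first derivative is P1; it
  -- integrates to zero, so the energy E has derivative -∫ Q.
  set Q : ℝ → ℝ → ℝ := fun s x => 2 * ‖v1 s x‖ ^ 2 * ‖w s x‖ ^ 2 + 2 * ‖v s x‖ ^ 2 * ‖w1 s x‖ ^ 2 +
    8 * inner ℝ (v s x) (v1 s x) * inner ℝ (w s x) (w1 s x) with hQ
  set P1 : ℝ → ℝ → ℝ := fun s x => (2 * inner ℝ (v s x) (v1 s x)) * ‖w s x‖ ^ 2 + ‖v s x‖ ^ 2 * (2 * inner ℝ (w s x) (w1 s x)) with hP1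
  -- Majorant of -Q: the density to be estimated, with a minus sign, plus a term in w1 alone, whose
  -- integral over time and space is controlled by Plancherel.
  set φ : ℝ → ℝ → ℝ := fun s x => -(‖v1 s x‖ ^ 2 * ‖w s x‖ ^ 2) + 14 * A ^ 2 * ‖w1 s x‖ ^ 2 with hφ
  have sqw : ∀ {z : ℂ} {C ω₀ : ℝ}, ‖z‖ ≤ C * ω₀ → ‖z‖ ≤ C → ‖z‖ ^ 2 ≤ C * (C * ω₀) := fun h1 h2 => by
    rw [pow_two]; gcongr
    exact (norm_nonneg _).trans h2
  have inn : ∀ {y z : ℂ} {a b : ℝ}, ‖y‖ ≤ a → ‖z‖ ≤ b → |inner ℝ y z| ≤ a * b := fun h1 h2 =>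
    (abs_real_inner_le_norm _ _).trans (mul_le_mul h1 h2 (norm_nonneg _) ((norm_nonneg _).trans h1))
  have abs2 : ∀ i a b j : ℝ, |2 * i * a ^ 2 + b ^ 2 * (2 * j)| ≤ 2 * |i| * a ^ 2 + b ^ 2 * (2 * |j|) := fun i a b j => by
    refine (abs_add_le _ _).trans_eq ?_
    rw [abs_mul, abs_mul, abs_mul, abs_mul, abs_two, abs_sq, abs_sq]
  have iw : ∀ {C : ℝ} {f : ℝ → ℝ}, Measurable f → (∀ x, |f x| ≤ C * ω x) → Integrable f :=
    fun {C f} hf hb => (hωi.const_mul C).mono hf.aestronglyMeasurable (.of_forall fun x => by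
      rw [norm_eq_abs]; exact (hb x).trans (le_abs_self _))
  have hEd : ∀ s ∈ Icc a b, Integrable (Et s) ∧ HasDerivAt E (∫ x, Et s x) s := by
    intro s hs
    have hs0 : 0 < s := ha.trans_le hs.1
    have hball : ∀ t ∈ ball s (s / 2), 0 < t ∧ s / 2 < t ∧ t ≤ 2 * b := fun t ht => by
      rw [mem_ball, dist_eq, abs_lt] at ht
      refine ⟨by linarith, by linarith, by linarith [hs.2]⟩
    refine hasDerivAt_integral_of_dominated_loc_of_deriv_le (F := fun s x => ‖v s x‖ ^ 2 * ‖w s x‖ ^ 2)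
      (F' := Et) (bound := fun x => (2 * (A * (3 * (s / 2)⁻¹ * A)) * (C0 * C0) + A ^ 2 * (2 * (C0 * C2))) * ω x)
      (ball_mem_nhds s (by positivity : 0 < s / 2)) ?_ ?_ ?_ ?_ (hωi.const_mul _) ?_
    · exact .of_forall fun t => (((mv t).norm.pow_const 2).mul
        ((mw t).norm.pow_const 2)).aestronglyMeasurable
    · refine iw (C := A ^ 2 * (C0 * C0)) (((mv s).norm.pow_const 2).mul ((mw s).norm.pow_const 2)) fun x => ?_
      have h1 := hw0 s hs0 (by linarith [hs.2]) x
      have h2 := sqw h1.1 h1.2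
      have h3 := bv s hs0 x
      rw [abs_of_nonneg (mul_nonneg (sq_nonneg ‖v s x‖) (sq_nonneg ‖w s x‖))]
      calc ‖v s x‖ ^ 2 * ‖w s x‖ ^ 2 ≤ A ^ 2 * (C0 * (C0 * ω x)) := by gcongr
        _ = _ := by ring
    · have := mv s; have := mv2 s; have := mw s; have := mw2 s
      exact Measurable.aestronglyMeasurable (by simp only [hEt]; fun_prop)
    · refine .of_forall fun x t ht => ?_
      obtain ⟨ht0, ht1, ht2⟩ := hball t ht
      have h1 := hw0 t ht0 ht2 x
      have h2 := sqw h1.1 h1.2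
      have h3 := bv t ht0 x
      have h4 : ‖v2 t x‖ ≤ 3 * (s / 2)⁻¹ * A := (bv2 t ht0 x).trans (by gcongr)
      have h5 := (hw2 t ht0 ht2 x).1
      rw [norm_eq_abs]
      calc |Et t x| ≤ 2 * |inner ℝ (v t x) (v2 t x)| * ‖w t x‖ ^ 2 + ‖v t x‖ ^ 2 * (2 * |inner ℝ (w t x) (w2 t x)|) := abs2 _ _ _ _
        _ ≤ (2 * (A * (3 * (s / 2)⁻¹ * A))) * (C0 * (C0 * ω x)) + A ^ 2 * (2 * (C0 * (C2 * ω x))) := by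
            have j1 := inn h3 h4
            have j2 := inn h1.2 h5
            gcongr
        _ = _ := by ring
    · refine .of_forall fun x t ht => ?_
      obtain ⟨ht0, ht1, ht2⟩ := hball t ht
      exact (dvt t ht0 x).norm_sq.mul (dwt t ht0 x).norm_sq
  have hP : ∀ s ∈ Icc a b, Integrable (fun x => Et s x + Q s x) ∧ ∫ x, Et s x + Q s x = 0 := by
    intro s hs
    have hs0 : 0 < s := ha.trans_le hs.1
    have hq : 0 < √s := sqrt_pos.2 hs0
    have h2b : s ≤ 2 * b := by linarith [hs.2]
    have := mv s; have := mv1 s; have := mv2 s; have := mw s; have := mw1 s; have := mw2 s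
    have hi : Integrable (fun x => Et s x + Q s x) := by
      refine iw (C := (2 * (A * (3 * s⁻¹ * A)) * (C0 * C0) + A ^ 2 * (2 * (C0 * C2))) +
        (2 * (3 * (√s)⁻¹ * A) ^ 2 * (C0 * C0) + 2 * A ^ 2 * (C1 * C1) +
          8 * (A * (3 * (√s)⁻¹ * A)) * (C0 * C1))) (by simp only [hEt, hQ]; fun_prop) fun x => ?_
      have b0 := hw0 s hs0 h2b x
      have b1 := hw1 s hs0 h2b x
      have b2 := hw2 s hs0 h2b x
      have q0 := sqw b0.1 b0.2
      have q1 := sqw b1.1 b1.2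
      have i1 := inn (bv s hs0 x) (bv2 s hs0 x)
      have i2 := inn b0.2 b2.1
      have i3 := inn (bv s hs0 x) (bv1 s hs0 x)
      have i4 := inn b0.2 b1.1
      have k1 := bv s hs0 x
      have k2 := bv1 s hs0 x
      have t1 : |Et s x| ≤ _ := abs2 _ _ _ _
      have t2 : |Q s x| ≤ 2 * ‖v1 s x‖ ^ 2 * ‖w s x‖ ^ 2 + 2 * ‖v s x‖ ^ 2 * ‖w1 s x‖ ^ 2 +
          8 * |inner ℝ (v s x) (v1 s x)| * |inner ℝ (w s x) (w1 s x)| := by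
        refine (abs_add_le _ _).trans ?_
        rw [abs_mul (8 * _), abs_mul 8, abs_of_nonneg (by positivity : 0 ≤ 2 * ‖v1 s x‖ ^ 2 * ‖w s x‖ ^ 2 + 2 * ‖v s x‖ ^ 2 * ‖w1 s x‖ ^ 2),
          abs_of_nonneg (by norm_num : (0 : ℝ) ≤ 8)]
      have hωx := hω0 x
      calc |Et s x + Q s x| ≤ |Et s x| + |Q s x| := abs_add_le _ _
        _ ≤ ((2 * (A * (3 * s⁻¹ * A))) * (C0 * (C0 * ω x)) + A ^ 2 * (2 * (C0 * (C2 * ω x)))) +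
            (2 * (3 * (√s)⁻¹ * A) ^ 2 * (C0 * (C0 * ω x)) + 2 * A ^ 2 * (C1 * (C1 * ω x)) +
              8 * (A * (3 * (√s)⁻¹ * A)) * (C0 * (C1 * ω x))) := by
            refine add_le_add (t1.trans ?_) (t2.trans ?_)
            · gcongr
            · gcongr
        _ = _ := by ring
    refine ⟨hi, integral_eq_zero_of_hasDerivAt_of_integrable (f := P1 s) (fun x => ?_) hi ?_⟩
    · have e1 := ((dv s hs0 x).inner ℝ (dv1 s hs0 x)).const_mul 2
      have e2 := ((dw s hs0 x).inner ℝ (dw1 s hs0 x)).const_mul 2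
      refine ((e1.mul (dw s hs0 x).norm_sq).add ((dv s hs0 x).norm_sq.mul e2)).congr_deriv ?_
      simp only [hEt, hQ, real_inner_self_eq_norm_sq]
      ring
    · refine iw (C := 2 * (A * (3 * (√s)⁻¹ * A)) * (C0 * C0) + A ^ 2 * (2 * (C0 * C1)))
        (by simp only [hP1]; fun_prop) fun x => ?_
      have b0 := hw0 s hs0 h2b x
      have b1 := hw1 s hs0 h2b x
      have q0 := sqw b0.1 b0.2
      have i3 := inn (bv s hs0 x) (bv1 s hs0 x)
      have i4 := inn b0.2 b1.1
      have k1 := bv s hs0 x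
      have t1 : |P1 s x| ≤ _ := abs2 _ _ _ _
      have hωx := hω0 x
      calc |P1 s x| ≤ (2 * (A * (3 * (√s)⁻¹ * A))) * (C0 * (C0 * ω x)) + A ^ 2 * (2 * (C0 * (C1 * ω x))) := t1.trans (by gcongr)
        _ = _ := by ring
  have ib : ∀ s ∈ Icc a b, (∀ x, ‖v1 s x‖ ^ 2 * ‖w s x‖ ^ 2 ≤ (3 * (√a)⁻¹ * A) ^ 2 * (C0 * C0) * ω x) ∧
      (∀ x, ‖w1 s x‖ ^ 2 ≤ C1 * C1 * ω x) ∧ (∀ x, ‖w s x‖ ^ 2 ≤ C0 * C0 * ω x) := fun s hs => by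
    have hs0 : 0 < s := ha.trans_le hs.1
    have h2b : s ≤ 2 * b := by linarith [hs.2]
    have hqa : 0 < √a := sqrt_pos.2 ha
    refine ⟨fun x => ?_, fun x => ?_, fun x => ?_⟩
    · have b0 := hw0 s hs0 h2b x
      have q0 := sqw b0.1 b0.2
      have k2 : ‖v1 s x‖ ≤ 3 * (√a)⁻¹ * A := (bv1 s hs0 x).trans (by
        have := sqrt_le_sqrt hs.1
        gcongr)
      calc ‖v1 s x‖ ^ 2 * ‖w s x‖ ^ 2 ≤ (3 * (√a)⁻¹ * A) ^ 2 * (C0 * (C0 * ω x)) := by gcongr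
        _ = _ := by ring
    · have b1 := hw1 s hs0 h2b x
      exact (sqw b1.1 b1.2).trans_eq (by ring)
    · have b0 := hw0 s hs0 h2b x
      exact (sqw b0.1 b0.2).trans_eq (by ring)
  have iD : ∀ s ∈ Icc a b, Integrable fun x => ‖v1 s x‖ ^ 2 * ‖w s x‖ ^ 2 := fun s hs =>
    iw (((mv1 s).norm.pow_const 2).mul ((mw s).norm.pow_const 2)) fun x => by
      rw [abs_of_nonneg (mul_nonneg (sq_nonneg _) (sq_nonneg _))]; exact (ib s hs).1 x
  have iW : ∀ s ∈ Icc a b, Integrable fun x => ‖w1 s x‖ ^ 2 := fun s hs =>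
    iw ((mw1 s).norm.pow_const 2) fun x => by
      rw [abs_of_nonneg (sq_nonneg _)]; exact (ib s hs).2.1 x
  have iφ : ∀ s ∈ Icc a b, Integrable (φ s) := fun s hs => (iD s hs).neg.add ((iW s hs).const_mul _)
  have iw0 : ∀ s ∈ Icc a b, Integrable fun x => ‖w s x‖ ^ 2 := fun s hs =>
    iw ((mw s).norm.pow_const 2) fun x => by
      rw [abs_of_nonneg (sq_nonneg _)]; exact (ib s hs).2.2 x
  have bdd : ∀ (F : ℝ → ℝ → ℝ) (C : ℝ), Measurable (uncurry F) → (∀ s x, 0 ≤ F s x) →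
      (∀ s ∈ Icc a b, ∀ x, F s x ≤ C * ω x) → IntegrableOn (fun s => ∫ x, F s x) (Icc a b) := by
    intro F C hF h0 hb
    refine Measure.integrableOn_of_bounded (M := ∫ x, C * ω x) (by simp)
      (hF.stronglyMeasurable.integral_prod_right).aestronglyMeasurable ?_
    rw [ae_restrict_iff' measurableSet_Icc]
    refine .of_forall fun s hs => ?_
    rw [norm_of_nonneg (integral_nonneg (h0 s))]
    exact integral_mono_of_nonneg (.of_forall (h0 s)) (hωi.const_mul C)
      (.of_forall (hb s hs))
  have jD : IntegrableOn (fun s => ∫ x, ‖v1 s x‖ ^ 2 * ‖w s x‖ ^ 2) (Icc a b) := by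
    refine bdd _ _ ?_ (fun s x => by positivity) fun s hs => (ib s hs).1
    exact ((measurable_heat1 hm).norm.pow_const 2).mul ((measurable_heat hum).norm.pow_const 2)
  have jW : IntegrableOn (fun s => ∫ x, ‖w1 s x‖ ^ 2) (Icc a b) := by
    refine bdd _ _ ?_ (fun s x => by positivity) fun s hs => (ib s hs).2.1
    exact (measurable_heat hum1).norm.pow_const 2
  -- With E(b) ≥ 0, E(a) ≤ A²‖u‖² and ∫∫|w1|² ≤ ‖u‖², the energy inequality on [a, b] yields the
  -- constant 1 + 14 = 15.
  have hmain := intervalIntegral.sub_le_integral_of_hasDeriv_right_of_le (g := E) (g' := fun s => ∫ x, Et s x)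
    (φ := fun s => -(∫ x, ‖v1 s x‖ ^ 2 * ‖w s x‖ ^ 2) + 14 * A ^ 2 * ∫ x, ‖w1 s x‖ ^ 2) hab
    (fun s hs => (hEd s hs).2.continuousAt.continuousWithinAt)
    (fun s hs => (hEd s (Ioo_subset_Icc_self hs)).2.hasDerivWithinAt)
    (jD.neg.add (jW.const_mul _)) (fun s hs => by
      have hs' := Ioo_subset_Icc_self hs
      have hs0 : 0 < s := ha.trans_le hs'.1
      calc ∫ x, Et s x ≤ ∫ x, ((Et s x + Q s x) + φ s x) := by
            refine integral_mono (hEd s hs').1 ((hP s hs').1.add (iφ s hs')) fun x => ?_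
            have := carleson_pointwise (v s x) (v1 s x) (w s x) (w1 s x) (bv s hs0 x)
            simp only [hφ, hQ]
            linarith
        _ = _ := by
            have e : ∫ x, φ s x = -(∫ x, ‖v1 s x‖ ^ 2 * ‖w s x‖ ^ 2) + 14 * A ^ 2 * ∫ x, ‖w1 s x‖ ^ 2 := by
              have nD : Integrable fun x => -(‖v1 s x‖ ^ 2 * ‖w s x‖ ^ 2) := (iD s hs').neg
              have cW : Integrable fun x => 14 * A ^ 2 * ‖w1 s x‖ ^ 2 := (iW s hs').const_mul _
              simp only [hφ]
              rw [integral_add nD cW, integral_neg, integral_const_mul]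
            rw [integral_add (hP s hs').1 (iφ s hs'), (hP s hs').2, zero_add]
            exact e)
  have njD : IntegrableOn (fun s => -(∫ x, ‖v1 s x‖ ^ 2 * ‖w s x‖ ^ 2)) (Icc a b) := jD.neg
  have cjW : IntegrableOn (fun s => 14 * A ^ 2 * ∫ x, ‖w1 s x‖ ^ 2) (Icc a b) := jW.const_mul _
  rw [intervalIntegral.integral_of_le hab, ← integral_Icc_eq_integral_Ioc, integral_add njD cjW, integral_neg, integral_const_mul] at hmain
  have hEb : 0 ≤ E b := integral_nonneg fun x => by positivity
  have hN0 : 0 ≤ ∫ x, ‖u x‖ ^ 2 := integral_nonneg fun x => by positivity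
  have hNe : ∫⁻ x, ‖u x‖ₑ ^ 2 = ofReal (∫ x, ‖u x‖ ^ 2) := by
    rw [ofReal_integral_eq_lintegral_ofReal (schwartz_sq_integrable u)
      (.of_forall fun x => by positivity)]
    simp only [enorm_sq_eq_ofReal]
  have haa : a ∈ Icc a b := ⟨le_rfl, hab⟩
  have hEa : E a ≤ A ^ 2 * ∫ x, ‖u x‖ ^ 2 := by
    have h1 : ∫ x, ‖w a x‖ ^ 2 ≤ ∫ x, ‖u x‖ ^ 2 := by
      rw [← ofReal_le_ofReal_iff hN0, ← hNe, ofReal_integral_eq_lintegral_ofReal (iw0 a haa)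
        (.of_forall fun x => by positivity)]
      simp only [← enorm_sq_eq_ofReal]
      exact lintegral_heat_sq_le u ha
    calc E a ≤ ∫ x, A ^ 2 * ‖w a x‖ ^ 2 := by
          refine integral_mono_of_nonneg (.of_forall fun x => by positivity)
            ((iw0 a haa).const_mul _) (.of_forall fun x => ?_)
          have := bv a ha x
          simp only
          gcongr
      _ ≤ _ := by rw [integral_const_mul]; gcongr
  have hW : ∫ s in Icc a b, ∫ x, ‖w1 s x‖ ^ 2 ≤ ∫ x, ‖u x‖ ^ 2 := by
    rw [← ofReal_le_ofReal_iff hN0, ← hNe, ofReal_integral_eq_lintegral_ofReal jW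
      (.of_forall fun s => integral_nonneg fun x => by positivity)]
    calc ∫⁻ s in Icc a b, ofReal (∫ x, ‖w1 s x‖ ^ 2) = ∫⁻ s in Icc a b, ∫⁻ x, ‖w1 s x‖ₑ ^ 2 := by
          refine setLIntegral_congr_fun measurableSet_Icc fun s hs => ?_
          rw [ofReal_integral_eq_lintegral_ofReal (iW s hs) (.of_forall fun x => by positivity)]
          simp only [← enorm_sq_eq_ofReal]
      _ ≤ ∫⁻ s in Ioi 0, ∫⁻ x, ‖w1 s x‖ₑ ^ 2 := lintegral_mono_set fun s hs => ha.trans_le hs.1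
      _ ≤ _ := lintegral_heat_deriv_le u
  calc ∫⁻ s in Icc a b, ∫⁻ x, (‖heat1 s h x‖ₑ * ‖heat s u x‖ₑ) ^ 2
      = ∫⁻ s in Icc a b, ofReal (∫ x, ‖v1 s x‖ ^ 2 * ‖w s x‖ ^ 2) := by
        refine setLIntegral_congr_fun measurableSet_Icc fun s hs => ?_
        rw [ofReal_integral_eq_lintegral_ofReal (iD s hs) (.of_forall fun x => by positivity)]
        refine lintegral_congr fun x => ?_
        rw [mul_pow, enorm_sq_eq_ofReal, enorm_sq_eq_ofReal, ← ofReal_mul (by positivity)]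
    _ = ofReal (∫ s in Icc a b, ∫ x, ‖v1 s x‖ ^ 2 * ‖w s x‖ ^ 2) := (ofReal_integral_eq_lintegral_ofReal jD
          (.of_forall fun s => integral_nonneg fun x => by positivity)).symm
    _ ≤ ofReal (15 * A ^ 2 * ∫ x, ‖u x‖ ^ 2) := by
        refine ofReal_le_ofReal ?_
        have := mul_le_mul_of_nonneg_left hW (by positivity : 0 ≤ 14 * A ^ 2)
        linarith
    _ = _ := by rw [hNe, ofReal_mul (by positivity)]

/-! ### The off-diagonal Carleson embedding and the trilinear estimate. -/

lemma lintegral_scale_swap {F : ℝ → ℝ → ℝ≥0∞} (hF : Measurable (uncurry F)) : ∫⁻ s in ℝ₊, ∫⁻ q in ℝ₊, F s q =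
      ∫⁻ q in ℝ₊, ∫⁻ s in ℝ₊, ofReal s * F s (s * q) := by
  have hF' : Measurable fun t : ℝ × ℝ => F t.1 (t.1 * t.2) :=
    hF.comp (g := uncurry F) (f := fun t : ℝ × ℝ => (t.1, t.1 * t.2)) (by fun_prop)
  calc ∫⁻ s in ℝ₊, ∫⁻ q in ℝ₊, F s q
      = ∫⁻ s in ℝ₊, ∫⁻ q in ℝ₊, ofReal s * F s (s * q) := by
        refine setLIntegral_congr_fun measurableSet_Ioi fun s (hs : 0 < s) => ?_
        rw [lintegral_Ioi_scale hs, lintegral_const_mul]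
        exact hF'.comp (measurable_const.prodMk measurable_id)
    _ = _ := by
        refine lintegral_lintegral_swap (Measurable.aemeasurable ?_)
        simp only [uncurry_def]
        fun_prop

/-- Three auxiliary times are measured in units of s and s becomes the innermost variable. For fixed
ratios the s-integral can then be treated by Cauchy-Schwarz. -/
lemma lintegral_scale_swap_three {G : ℝ → ℝ → ℝ → ℝ → ℝ≥0∞}
    (hG : Measurable fun t : ℝ × ℝ × ℝ × ℝ => G t.1 t.2.1 t.2.2.1 t.2.2.2) :
    ∫⁻ s in ℝ₊, ∫⁻ q in ℝ₊, ∫⁻ p in ℝ₊, ∫⁻ ρ in ℝ₊, G s q p ρ =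
      ∫⁻ q in ℝ₊, ∫⁻ p in ℝ₊, ∫⁻ ρ in ℝ₊, ∫⁻ s in ℝ₊,
        ofReal s * (ofReal s * (ofReal s * G s (s * q) (s * p) (s * ρ))) := by
  have hG3 : Measurable fun t : (ℝ × ℝ) × ℝ => ∫⁻ ρ in ℝ₊, G t.1.1 t.1.2 t.2 ρ := by
    refine Measurable.lintegral_prod_right' (f := fun t : ((ℝ × ℝ) × ℝ) × ℝ => G t.1.1.1 t.1.1.2 t.1.2 t.2) ?_
    exact hG.comp (f := fun t : ((ℝ × ℝ) × ℝ) × ℝ => (t.1.1.1, t.1.1.2, t.1.2, t.2)) (by fun_prop)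
  have hG2 : Measurable fun t : ℝ × ℝ => ∫⁻ p in ℝ₊, ∫⁻ ρ in ℝ₊, G t.1 t.2 p ρ := Measurable.lintegral_prod_right' hG3
  rw [lintegral_scale_swap (F := fun s q => ∫⁻ p in ℝ₊, ∫⁻ ρ in ℝ₊, G s q p ρ) hG2]
  refine lintegral_congr fun q => ?_
  have m2 : Measurable fun t : ℝ × ℝ => ∫⁻ ρ in ℝ₊, G t.1 (t.1 * q) t.2 ρ :=
    hG3.comp (f := fun t : ℝ × ℝ => ((t.1, t.1 * q), t.2)) (by fun_prop)
  have e1 : ∀ s, ofReal s * ∫⁻ p in ℝ₊, ∫⁻ ρ in ℝ₊, G s (s * q) p ρ =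
      ∫⁻ p in ℝ₊, ofReal s * ∫⁻ ρ in ℝ₊, G s (s * q) p ρ := fun s => by
    rw [lintegral_const_mul]
    exact m2.comp (f := fun p => (s, p)) (by fun_prop)
  simp only [e1]
  rw [lintegral_scale_swap (F := fun s p => ofReal s * ∫⁻ ρ in ℝ₊, G s (s * q) p ρ)
    (by simp only [uncurry_def]; fun_prop)]
  refine lintegral_congr fun p => ?_
  have m1 : Measurable fun t : ℝ × ℝ => G t.1 (t.1 * q) (t.1 * p) t.2 :=
    hG.comp (f := fun t : ℝ × ℝ => (t.1, t.1 * q, t.1 * p, t.2)) (by fun_prop)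
  have e2 : ∀ s, ofReal s * (ofReal s * ∫⁻ ρ in ℝ₊, G s (s * q) (s * p) ρ) =
      ∫⁻ ρ in ℝ₊, ofReal s * (ofReal s * G s (s * q) (s * p) ρ) := fun s => by
    have m0 : Measurable fun ρ => G s (s * q) (s * p) ρ := m1.comp (f := fun ρ => (s, ρ)) (by fun_prop)
    rw [lintegral_const_mul _ (by fun_prop), lintegral_const_mul _ m0]
  simp only [e2]
  rw [lintegral_scale_swap (F := fun s ρ => ofReal s * (ofReal s * G s (s * q) (s * p) ρ))
    (by simp only [uncurry_def]; fun_prop)]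

lemma lintegral_rpow_mul_one_add_lt_top {a b : ℝ} (ha : a < 1) (_ : 0 ≤ b) (hab : 1 < a + b) :
    ∫⁻ x in ℝ₊, ofReal (x ^ (-a) * (1 + x) ^ (-b)) < ∞ := by
  have hm : Measurable fun x : ℝ => x ^ (-a) * (1 + x) ^ (-b) := by fun_prop
  have : IntegrableOn (fun x : ℝ => x ^ (-a) * (1 + x) ^ (-b)) (Ioi 0) := by
    rw [← Ioc_union_Ioi_eq_Ioi (zero_le_one' ℝ)]
    refine IntegrableOn.union ?_ ?_
    · refine Integrable.mono (integrableOn_Ioc_rpow (a := -a) (by linarith) 1) hm.aestronglyMeasurable ?_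
      rw [ae_restrict_iff' measurableSet_Ioc]
      refine .of_forall fun x hx => ?_
      have hx0 := hx.1
      rw [norm_of_nonneg (by positivity), norm_of_nonneg (by positivity)]
      refine mul_le_of_le_one_right (by positivity) (rpow_le_one_of_one_le_of_nonpos (by linarith) (by linarith))
    · have hI : IntegrableOn (fun x : ℝ => x ^ (-a - b)) (Ioi 1) := integrableOn_Ioi_rpow_of_lt (by linarith) one_pos
      refine Integrable.mono hI hm.aestronglyMeasurable ?_
      rw [ae_restrict_iff' measurableSet_Ioi]
      refine .of_forall fun x (hx : 1 < x) => ?_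
      have hx0 : 0 < x := by linarith
      rw [norm_of_nonneg (by positivity), norm_of_nonneg (by positivity), sub_eq_add_neg, rpow_add hx0]
      have := rpow_le_rpow_of_nonpos hx0 (by linarith : x ≤ 1 + x) (by linarith : -b ≤ 0)
      gcongr
  exact this.lintegral_lt_top

lemma lintegral_prod_three {F₁ F₂ F₃ : ℝ → ℝ≥0∞} (h₁ : Measurable F₁) (h₂ : Measurable F₂)
    (h₃ : Measurable F₃) :
    ∫⁻ q in ℝ₊, ∫⁻ p in ℝ₊, ∫⁻ ρ in ℝ₊, F₁ q * (F₂ p * F₃ ρ) =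
      (∫⁻ q in ℝ₊, F₁ q) * ((∫⁻ p in ℝ₊, F₂ p) * ∫⁻ ρ in ℝ₊, F₃ ρ) := by
  have e : ∀ q p, ∫⁻ ρ in ℝ₊, F₁ q * (F₂ p * F₃ ρ) = F₁ q * (F₂ p * ∫⁻ ρ in ℝ₊, F₃ ρ) :=
    fun q p => by rw [lintegral_const_mul _ (by fun_prop), lintegral_const_mul _ h₃]
  simp only [e]
  have e2 : ∀ q, ∫⁻ p in ℝ₊, F₁ q * (F₂ p * ∫⁻ ρ in ℝ₊, F₃ ρ) =
      F₁ q * ((∫⁻ p in ℝ₊, F₂ p) * ∫⁻ ρ in ℝ₊, F₃ ρ) := fun q => by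
    rw [lintegral_const_mul _ (by fun_prop), lintegral_mul_const _ h₂]
  simp only [e2]
  rw [lintegral_mul_const _ h₁]

/-- The coupled weight is replaced by a product: each variable takes the singularity with exponent
a. The growth (1 + q)^a is harmless, as the third derivative of f supplies (1 + q)^(-3/2). -/
lemma weight_le {a p q : ℝ} (ha : 0 ≤ a) (hp : 0 < p) (hq : 0 < q) :
    (p + q) ^ (-(2 * a)) ≤ 2 ^ a * (p ^ (-a) * (1 + p) ^ (-a) * (q ^ (-a) * (1 + q) ^ a)) := by
  have h1 : p * (1 + p) * q ≤ 2 * ((p + q) ^ 2 * (1 + q)) := by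
    have : 0 < p * q := by positivity
    have : 0 < p * p * q := by positivity
    have : 0 < p * q * q := by positivity
    have : 0 < q * q * q := by positivity
    nlinarith [sq_nonneg p, sq_nonneg q]
  have h2 : ((p + q) ^ 2)⁻¹ ≤ 2 * (p⁻¹ * (1 + p)⁻¹ * (q⁻¹ * (1 + q))) := by
    rw [inv_le_iff_one_le_mul₀ (by positivity)]
    have e : 2 * (p⁻¹ * (1 + p)⁻¹ * (q⁻¹ * (1 + q))) * (p + q) ^ 2 = (2 * ((p + q) ^ 2 * (1 + q))) / (p * (1 + p) * q) := by field_simp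
    rw [e, one_le_div (by positivity)]
    exact h1
  have h3 := rpow_le_rpow (by positivity) h2 ha
  have e1 : (((p + q) ^ 2)⁻¹) ^ a = (p + q) ^ (-(2 * a)) := by
    rw [inv_rpow (by positivity), ← Real.rpow_natCast, ← rpow_mul (by positivity), ← rpow_neg (by positivity)]
    norm_num
  rw [e1, mul_rpow (by norm_num) (by positivity), mul_rpow (by positivity) (by positivity),
    mul_rpow (by positivity) (by positivity), mul_rpow (by positivity) (by positivity),
    inv_rpow hp.le, inv_rpow (by positivity), inv_rpow hq.le,
    ← rpow_neg hp.le, ← rpow_neg (by positivity), ← rpow_neg hq.le] at h3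
  exact h3

lemma enorm_add_mul_sq_le {x y z w : ℝ≥0∞} (h : x ≤ y + z) : (w * x) ^ 2 ≤ 2 * (w * y) ^ 2 + 2 * (w * z) ^ 2 := by
  have h2 := ENNReal.rpow_add_le_mul_rpow_add_rpow (w * y) (w * z) (p := 2) (by norm_num)
  have e : (2 : ℝ≥0∞) ^ ((2 : ℝ) - 1) = 2 := by norm_num
  rw [e, ENNReal.rpow_two, ENNReal.rpow_two, ENNReal.rpow_two] at h2
  calc (w * x) ^ 2 ≤ (w * y + w * z) ^ 2 := by rw [← mul_add]; gcongr
    _ ≤ _ := by rw [← mul_add 2]; exact h2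

lemma lintegral_Ioi_comp_mul (F : ℝ → ℝ≥0∞) {c : ℝ} (hc : 0 < c) :
    ∫⁻ s in ℝ₊, F (s * c) = ofReal c⁻¹ * ∫⁻ s in ℝ₊, F s := by
  rw [lintegral_Ioi_scale hc F, ← mul_assoc, ← ofReal_mul (by positivity), inv_mul_cancel₀ hc.ne', ENNReal.ofReal_one, one_mul]
  simp only [mul_comm c]

/-- Off-diagonal version of the Carleson embedding. -/
lemma carleson_shift {κ : ℝ} (hκ0 : 0 < κ) (hκ1 : κ ≤ 1) : ∃ C : ℝ, 0 < C ∧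
    ∀ (h : ℝ → ℂ) (A : ℝ), AEStronglyMeasurable h → (∀ᵐ y, ‖h y‖ ≤ A) → ∀ (u : 𝒮) (p ρ : ℝ),
      0 < p → 0 < ρ → ∫⁻ s in ℝ₊, ∫⁻ x, (‖heat1 (s * (1 + ρ)) h x‖ₑ * ‖heat (s * (1 + p)) u x‖ₑ) ^ 2 ≤
        ofReal (C * A ^ 2 * ((1 + ρ) ^ (-(1 - 2 * κ)) * (1 + p) ^ (2 * κ))) * ∫⁻ x, ‖u x‖ₑ ^ 2 := by
  have hG : 0 < Gamma (2 * κ) := Real.Gamma_pos_of_pos (by positivity)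
  -- Here 30 = 2·15 comes from the diagonal embedding and 18 = 2·3² from the supremum bound on the
  -- derivative of the heat extension.
  refine ⟨30 + 18 * Gamma (2 * κ), by positivity, fun h A hm hA u p ρ hp hρ => ?_⟩
  have hA0 : 0 ≤ A := by
    obtain ⟨y, hy⟩ := hA.exists
    exact (norm_nonneg _).trans hy
  have hum := (schwartz_tempered u).aestronglyMeasurable
  have hρ1 : 0 < 1 + ρ := by linarith
  have mh : ∀ s, Measurable (heat1 s h) := measurable_heat1_space hm
  have mu : ∀ s, Measurable (heat s u) := measurable_heat_space hum
  have mh2 := measurable_heat1 hm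
  have mu2 := measurable_heat hum
  set N := ∫⁻ x, ‖u x‖ₑ ^ 2 with hN
  -- The heat extension of u at time s(1+p) is compared with that at s(1+ρ). The diagonal part is
  -- the Carleson embedding; in the difference the derivative of h is bounded by 3A/√(s(1+ρ)), which
  -- leaves a square function for ds/s.
  have hpt : ∀ s ∈ ℝ₊, ∫⁻ x, (‖heat1 (s * (1 + ρ)) h x‖ₑ * ‖heat (s * (1 + p)) u x‖ₑ) ^ 2 ≤
      2 * (∫⁻ x, (‖heat1 (s * (1 + ρ)) h x‖ₑ * ‖heat (s * (1 + ρ)) u x‖ₑ) ^ 2) + ofReal (18 * A ^ 2 * (1 + ρ)⁻¹) * (ofReal s⁻¹ *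
          ∫⁻ x, ‖heat (s * (1 + p)) u x - heat (s * (1 + ρ)) u x‖ₑ ^ 2) := by
    intro s (hs : 0 < s)
    have hτ : 0 < s * (1 + ρ) := by positivity
    have := mh (s * (1 + ρ)); have := mu (s * (1 + ρ)); have := mu (s * (1 + p))
    rw [← mul_assoc, ← ofReal_mul (by positivity), ← lintegral_const_mul _ (by fun_prop),
      ← lintegral_const_mul _ (by fun_prop), ← lintegral_add_left (by fun_prop)]
    refine lintegral_mono fun x => ?_
    refine (enorm_add_mul_sq_le (y := ‖heat (s * (1 + ρ)) u x‖ₑ)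
      (z := ‖heat (s * (1 + p)) u x - heat (s * (1 + ρ)) u x‖ₑ) ?_).trans ?_
    · calc ‖heat (s * (1 + p)) u x‖ₑ = ‖heat (s * (1 + ρ)) u x + (heat (s * (1 + p)) u x - heat (s * (1 + ρ)) u x)‖ₑ := by congr 1; ring
        _ ≤ _ := enorm_add_le _ _
    · refine add_le_add le_rfl ?_
      rw [mul_pow, ← mul_assoc]
      gcongr
      rw [enorm_sq_eq_ofReal, show (2 : ℝ≥0∞) = ofReal 2 by simp, ← ofReal_mul (by norm_num)]
      refine ofReal_le_ofReal ?_
      have h1 := norm_heat1_le hA hτ x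
      calc 2 * ‖heat1 (s * (1 + ρ)) h x‖ ^ 2 ≤ 2 * (3 * (√(s * (1 + ρ)))⁻¹ * A) ^ 2 := by gcongr
        _ = _ := by
          rw [mul_pow, mul_pow, inv_pow, sq_sqrt hτ.le]
          field_simp; ring
  have m1 : Measurable fun s => ∫⁻ x, (‖heat1 (s * (1 + ρ)) h x‖ₑ * ‖heat (s * (1 + ρ)) u x‖ₑ) ^ 2 := by
    refine Measurable.lintegral_prod_right'
      (f := fun t : ℝ × ℝ => (‖heat1 (t.1 * (1 + ρ)) h t.2‖ₑ * ‖heat (t.1 * (1 + ρ)) u t.2‖ₑ) ^ 2) ?_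
    have a1 := mh2.comp (f := fun t : ℝ × ℝ => (t.1 * (1 + ρ), t.2)) (by fun_prop)
    have a2 := mu2.comp (f := fun t : ℝ × ℝ => (t.1 * (1 + ρ), t.2)) (by fun_prop)
    exact (a1.enorm.mul a2.enorm).pow_const 2
  have m2 : Measurable fun s => ∫⁻ x, ‖heat (s * (1 + p)) u x - heat (s * (1 + ρ)) u x‖ₑ ^ 2 := by
    refine Measurable.lintegral_prod_right'
      (f := fun t : ℝ × ℝ => ‖heat (t.1 * (1 + p)) u t.2 - heat (t.1 * (1 + ρ)) u t.2‖ₑ ^ 2) ?_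
    have a1 := mu2.comp (f := fun t : ℝ × ℝ => (t.1 * (1 + p), t.2)) (by fun_prop)
    have a2 := mu2.comp (f := fun t : ℝ × ℝ => (t.1 * (1 + ρ), t.2)) (by fun_prop)
    exact (a1.sub a2).enorm.pow_const 2
  refine (setLIntegral_mono' measurableSet_Ioi hpt).trans ?_
  rw [lintegral_add_left (by fun_prop), lintegral_const_mul _ m1, lintegral_const_mul _ (by fun_prop),
    lintegral_Ioi_comp_mul (fun τ => ∫⁻ x, (‖heat1 τ h x‖ₑ * ‖heat τ u x‖ₑ) ^ 2) hρ1]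
  have k1 := carleson_embedding hm hA u
  have k2 := lintegral_heat_sub_le u (a := 1 + p) (b := 1 + ρ) (by linarith) (by linarith) hκ0 hκ1
  have e1 : (1 + ρ) ^ (-(1 - 2 * κ)) = (1 + ρ)⁻¹ * (1 + ρ) ^ (2 * κ) := by
    rw [← rpow_neg_one, ← rpow_add hρ1]; congr 1; ring
  calc 2 * (ofReal (1 + ρ)⁻¹ * ∫⁻ τ in ℝ₊, ∫⁻ x, (‖heat1 τ h x‖ₑ * ‖heat τ u x‖ₑ) ^ 2) +
        ofReal (18 * A ^ 2 * (1 + ρ)⁻¹) * ∫⁻ s in ℝ₊, ofReal s⁻¹ * ∫⁻ x, ‖heat (s * (1 + p)) u x - heat (s * (1 + ρ)) u x‖ₑ ^ 2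
      ≤ 2 * (ofReal (1 + ρ)⁻¹ * (ofReal (15 * A ^ 2) * N)) + ofReal (18 * A ^ 2 * (1 + ρ)⁻¹) *
          (ofReal (Gamma (2 * κ) * |1 + p - (1 + ρ)| ^ (2 * κ)) * N) := by gcongr
    _ = ofReal (2 * ((1 + ρ)⁻¹ * (15 * A ^ 2)) + 18 * A ^ 2 * (1 + ρ)⁻¹ * (Gamma (2 * κ) * |1 + p - (1 + ρ)| ^ (2 * κ))) * N := by
        rw [ofReal_add (by positivity) (by positivity), add_mul]
        rw [ofReal_mul (by norm_num : (0 : ℝ) ≤ 2), ofReal_mul (by positivity : 0 ≤ (1 + ρ)⁻¹),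
          ofReal_mul (by positivity : 0 ≤ 18 * A ^ 2 * (1 + ρ)⁻¹)]
        simp only [ofReal_ofNat]
        ring
    _ ≤ _ := by
        gcongr
        rw [e1]
        have b1 : |1 + p - (1 + ρ)| ≤ (1 + ρ) * (1 + p) := by
          rw [abs_le]; constructor <;> nlinarith
        have b2 : |1 + p - (1 + ρ)| ^ (2 * κ) ≤ (1 + ρ) ^ (2 * κ) * (1 + p) ^ (2 * κ) := by
          rw [← mul_rpow hρ1.le (by linarith)]
          exact rpow_le_rpow (abs_nonneg _) b1 (by positivity)
        have b3 : 1 ≤ (1 + ρ) ^ (2 * κ) * (1 + p) ^ (2 * κ) := by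
          have c1 := one_le_rpow (by linarith : 1 ≤ 1 + ρ) (by positivity : 0 ≤ 2 * κ)
          have c2 := one_le_rpow (by linarith : 1 ≤ 1 + p) (by positivity : 0 ≤ 2 * κ)
          nlinarith
        calc 2 * ((1 + ρ)⁻¹ * (15 * A ^ 2)) + 18 * A ^ 2 * (1 + ρ)⁻¹ * (Gamma (2 * κ) * |1 + p - (1 + ρ)| ^ (2 * κ))
            ≤ 2 * ((1 + ρ)⁻¹ * (15 * A ^ 2)) * ((1 + ρ) ^ (2 * κ) * (1 + p) ^ (2 * κ)) +
              18 * A ^ 2 * (1 + ρ)⁻¹ * (Gamma (2 * κ) * ((1 + ρ) ^ (2 * κ) * (1 + p) ^ (2 * κ))) := by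
              refine add_le_add (le_mul_of_one_le_right (by positivity) b3) ?_
              gcongr
          _ = _ := by ring

lemma enorm_heat1_le_lintegral {α : ℝ} {g h : ℝ → ℂ} (hg : IsFracDeriv α g h) (h0 : 0 < α) (h1 : α < 1)
    {s : ℝ} (hs : 0 < s) (x : ℝ) :
    ‖heat1 s g x‖ₑ ≤ ofReal (Gamma (α / 2))⁻¹ * ∫⁻ ρ in ℝ₊, ofReal (ρ ^ (α / 2 - 1)) * ‖heat1 (s + ρ) h x‖ₑ := by
  have hG := Gamma_half_pos h0
  have e := heat1_rep hg h0 h1 hs x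
  have h2 : heat1 s g x = (Gamma (α / 2))⁻¹ • ∫ ρ in ℝ₊, (ρ ^ (α / 2 - 1) : ℝ) • heat1 (s + ρ) h x := by
    rw [e, smul_smul, inv_mul_cancel₀ hG.ne', one_smul]
  rw [h2, enorm_smul, ← ofReal_norm (Gamma (α / 2))⁻¹, norm_of_nonneg (by positivity)]
  gcongr
  refine (enorm_integral_le_lintegral_enorm _).trans (setLIntegral_mono' measurableSet_Ioi fun ρ (hρ : 0 < ρ) => ?_)
  rw [enorm_smul, ← ofReal_norm (ρ ^ (α / 2 - 1)), norm_of_nonneg (by positivity)]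

/-- The trilinear square function estimate behind the `L²` bound. -/
lemma trilinear_bound {α : ℝ} (h0 : 0 < α) (h1 : α < 1) : ∃ C : ℝ, 0 < C ∧ ∀ (g h : ℝ → ℂ) (A : ℝ), BddFracDeriv α A g h → ∀ f u : 𝒮,
      ∫⁻ s in ℝ₊, ∫⁻ q in ℝ₊, ∫⁻ p in ℝ₊, ofReal ((p + q) ^ (-(1 + α / 2))) * ∫⁻ x, ‖heat1 s g x‖ₑ *
          (‖heat (s + q) (sderiv (sderiv (sderiv f))) x‖ₑ * ‖heat (s + p) u x‖ₑ) ≤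
      ofReal (C * A) * ((∫⁻ x, ‖f x‖ₑ ^ 2) ^ (1 / 2 : ℝ) * (∫⁻ x, ‖u x‖ₑ ^ 2) ^ (1 / 2 : ℝ)) := by
  -- Convergence at infinity requires κ < α/2 for the p-integral and κ < (1-α)/2 for the ρ-integral;
  -- this choice satisfies both.
  set κ := α * (1 - α) / 4 with hκ
  have hα' : 0 < 1 - α := by linarith
  have hκ0 : 0 < κ := by positivity
  have hκ1 : κ < α / 2 := by simp only [hκ]; nlinarith
  have hκ2 : κ < (1 - α) / 2 := by simp only [hκ]; nlinarith
  obtain ⟨C, hC, hcar⟩ := carleson_shift hκ0 (by linarith)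
  -- Half the exponent of the coupled weight. Since a < 1, the singularities of the separated
  -- weights at zero are integrable.
  set a := (1 + α / 2) / 2 with ha
  have ha0 : 0 < a := by positivity
  have hG := Gamma_half_pos h0
  set F₁ : ℝ → ℝ≥0∞ := fun q => ofReal (q ^ (-a) * (1 + q) ^ (-(3 / 2 - a))) with hF₁
  set F₂ : ℝ → ℝ≥0∞ := fun p => ofReal (p ^ (-a) * (1 + p) ^ (-(a - κ))) with hF₂
  set F₃ : ℝ → ℝ≥0∞ := fun ρ => ofReal (ρ ^ (-(1 - α / 2)) * (1 + ρ) ^ (-(1 / 2 - κ))) with hF₃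
  have i₁ : ∫⁻ q in ℝ₊, F₁ q < ∞ := lintegral_rpow_mul_one_add_lt_top (by linarith) (by linarith) (by linarith)
  have i₂ : ∫⁻ q in ℝ₊, F₂ q < ∞ := lintegral_rpow_mul_one_add_lt_top (by linarith) (by linarith) (by linarith)
  have i₃ : ∫⁻ q in ℝ₊, F₃ q < ∞ := lintegral_rpow_mul_one_add_lt_top (by linarith) (by linarith) (by linarith)
  set I := (∫⁻ q in ℝ₊, F₁ q) * ((∫⁻ p in ℝ₊, F₂ p) * ∫⁻ ρ in ℝ₊, F₃ ρ) with hI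
  have hIt : I < ∞ := mul_lt_top i₁ (mul_lt_top i₂ i₃)
  refine ⟨(Gamma (α / 2))⁻¹ * (2 ^ a * √C) * (I.toReal + 1), by positivity, fun g h A hg f u => ?_⟩
  have hA := hg.nonneg
  have hm : AEStronglyMeasurable h := Tempered.aestronglyMeasurable hg.fd.tempered
  set f3 := sderiv (sderiv (sderiv f)) with hf3
  have mh := measurable_heat1 hm
  have mf := measurable_heat (schwartz_tempered f3).aestronglyMeasurable
  have mu := measurable_heat (schwartz_tempered u).aestronglyMeasurable
  set Nf := (∫⁻ x, ‖f x‖ₑ ^ 2) with hNf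
  set Nu := (∫⁻ x, ‖u x‖ₑ ^ 2) with hNu
  set K : ℝ → ℝ → ℝ → ℝ → ℝ≥0∞ := fun s q p ρ => ∫⁻ x, ‖heat1 (s + ρ) h x‖ₑ * (‖heat (s + q) f3 x‖ₑ * ‖heat (s + p) u x‖ₑ) with hK
  set G : ℝ → ℝ → ℝ → ℝ → ℝ≥0∞ := fun s q p ρ =>
    ofReal ((p + q) ^ (-(1 + α / 2)) * ρ ^ (α / 2 - 1)) * K s q p ρ with hG'
  have mK : Measurable fun t : ℝ × ℝ × ℝ × ℝ => K t.1 t.2.1 t.2.2.1 t.2.2.2 := by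
    refine Measurable.lintegral_prod_right' (f := fun t : (ℝ × ℝ × ℝ × ℝ) × ℝ =>
      ‖heat1 (t.1.1 + t.1.2.2.2) h t.2‖ₑ * (‖heat (t.1.1 + t.1.2.1) f3 t.2‖ₑ * ‖heat (t.1.1 + t.1.2.2.1) u t.2‖ₑ)) ?_
    have a1 := mh.comp (f := fun t : (ℝ × ℝ × ℝ × ℝ) × ℝ => (t.1.1 + t.1.2.2.2, t.2)) (by fun_prop)
    have a2 := mf.comp (f := fun t : (ℝ × ℝ × ℝ × ℝ) × ℝ => (t.1.1 + t.1.2.1, t.2)) (by fun_prop)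
    have a3 := mu.comp (f := fun t : (ℝ × ℝ × ℝ × ℝ) × ℝ => (t.1.1 + t.1.2.2.1, t.2)) (by fun_prop)
    exact a1.enorm.mul (a2.enorm.mul a3.enorm)
  have mG : Measurable fun t : ℝ × ℝ × ℝ × ℝ => G t.1 t.2.1 t.2.2.1 t.2.2.2 := by
    simp only [hG']; fun_prop
  -- replace the derivative of `g` by derivatives of `h`
  have step1 : ∀ s, 0 < s → ∀ q p, ofReal ((p + q) ^ (-(1 + α / 2))) * ∫⁻ x, ‖heat1 s g x‖ₑ * (‖heat (s + q) f3 x‖ₑ * ‖heat (s + p) u x‖ₑ) ≤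
        ofReal (Gamma (α / 2))⁻¹ * ∫⁻ ρ in ℝ₊, G s q p ρ := by
    intro s hs q p
    have b1 : Measurable fun t : ℝ × ℝ => ‖heat1 (s + t.2) h t.1‖ₑ := (mh.comp (f := fun t : ℝ × ℝ => (s + t.2, t.1)) (by fun_prop)).enorm
    have b2 : Measurable (heat (s + q) f3) := measurable_heat_space (schwartz_tempered f3).aestronglyMeasurable _
    have b3 : Measurable (heat (s + p) u) := measurable_heat_space (schwartz_tempered u).aestronglyMeasurable _
    have b4 : Measurable fun t : ℝ × ℝ => ‖heat (s + q) f3 t.1‖ₑ * ‖heat (s + p) u t.1‖ₑ :=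
      (b2.comp measurable_fst).enorm.mul (b3.comp measurable_fst).enorm
    have b5 : ∀ x, Measurable fun ρ => ‖heat1 (s + ρ) h x‖ₑ := fun x =>
      b1.comp (f := fun ρ => (x, ρ)) (by fun_prop)
    calc ofReal ((p + q) ^ (-(1 + α / 2))) * ∫⁻ x, ‖heat1 s g x‖ₑ * (‖heat (s + q) f3 x‖ₑ * ‖heat (s + p) u x‖ₑ)
        ≤ ofReal ((p + q) ^ (-(1 + α / 2))) * ∫⁻ x, ofReal (Gamma (α / 2))⁻¹ *
          ∫⁻ ρ in ℝ₊, ofReal (ρ ^ (α / 2 - 1)) * (‖heat1 (s + ρ) h x‖ₑ * (‖heat (s + q) f3 x‖ₑ * ‖heat (s + p) u x‖ₑ)) := by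
          refine mul_le_mul_right (lintegral_mono fun x => ?_) _
          refine (mul_le_mul_left (enorm_heat1_le_lintegral hg.fd h0 h1 hs x) _).trans_eq ?_
          rw [mul_assoc, ← lintegral_mul_const]
          · simp only [mul_assoc]
          · have := b5 x; fun_prop
      _ = ofReal (Gamma (α / 2))⁻¹ * (ofReal ((p + q) ^ (-(1 + α / 2))) *
          ∫⁻ ρ in ℝ₊, ∫⁻ x, ofReal (ρ ^ (α / 2 - 1)) * (‖heat1 (s + ρ) h x‖ₑ * (‖heat (s + q) f3 x‖ₑ * ‖heat (s + p) u x‖ₑ))) := by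
          have b6 : Measurable fun t : ℝ × ℝ => ofReal (t.2 ^ (α / 2 - 1)) *
            (‖heat1 (s + t.2) h t.1‖ₑ * (‖heat (s + q) f3 t.1‖ₑ * ‖heat (s + p) u t.1‖ₑ)) := by fun_prop
          rw [lintegral_const_mul, lintegral_lintegral_swap b6.aemeasurable]
          · ring
          · exact Measurable.lintegral_prod_right' b6
      _ = _ := by
          have b7 : Measurable fun ρ => G s q p ρ := mG.comp (f := fun ρ => (s, q, p, ρ)) (by fun_prop)
          have b8 : Measurable fun ρ => ∫⁻ x, ofReal (ρ ^ (α / 2 - 1)) * (‖heat1 (s + ρ) h x‖ₑ *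
            (‖heat (s + q) f3 x‖ₑ * ‖heat (s + p) u x‖ₑ)) := by
            refine Measurable.lintegral_prod_right' (f := fun t : ℝ × ℝ => ofReal (t.1 ^ (α / 2 - 1)) *
              (‖heat1 (s + t.1) h t.2‖ₑ * (‖heat (s + q) f3 t.2‖ₑ * ‖heat (s + p) u t.2‖ₑ))) ?_
            have c1 := b1.comp measurable_swap
            have c2 := b4.comp measurable_swap
            exact Measurable.mul (by fun_prop) (c1.mul c2)
          rw [← lintegral_const_mul _ b8]
          congr 1
          refine setLIntegral_congr_fun measurableSet_Ioi fun ρ (hρ : 0 < ρ) => ?_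
          simp only [hG', hK]
          rw [ENNReal.ofReal_mul' (by positivity), mul_assoc, lintegral_const_mul]
          have d1 := b1.comp (f := fun x => (x, ρ)) (by fun_prop)
          have d2 := b4.comp (f := fun x => (x, ρ)) (by fun_prop)
          exact d1.mul d2
  -- the bound for fixed relative scales
  have step2 : ∀ q, 0 < q → ∀ p, 0 < p → ∀ ρ, 0 < ρ → ∫⁻ s in ℝ₊,
      ofReal s * (ofReal s * (ofReal s * G s (s * q) (s * p) (s * ρ))) ≤
        ofReal (2 ^ a * √C * A) * (Nf ^ (1 / 2 : ℝ) * Nu ^ (1 / 2 : ℝ)) * (F₁ q * (F₂ p * F₃ ρ)) := by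
    intro q hq p hp ρ hρ
    -- The two factors for Cauchy-Schwarz in (s, x): B is controlled by Plancherel, D by the shifted
    -- Carleson embedding.
    set B : ℝ → ℝ → ℝ≥0∞ := fun s x => ofReal s * ‖heat (s * (1 + q)) f3 x‖ₑ with hB
    set D : ℝ → ℝ → ℝ≥0∞ := fun s x => ‖heat1 (s * (1 + ρ)) h x‖ₑ * ‖heat (s * (1 + p)) u x‖ₑ with hD
    have c1 := mh.comp (f := fun t : ℝ × ℝ => (t.1 * (1 + ρ), t.2)) (by fun_prop)
    have c2 := mf.comp (f := fun t : ℝ × ℝ => (t.1 * (1 + q), t.2)) (by fun_prop)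
    have c3 := mu.comp (f := fun t : ℝ × ℝ => (t.1 * (1 + p), t.2)) (by fun_prop)
    have mD : Measurable (uncurry D) := c1.enorm.mul c3.enorm
    have mB : Measurable (uncurry B) := Measurable.mul (by fun_prop) c2.enorm
    have e1 : ∀ s ∈ ℝ₊, ofReal s * (ofReal s * (ofReal s *
        G s (s * q) (s * p) (s * ρ))) = ofReal ((p + q) ^ (-(1 + α / 2)) * ρ ^ (α / 2 - 1)) * ∫⁻ x, D s x * B s x := by
      intro s (hs : 0 < s)
      -- The three Jacobian factors s³ meet s^(-1-α/2) s^(α/2-1) = s^(-2); the single s left over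
      -- goes with the third derivative of f.
      have w1 : s * (s * (s * ((s * p + s * q) ^ (-(1 + α / 2)) * (s * ρ) ^ (α / 2 - 1)))) =
          ((p + q) ^ (-(1 + α / 2)) * ρ ^ (α / 2 - 1)) * s := by
        rw [← mul_add, mul_rpow hs.le (by positivity), mul_rpow hs.le hρ.le]
        have : s * s * (s ^ (-(1 + α / 2)) * s ^ (α / 2 - 1)) = 1 := by
          rw [← rpow_add hs, show -(1 + α / 2) + (α / 2 - 1) = (-2 : ℤ) by push_cast; ring, Real.rpow_intCast, zpow_neg]
          field_simp
        linear_combination (s * (p + q) ^ (-(1 + α / 2)) * ρ ^ (α / 2 - 1)) * this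
      have w2 : ∫⁻ x, D s x * B s x = ofReal s * K s (s * q) (s * p) (s * ρ) := by
        simp only [hK]
        rw [← lintegral_const_mul]
        · refine lintegral_congr fun x => ?_
          simp only [hD, hB, mul_add, mul_one]
          ring
        · have d1 : Measurable (heat1 (s + s * ρ) h) := measurable_heat1_space hm _
          have d2 : Measurable (heat (s + s * q) f3) := measurable_heat_space (schwartz_tempered f3).aestronglyMeasurable _
          have d3 : Measurable (heat (s + s * p) u) := measurable_heat_space (schwartz_tempered u).aestronglyMeasurable _
          fun_prop
      rw [w2, ← mul_assoc (ofReal (_ * _)), ← ofReal_mul (by positivity), ← w1]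
      simp only [hG']
      rw [ofReal_mul hs.le, ofReal_mul hs.le, ofReal_mul hs.le]
      ring
    have mDB : Measurable fun s => ∫⁻ x, D s x * B s x :=
      Measurable.lintegral_prod_right' (f := fun t : ℝ × ℝ => D t.1 t.2 * B t.1 t.2) (mD.mul mB)
    rw [setLIntegral_congr_fun measurableSet_Ioi e1, lintegral_const_mul _ mDB]
    have cs := lintegral_lintegral_mul_le (μ := volume.restrict (ℝ₊)) (ν := volume) mD mB
    have k1 := hcar h A hm hg.bound u p ρ hp hρ
    have k2 : ∫⁻ s in ℝ₊, ∫⁻ x, B s x ^ 2 ≤ ofReal (((1 + q) ^ 3)⁻¹) * Nf := by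
      refine le_trans (le_of_eq ?_) (lintegral_heat_third_le f (c := 1 + q) (by linarith))
      refine setLIntegral_congr_fun measurableSet_Ioi fun s (hs : 0 < s) => ?_
      simp only [hB, mul_pow]
      rw [lintegral_const_mul, ofReal_pow hs.le]
      have : Measurable (heat (s * (1 + q)) f3) := measurable_heat_space (schwartz_tempered f3).aestronglyMeasurable _
      fun_prop
    have half : (0 : ℝ) ≤ 1 / 2 := by norm_num
    have r1 : (((1 + q) ^ 3)⁻¹) ^ (1 / 2 : ℝ) = (1 + q) ^ (-(3 / 2) : ℝ) := by
      rw [inv_rpow (by positivity), ← Real.rpow_natCast, ← rpow_mul (by positivity), ← rpow_neg (by positivity)]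
      norm_num
    have r2 : (C * A ^ 2 * ((1 + ρ) ^ (-(1 - 2 * κ)) * (1 + p) ^ (2 * κ))) ^ (1 / 2 : ℝ) =
        √C * A * ((1 + ρ) ^ (-(1 / 2 - κ)) * (1 + p) ^ κ) := by
      rw [mul_rpow (by positivity) (by positivity), mul_rpow (by positivity) (by positivity),
        mul_rpow (by positivity) (by positivity), ← sqrt_eq_rpow, ← sqrt_eq_rpow,
        sqrt_sq hA, ← rpow_mul (by positivity), ← rpow_mul (by positivity)]
      congr 3 <;> ring
    calc ofReal ((p + q) ^ (-(1 + α / 2)) * ρ ^ (α / 2 - 1)) * ∫⁻ s in ℝ₊, ∫⁻ x, D s x * B s x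
        ≤ ofReal ((p + q) ^ (-(1 + α / 2)) * ρ ^ (α / 2 - 1)) *
          ((ofReal (C * A ^ 2 * ((1 + ρ) ^ (-(1 - 2 * κ)) * (1 + p) ^ (2 * κ))) * Nu) ^ (1 / 2 : ℝ) *
            (ofReal (((1 + q) ^ 3)⁻¹) * Nf) ^ (1 / 2 : ℝ)) := by
          gcongr
          exact cs.trans (by gcongr)
      _ = ofReal ((p + q) ^ (-(1 + α / 2)) * ρ ^ (α / 2 - 1) *
          ((√C * A * ((1 + ρ) ^ (-(1 / 2 - κ)) * (1 + p) ^ κ)) * (1 + q) ^ (-(3 / 2) : ℝ))) * (Nf ^ (1 / 2 : ℝ) * Nu ^ (1 / 2 : ℝ)) := by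
          rw [ENNReal.mul_rpow_of_nonneg _ _ half, ENNReal.mul_rpow_of_nonneg _ _ half,
            ofReal_rpow_of_nonneg (by positivity) half, ofReal_rpow_of_nonneg (by positivity) half,
            r1, r2, ofReal_mul (by positivity : 0 ≤ (p + q) ^ (-(1 + α / 2)) * ρ ^ (α / 2 - 1)),
            ofReal_mul (by positivity : 0 ≤ √C * A * ((1 + ρ) ^ (-(1 / 2 - κ)) * (1 + p) ^ κ))]
          ring
      _ ≤ ofReal (2 ^ a * √C * A * ((q ^ (-a) * (1 + q) ^ (-(3 / 2 - a))) *
            ((p ^ (-a) * (1 + p) ^ (-(a - κ))) * (ρ ^ (-(1 - α / 2)) * (1 + ρ) ^ (-(1 / 2 - κ)))))) *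
            (Nf ^ (1 / 2 : ℝ) * Nu ^ (1 / 2 : ℝ)) := by
          refine mul_le_mul_left (ofReal_le_ofReal ?_) _
          have hw := weight_le ha0.le hp hq
          have ea : 2 * a = 1 + α / 2 := by simp only [ha]; ring
          rw [ea] at hw
          have eq1 : (1 + q) ^ (-(3 / 2 - a)) = (1 + q) ^ a * (1 + q) ^ (-(3 / 2) : ℝ) := by
            rw [← rpow_add (by positivity)]; congr 1; ring
          have ep1 : (1 + p) ^ (-(a - κ)) = (1 + p) ^ (-a) * (1 + p) ^ κ := by
            rw [← rpow_add (by positivity)]; congr 1; ring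
          have er1 : ρ ^ (-(1 - α / 2)) = ρ ^ (α / 2 - 1) := by congr 1; ring
          rw [eq1, ep1, er1]
          calc _ ≤ (2 ^ a * (p ^ (-a) * (1 + p) ^ (-a) * (q ^ (-a) * (1 + q) ^ a))) * ρ ^ (α / 2 - 1) *
              ((√C * A * ((1 + ρ) ^ (-(1 / 2 - κ)) * (1 + p) ^ κ)) * (1 + q) ^ (-(3 / 2) : ℝ)) := by gcongr
            _ = _ := by ring
      _ = _ := by
          rw [ofReal_mul (by positivity : 0 ≤ 2 ^ a * √C * A), ofReal_mul (by positivity : 0 ≤ q ^ (-a) * (1 + q) ^ (-(3 / 2 - a))),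
            ofReal_mul (by positivity : 0 ≤ p ^ (-a) * (1 + p) ^ (-(a - κ)))]
          ring
  have mF₁ : Measurable F₁ := by simp only [hF₁]; fun_prop
  have mF₂ : Measurable F₂ := by simp only [hF₂]; fun_prop
  have mF₃ : Measurable F₃ := by simp only [hF₃]; fun_prop
  set c := ofReal (Gamma (α / 2))⁻¹ with hc
  set M := ofReal (2 ^ a * √C * A) * (Nf ^ (1 / 2 : ℝ) * Nu ^ (1 / 2 : ℝ)) with hM
  calc ∫⁻ s in ℝ₊, ∫⁻ q in ℝ₊, ∫⁻ p in ℝ₊, ofReal ((p + q) ^ (-(1 + α / 2))) * ∫⁻ x, ‖heat1 s g x‖ₑ *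
          (‖heat (s + q) f3 x‖ₑ * ‖heat (s + p) u x‖ₑ)
      ≤ ∫⁻ s in ℝ₊, ∫⁻ q in ℝ₊, ∫⁻ p in ℝ₊, c * ∫⁻ ρ in ℝ₊, G s q p ρ :=
        setLIntegral_mono' measurableSet_Ioi fun s (hs : 0 < s) => lintegral_mono fun q =>
          lintegral_mono fun p => step1 s hs q p
    _ = c * ∫⁻ s in ℝ₊, ∫⁻ q in ℝ₊, ∫⁻ p in ℝ₊, ∫⁻ ρ in ℝ₊, G s q p ρ := by
        have hct : c ≠ ∞ := ofReal_ne_top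
        simp only [lintegral_const_mul' _ _ hct]
    _ = c * ∫⁻ q in ℝ₊, ∫⁻ p in ℝ₊, ∫⁻ ρ in ℝ₊, ∫⁻ s in ℝ₊,
        ofReal s * (ofReal s * (ofReal s * G s (s * q) (s * p) (s * ρ))) := by
        rw [lintegral_scale_swap_three mG]
    _ ≤ c * ∫⁻ q in ℝ₊, ∫⁻ p in ℝ₊, ∫⁻ ρ in ℝ₊, (M * F₁ q) * (F₂ p * F₃ ρ) := by
        refine mul_le_mul_right ?_ _
        refine setLIntegral_mono' measurableSet_Ioi fun q hq => ?_
        refine setLIntegral_mono' measurableSet_Ioi fun p hp => ?_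
        refine setLIntegral_mono' measurableSet_Ioi fun ρ hρ => ?_
        exact (step2 q hq p hp ρ hρ).trans_eq (by ring)
    _ = c * (M * I) := by
        rw [lintegral_prod_three (F₁ := fun q => M * F₁ q) (by fun_prop) mF₂ mF₃, lintegral_const_mul _ mF₁, hI]
        ring
    _ ≤ _ := by
        have hIr : I ≤ ofReal (I.toReal + 1) := by
          refine (ofReal_toReal hIt.ne).symm.le.trans (ofReal_le_ofReal (by linarith))
        calc c * (M * I) ≤ c * (M * ofReal (I.toReal + 1)) := by gcongr
          _ = ofReal ((Gamma (α / 2))⁻¹ * (2 ^ a * √C * A) * (I.toReal + 1)) * (Nf ^ (1 / 2 : ℝ) * Nu ^ (1 / 2 : ℝ)) := by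
              rw [ofReal_mul (by positivity), ofReal_mul (by positivity)]
              simp only [hM, hc]; ring
          _ = _ := by congr 2; ring

/-! ### The antisymmetric form as an integral with three derivatives on one factor. -/

lemma enorm_sub_le_lintegral_deriv {f f' : ℝ → ℂ} {a b : ℝ} (hab : a ≤ b)
    (hf : ∀ x ∈ Icc a b, HasDerivAt f (f' x) x) : ‖f b - f a‖ₑ ≤ ∫⁻ x in Ioc a b, ‖f' x‖ₑ := by
  by_cases h : ∫⁻ x in Ioc a b, ‖f' x‖ₑ = ∞
  · rw [h]; exact le_top
  have hm : AEStronglyMeasurable f' (volume.restrict (Ioc a b)) := by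
    refine (aestronglyMeasurable_deriv f (volume.restrict (Ioc a b))).congr ?_
    rw [EventuallyEq, ae_restrict_iff' measurableSet_Ioc]
    exact .of_forall fun x hx => (hf x (Ioc_subset_Icc_self hx)).deriv
  have hi : IntervalIntegrable f' volume a b := by
    rw [intervalIntegrable_iff_integrableOn_Ioc_of_le hab]
    exact ⟨hm, lt_top_iff_ne_top.2 h⟩
  rw [← intervalIntegral.integral_eq_sub_of_hasDerivAt (f := f) (f' := f')
    (fun x hx => hf x (by rwa [uIcc_of_le hab] at hx)) hi, intervalIntegral.integral_of_le hab]
  exact enorm_integral_le_lintegral_enorm _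

lemma enorm_limit_le_lintegral_deriv {f f' : ℝ → ℂ} {L : ℂ} (hf : ∀ x, 0 < x → HasDerivAt f (f' x) x)
    (h0 : Tendsto f (𝓝[>] 0) (𝓝 L)) (h1 : Tendsto f atTop (𝓝 0)) :
    ‖L‖ₑ ≤ ∫⁻ x in ℝ₊, ‖f' x‖ₑ := by
  have k : ∀ a, 0 < a → ‖f a‖ₑ ≤ ∫⁻ x in ℝ₊, ‖f' x‖ₑ := fun a ha => by
    have t : Tendsto (fun b => ‖f b - f a‖ₑ) atTop (𝓝 ‖0 - f a‖ₑ) := (h1.sub_const _).enorm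
    rw [zero_sub, enorm_neg] at t
    refine le_of_tendsto t ?_
    filter_upwards [eventually_ge_atTop a] with b hb
    exact (enorm_sub_le_lintegral_deriv hb fun x hx => hf x (ha.trans_le hx.1)).trans
      (lintegral_mono_set fun x hx => ha.trans hx.1)
  refine le_of_tendsto h0.enorm ?_
  filter_upwards [self_mem_nhdsWithin] with a ha using k a ha

/-- The product of two Schwartz functions. -/
noncomputable def mulS (f u : 𝒮) : 𝒮 := SchwartzMap.pairing (ContinuousLinearMap.mul ℂ ℂ) f u

lemma mulS_apply (f u : 𝒮) (x : ℝ) : mulS f u x = f x * u x := by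
  rw [mulS, SchwartzMap.pairing_apply_apply]; rfl

lemma sderiv_mulS (f u : 𝒮) : sderiv (mulS f u) = mulS (sderiv f) u + mulS f (sderiv u) := by
  ext x
  have h1 := hasDerivAt_schwartz (mulS f u) x
  have h2 := (hasDerivAt_schwartz f x).mul (hasDerivAt_schwartz u x)
  have e : (mulS f u : ℝ → ℂ) = f * u := funext fun y => mulS_apply f u y
  rw [e] at h1
  rw [h1.unique h2, add_apply, mulS_apply, mulS_apply]

lemma sderiv_add (f u : 𝒮) : sderiv (f + u) = sderiv f + sderiv u := map_add _ _ _

lemma sderiv_heatS {s : ℝ} (hs : 0 < s) (f : 𝒮) : sderiv (heatS s hs f) = heatS s hs (sderiv f) := by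
  ext x
  have h1 := hasDerivAt_schwartz (heatS s hs f) x
  have h2 := hasDerivAt_heat (schwartz_tempered f) hs x
  rw [heatS_coe] at h1
  rw [h1.unique h2, heat1_schwartz f hs, heatS_apply]

lemma integrable_growth_mul {v : ℝ → ℂ} {K : ℝ} (hv : AEStronglyMeasurable v)
    (hb : ∀ x, ‖v x‖ ≤ K * (1 + |x|)) (w : 𝒮) : Integrable fun x => v x * w x := by
  have h1 : Integrable fun x => (K * (1 + |x|)) * ‖w x‖ := integrable_mul_schwartz (m := fun x => K * (1 + |x|)) (by fun_prop) (C := |K|) 1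
      (fun ζ => by rw [abs_mul, abs_of_nonneg (by positivity : 0 ≤ 1 + |ζ|), pow_one]) w
  refine h1.mono (hv.mul w.continuous.aestronglyMeasurable) (.of_forall fun x => ?_)
  rw [norm_mul]
  exact (mul_le_mul_of_nonneg_right (hb x) (norm_nonneg _)).trans (le_abs_self _)

lemma integral_mul_sderiv {v v' : ℝ → ℂ} {K K' : ℝ} (hv : ∀ x, HasDerivAt v (v' x) x)
    (hb : ∀ x, ‖v x‖ ≤ K * (1 + |x|)) (hm' : AEStronglyMeasurable v') (hb' : ∀ x, ‖v' x‖ ≤ K' * (1 + |x|))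
    (w : 𝒮) : ∫ x, v x * sderiv w x = -∫ x, v' x * w x := by
  have hm : AEStronglyMeasurable v := (continuous_iff_continuousAt.2 fun x => (hv x).continuousAt).aestronglyMeasurable
  exact integral_mul_deriv_eq_deriv_mul_of_integrable (u := v) (u' := v') (v := w) (v' := sderiv w)
    (fun x _ => hv x) (fun x _ => hasDerivAt_schwartz w x)
    (integrable_growth_mul hm hb (sderiv w)) (integrable_growth_mul hm' hb' w)
    (integrable_growth_mul hm hb w)

/-- Polynomial growth of `g` and its heat extensions. -/
lemma BddFracDeriv.growth {α A : ℝ} (h0 : 0 < α) (h1 : α < 1) {g h : ℝ → ℂ} (hg : BddFracDeriv α A g h) :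
    ∃ K : ℝ, 0 ≤ K ∧ (∀ x, ‖g x‖ ≤ K * (1 + |x|)) ∧ (∀ s, 0 < s → ∀ x, ‖heat s g x‖ ≤ K * (1 + s ^ (α / 2)) * (1 + |x|)) ∧
      (∀ s, 1 ≤ s → ∀ x, ‖heat s g x‖ ≤ K * s ^ (α / 2) * (1 + |x / √s|)) ∧
      (∀ s, 0 < s → ∀ x, ‖heat1 s g x‖ ≤ K * s ^ (α / 2 - 1 / 2) * (1 + |x|)) ∧
      (∀ s, 0 < s → ∀ x, ‖heat2 s g x‖ ≤ K * s ^ (α / 2 - 1) * (1 + |x|)) := by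
  obtain ⟨C, hC, hr⟩ := exists_regularity_bound h0 h1
  obtain ⟨r1, r2, r3, r4⟩ := hr g h A hg
  have hA := hg.nonneg
  set K := ‖g 0‖ + 3 * (C * A) with hK
  have hCA : 0 ≤ C * A := by positivity
  have hCK : C * A ≤ K := by simp only [hK]; linarith [norm_nonneg (g 0)]
  have hK0 : 0 ≤ K := hCA.trans hCK
  have hg1 : ∀ x, ‖g x‖ ≤ ‖g 0‖ + C * A * |x| ^ α := fun x => by
    have := r4 x 0
    rw [sub_zero] at this
    calc ‖g x‖ = ‖g 0 + (g x - g 0)‖ := by congr 1; ring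
      _ ≤ _ := (norm_add_le _ _).trans (by gcongr)
  have hg2 : ∀ x, ‖g x‖ ≤ (‖g 0‖ + C * A) * (1 + |x|) := fun x => by
    have h2 := rpow_le_one_add (abs_nonneg x) h0.le h1.le
    have h3 := abs_nonneg x
    have h4 := norm_nonneg (g 0)
    calc ‖g x‖ ≤ ‖g 0‖ + C * A * (1 + |x|) := (hg1 x).trans (by gcongr)
      _ ≤ _ := by nlinarith
  have one_le : ∀ x : ℝ, 1 ≤ 1 + |x| := fun x => by linarith [abs_nonneg x]
  have hh : ∀ s, 0 < s → ∀ x, ‖heat s g x‖ ≤ ‖g x‖ + C * A * s ^ (α / 2) := fun s hs x => by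
    calc ‖heat s g x‖ = ‖g x + (heat s g x - g x)‖ := by congr 1; ring
      _ ≤ _ := (norm_add_le _ _).trans (by gcongr; exact r3 s hs x)
  refine ⟨K, hK0, fun x => (hg2 x).trans ?_, fun s hs x => (hh s hs x).trans ?_,
    fun s hs x => (hh s (by linarith) x).trans ?_, fun s hs x => (r1 s hs x).trans ?_,
    fun s hs x => (r2 s hs x).trans ?_⟩
  · gcongr; simp only [hK]; linarith
  · have h3 : 0 ≤ s ^ (α / 2) := by positivity
    have h4 := norm_nonneg (g 0)
    calc ‖g x‖ + C * A * s ^ (α / 2) ≤ (‖g 0‖ + C * A) * (1 + |x|) + C * A * s ^ (α / 2) * (1 + |x|) :=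
          add_le_add (hg2 x) (le_mul_of_one_le_right (by positivity) (one_le x))
      _ ≤ K * (1 + |x|) + K * s ^ (α / 2) * (1 + |x|) := by
          gcongr; simp only [hK]; linarith
      _ = _ := by ring
  -- For large times growth is measured at the parabolic scale, |x|^α = s^(α/2) |x/√s|^α. This form
  -- gives the decay of the heat forms as s tends to infinity.
  · have hs0 : 0 < s := by linarith
    have hq : 0 < √s := sqrt_pos.2 hs0
    have h3 : 1 ≤ s ^ (α / 2) := one_le_rpow hs (by positivity)
    have h4 := norm_nonneg (g 0)
    have e : |x| ^ α = s ^ (α / 2) * |x / √s| ^ α := by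
      rw [abs_div, abs_of_pos hq, div_rpow (abs_nonneg _) hq.le, sqrt_eq_rpow,
        ← rpow_mul hs0.le, show 1 / 2 * α = α / 2 by ring, mul_div_cancel₀]
      positivity
    have h2 := rpow_le_one_add (abs_nonneg (x / √s)) h0.le h1.le
    have h5 := one_le (x / √s)
    have h6 : ‖g 0‖ ≤ ‖g 0‖ * (s ^ (α / 2) * (1 + |x / √s|)) := le_mul_of_one_le_right h4 (one_le_mul_of_one_le_of_one_le h3 h5)
    have h7 : C * A * s ^ (α / 2) ≤ C * A * s ^ (α / 2) * (1 + |x / √s|) := le_mul_of_one_le_right (by positivity) h5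
    calc ‖g x‖ + C * A * s ^ (α / 2) ≤ (‖g 0‖ + C * A * |x| ^ α) + C * A * s ^ (α / 2) := by
          gcongr; exact hg1 x
      _ ≤ (‖g 0‖ * (s ^ (α / 2) * (1 + |x / √s|)) + C * A * (s ^ (α / 2) * (1 + |x / √s|))) + C * A * s ^ (α / 2) * (1 + |x / √s|) := by
          rw [e]; gcongr
      _ = (‖g 0‖ + 2 * (C * A)) * (s ^ (α / 2) * (1 + |x / √s|)) := by ring
      _ ≤ K * (s ^ (α / 2) * (1 + |x / √s|)) := by
          gcongr; simp only [hK]; linarith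
      _ = _ := by ring
  · calc _ ≤ K * s ^ (α / 2 - 1 / 2) := by gcongr
      _ ≤ _ := le_mul_of_one_le_right (by positivity) (one_le x)
  · calc _ ≤ K * s ^ (α / 2 - 1) := by gcongr
      _ ≤ _ := le_mul_of_one_le_right (by positivity) (one_le x)

/-- Differentiation of a product of heat extensions in the time parameter. -/
lemma hasDerivAt_integral_heat_mul (φ ψ : 𝒮) {V V' : ℝ → ℝ → ℂ} {t₀ ε K T a b σ τ : ℝ} (hε : 0 < ε)
    (hK : 0 ≤ K)
    (ha : ∀ t ∈ ball t₀ ε, 0 < a + σ * t ∧ a + σ * t ≤ T)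
    (hb : ∀ t ∈ ball t₀ ε, 0 < b + τ * t ∧ b + τ * t ≤ T)
    (hV : ∀ t ∈ ball t₀ ε, ∀ x, HasDerivAt (fun t => V t x) (V' t x) t)
    (hm : ∀ t, AEStronglyMeasurable (V t)) (hm' : AEStronglyMeasurable (V' t₀))
    (hVb : ∀ t ∈ ball t₀ ε, ∀ x, ‖V t x‖ ≤ K * (1 + |x|))
    (hVb' : ∀ t ∈ ball t₀ ε, ∀ x, ‖V' t x‖ ≤ K * (1 + |x|)) :
    HasDerivAt (fun t => ∫ x, V t x * (heat (a + σ * t) φ x * heat (b + τ * t) ψ x))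
      (∫ x, (V' t₀ x * (heat (a + σ * t₀) φ x * heat (b + τ * t₀) ψ x) +
        V t₀ x * (σ * heat (a + σ * t₀) (sderiv (sderiv φ)) x * heat (b + τ * t₀) ψ x +
          τ * (heat (a + σ * t₀) φ x * heat (b + τ * t₀) (sderiv (sderiv ψ)) x)))) t₀ := by
  obtain ⟨C0, hC0, d0⟩ := heat_schwartz_decay φ 3 T
  obtain ⟨C1, hC1, d1⟩ := heat_schwartz_decay ψ 0 T
  obtain ⟨C2, hC2, d2⟩ := heat_schwartz_decay (sderiv (sderiv φ)) 3 T
  obtain ⟨C3, hC3, d3⟩ := heat_schwartz_decay (sderiv (sderiv ψ)) 0 T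
  simp only [pow_zero, inv_one, mul_one] at d1 d3
  have mφ : ∀ (χ : 𝒮) s, Measurable (heat s χ) := fun χ s =>
    measurable_heat_space (schwartz_tempered χ).aestronglyMeasurable s
  have hωe : ∀ x : ℝ, (1 + |x|) * ((1 + |x|) ^ 3)⁻¹ = ((1 + |x|) ^ 2)⁻¹ := fun x => by
    field_simp
  have m0 : ∀ t, AEStronglyMeasurable fun x => V t x * (heat (a + σ * t) φ x * heat (b + τ * t) ψ x) := fun t =>
    (hm t).mul ((mφ φ _).mul (mφ ψ _)).aestronglyMeasurable
  have ht₀ : t₀ ∈ ball t₀ ε := mem_ball_self hε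
  refine (hasDerivAt_integral_of_dominated_loc_of_deriv_le
    (F := fun t x => V t x * (heat (a + σ * t) φ x * heat (b + τ * t) ψ x))
    (F' := fun t x => V' t x * (heat (a + σ * t) φ x * heat (b + τ * t) ψ x) +
        V t x * (σ * heat (a + σ * t) (sderiv (sderiv φ)) x * heat (b + τ * t) ψ x +
          τ * (heat (a + σ * t) φ x * heat (b + τ * t) (sderiv (sderiv ψ)) x)))
    (bound := fun x => (K * (C0 * C1) + K * (|σ| * C2 * C1 + |τ| * (C0 * C3))) * ((1 + |x|) ^ 2)⁻¹)
    (ball_mem_nhds t₀ hε) (.of_forall m0) ?_ ?_ ?_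
    (integrable_weight_two.const_mul _) ?_).2
  · refine (integrable_weight_two.const_mul (K * (C0 * C1))).mono (m0 t₀) (.of_forall fun x => ?_)
    rw [norm_mul, norm_mul, norm_of_nonneg (by positivity)]
    have a1 := d0 _ (ha t₀ ht₀).1 (ha t₀ ht₀).2 x
    have a2 := d1 _ (hb t₀ ht₀).1 (hb t₀ ht₀).2 x
    have a3 := hVb t₀ ht₀ x
    calc _ ≤ (K * (1 + |x|)) * ((C0 * ((1 + |x|) ^ 3)⁻¹) * C1) := by gcongr
      _ = (K * (C0 * C1)) * ((1 + |x|) * ((1 + |x|) ^ 3)⁻¹) := by ring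
      _ = _ := by rw [hωe]
  · refine (hm'.mul ((mφ φ _).mul (mφ ψ _)).aestronglyMeasurable).add ((hm t₀).mul ?_)
    have := mφ φ (a + σ * t₀); have := mφ ψ (b + τ * t₀)
    have := mφ (sderiv (sderiv φ)) (a + σ * t₀); have := mφ (sderiv (sderiv ψ)) (b + τ * t₀)
    exact Measurable.aestronglyMeasurable (by fun_prop)
  · refine .of_forall fun x t ht => ?_
    have a0 := d0 _ (ha t ht).1 (ha t ht).2 x
    have a1 := d1 _ (hb t ht).1 (hb t ht).2 x
    have a2 := d2 _ (ha t ht).1 (ha t ht).2 x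
    have a3 := d3 _ (hb t ht).1 (hb t ht).2 x
    have b0 := hVb t ht x
    have b1 := hVb' t ht x
    calc _ ≤ ‖V' t x‖ * (‖heat (a + σ * t) φ x‖ * ‖heat (b + τ * t) ψ x‖) +
          ‖V t x‖ * (|σ| * ‖heat (a + σ * t) (sderiv (sderiv φ)) x‖ * ‖heat (b + τ * t) ψ x‖ +
            |τ| * (‖heat (a + σ * t) φ x‖ * ‖heat (b + τ * t) (sderiv (sderiv ψ)) x‖)) := by
          refine (norm_add_le _ _).trans ?_
          rw [norm_mul, norm_mul, norm_mul (V t x)]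
          gcongr
          refine (norm_add_le _ _).trans_eq ?_
          simp only [norm_mul, norm_real, norm_eq_abs]
      _ ≤ (K * (1 + |x|)) * ((C0 * ((1 + |x|) ^ 3)⁻¹) * C1) + (K * (1 + |x|)) * (|σ| * (C2 * ((1 + |x|) ^ 3)⁻¹) * C1 +
            |τ| * ((C0 * ((1 + |x|) ^ 3)⁻¹) * C3)) := by gcongr
      _ = (K * (C0 * C1) + K * (|σ| * C2 * C1 + |τ| * (C0 * C3))) * ((1 + |x|) * ((1 + |x|) ^ 3)⁻¹) := by ring
      _ = _ := by rw [hωe]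
  · refine .of_forall fun x t ht => ?_
    have e1 : HasDerivAt (fun t => heat (a + σ * t) φ x) (σ • heat (a + σ * t) (sderiv (sderiv φ)) x) t := by
      have := (hasDerivAt_heat_time (schwartz_tempered φ) (ha t ht).1 x).scomp t
        (((hasDerivAt_id t).const_mul σ).const_add a)
      rw [heat2_schwartz φ (ha t ht).1, mul_one] at this
      exact this
    have e2 : HasDerivAt (fun t => heat (b + τ * t) ψ x) (τ • heat (b + τ * t) (sderiv (sderiv ψ)) x) t := by
      have := (hasDerivAt_heat_time (schwartz_tempered ψ) (hb t ht).1 x).scomp t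
        (((hasDerivAt_id t).const_mul τ).const_add b)
      rw [heat2_schwartz ψ (hb t ht).1, mul_one] at this
      exact this
    refine ((hV t ht x).mul (e1.mul e2)).congr_deriv ?_
    simp only [real_smul, Pi.mul_apply]
    ring

lemma BddFracDeriv.tempered {α A : ℝ} (h1 : α < 1) {g h : ℝ → ℂ} (hg : BddFracDeriv α A g h) : Tempered g := hg.fd.tempered_left h1

lemma integral_add_three {a b c : ℝ → ℂ} (ha : Integrable a) (hb : Integrable b) (hc : Integrable c) :
    ∫ x, (a x + b x + c x) = (∫ x, a x) + (∫ x, b x) + ∫ x, c x := by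
  have hab : Integrable fun x => a x + b x := ha.add hb
  rw [← integral_add ha hb, ← integral_add hab hc]

lemma sderiv_sub (f u : 𝒮) : sderiv (f - u) = sderiv f - sderiv u := map_sub _ _ _

lemma integrable_heat_mul_schwartz {α A : ℝ} (h0 : 0 < α) (h1 : α < 1) {g h : ℝ → ℂ} (hg : BddFracDeriv α A g h)
    {s : ℝ} (hs : 0 < s) (w : 𝒮) : Integrable fun x => heat s g x * w x := by
  obtain ⟨K, hK, -, k0, -, -, -⟩ := hg.growth h0 h1
  exact integrable_growth_mul
    (measurable_heat_space (hg.tempered h1).aestronglyMeasurable s).aestronglyMeasurable (k0 s hs) w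

lemma integral_heat_mul_sderiv {α A : ℝ} (h0 : 0 < α) (h1 : α < 1) {g h : ℝ → ℂ} (hg : BddFracDeriv α A g h)
    {s : ℝ} (hs : 0 < s) (w : 𝒮) :
    ∫ x, heat s g x * sderiv w x = -∫ x, heat1 s g x * w x := by
  obtain ⟨K, hK, -, k0, -, k1, -⟩ := hg.growth h0 h1
  exact integral_mul_sderiv (hasDerivAt_heat (hg.tempered h1) hs) (k0 s hs)
    (measurable_heat1_space (hg.tempered h1).aestronglyMeasurable s).aestronglyMeasurable (k1 s hs) w

lemma integral_heat2_mul {α A : ℝ} (h0 : 0 < α) (h1 : α < 1) {g h : ℝ → ℂ} (hg : BddFracDeriv α A g h)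
    {s : ℝ} (hs : 0 < s) (w : 𝒮) :
    ∫ x, heat2 s g x * w x = ∫ x, heat s g x * sderiv (sderiv w) x := by
  obtain ⟨K, hK, -, k0, -, k1, k2⟩ := hg.growth h0 h1
  rw [integral_heat_mul_sderiv h0 h1 hg hs, integral_mul_sderiv (hasDerivAt_heat1 (hg.tempered h1) hs) (k1 s hs)
    (measurable_heat2_space (hg.tempered h1).aestronglyMeasurable s).aestronglyMeasurable (k2 s hs) w, neg_neg]

/-- `(f₁' + f₂')`-type second order expression of the product rule for heat extensions. -/
noncomputable def heatHess (f u : 𝒮) (a b x : ℝ) : ℂ :=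
  heat a (sderiv (sderiv f)) x * heat b u x + heat a (sderiv f) x * heat b (sderiv u) x + heat a f x * heat b (sderiv (sderiv u)) x

/-- All three factors solve the heat equation. Moving both derivatives off g_s produces (FU)'' +
F''U + FU'' = 2(F''U + F'U' + FU''). -/
lemma hasDerivAt_heat_form {α A : ℝ} (h0 : 0 < α) (h1 : α < 1) {g h : ℝ → ℂ} (hg : BddFracDeriv α A g h)
    (f u : 𝒮) {p q s : ℝ} (hp : 0 ≤ p) (hq : 0 ≤ q) (hs : 0 < s) :
    HasDerivAt (fun s => ∫ x, heat s g x * (heat (p + s) f x * heat (q + s) u x))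
      (2 * ∫ x, heat s g x * heatHess f u (p + s) (q + s) x) s := by
  have hT := hg.tempered h1
  obtain ⟨K, hK, -, k0, -, k1, k2⟩ := hg.growth h0 h1
  have hball : ∀ t ∈ ball s (s / 2), s / 2 < t ∧ t < 2 * s := fun t ht => by
    rw [mem_ball, dist_eq, abs_lt] at ht
    constructor <;> linarith
  have key := hasDerivAt_integral_heat_mul f u (V := fun t => heat t g) (V' := fun t => heat2 t g)
    (t₀ := s) (ε := s / 2) (K := K * (1 + (2 * s) ^ (α / 2)) + K * (s / 2) ^ (α / 2 - 1))
    (T := p + q + 2 * s) (a := p) (b := q) (σ := 1) (τ := 1)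
    (by positivity) (by positivity)
    (fun t ht => by have := hball t ht; constructor <;> linarith)
    (fun t ht => by have := hball t ht; constructor <;> linarith)
    (fun t ht x => hasDerivAt_heat_time hT (by linarith [(hball t ht).1]) x)
    (fun t => (measurable_heat_space hT.aestronglyMeasurable t).aestronglyMeasurable)
    (measurable_heat2_space hT.aestronglyMeasurable s).aestronglyMeasurable
    (fun t ht x => by
      have := hball t ht
      have ht0 : 0 < t := by linarith
      refine (k0 t ht0 x).trans (mul_le_mul_of_nonneg_right ?_ (by positivity))
      have : t ^ (α / 2) ≤ (2 * s) ^ (α / 2) := rpow_le_rpow ht0.le this.2.le (by positivity)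
      have h3 : 0 ≤ K * (s / 2) ^ (α / 2 - 1) := by positivity
      nlinarith)
    (fun t ht x => by
      have := hball t ht
      have ht0 : 0 < t := by linarith
      refine (k2 t ht0 x).trans (mul_le_mul_of_nonneg_right ?_ (by positivity))
      have : t ^ (α / 2 - 1) ≤ (s / 2) ^ (α / 2 - 1) := rpow_le_rpow_of_nonpos (by positivity) this.1.le (by linarith)
      have h3 : 0 ≤ K * (1 + (2 * s) ^ (α / 2)) := by positivity
      nlinarith)
  simp only [one_mul, ofReal_one] at key
  refine key.congr_deriv ?_
  have hps : 0 < p + s := by positivity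
  have hqs : 0 < q + s := by positivity
  set F := heatS (p + s) hps f with hF
  set U := heatS (q + s) hqs u with hU
  have e0 : ∀ x, heat (p + s) f x * heat (q + s) u x = mulS F U x := fun x => by
    rw [mulS_apply, heatS_apply, heatS_apply]
  have e1 : ∀ x, heat (p + s) (sderiv (sderiv f)) x * heat (q + s) u x + heat (p + s) f x * heat (q + s) (sderiv (sderiv u)) x =
      (mulS (sderiv (sderiv F)) U + mulS F (sderiv (sderiv U))) x := fun x => by
    simp only [add_apply, mulS_apply, hF, hU, sderiv_heatS, heatS_apply]
  have i1 := integrable_heat_mul_schwartz h0 h1 hg hs (mulS (sderiv (sderiv F)) U + mulS F (sderiv (sderiv U)))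
  have i2 := integrable_growth_mul
    (measurable_heat2_space hT.aestronglyMeasurable s).aestronglyMeasurable (k2 s hs) (mulS F U)
  simp only [e0, e1]
  rw [integral_add i2 i1, integral_heat2_mul h0 h1 hg hs, ← integral_const_mul,
    ← integral_add (integrable_heat_mul_schwartz h0 h1 hg hs _) i1]
  refine integral_congr_ae (.of_forall fun x => ?_)
  simp only [sderiv_mulS, sderiv_add, add_apply, mulS_apply, hF, hU, sderiv_heatS, heatS_apply, heatHess]
  ring

/-- Increasing q transfers heat time from u to f. The derivative of F''U + F'U' + FU'' is then the
exact derivative (F'''U - FU''')', and one integration by parts puts it on g_s. This is the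
cancellation in the commutator. -/
lemma hasDerivAt_heatHess_form {α A : ℝ} (h0 : 0 < α) (h1 : α < 1) {g h : ℝ → ℂ} (hg : BddFracDeriv α A g h)
    (f u : 𝒮) {r s q : ℝ} (hs : 0 < s) (hq : q ∈ Icc 0 r) :
    HasDerivAt (fun q => ∫ x, heat s g x * heatHess f u (s + q) (s + r - q) x)
      (-∫ x, heat1 s g x * (heat (s + q) (sderiv (sderiv (sderiv f))) x * heat (s + r - q) u x -
        heat (s + q) f x * heat (s + r - q) (sderiv (sderiv (sderiv u))) x)) q := by
  have hT := hg.tempered h1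
  obtain ⟨K, hK, -, k0, -, k1, k2⟩ := hg.growth h0 h1
  have hsq : 0 < s + q := by linarith [hq.1]
  have hsr : 0 < s + r - q := by linarith [hq.2]
  have der : ∀ φ ψ : 𝒮, HasDerivAt
      (fun q => ∫ x, heat s g x * (heat (s + q) φ x * heat (s + r - q) ψ x))
      (∫ x, heat s g x * (mulS (sderiv (sderiv (heatS _ hsq φ))) (heatS _ hsr ψ) -
        mulS (heatS _ hsq φ) (sderiv (sderiv (heatS _ hsr ψ)))) x) q := fun φ ψ => by
    have key := hasDerivAt_integral_heat_mul φ ψ (V := fun _ => heat s g) (V' := fun _ _ => 0)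
      (t₀ := q) (ε := s / 2) (K := K * (1 + s ^ (α / 2)))
      (T := 2 * s + r) (a := s) (b := s + r) (σ := 1) (τ := -1)
      (by positivity) (by positivity)
      (fun t ht => by
        rw [mem_ball, dist_eq, abs_lt] at ht
        constructor <;> linarith [hq.1, hq.2])
      (fun t ht => by
        rw [mem_ball, dist_eq, abs_lt] at ht
        constructor <;> linarith [hq.1, hq.2])
      (fun t ht x => hasDerivAt_const _ _)
      (fun t => (measurable_heat_space hT.aestronglyMeasurable s).aestronglyMeasurable)
      aestronglyMeasurable_const (fun t _ x => k0 s hs x)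
      (fun t _ x => by rw [norm_zero]; positivity)
    simp only [one_mul, ofReal_one, Complex.ofReal_neg, neg_mul, ← sub_eq_add_neg, zero_mul, zero_add] at key
    refine key.congr_deriv (integral_congr_ae (.of_forall fun x => ?_))
    simp only [sub_apply, mulS_apply, sderiv_heatS, heatS_apply]
  have hi := fun w => integrable_heat_mul_schwartz h0 h1 hg hs w
  have hi' : ∀ (φ ψ : 𝒮) (t : ℝ), 0 < s + t → 0 < s + r - t →
      Integrable fun x => heat s g x * (heat (s + t) φ x * heat (s + r - t) ψ x) := fun φ ψ t ha hb => by
    refine (hi (mulS (heatS _ ha φ) (heatS _ hb ψ))).congr (.of_forall fun x => ?_)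
    simp only [mulS_apply, heatS_apply]
  have key := ((der (sderiv (sderiv f)) u).add (der (sderiv f) (sderiv u))).add (der f (sderiv (sderiv u)))
  refine (key.congr_of_eventuallyEq ?_).congr_deriv ?_
  · filter_upwards [ball_mem_nhds q (half_pos hs)] with t ht
    rw [mem_ball, dist_eq, abs_lt] at ht
    have ha : 0 < s + t := by linarith [hq.1, hq.2]
    have hb : 0 < s + r - t := by linarith [hq.1, hq.2]
    simp only [Pi.add_apply]
    rw [← integral_add_three (hi' _ _ t ha hb) (hi' _ _ t ha hb) (hi' _ _ t ha hb)]
    refine integral_congr_ae (.of_forall fun x => ?_)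
    simp only [heatHess, mul_add]
  · set F := heatS (s + q) hsq f with hF
    set U := heatS (s + r - q) hsr u with hU
    have e : ∀ x, heat (s + q) (sderiv (sderiv (sderiv f))) x * heat (s + r - q) u x -
        heat (s + q) f x * heat (s + r - q) (sderiv (sderiv (sderiv u))) x =
        (mulS (sderiv (sderiv (sderiv F))) U - mulS F (sderiv (sderiv (sderiv U)))) x := fun x => by
      simp only [sub_apply, mulS_apply, hF, hU, sderiv_heatS, heatS_apply]
    simp only [e]
    rw [← integral_heat_mul_sderiv h0 h1 hg hs, ← integral_add_three (hi _) (hi _) (hi _)]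
    refine integral_congr_ae (.of_forall fun x => ?_)
    simp only [sderiv_sub, sub_apply, sderiv_mulS, add_apply, mulS_apply, hF, hU, sderiv_heatS, heatS_apply]
    ring

lemma enorm_heat_le_lintegral {v : ℝ → ℂ} (s x : ℝ) : ‖heat s v x‖ₑ ≤ ∫⁻ y, ofReal (hk s (x - y)) * ‖v y‖ₑ := by
  refine (enorm_integral_le_lintegral_enorm _).trans_eq (lintegral_congr fun y => ?_)
  rw [enorm_smul, enorm_eq_ofReal (hk_nonneg _ _)]

/-- For s ≥ 1, 1 + |x/√s| ≤ (1 + |(x-y)/√s|)(1 + |y|) splits the weight between the kernel, whose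
scaled moment is independent of s, and the Schwartz function. -/
lemma lintegral_heat_mul_weight_le (u : 𝒮) : ∃ C : ℝ, 0 ≤ C ∧ ∀ s, 1 ≤ s → ∫⁻ x, ofReal (1 + |x / √s|) * ‖heat s u x‖ₑ ≤ ofReal C := by
  have hM := integrable_hk_moment 1
  simp only [pow_one] at hM
  set M := ∫ t, hk 1 t * (1 + |t|) with hMdef
  have hM0 : 0 ≤ M := integral_nonneg fun t => mul_nonneg (hk_nonneg _ _) (by positivity)
  have hu : Integrable fun y => (1 + |y|) * ‖u y‖ := integrable_mul_schwartz (m := fun x => 1 + |x|) (by fun_prop) (C := 1) 1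
      (fun ζ => by rw [abs_of_nonneg (by positivity), one_mul, pow_one]) u
  refine ⟨M * ∫ y, (1 + |y|) * ‖u y‖, mul_nonneg hM0 (integral_nonneg fun y => by positivity), fun s hs => ?_⟩
  have hs0 : 0 < s := by linarith
  have hq : 1 ≤ √s := one_le_sqrt.2 hs
  have hq0 : 0 < √s := by linarith
  have hw : ∀ x y, 1 + |x / √s| ≤ (1 + |(x - y) / √s|) * (1 + |y|) := fun x y => by
    have h1 : |x / √s| ≤ |(x - y) / √s| + |y / √s| := by
      calc _ = |(x - y) / √s + y / √s| := by congr 1; ring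
        _ ≤ _ := abs_add_le _ _
    have h2 : |y / √s| ≤ |y| := by
      rw [abs_div, abs_of_pos hq0]; exact div_le_self (abs_nonneg y) hq
    nlinarith [abs_nonneg ((x - y) / √s), abs_nonneg y]
  have hmk := continuous_hk hs0
  have hmu := u.continuous
  calc ∫⁻ x, ofReal (1 + |x / √s|) * ‖heat s u x‖ₑ
      ≤ ∫⁻ x, ∫⁻ y, ofReal (hk s (x - y) * (1 + |(x - y) / √s|)) * ofReal ((1 + |y|) * ‖u y‖) := by
        refine lintegral_mono fun x => (mul_le_mul_right (enorm_heat_le_lintegral s x) _).trans ?_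
        rw [← lintegral_const_mul' _ _ ofReal_ne_top]
        refine lintegral_mono fun y => ?_
        rw [← ofReal_norm, ← ofReal_mul (hk_nonneg _ _), ← ofReal_mul (by positivity),
          ← ofReal_mul (mul_nonneg (hk_nonneg _ _) (by positivity))]
        refine ofReal_le_ofReal ?_
        have := mul_le_mul_of_nonneg_right (hw x y) (mul_nonneg (hk_nonneg s (x - y)) (norm_nonneg (u y)))
        linarith
    _ = ∫⁻ y, ∫⁻ x, ofReal (hk s (x - y) * (1 + |(x - y) / √s|)) * ofReal ((1 + |y|) * ‖u y‖) := by
        refine lintegral_lintegral_swap (Measurable.aemeasurable ?_)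
        simp only [uncurry_def]
        have c1 : Continuous fun p : ℝ × ℝ => hk s (p.1 - p.2) * (1 + |(p.1 - p.2) / √s|) := (hmk.comp (by fun_prop)).mul (by fun_prop)
        have c2 : Continuous fun p : ℝ × ℝ => (1 + |p.2|) * ‖u p.2‖ := by fun_prop
        exact c1.measurable.ennreal_ofReal.mul c2.measurable.ennreal_ofReal
    _ = ∫⁻ y, ofReal M * ofReal ((1 + |y|) * ‖u y‖) := by
        refine lintegral_congr fun y => ?_
        rw [lintegral_mul_const' _ _ ofReal_ne_top, lintegral_sub_right_eq_self (fun z => ofReal (hk s z * (1 + |z / √s|))) y,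
          ← ofReal_integral_eq_lintegral_ofReal (integrable_hk_scale hs0 hM)
            (.of_forall fun z => mul_nonneg (hk_nonneg _ _) (by positivity)),
          integral_hk_scale hs0 (fun t => 1 + |t|)]
    _ = _ := by
        rw [lintegral_const_mul' _ _ ofReal_ne_top, ← ofReal_integral_eq_lintegral_ofReal hu
          (.of_forall fun z => by positivity), ← ofReal_mul hM0]

/-- At scale √s the function g_s grows like s^(α/2), one heat extension is O(s^(-1/2)) uniformly,
and the other stays bounded in a weighted L¹. As α < 1, the product decays like s^(-(1-α)/2). -/
lemma tendsto_heat_form_atTop {α A : ℝ} (h0 : 0 < α) (h1 : α < 1) {g h : ℝ → ℂ} (hg : BddFracDeriv α A g h)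
    (f u : 𝒮) {p : ℝ} (hp : 0 ≤ p) :
    Tendsto (fun s => ∫ x, heat s g x * (heat (p + s) f x * heat s u x)) atTop (𝓝 0) := by
  obtain ⟨K, hK, -, -, k0, -, -⟩ := hg.growth h0 h1
  obtain ⟨C, hC, hu⟩ := lintegral_heat_mul_weight_le u
  set N := ∫ y, ‖f y‖ with hN
  have hN0 : 0 ≤ N := integral_nonneg fun y => norm_nonneg _
  have key : ∀ s, 1 ≤ s → ‖∫ x, heat s g x * (heat (p + s) f x * heat s u x)‖ ≤ K * N * C * s ^ (-((1 - α) / 2)) := fun s hs => by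
    have hs0 : 0 < s := by linarith
    have hB : ∀ x, ‖heat (p + s) f x‖ ≤ s ^ (-(1 / 2) : ℝ) * N := fun x => by
      refine (norm_heat_le_sqrt f.integrable (by positivity) x).trans (mul_le_mul_of_nonneg_right ?_ hN0)
      rw [rpow_neg hs0.le, ← sqrt_eq_rpow]
      refine inv_anti₀ (sqrt_pos.2 hs0) (sqrt_le_sqrt ?_)
      nlinarith [Real.pi_gt_three]
    have hle : ‖∫ x, heat s g x * (heat (p + s) f x * heat s u x)‖ₑ ≤ ofReal (K * N * C * s ^ (-((1 - α) / 2))) := by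
      calc _ ≤ ∫⁻ x, ‖heat s g x * (heat (p + s) f x * heat s u x)‖ₑ := enorm_integral_le_lintegral_enorm _
        _ ≤ ∫⁻ x, ofReal (K * N * s ^ (-((1 - α) / 2))) * (ofReal (1 + |x / √s|) * ‖heat s u x‖ₑ) := by
            refine lintegral_mono fun x => ?_
            rw [← ofReal_norm, ← ofReal_norm, ← ofReal_mul (by positivity), ← ofReal_mul (by positivity)]
            refine ofReal_le_ofReal ?_
            rw [norm_mul, norm_mul]
            calc _ ≤ (K * s ^ (α / 2) * (1 + |x / √s|)) * ((s ^ (-(1 / 2) : ℝ) * N) * ‖heat s u x‖) := by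
                  gcongr
                  · exact k0 s hs x
                  · exact hB x
              _ = K * N * (s ^ (α / 2) * s ^ (-(1 / 2) : ℝ)) * ((1 + |x / √s|) * ‖heat s u x‖) := by ring
              _ = _ := by rw [← rpow_add hs0]; ring_nf
        _ ≤ _ := by
            rw [lintegral_const_mul' _ _ ofReal_ne_top]
            refine (mul_le_mul_right (hu s hs) _).trans_eq ?_
            rw [← ofReal_mul (by positivity)]
            ring_nf
    rw [← ofReal_norm] at hle
    exact (ofReal_le_ofReal_iff (by positivity)).1 hle
  refine squeeze_zero_norm' (a := fun s => K * N * C * s ^ (-((1 - α) / 2))) ?_ ?_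
  · filter_upwards [eventually_ge_atTop 1] with s hs using key s hs
  · simpa using (tendsto_rpow_neg_atTop (by linarith : 0 < (1 - α) / 2)).const_mul (K * N * C)

lemma tendsto_heat_form_zero {α A : ℝ} (h0 : 0 < α) (h1 : α < 1) {g h : ℝ → ℂ} (hg : BddFracDeriv α A g h)
    (f u : 𝒮) {p : ℝ} (hp : 0 < p) :
    Tendsto (fun s => ∫ x, heat s g x * (heat (p + s) f x * heat s u x)) (𝓝[>] 0)
      (𝓝 (∫ x, g x * (heat p f x * u x))) := by
  obtain ⟨Cr, hCr, hr⟩ := exists_regularity_bound h0 h1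
  obtain ⟨-, -, r3, -⟩ := hr g h A hg
  obtain ⟨K, hK, -, k0, -, -, -⟩ := hg.growth h0 h1
  obtain ⟨C0, hC0, d0⟩ := heat_schwartz_decay f 3 (p + 1)
  obtain ⟨C1, hC1, d1⟩ := heat_schwartz_decay u 0 1
  simp only [pow_zero, inv_one, mul_one] at d1
  obtain ⟨B, hB, hu⟩ := schwartz_decay u 0
  simp only [pow_zero, inv_one, mul_one] at hu
  have hsm : ∀ᶠ s in 𝓝[>] (0 : ℝ), 0 < s ∧ s ≤ 1 := by
    filter_upwards [Ioc_mem_nhdsGT one_pos] with s hs using hs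
  have hωe : ∀ x : ℝ, (1 + |x|) * ((1 + |x|) ^ 3)⁻¹ = ((1 + |x|) ^ 2)⁻¹ := fun x => by
    field_simp
  refine tendsto_integral_filter_of_dominated_convergence
    (fun x => K * 2 * C0 * C1 * ((1 + |x|) ^ 2)⁻¹) (.of_forall fun s => ?_) ?_
    (integrable_weight_two.const_mul _) (.of_forall fun x => ?_)
  · exact ((measurable_heat_space (hg.tempered h1).aestronglyMeasurable s).mul
      ((measurable_heat_space (schwartz_tempered f).aestronglyMeasurable _).mul
        (measurable_heat_space (schwartz_tempered u).aestronglyMeasurable _))).aestronglyMeasurable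
  · filter_upwards [hsm] with s hs
    refine .of_forall fun x => ?_
    have a1 := d0 (p + s) (by linarith) (by linarith) x
    have a2 := d1 s hs.1 hs.2 x
    have a3 : ‖heat s g x‖ ≤ K * 2 * (1 + |x|) := (k0 s hs.1 x).trans (by
      have := rpow_le_one hs.1.le hs.2 (by positivity : 0 ≤ α / 2)
      gcongr; linarith)
    rw [norm_mul, norm_mul]
    calc _ ≤ (K * 2 * (1 + |x|)) * ((C0 * ((1 + |x|) ^ 3)⁻¹) * C1) := by gcongr
      _ = K * 2 * C0 * C1 * ((1 + |x|) * ((1 + |x|) ^ 3)⁻¹) := by ring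
      _ = _ := by rw [hωe]
  · refine Tendsto.mul ?_ (Tendsto.mul ?_ (tendsto_heat u.continuous hu x))
    · rw [tendsto_iff_norm_sub_tendsto_zero]
      have hz : Tendsto (fun s : ℝ => Cr * A * s ^ (α / 2)) (𝓝[>] 0) (𝓝 0) := by
        have := ((Real.continuousAt_rpow_const 0 (α / 2) (Or.inr (by positivity))).tendsto.const_mul (Cr * A))
        rw [zero_rpow (by positivity), mul_zero] at this
        exact this.mono_left nhdsWithin_le_nhds
      refine squeeze_zero' (.of_forall fun _ => norm_nonneg _) ?_ hz
      filter_upwards [hsm] with s hs using r3 s hs.1 x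
    · have hc := (hasDerivAt_heat_time (schwartz_tempered f) hp x).continuousAt
      have : Tendsto (fun s : ℝ => p + s) (𝓝[>] 0) (𝓝 p) := by
        have : Tendsto (fun s : ℝ => p + s) (𝓝 0) (𝓝 (p + 0)) := tendsto_const_nhds.add tendsto_id
        rw [add_zero] at this
        exact this.mono_left nhdsWithin_le_nhds
      exact hc.tendsto.comp this

/-- The trilinear heat expression in which the estimates are carried out. -/
noncomputable def heatTri (g : ℝ → ℂ) (f u : 𝒮) (s q p : ℝ) : ℝ≥0∞ := ∫⁻ x, ‖heat1 s g x‖ₑ * (‖heat (s + q) f x‖ₑ * ‖heat (s + p) u x‖ₑ)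

lemma measurable_heatTri {g : ℝ → ℂ} (hg : AEStronglyMeasurable g) (f u : 𝒮) :
    Measurable fun z : ℝ × ℝ × ℝ => heatTri g f u z.1 z.2.1 z.2.2 := by
  have m0 := measurable_heat1 hg
  have m1 := measurable_heat (schwartz_tempered f).aestronglyMeasurable
  have m2 := measurable_heat (schwartz_tempered u).aestronglyMeasurable
  refine Measurable.lintegral_prod_right' (f := fun w : (ℝ × ℝ × ℝ) × ℝ => ‖heat1 w.1.1 g w.2‖ₑ *
    (‖heat (w.1.1 + w.1.2.1) f w.2‖ₑ * ‖heat (w.1.1 + w.1.2.2) u w.2‖ₑ)) ?_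
  have a0 := m0.comp (f := fun w : (ℝ × ℝ × ℝ) × ℝ => (w.1.1, w.2)) (by fun_prop)
  have a1 := m1.comp (f := fun w : (ℝ × ℝ × ℝ) × ℝ => (w.1.1 + w.1.2.1, w.2)) (by fun_prop)
  have a2 := m2.comp (f := fun w : (ℝ × ℝ × ℝ) × ℝ => (w.1.1 + w.1.2.2, w.2)) (by fun_prop)
  exact a0.enorm.mul (a1.enorm.mul a2.enorm)

/-- The antisymmetric form `∫ g (f_r u - f u_r)` is controlled by third derivatives of heat extensions. -/
lemma enorm_heat_commutator_le {α A : ℝ} (h0 : 0 < α) (h1 : α < 1) {g h : ℝ → ℂ} (hg : BddFracDeriv α A g h)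
    (f u : 𝒮) {r : ℝ} (hr : 0 < r) :
    ‖∫ x, g x * (heat r f x * u x - f x * heat r u x)‖ₑ ≤ 2 * ∫⁻ s in ℝ₊, ∫⁻ q in Ioo 0 r,
        (heatTri g (sderiv (sderiv (sderiv f))) u s q (r - q) + heatTri g f (sderiv (sderiv (sderiv u))) s q (r - q)) := by
  obtain ⟨K, hK, kg, -, -, -, -⟩ := hg.growth h0 h1
  have hgm := hg.cont.aestronglyMeasurable (μ := volume)
  have e0 : ∫ x, g x * (heat r f x * u x - f x * heat r u x) = (∫ x, g x * (heat r f x * u x)) - ∫ x, g x * (heat r u x * f x) := by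
    rw [← integral_sub]
    · exact integral_congr_ae (.of_forall fun x => by ring)
    · exact (integrable_growth_mul hgm kg (mulS (heatS r hr f) u)).congr
        (.of_forall fun x => by simp only [mulS_apply, heatS_apply])
    · exact (integrable_growth_mul hgm kg (mulS (heatS r hr u) f)).congr
        (.of_forall fun x => by simp only [mulS_apply, heatS_apply])
  -- As s runs from 0 to infinity, this difference goes from the antisymmetric form to zero. Its
  -- derivative is twice the difference of one Hessian form at q = r and q = 0, which is in turn
  -- integrated in q.
  have hder : ∀ s, 0 < s → HasDerivAt (fun s => (∫ x, heat s g x * (heat (r + s) f x * heat s u x)) -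
      ∫ x, heat s g x * (heat (r + s) u x * heat s f x))
      (2 * ((∫ x, heat s g x * heatHess f u (s + r) (s + r - r) x) -
        ∫ x, heat s g x * heatHess f u (s + 0) (s + r - 0) x)) s := fun s hs => by
    have k1 := hasDerivAt_heat_form h0 h1 hg f u hr.le le_rfl hs
    have k2 := hasDerivAt_heat_form h0 h1 hg f u le_rfl hr.le hs
    simp only [zero_add] at k1 k2
    have e : ∀ s, ∫ x, heat s g x * (heat (r + s) u x * heat s f x) =
        ∫ x, heat s g x * (heat s f x * heat (r + s) u x) := fun s => by simp only [mul_comm (heat s f _)]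
    simp only [e]
    refine (k1.sub k2).congr_deriv ?_
    rw [add_sub_cancel_right, add_zero, sub_zero, add_comm s r]
    ring
  have t0 := (tendsto_heat_form_zero h0 h1 hg f u hr).sub (tendsto_heat_form_zero h0 h1 hg u f hr)
  have t1 := (tendsto_heat_form_atTop h0 h1 hg f u hr.le).sub (tendsto_heat_form_atTop h0 h1 hg u f hr.le)
  rw [sub_zero] at t1
  rw [e0]
  refine (enorm_limit_le_lintegral_deriv hder t0 t1).trans ?_
  rw [← lintegral_const_mul' _ _ (by simp)]
  refine setLIntegral_mono' measurableSet_Ioi fun s (hs : 0 < s) => ?_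
  rw [enorm_mul]
  refine mul_le_mul' (by simp [enorm_eq_nnnorm]) ?_
  rw [Measure.restrict_congr_set Ioo_ae_eq_Ioc]
  refine (enorm_sub_le_lintegral_deriv hr.le
    fun q hq => hasDerivAt_heatHess_form h0 h1 hg f u hs hq).trans ?_
  refine lintegral_mono fun q => ?_
  rw [enorm_neg]
  refine (enorm_integral_le_lintegral_enorm _).trans ?_
  have hm1 := measurable_heat1_space hgm s
  have hm2 := measurable_heat_space (schwartz_tempered (sderiv (sderiv (sderiv f)))).aestronglyMeasurable (s + q)
  have hm3 := measurable_heat_space (schwartz_tempered u).aestronglyMeasurable (s + (r - q))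
  have hm : Measurable fun x => ‖heat1 s g x‖ₑ * (‖heat (s + q) (sderiv (sderiv (sderiv f))) x‖ₑ * ‖heat (s + (r - q)) u x‖ₑ) :=
    hm1.enorm.mul (hm2.enorm.mul hm3.enorm)
  rw [heatTri, heatTri, ← lintegral_add_left hm]
  refine lintegral_mono fun x => ?_
  rw [enorm_mul, add_sub_assoc, ← mul_add]
  gcongr
  refine (enorm_sub_le).trans_eq ?_
  rw [enorm_mul, enorm_mul]

/-- The shear p = r - q maps the cone 0 < q < r to the quadrant, and turns a weight in r into a
weight in p + q. -/
lemma lintegral_Ioi_Ioo_sub {Φ : ℝ × ℝ → ℝ≥0∞} (hΦ : Measurable Φ) : ∫⁻ r in ℝ₊, ∫⁻ q in Ioo 0 r, Φ (q, r - q) =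
      ∫⁻ q in ℝ₊, ∫⁻ p in ℝ₊, Φ (q, p) := by
  set D : Set (ℝ × ℝ) := Ioi 0 ×ˢ Ioi 0 with hD
  have hDm : MeasurableSet D := measurableSet_Ioi.prod measurableSet_Ioi
  have hΨ : Measurable (D.indicator Φ) := hΦ.indicator hDm
  calc _ = ∫⁻ r, ∫⁻ q, D.indicator Φ (q, r - q) := by
        rw [← lintegral_indicator measurableSet_Ioi]
        refine lintegral_congr fun r => ?_
        by_cases hr : 0 < r
        · rw [indicator_of_mem (mem_Ioi.2 hr), ← lintegral_indicator measurableSet_Ioo]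
          refine lintegral_congr fun q => ?_
          simp only [indicator, hD, mem_Ioo, mem_prod, mem_Ioi, sub_pos]
        · rw [indicator_of_notMem (by simpa using hr), eq_comm, lintegral_eq_zero_iff' (by
            exact (hΨ.comp (f := fun q => (q, r - q)) (by fun_prop)).aemeasurable)]
          refine .of_forall fun q => ?_
          refine indicator_of_notMem (fun h => hr ?_) _
          have h1 : 0 < q := h.1
          have h2 : 0 < r - q := h.2
          linarith
    _ = ∫⁻ q, ∫⁻ r, D.indicator Φ (q, r - q) :=
        lintegral_lintegral_swap (hΨ.comp (f := fun z : ℝ × ℝ => (z.2, z.1 - z.2)) (by fun_prop)).aemeasurable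
    _ = ∫⁻ q, ∫⁻ p, D.indicator Φ (q, p) := lintegral_congr fun q => lintegral_sub_right_eq_self (fun p => D.indicator Φ (q, p)) q
    _ = _ := by
        rw [← lintegral_indicator measurableSet_Ioi]
        refine lintegral_congr fun q => ?_
        by_cases hq : 0 < q
        · rw [indicator_of_mem (mem_Ioi.2 hq), ← lintegral_indicator measurableSet_Ioi]
          refine lintegral_congr fun p => ?_
          simp only [indicator, hD, mem_prod, mem_Ioi, hq, true_and]
        · rw [indicator_of_notMem (by simpa using hq)]
          simp [indicator, hD, hq]

/-- The `L²` bound for the antisymmetric form, with absolute values inside the integral in `r`. -/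
lemma exists_commutator_sq_bound {α : ℝ} (h0 : 0 < α) (h1 : α < 1) : ∃ C : ℝ, 0 < C ∧
    ∀ (g h : ℝ → ℂ) (A : ℝ), BddFracDeriv α A g h → ∀ f u : 𝒮, ∫⁻ r in ℝ₊, ofReal (r ^ (-(1 + α / 2))) *
        ‖∫ x, g x * (heat r f x * u x - f x * heat r u x)‖ₑ ≤
      ofReal (C * A) * ((∫⁻ x, ‖f x‖ₑ ^ 2) ^ (1 / 2 : ℝ) * (∫⁻ x, ‖u x‖ₑ ^ 2) ^ (1 / 2 : ℝ)) := by
  obtain ⟨C, hC, hb⟩ := trilinear_bound h0 h1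
  -- One factor 2 comes from the time derivative of the heat form, the other from the two terms with
  -- f''' and u'''.
  refine ⟨4 * C, by positivity, fun g h A hg f u => ?_⟩
  have hgm := hg.cont.aestronglyMeasurable (μ := volume)
  have hA := hg.nonneg
  set w : ℝ → ℝ≥0∞ := fun r => ofReal (r ^ (-(1 + α / 2))) with hw
  have hwm : Measurable w := by
    have : Measurable fun r : ℝ => r ^ (-(1 + α / 2)) := by fun_prop
    exact this.ennreal_ofReal
  set f3 := sderiv (sderiv (sderiv f))
  set u3 := sderiv (sderiv (sderiv u))
  set H : ℝ × ℝ × ℝ → ℝ≥0∞ := fun z => heatTri g f3 u z.1 z.2.1 z.2.2 + heatTri g f u3 z.1 z.2.1 z.2.2 with hH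
  have hHm : Measurable H := (measurable_heatTri hgm f3 u).add (measurable_heatTri hgm f u3)
  have b1 := hb g h A hg f u
  have b2 := hb g h A hg u f
  rw [mul_comm ((∫⁻ x, ‖u x‖ₑ ^ 2) ^ (1 / 2 : ℝ))] at b2
  set R := ofReal (C * A) * ((∫⁻ x, ‖f x‖ₑ ^ 2) ^ (1 / 2 : ℝ) * (∫⁻ x, ‖u x‖ₑ ^ 2) ^ (1 / 2 : ℝ))
  have hm1 : Measurable fun z : ℝ × ℝ × ℝ => w (z.2.2 + z.2.1) * heatTri g f3 u z.1 z.2.1 z.2.2 :=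
    (hwm.comp (by fun_prop)).mul (measurable_heatTri hgm f3 u)
  have hm2 : Measurable fun z : ℝ × ℝ × ℝ => w (z.2.2 + z.2.1) * heatTri g f u3 z.1 z.2.1 z.2.2 :=
    (hwm.comp (by fun_prop)).mul (measurable_heatTri hgm f u3)
  have hm12 : Measurable fun z : ℝ × ℝ × ℝ => w (z.2.2 + z.2.1) * H z := (hwm.comp (by fun_prop)).mul hHm
  have hin : ∀ r : ℝ, (∫⁻ s in ℝ₊, ∫⁻ q in Ioo 0 r, w r * H (s, q, r - q)) =
      w r * ∫⁻ s in ℝ₊, ∫⁻ q in Ioo 0 r, H (s, q, r - q) := fun r => by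
    rw [← lintegral_const_mul' _ _ ofReal_ne_top]
    exact lintegral_congr fun s => lintegral_const_mul' _ _ ofReal_ne_top
  have hind : ∀ r s : ℝ, ∫⁻ q in Ioo 0 r, w r * H (s, q, r - q) = ∫⁻ q, (ℝ₊ ×ˢ ℝ₊).indicator
        (fun z : ℝ × ℝ => w (z.2 + z.1) * H (s, z.1, z.2)) (q, r - q) := fun r s => by
    rw [← lintegral_indicator measurableSet_Ioo]
    refine lintegral_congr fun q => ?_
    simp only [indicator, mem_Ioo, mem_prod, mem_Ioi, sub_pos, sub_add_cancel]
  have hmeas : Measurable fun z : ℝ × ℝ => ∫⁻ q in Ioo 0 z.1, w z.1 * H (z.2, q, z.1 - q) := by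
    simp only [hind]
    have hD : MeasurableSet {z : (ℝ × ℝ) × ℝ | (z.2, z.1.1 - z.2) ∈ (ℝ₊ ×ˢ ℝ₊)} :=
      (measurableSet_Ioi.prod measurableSet_Ioi).preimage (f := fun z : (ℝ × ℝ) × ℝ => (z.2, z.1.1 - z.2))
        (by fun_prop)
    have := (hm12.comp (f := fun z : (ℝ × ℝ) × ℝ => (z.1.2, z.2, z.1.1 - z.2)) (by fun_prop)).indicator hD
    exact Measurable.lintegral_prod_right' this
  calc _ ≤ ∫⁻ r in ℝ₊, 2 * ∫⁻ s in ℝ₊, ∫⁻ q in Ioo 0 r, w r * H (s, q, r - q) := by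
        refine setLIntegral_mono' measurableSet_Ioi fun r (hr : 0 < r) => ?_
        rw [hin, mul_left_comm 2]
        exact mul_le_mul_right (enorm_heat_commutator_le h0 h1 hg f u hr) _
    _ = 2 * ∫⁻ s in ℝ₊, ∫⁻ r in ℝ₊, ∫⁻ q in Ioo 0 r, w r * H (s, q, r - q) := by
        rw [lintegral_const_mul' _ _ (by simp), lintegral_lintegral_swap hmeas.aemeasurable]
    _ = 2 * ∫⁻ s in ℝ₊, ∫⁻ q in ℝ₊, ∫⁻ p in ℝ₊, w (p + q) * H (s, q, p) := by
        congr 1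
        refine lintegral_congr fun s => ?_
        rw [← lintegral_Ioi_Ioo_sub (Φ := fun z => w (z.2 + z.1) * H (s, z.1, z.2))
          (hm12.comp (f := fun z : ℝ × ℝ => (s, z.1, z.2)) (by fun_prop))]
        simp only [sub_add_cancel]
    _ = 2 * ((∫⁻ s in ℝ₊, ∫⁻ q in ℝ₊, ∫⁻ p in ℝ₊, w (p + q) * heatTri g f3 u s q p) +
          ∫⁻ s in ℝ₊, ∫⁻ q in ℝ₊, ∫⁻ p in ℝ₊, w (p + q) * heatTri g f u3 s q p) := by
        congr 1
        have n2 : Measurable fun z : ℝ × ℝ => ∫⁻ p in ℝ₊, w (p + z.2) * heatTri g f3 u z.1 z.2 p :=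
          Measurable.lintegral_prod_right' (hm1.comp (f := fun y : (ℝ × ℝ) × ℝ => (y.1.1, y.1.2, y.2)) (by fun_prop))
        have n1 : Measurable fun s : ℝ => ∫⁻ q in ℝ₊, ∫⁻ p in ℝ₊, w (p + q) * heatTri g f3 u s q p :=
          Measurable.lintegral_prod_right' n2
        rw [← lintegral_add_left n1]
        refine lintegral_congr fun s => ?_
        have n3 : Measurable fun q : ℝ => ∫⁻ p in ℝ₊, w (p + q) * heatTri g f3 u s q p :=
          n2.comp (f := fun q => (s, q)) (by fun_prop)
        rw [← lintegral_add_left n3]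
        refine lintegral_congr fun q => ?_
        have n4 : Measurable fun p : ℝ => w (p + q) * heatTri g f3 u s q p := hm1.comp (f := fun p => (s, q, p)) (by fun_prop)
        rw [← lintegral_add_left n4]
        exact lintegral_congr fun p => mul_add _ _ _
    _ ≤ 2 * (R + R) := by
        gcongr
        · exact b1
        -- The term with u''' is the trilinear expression with f and u exchanged, and p and q
        -- exchanged.
        · refine le_trans (le_of_eq ?_) b2
          refine lintegral_congr fun s => ?_
          have n5 : Measurable (uncurry fun q p : ℝ => w (p + q) * heatTri g f u3 s q p) :=
            hm2.comp (f := fun z : ℝ × ℝ => (s, z.1, z.2)) (by fun_prop)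
          rw [lintegral_lintegral_swap n5.aemeasurable]
          refine lintegral_congr fun p => lintegral_congr fun q => ?_
          rw [add_comm p q, heatTri]
          simp only [mul_comm ‖heat (s + q) f _‖ₑ]
          rfl
    _ = _ := by
        rw [← two_mul, ← mul_assoc, ← mul_assoc, show (4 * C * A) = 4 * (C * A) by ring,
          ofReal_mul (by norm_num : (0 : ℝ) ≤ 4), show ofReal 4 = 2 * 2 by norm_num]

/-! ### Dyadic intervals and the Calderón-Zygmund decomposition. -/

/-- The dyadic interval `[k 2ⁿ, (k + 1) 2ⁿ)`, indexed by `(n, k)`. -/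
def dyadic (i : ℤ × ℤ) : Set ℝ := Ico (i.2 * (2 : ℝ) ^ i.1) ((i.2 + 1) * (2 : ℝ) ^ i.1)

lemma measurableSet_dyadic (i : ℤ × ℤ) : MeasurableSet (dyadic i) := measurableSet_Ico

lemma volume_dyadic (i : ℤ × ℤ) : volume (dyadic i) = ofReal ((2 : ℝ) ^ i.1) := by
  rw [dyadic, Real.volume_Ico]; ring_nf

lemma mem_dyadic_floor (n : ℤ) (x : ℝ) : x ∈ dyadic (n, ⌊x / (2 : ℝ) ^ n⌋) := by
  have h : (0 : ℝ) < 2 ^ n := by positivity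
  exact ⟨(le_div_iff₀ h).1 (Int.floor_le _), (div_lt_iff₀ h).1 (Int.lt_floor_add_one _)⟩

lemma dyadic_subset {i j : ℤ × ℤ} {x : ℝ} (h : i.1 ≤ j.1) (hi : x ∈ dyadic i) (hj : x ∈ dyadic j) : dyadic i ⊆ dyadic j := by
  obtain ⟨n, k⟩ := i
  obtain ⟨n', k'⟩ := j
  obtain ⟨m, hm⟩ := Int.le.dest h
  simp only at hm
  have e : (2 : ℝ) ^ n' = (2 ^ m : ℤ) * 2 ^ n := by
    rw [← hm, zpow_add₀ two_ne_zero, mul_comm]; simp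
  have hp : (0 : ℝ) < 2 ^ n := by positivity
  simp only [dyadic, e] at hi hj ⊢
  rw [← mul_assoc, ← mul_assoc] at hj
  have h1 : k' * 2 ^ m < k + 1 := by
    have := lt_of_mul_lt_mul_right (hj.1.trans_lt hi.2) hp.le
    exact_mod_cast this
  have h2 : k < (k' + 1) * 2 ^ m := by
    have := lt_of_mul_lt_mul_right (hi.1.trans_lt hj.2) hp.le
    exact_mod_cast this
  have h3 : ((k' * 2 ^ m : ℤ) : ℝ) ≤ k := by exact_mod_cast Int.lt_add_one_iff.1 h1
  have h4 : ((k + 1 : ℤ) : ℝ) ≤ ((k' + 1) * 2 ^ m : ℤ) := by exact_mod_cast h2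
  refine Ico_subset_Ico ?_ ?_
  · rw [← mul_assoc]
    refine mul_le_mul_of_nonneg_right ?_ hp.le
    push_cast at h3 ⊢; exact h3
  · rw [← mul_assoc]
    refine mul_le_mul_of_nonneg_right ?_ hp.le
    push_cast at h4 ⊢; exact h4

lemma dyadic_eq_of_mem {i j : ℤ × ℤ} {x : ℝ} (h : i.1 = j.1) (hi : x ∈ dyadic i) (hj : x ∈ dyadic j) : i = j := by
  obtain ⟨n, k⟩ := i
  obtain ⟨n', k'⟩ := j
  simp only at h
  subst h
  have hp : (0 : ℝ) < 2 ^ n := by positivity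
  have h1 := lt_of_mul_lt_mul_right (hj.1.trans_lt hi.2) hp.le
  have h2 := lt_of_mul_lt_mul_right (hi.1.trans_lt hj.2) hp.le
  simp only at h1 h2
  have h3 : k' < k + 1 := by exact_mod_cast h1
  have h4 : k < k' + 1 := by exact_mod_cast h2
  ext
  · rfl
  · simp only; omega

/-- Averages of an integrable function over shrinking dyadic intervals converge almost everywhere. -/
lemma ae_le_of_dyadic_average_le {f : ℝ → ℂ} (hf : Integrable f) {l : ℝ} (hl : 0 < l) : ∀ᵐ x,
    (∀ n : ℤ, ∫⁻ y in dyadic (n, ⌊x / (2 : ℝ) ^ n⌋), ‖f y‖ₑ ≤ ofReal (l * 2 ^ n)) → ‖f x‖ ≤ l := by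
  filter_upwards [IsUnifLocDoublingMeasure.ae_tendsto_average volume hf.norm.locallyIntegrable 1] with x hx h
  have hp : ∀ m : ℕ, (0 : ℝ) < 2 ^ (-(m : ℤ)) := fun m => by positivity
  -- The closure of a dyadic interval is the closed ball about its midpoint. The balls contain x
  -- without being centred at it, so the differentiation theorem for such balls is needed.
  set c : ℕ → ℝ := fun m => (⌊x / (2 : ℝ) ^ (-(m : ℤ))⌋ + 1 / 2) * 2 ^ (-(m : ℤ)) with hc
  have hlim : Tendsto (fun m : ℕ => (2 : ℝ) ^ (-(m : ℤ)) / 2) atTop (𝓝[>] 0) := by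
    refine tendsto_nhdsWithin_iff.2 ⟨?_, .of_forall fun m => half_pos (hp m)⟩
    have : Tendsto (fun m : ℕ => ((1 / 2 : ℝ)) ^ m / 2) atTop (𝓝 (0 / 2)) :=
      (tendsto_pow_atTop_nhds_zero_of_lt_one (by norm_num) (by norm_num)).div_const 2
    simpa [zpow_neg, one_div, inv_pow] using this
  have hball : ∀ m : ℕ, Metric.closedBall (c m) ((2 : ℝ) ^ (-(m : ℤ)) / 2) =
      Icc (⌊x / (2 : ℝ) ^ (-(m : ℤ))⌋ * (2 : ℝ) ^ (-(m : ℤ))) ((⌊x / (2 : ℝ) ^ (-(m : ℤ))⌋ + 1) * (2 : ℝ) ^ (-(m : ℤ))) :=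
    fun m => by
      rw [Real.closedBall_eq_Icc]; simp only [hc]; congr 1 <;> ring
  refine le_of_tendsto (hx c _ hlim (.of_forall fun m => ?_)) (.of_forall fun m => ?_)
  · rw [one_mul, hball]
    exact Ico_subset_Icc_self (mem_dyadic_floor _ x)
  · have hv : volume.real (Metric.closedBall (c m) ((2 : ℝ) ^ (-(m : ℤ)) / 2)) = 2 ^ (-(m : ℤ)) := by
      rw [Measure.real, Real.volume_closedBall, toReal_ofReal (by positivity)]; ring
    rw [setAverage_eq, hv, hball, ← Measure.restrict_congr_set Ico_ae_eq_Icc, smul_eq_mul, inv_mul_le_iff₀ (hp m), mul_comm _ l]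
    have := h (-(m : ℤ))
    have hi := ofReal_integral_norm_eq_lintegral_enorm (hf.restrict (s := dyadic (-(m : ℤ), ⌊x / (2 : ℝ) ^ (-(m : ℤ))⌋)))
    rw [← hi] at this
    exact (ofReal_le_ofReal_iff (by positivity)).1 this

/-- Selection of the maximal dyadic intervals on which the mean of `|f|` exceeds `l`. -/
lemma exists_stopping_intervals {f : ℝ → ℂ} (hf : Integrable f) {l : ℝ} (hl : 0 < l) : ∃ S : Set (ℤ × ℤ),
    S.PairwiseDisjoint dyadic ∧ (∀ i ∈ S, ofReal (l * 2 ^ i.1) ≤ ∫⁻ y in dyadic i, ‖f y‖ₑ) ∧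
      (∀ i ∈ S, ∫⁻ y in dyadic i, ‖f y‖ₑ ≤ ofReal (2 * l * 2 ^ i.1)) ∧
      ∀ᵐ x, x ∉ (⋃ i ∈ S, dyadic i) → ‖f x‖ ≤ l := by
  set S : Set (ℤ × ℤ) := {i | ofReal (l * 2 ^ i.1) < ∫⁻ y in dyadic i, ‖f y‖ₑ ∧
    ∀ j, i.1 < j.1 → dyadic i ⊆ dyadic j → ∫⁻ y in dyadic j, ‖f y‖ₑ ≤ ofReal (l * 2 ^ j.1)} with hS
  have key : ∀ i ∈ S, ∀ j ∈ S, ∀ x ∈ dyadic i, x ∈ dyadic j → i.1 < j.1 → False := fun i hi j hj x hxi hxj hij =>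
    (hi.2 j hij (dyadic_subset hij.le hxi hxj)).not_gt hj.1
  refine ⟨S, fun i hi j hj hij => Set.disjoint_left.2 fun x hxi hxj => ?_, fun i hi => hi.1.le, fun i hi => ?_, ?_⟩
  · rcases lt_trichotomy i.1 j.1 with h | h | h
    · exact key i hi j hj x hxi hxj h
    · exact hij (dyadic_eq_of_mem h hxi hxj)
    · exact key j hj i hi x hxj hxi h
  · obtain ⟨x, hx⟩ : (dyadic i).Nonempty := by
      have : (0 : ℝ) < 2 ^ i.1 := by positivity
      exact ⟨_, le_rfl, by nlinarith⟩
    -- The dyadic parent has mean at most l by maximality, and twice the length; hence the factor 2.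
    have hx' := mem_dyadic_floor (i.1 + 1) x
    have hsub := dyadic_subset (j := (i.1 + 1, _)) (by simp) hx hx'
    refine (lintegral_mono_set hsub).trans ((hi.2 _ (by simp) hsub).trans_eq ?_)
    simp only [zpow_add_one₀ (two_ne_zero (α := ℝ))]
    ring_nf
  · filter_upwards [ae_le_of_dyadic_average_le hf hl] with x hx hxS
    refine hx fun n => ?_
    by_contra! hn
    have hfin : ∫⁻ y, ‖f y‖ₑ ≠ ∞ := hf.2.ne
    -- A mean above l forces l 2^n below the total mass of |f|, so the bad scales at x are bounded
    -- above and a largest one exists.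
    obtain ⟨b, hb⟩ : ∃ b : ℤ, ∀ n, ofReal (l * 2 ^ n) < ∫⁻ y in dyadic (n, ⌊x / (2 : ℝ) ^ n⌋), ‖f y‖ₑ → n ≤ b := by
      obtain ⟨m, hm⟩ := pow_unbounded_of_one_lt ((∫⁻ y, ‖f y‖ₑ).toReal / l) (one_lt_two (α := ℝ))
      refine ⟨m, fun n hn => ?_⟩
      by_contra! hmn
      have h1 : (2 : ℝ) ^ m ≤ 2 ^ n := by
        rw [← zpow_natCast]; exact zpow_le_zpow_right₀ one_le_two hmn.le
      have h2 := (hn.trans_le (setLIntegral_le_lintegral _ _))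
      rw [← ofReal_toReal hfin, ENNReal.ofReal_lt_ofReal_iff_of_nonneg (by positivity)] at h2
      rw [div_lt_iff₀ hl] at hm
      nlinarith
    obtain ⟨N, hN, hmax⟩ := Int.exists_greatest_of_bdd ⟨b, hb⟩ ⟨n, hn⟩
    refine hxS (mem_biUnion (x := (N, ⌊x / (2 : ℝ) ^ N⌋)) ⟨hN, fun j hj hsub => ?_⟩ (mem_dyadic_floor N x))
    by_contra! hcon
    have : j = (j.1, ⌊x / (2 : ℝ) ^ j.1⌋) := dyadic_eq_of_mem rfl (hsub (mem_dyadic_floor N x)) (mem_dyadic_floor j.1 x)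
    rw [this] at hcon
    exact (hmax _ hcon).not_gt hj

/-- The good part is the mean of f on each selected interval and f elsewhere; averaging does not
increase the mass, and the bad part f - G has mean zero on each interval. -/
lemma exists_good_part {f : ℝ → ℂ} (hf : Integrable f) {l : ℝ} {S : Set (ℤ × ℤ)}
    (hd : S.PairwiseDisjoint dyadic) (hS : ∀ i ∈ S, ∫⁻ y in dyadic i, ‖f y‖ₑ ≤ ofReal (2 * l * 2 ^ i.1))
    (hl : 0 < l) (hoff : ∀ᵐ x, x ∉ (⋃ i ∈ S, dyadic i) → ‖f x‖ ≤ l) :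
    ∃ G : ℝ → ℂ, Integrable G ∧ (∀ᵐ x, ‖G x‖ₑ ≤ ofReal (2 * l)) ∧ ∫⁻ x, ‖G x‖ₑ ≤ ∫⁻ x, ‖f x‖ₑ ∧
      (∀ x, x ∉ (⋃ i ∈ S, dyadic i) → G x = f x) ∧ ∀ i ∈ S, ∫ y in dyadic i, (f y - G y) = 0 := by
  classical
  set O := ⋃ i ∈ S, dyadic i with hO
  set a : ℤ × ℤ → ℂ := fun i => ((2 : ℝ) ^ i.1)⁻¹ • ∫ y in dyadic i, f y with ha
  set G : ℝ → ℂ := fun x => if h : ∃ i ∈ S, x ∈ dyadic i then a h.choose else f x with hG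
  have hGI : ∀ i ∈ S, ∀ x ∈ dyadic i, G x = a i := fun i hi x hx => by
    have h : ∃ i ∈ S, x ∈ dyadic i := ⟨i, hi, hx⟩
    simp only [hG, dif_pos h]
    congr 1
    by_contra hne
    exact Set.disjoint_left.1 (hd h.choose_spec.1 hi hne) h.choose_spec.2 hx
  have hGoff : ∀ x, x ∉ O → G x = f x := fun x hx => by
    simp only [hO, mem_iUnion, exists_prop] at hx
    simp only [hG, dif_neg hx]
  have hOm : MeasurableSet O := MeasurableSet.biUnion (to_countable S) fun i _ => measurableSet_dyadic i
  have hpos : ∀ i : ℤ × ℤ, (0 : ℝ) < 2 ^ i.1 := fun i => by positivity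
  have hae : ∀ i, ‖a i‖ₑ * ofReal (2 ^ i.1) ≤ ∫⁻ y in dyadic i, ‖f y‖ₑ := fun i => by
    simp only [ha]
    rw [enorm_smul, enorm_eq_ofReal (by positivity), mul_right_comm,
      ← ofReal_mul (by positivity), inv_mul_cancel₀ (hpos i).ne', ENNReal.ofReal_one, one_mul]
    exact enorm_integral_le_lintegral_enorm _
  have haI : ∀ i ∈ S, ∫⁻ y in dyadic i, ‖G y‖ₑ ≤ ∫⁻ y in dyadic i, ‖f y‖ₑ := fun i hi => by
    rw [setLIntegral_congr_fun (measurableSet_dyadic i) fun x hx => by rw [hGI i hi x hx], setLIntegral_const, volume_dyadic]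
    exact hae i
  have hm : AEStronglyMeasurable G := by
    rw [← Measure.restrict_univ (μ := volume), ← union_compl_self O, aestronglyMeasurable_union_iff]
    constructor
    · rw [hO, biUnion_eq_iUnion, aestronglyMeasurable_iUnion_iff]
      refine fun i => (aestronglyMeasurable_const (b := a i)).congr ?_
      filter_upwards [ae_restrict_mem (measurableSet_dyadic i)] with x hx using (hGI i i.2 x hx).symm
    · refine hf.1.restrict.congr ?_
      filter_upwards [ae_restrict_mem hOm.compl] with x hx using (hGoff x hx).symm
  have hle : ∫⁻ x, ‖G x‖ₑ ≤ ∫⁻ x, ‖f x‖ₑ := by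
    rw [← lintegral_add_compl _ hOm, ← lintegral_add_compl (fun x => ‖f x‖ₑ) hOm, hO,
      lintegral_biUnion (to_countable S) (fun i _ => measurableSet_dyadic i) hd,
      lintegral_biUnion (to_countable S) (fun i _ => measurableSet_dyadic i) hd]
    refine add_le_add (ENNReal.tsum_le_tsum fun i => haI i i.2)
      (setLIntegral_mono' hOm.compl fun x hx => ?_)
    rw [hGoff x hx]
  have hi : Integrable G := ⟨hm, hle.trans_lt hf.2⟩
  refine ⟨G, hi, ?_, hle, hGoff, fun i hiS => ?_⟩
  · filter_upwards [hoff] with x hx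
    by_cases h : x ∈ O
    · obtain ⟨i, hiS, hxi⟩ := mem_iUnion₂.1 h
      rw [hGI i hiS x hxi]
      have := (hae i).trans (hS i hiS)
      rw [ofReal_mul (by positivity)] at this
      exact (ENNReal.mul_le_mul_iff_left (ENNReal.ofReal_pos.2 (hpos i)).ne' ofReal_ne_top).1 this
    · rw [hGoff x h, ← ofReal_norm]
      exact ofReal_le_ofReal ((hx h).trans (by linarith))
  · rw [integral_sub hf.restrict hi.restrict,
      setIntegral_congr_fun (g := fun _ => a i) (measurableSet_dyadic i) (fun x hx => hGI i hiS x hx),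
      setIntegral_const, Measure.real, volume_dyadic, toReal_ofReal (hpos i).le]
    simp only [ha]
    rw [smul_inv_smul₀ (hpos i).ne', sub_self]

/-! ### Calderón-Zygmund operators: weak type (1,1) and interpolation. -/

/-- Bounded kernels that satisfy a normalized Hörmander condition and a normalized `L²` bound. -/
structure IsCZKernel (K : ℝ → ℝ → ℂ) (M : ℝ) : Prop where
  meas : Measurable (uncurry K)
  bound : ∀ x y, ‖K x y‖ ≤ M
  hormander : ∀ y c, ∫⁻ x in {x | 2 * |y - c| ≤ |x - c|}, ‖K x y - K x c‖ₑ ≤ 1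
  sq_le : ∀ f : ℝ → ℂ, Integrable f → ∫⁻ x, ‖∫ y, K x y * f y‖ₑ ^ 2 ≤ ∫⁻ x, ‖f x‖ₑ ^ 2

lemma IsCZKernel.integrable {K : ℝ → ℝ → ℂ} {M : ℝ} (hK : IsCZKernel K M) {f : ℝ → ℂ} (hf : Integrable f) (x : ℝ) :
    Integrable fun y => K x y * f y := by
  have : Measurable fun y => K x y := hK.meas.comp (f := fun y => (x, y)) (by fun_prop)
  exact hf.bdd_mul this.aestronglyMeasurable (.of_forall fun y => hK.bound x y)

lemma IsCZKernel.aestronglyMeasurable {K : ℝ → ℝ → ℂ} {M : ℝ} (hK : IsCZKernel K M) {f : ℝ → ℂ}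
    (hf : Integrable f) : AEStronglyMeasurable fun x => ∫ y, K x y * f y := by
  have e : (fun x => ∫ y, K x y * f y) = fun x => ∫ y, K x y * hf.1.mk f y := funext fun x => by
    refine integral_congr_ae ?_
    filter_upwards [hf.1.ae_eq_mk] with y hy
    rw [hy]
  rw [e]
  have : StronglyMeasurable fun p : ℝ × ℝ => K p.1 p.2 * hf.1.mk f p.2 :=
    hK.meas.stronglyMeasurable.mul (hf.1.stronglyMeasurable_mk.comp_measurable measurable_snd)
  exact this.integral_prod_right.aestronglyMeasurable

/-- Off the doubled intervals, the image of the bad part is integrable. -/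
lemma IsCZKernel.lintegral_bad_le {K : ℝ → ℝ → ℂ} {M : ℝ} (hK : IsCZKernel K M) {b : ℝ → ℂ} (hb : Integrable b)
    {S : Set (ℤ × ℤ)} (hd : S.PairwiseDisjoint dyadic) (hoff : ∀ x, x ∉ (⋃ i ∈ S, dyadic i) → b x = 0)
    (hmean : ∀ i ∈ S, ∫ y in dyadic i, b y = 0) {E : Set ℝ}
    (hES : ∀ x ∈ E, ∀ i ∈ S, (2 : ℝ) ^ i.1 ≤ |x - (i.2 + 1 / 2) * 2 ^ i.1|) :
    ∫⁻ x in E, ‖∫ y, K x y * b y‖ₑ ≤ ∫⁻ y, ‖b y‖ₑ := by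
  set c : ℤ × ℤ → ℝ := fun i => (i.2 + 1 / 2) * 2 ^ i.1 with hc
  have hOm : MeasurableSet (⋃ i ∈ S, dyadic i) := MeasurableSet.biUnion (to_countable S) fun i _ => measurableSet_dyadic i
  have hd' : Pairwise (Function.onFun Disjoint fun i : S => dyadic i) := fun i j hij =>
    hd i.2 j.2 fun h => hij (Subtype.ext h)
  have hpt : ∀ x, ‖∫ y, K x y * b y‖ₑ ≤ ∑' i : S, ∫⁻ y in dyadic i, ‖K x y - K x (c i)‖ₑ * ‖b y‖ₑ := fun x => by
    have e1 : ∫ y, K x y * b y = ∫ y in ⋃ i : S, dyadic i, K x y * b y := by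
      rw [← biUnion_eq_iUnion S fun i _ => dyadic i, setIntegral_eq_integral_of_forall_compl_eq_zero]
      intro y hy
      rw [hoff y hy, mul_zero]
    rw [e1, integral_iUnion (s := fun i : S => dyadic i) (fun i => measurableSet_dyadic i) hd' (hK.integrable hb x).integrableOn]
    refine enorm_tsum_le_tsum_enorm.trans (ENNReal.tsum_le_tsum fun i => ?_)
    -- Mean zero allows the value of the kernel at the midpoint to be subtracted, which prepares the
    -- Hörmander condition.
    have e2 : ∫ y in dyadic i, K x y * b y = ∫ y in dyadic i, (K x y - K x (c i)) * b y := by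
      simp only [sub_mul]
      rw [integral_sub (hK.integrable hb x).restrict (hb.restrict.const_mul _), integral_const_mul, hmean i i.2, mul_zero, sub_zero]
    rw [e2]
    refine (enorm_integral_le_lintegral_enorm _).trans_eq ?_
    simp only [enorm_mul]
  have hmeas : ∀ i : S, AEMeasurable (uncurry fun x y => ‖K x y - K x (c i)‖ₑ * ‖b y‖ₑ)
      ((volume.restrict E).prod (volume.restrict (dyadic i))) := fun i => by
    have m1 : Measurable fun p : ℝ × ℝ => K p.1 p.2 := hK.meas
    have m2 : Measurable fun p : ℝ × ℝ => K p.1 (c i) := hK.meas.comp (f := fun p : ℝ × ℝ => (p.1, c i)) (by fun_prop)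
    exact (m1.sub m2).enorm.aemeasurable.mul (hb.1.restrict.enorm.comp_snd)
  calc _ ≤ ∫⁻ x in E, ∑' i : S, ∫⁻ y in dyadic i, ‖K x y - K x (c i)‖ₑ * ‖b y‖ₑ := lintegral_mono hpt
    _ = ∑' i : S, ∫⁻ x in E, ∫⁻ y in dyadic i, ‖K x y - K x (c i)‖ₑ * ‖b y‖ₑ := lintegral_tsum fun i => (hmeas i).lintegral_prod_right'
    _ ≤ ∑' i : S, ∫⁻ y in dyadic i, ‖b y‖ₑ := by
        refine ENNReal.tsum_le_tsum fun i => ?_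
        rw [lintegral_lintegral_swap (hmeas i)]
        refine setLIntegral_mono' (measurableSet_dyadic i) fun y hy => ?_
        rw [lintegral_mul_const'' _ (by
          have m1 : Measurable fun x => K x y := hK.meas.comp (f := fun x => (x, y)) (by fun_prop)
          have m2 : Measurable fun x => K x (c i) := hK.meas.comp (f := fun x => (x, c i)) (by fun_prop)
          exact (m1.sub m2).enorm.aemeasurable)]
        refine mul_le_of_le_one_left' ((lintegral_mono_set fun x hx => ?_).trans (hK.hormander y (c i)))
        have h1 : |y - c i| ≤ 2 ^ i.1.1 / 2 := by
          rw [abs_le]; simp only [hc]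
          constructor <;> [linarith [hy.1]; linarith [hy.2]]
        exact (by linarith : 2 * |y - c i| ≤ 2 ^ i.1.1).trans (hES x hx i i.2)
    _ = ∫⁻ y in ⋃ i ∈ S, dyadic i, ‖b y‖ₑ := (lintegral_biUnion (to_countable S) (fun i _ => measurableSet_dyadic i) hd _).symm
    _ ≤ _ := setLIntegral_le_lintegral _ _

/-- The weak type `(1,1)` bound. -/
lemma IsCZKernel.weak_type {K : ℝ → ℝ → ℂ} {M : ℝ} (hK : IsCZKernel K M) {f : ℝ → ℂ} (hf : Integrable f)
    {l : ℝ} (hl : 0 < l) :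
    volume {x | ofReal (2 * l) < ‖∫ y, K x y * f y‖ₑ} ≤ ofReal (6 / l) * ∫⁻ x, ‖f x‖ₑ := by
  obtain ⟨S, hd, hlow, hup, hoff⟩ := exists_stopping_intervals hf hl
  obtain ⟨G, hGi, hGb, hGf, hGoff, hG0⟩ := exists_good_part hf hd hup hl hoff
  have hL0 : ofReal l ≠ 0 := (ENNReal.ofReal_pos.2 hl).ne'
  set N := ∫⁻ x, ‖f x‖ₑ
  set b : ℝ → ℂ := fun x => f x - G x with hb
  have hbi : Integrable b := hf.sub hGi
  -- The doubled intervals; outside them x is far enough from each midpoint for the Hörmander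
  -- condition.
  set D : Set ℝ := ⋃ i ∈ S, ball ((i.2 + 1 / 2) * (2 : ℝ) ^ i.1) (2 ^ i.1) with hD
  have hDm : MeasurableSet D := MeasurableSet.biUnion (to_countable S) fun i _ => measurableSet_ball
  have v1 : volume D ≤ ofReal (2 / l) * N := by
    calc _ ≤ ∑' i : S, volume (ball ((i.1.2 + 1 / 2) * (2 : ℝ) ^ i.1.1) (2 ^ i.1.1)) := measure_biUnion_le _ (to_countable S) _
      _ ≤ ∑' i : S, ofReal (2 / l) * ∫⁻ y in dyadic i, ‖f y‖ₑ := by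
          refine ENNReal.tsum_le_tsum fun i => ?_
          rw [Real.volume_ball]
          refine le_trans (le_of_eq ?_) (mul_le_mul_right (hlow i i.2) _)
          rw [← ofReal_mul (by positivity)]
          congr 1; field_simp
      _ = ofReal (2 / l) * ∫⁻ y in ⋃ i ∈ S, dyadic i, ‖f y‖ₑ := by
          rw [ENNReal.tsum_mul_left, lintegral_biUnion (to_countable S) (fun i _ => measurableSet_dyadic i) hd]
      _ ≤ _ := mul_le_mul_right (setLIntegral_le_lintegral _ _) _
  -- The good part: Chebyshev in L², with |G|² ≤ 2l|G|. This set, the doubled intervals and the bad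
  -- part contribute 2/l each, which makes 6/l.
  have v2 : volume {x | ofReal l ≤ ‖∫ y, K x y * G y‖ₑ} ≤ ofReal (2 / l) * N := by
    have h1 : {x | ofReal l ≤ ‖∫ y, K x y * G y‖ₑ} ⊆ {x | ofReal l ^ 2 ≤ ‖∫ y, K x y * G y‖ₑ ^ 2} := fun x hx => by
        rw [mem_ofPred_eq] at hx ⊢; exact pow_le_pow_left' hx 2
    refine (measure_mono h1).trans ((meas_ge_le_lintegral_div ((hK.aestronglyMeasurable hGi).enorm.pow_const 2)
      (by positivity) (by simp)).trans ?_)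
    have h2 : ∫⁻ x, ‖∫ y, K x y * G y‖ₑ ^ 2 ≤ ofReal (2 * l) * N := by
      refine (hK.sq_le G hGi).trans ?_
      calc _ ≤ ∫⁻ x, ofReal (2 * l) * ‖G x‖ₑ := by
            refine lintegral_mono_ae ?_
            filter_upwards [hGb] with x hx
            rw [sq]; exact mul_le_mul_left hx _
        _ ≤ _ := by rw [lintegral_const_mul' _ _ ofReal_ne_top]; exact mul_le_mul_right hGf _
    refine (ENNReal.div_le_div_right h2 _).trans_eq ?_
    rw [← ofReal_pow hl.le, div_eq_mul_inv, mul_right_comm, ← ENNReal.ofReal_inv_of_pos (by positivity), ← ofReal_mul (by positivity)]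
    congr 2; field_simp
  have v3 : volume ({x | ofReal l ≤ ‖∫ y, K x y * b y‖ₑ} ∩ Dᶜ) ≤ ofReal (2 / l) * N := by
    rw [← Measure.restrict_apply' hDm.compl]
    refine (meas_ge_le_lintegral_div (hK.aestronglyMeasurable hbi).restrict.enorm hL0 (by simp)).trans ?_
    have h1 := hK.lintegral_bad_le hbi hd (fun x hx => by simp only [hb, hGoff x hx, sub_self])
      hG0 (E := Dᶜ) (fun x hx i hi => by
        by_contra! hcon
        exact hx (mem_biUnion hi (by rw [mem_ball, dist_eq]; exact hcon)))
    have h2 : ∫⁻ y, ‖b y‖ₑ ≤ 2 * N := by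
      calc _ ≤ ∫⁻ y, (‖f y‖ₑ + ‖G y‖ₑ) := lintegral_mono fun y => enorm_sub_le
        _ ≤ _ := by rw [lintegral_add_left' hf.1.enorm, two_mul]; exact add_le_add_right hGf _
    refine (ENNReal.div_le_div_right (h1.trans h2) _).trans_eq ?_
    rw [div_eq_mul_inv, mul_right_comm, ← ENNReal.ofReal_inv_of_pos hl, div_eq_mul_inv, ofReal_mul zero_le_two]
    norm_num
  have hsub : {x | ofReal (2 * l) < ‖∫ y, K x y * f y‖ₑ} ⊆
      D ∪ ({x | ofReal l ≤ ‖∫ y, K x y * G y‖ₑ} ∪ ({x | ofReal l ≤ ‖∫ y, K x y * b y‖ₑ} ∩ Dᶜ)) := by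
    intro x hx
    by_contra hcon
    simp only [mem_union, mem_inter_iff, mem_compl_iff, mem_ofPred_eq, not_or, not_and, not_not, not_le] at hcon
    obtain ⟨n1, n2, n3⟩ := hcon
    have n4 : ‖∫ y, K x y * b y‖ₑ < ofReal l := by
      by_contra! h
      exact n1 (n3 h)
    have e : ∫ y, K x y * f y = (∫ y, K x y * G y) + ∫ y, K x y * b y := by
      rw [← integral_add (hK.integrable hGi x) (hK.integrable hbi x)]
      refine integral_congr_ae (.of_forall fun y => ?_)
      simp only [hb]; ring
    have := (enorm_add_le (∫ y, K x y * G y) (∫ y, K x y * b y)).trans_lt (ENNReal.add_lt_add n2 n4)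
    rw [← e, ← ofReal_add hl.le hl.le, ← two_mul] at this
    exact lt_asymm hx this
  refine (measure_mono hsub).trans ((measure_union_le _ _).trans ?_)
  refine (add_le_add v1 ((measure_union_le _ _).trans (add_le_add v2 v3))).trans_eq ?_
  rw [← add_mul, ← add_mul, ← ofReal_add (by positivity) (by positivity), ← ofReal_add (by positivity) (by positivity)]
  congr 2; ring

/-- Level integral for the part of f above height t, to be used in the layer cake formula; p > 1
gives convergence at t = 0. -/
lemma lintegral_rpow_below {p a : ℝ} (hp : 1 < p) (ha : 0 ≤ a) :
    ∫⁻ t in ℝ₊, ofReal (t ^ (p - 2)) * (if t < a then ofReal a else 0) = ofReal (a ^ p / (p - 1)) := by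
  rcases ha.eq_or_lt with rfl | ha'
  · simp [zero_rpow (by linarith : p ≠ 0)]
  have e : ∀ t ∈ ℝ₊, ofReal (t ^ (p - 2)) * (if t < a then ofReal a else 0) =
      (Ioo 0 a).indicator (fun t => ofReal a * ofReal (t ^ (p - 2))) t := fun t (ht : 0 < t) => by
    by_cases h : t < a <;> simp [indicator, h, ht, mul_comm]
  have hI : IntervalIntegrable (fun t : ℝ => t ^ (p - 2)) volume 0 a := intervalIntegral.intervalIntegrable_rpow' (by linarith)
  rw [setLIntegral_congr_fun measurableSet_Ioi e, lintegral_indicator measurableSet_Ioo,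
    Measure.restrict_restrict measurableSet_Ioo, inter_eq_left.2 (fun t ht => ht.1),
    lintegral_const_mul' _ _ ofReal_ne_top, Measure.restrict_congr_set Ioo_ae_eq_Ioc,
    ← ofReal_integral_eq_lintegral_ofReal ((intervalIntegrable_iff_integrableOn_Ioc_of_le ha).1 hI) (by
      filter_upwards [ae_restrict_mem measurableSet_Ioc] with t ht using rpow_nonneg ht.1.le _),
    ← intervalIntegral.integral_of_le ha, integral_rpow (Or.inl (by linarith)), ← ofReal_mul ha,
    zero_rpow (by linarith), show p - 2 + 1 = p - 1 by ring, sub_zero]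
  congr 1
  have : a ^ p = a * a ^ (p - 1) := by rw [← rpow_one_add' ha (by linarith)]; ring_nf
  rw [this]; ring

/-- The counterpart for the part of f below height t; p < 2 gives convergence at infinity. -/
lemma lintegral_rpow_above {p a : ℝ} (hp : 0 < p) (hp' : p < 2) (ha : 0 ≤ a) :
    ∫⁻ t in ℝ₊, ofReal (t ^ (p - 3)) * (if t < a then 0 else ofReal (a ^ 2)) = ofReal (a ^ p / (2 - p)) := by
  rcases ha.eq_or_lt with rfl | ha'
  · simp [zero_rpow hp.ne']
  have e : ∀ t ∈ ℝ₊, ofReal (t ^ (p - 3)) * (if t < a then 0 else ofReal (a ^ 2)) =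
      (Ici a).indicator (fun t => ofReal (a ^ 2) * ofReal (t ^ (p - 3))) t := fun t _ => by
    by_cases h : t < a <;> simp [indicator, h, mul_comm]
  rw [setLIntegral_congr_fun measurableSet_Ioi e, lintegral_indicator measurableSet_Ici,
    Measure.restrict_restrict measurableSet_Ici, inter_eq_left.2 (Ici_subset_Ioi.2 ha'),
    lintegral_const_mul' _ _ ofReal_ne_top, Measure.restrict_congr_set Ioi_ae_eq_Ici.symm,
    ← ofReal_integral_eq_lintegral_ofReal (integrableOn_Ioi_rpow_of_lt (by linarith) ha') (by
      filter_upwards [ae_restrict_mem measurableSet_Ioi] with t (ht : a < t) using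
        rpow_nonneg (ha.trans ht.le) _),
    integral_Ioi_rpow_of_lt (by linarith) ha', ← ofReal_mul (by positivity)]
  congr 1
  have : a ^ p = a ^ 2 * a ^ (p - 2) := by
    rw [← Real.rpow_natCast, ← rpow_add ha']; congr 1; push_cast; ring
  rw [this, show p - 3 + 1 = -(2 - p) by ring, show p - 2 = -(2 - p) by ring, neg_div_neg_eq, mul_div_assoc]

/-- Calderón–Zygmund operators are bounded on `L^p`, `1 < p < 2`. -/
lemma IsCZKernel.lintegral_rpow_le {p : ℝ} (hp1 : 1 < p) (hp2 : p < 2) {K : ℝ → ℝ → ℂ} {M : ℝ}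
    (hK : IsCZKernel K M) {f : ℝ → ℂ} (hf : Integrable f) (hfm : Measurable f) :
    ∫⁻ x, ‖∫ y, K x y * f y‖ₑ ^ p ≤ ofReal (4 ^ p * p * (6 / (p - 1) + 1 / (2 - p))) * ∫⁻ x, ‖f x‖ₑ ^ p := by
  have hp0 : 0 < p := by linarith
  set T : (ℝ → ℂ) → ℝ → ℂ := fun f x => ∫ y, K x y * f y with hT
  set lo : ℝ → ℝ → ℝ≥0∞ := fun t x => if t < ‖f x‖ then ofReal ‖f x‖ else 0 with hlo
  set hi : ℝ → ℝ → ℝ≥0∞ := fun t x => if t < ‖f x‖ then 0 else ofReal (‖f x‖ ^ 2) with hhi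
  have hset : MeasurableSet {z : ℝ × ℝ | z.1 < ‖f z.2‖} := measurableSet_lt measurable_fst (hfm.comp measurable_snd).norm
  have hlom : Measurable (uncurry lo) := Measurable.ite hset (hfm.comp measurable_snd).norm.ennreal_ofReal measurable_const
  have hhim : Measurable (uncurry hi) :=
    Measurable.ite hset measurable_const ((hfm.comp measurable_snd).norm.pow_const 2).ennreal_ofReal
  -- Marcinkiewicz interpolation: f is cut at height t. If |Tf| > 4t, one of the two images has size
  -- at least 2t; the weak type bound treats the large part, the L² bound the small part.
  have dist : ∀ t, 0 < t → volume {x | t < ‖T f x‖ / 4} * ofReal (t ^ (p - 1)) ≤ ofReal 6 * (∫⁻ x, ofReal (t ^ (p - 2)) * lo t x) +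
        ∫⁻ x, ofReal (t ^ (p - 3)) * hi t x := fun t ht => by
    have hA : MeasurableSet {x | t < ‖f x‖} := measurableSet_lt measurable_const hfm.norm
    set f1 := {x | t < ‖f x‖}.indicator f with hf1
    set f2 := {x | t < ‖f x‖}ᶜ.indicator f with hf2
    have i1 : Integrable f1 := hf.indicator hA
    have i2 : Integrable f2 := hf.indicator hA.compl
    have n1 : ∫⁻ x, ‖f1 x‖ₑ = ∫⁻ x, lo t x := lintegral_congr fun x => by
      by_cases h : t < ‖f x‖ <;> simp [hf1, hlo, h]
    have n2 : ∫⁻ x, ‖f2 x‖ₑ ^ 2 = ∫⁻ x, hi t x := lintegral_congr fun x => by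
      by_cases h : t < ‖f x‖
      · simp [hf2, hhi, h]
      · simp [hf2, hhi, h]
    have v1 := hK.weak_type i1 ht
    have v2 : volume {x | ofReal (2 * t) ≤ ‖T f2 x‖ₑ} ≤ ofReal (1 / t ^ 2) * ∫⁻ x, hi t x := by
      have h1 : {x | ofReal (2 * t) ≤ ‖T f2 x‖ₑ} ⊆ {x | ofReal (t ^ 2) ≤ ‖T f2 x‖ₑ ^ 2} := fun x hx => by
          rw [mem_ofPred_eq] at hx ⊢
          rw [ofReal_pow ht.le]
          exact pow_le_pow_left' ((ofReal_le_ofReal (by linarith)).trans hx) 2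
      refine (measure_mono h1).trans ((meas_ge_le_lintegral_div ((hK.aestronglyMeasurable i2).enorm.pow_const 2)
        (by positivity) (by simp)).trans ?_)
      refine (ENNReal.div_le_div_right ((hK.sq_le f2 i2).trans_eq n2) _).trans_eq ?_
      rw [div_eq_mul_inv, mul_comm, ← ENNReal.ofReal_inv_of_pos (by positivity), one_div]
    have hsub : {x | t < ‖T f x‖ / 4} ⊆ {x | ofReal (2 * t) < ‖T f1 x‖ₑ} ∪
        {x | ofReal (2 * t) ≤ ‖T f2 x‖ₑ} := fun x hx => by
      by_contra hcon
      simp only [mem_union, mem_ofPred_eq, not_or, not_lt, not_le] at hcon hx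
      have e : T f x = T f1 x + T f2 x := by
        simp only [hT]
        rw [← integral_add (hK.integrable i1 x) (hK.integrable i2 x)]
        refine integral_congr_ae (.of_forall fun y => ?_)
        simp only [hf1, hf2, ← mul_add, indicator_self_add_compl_apply]
      obtain ⟨c1, c2⟩ := hcon
      rw [← ofReal_norm, ofReal_le_ofReal_iff (by positivity)] at c1
      rw [← ofReal_norm, ENNReal.ofReal_lt_ofReal_iff (by positivity)] at c2
      have := norm_add_le (T f1 x) (T f2 x)
      rw [← e] at this
      linarith
    have v := (measure_mono hsub).trans ((measure_union_le _ _).trans (add_le_add v1 v2))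
    refine (mul_le_mul_left v _).trans_eq ?_
    rw [n1, add_mul, lintegral_const_mul' _ _ ofReal_ne_top, lintegral_const_mul' _ _ ofReal_ne_top,
      mul_right_comm, mul_right_comm (ofReal (1 / t ^ 2)), ← ofReal_mul (by positivity),
      ← ofReal_mul (by positivity), ← mul_assoc, ← ofReal_mul (by norm_num)]
    have e1 : 6 / t * t ^ (p - 1) = 6 * t ^ (p - 2) := by
      rw [show p - 1 = (p - 2) + 1 by ring, rpow_add_one ht.ne']; field_simp
    have e2 : 1 / t ^ 2 * t ^ (p - 1) = t ^ (p - 3) := by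
      rw [show p - 1 = (p - 3) + (2 : ℕ) by push_cast; ring, Real.rpow_add_natCast ht.ne']; field_simp
    rw [e1, e2]
  have hw : ∀ a : ℝ, Measurable fun z : ℝ × ℝ => ofReal (z.1 ^ a) := fun a => by
    have : Measurable fun z : ℝ × ℝ => z.1 ^ a := by fun_prop
    exact this.ennreal_ofReal
  have ml : Measurable (uncurry fun t x => ofReal (t ^ (p - 2)) * lo t x) := (hw _).mul hlom
  have mh : Measurable (uncurry fun t x => ofReal (t ^ (p - 3)) * hi t x) := (hw _).mul hhim
  have hsp : ∀ (F : ℝ → ℂ) x, ofReal (‖F x‖ ^ p) = ‖F x‖ₑ ^ p := fun F x => by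
    rw [← ofReal_rpow_of_nonneg (norm_nonneg _) hp0.le, ofReal_norm]
  have s1 : ∫⁻ t in ℝ₊, ∫⁻ x, ofReal (t ^ (p - 2)) * lo t x = ofReal (1 / (p - 1)) * ∫⁻ x, ‖f x‖ₑ ^ p := by
    rw [lintegral_lintegral_swap ml.aemeasurable, ← lintegral_const_mul' _ _ ofReal_ne_top]
    refine lintegral_congr fun x => ?_
    simp only [hlo]
    rw [lintegral_rpow_below hp1 (norm_nonneg _), div_eq_mul_one_div, mul_comm, ofReal_mul (one_div_nonneg.2 (by linarith)), hsp]
  have s2 : ∫⁻ t in ℝ₊, ∫⁻ x, ofReal (t ^ (p - 3)) * hi t x = ofReal (1 / (2 - p)) * ∫⁻ x, ‖f x‖ₑ ^ p := by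
    rw [lintegral_lintegral_swap mh.aemeasurable, ← lintegral_const_mul' _ _ ofReal_ne_top]
    refine lintegral_congr fun x => ?_
    simp only [hhi]
    rw [lintegral_rpow_above hp0 hp2 (norm_nonneg _), div_eq_mul_one_div, mul_comm, ofReal_mul (one_div_nonneg.2 (by linarith)), hsp]
  have hlc := lintegral_rpow_eq_lintegral_meas_lt_mul volume (f := fun x => ‖T f x‖ / 4)
    (.of_forall fun x => by positivity) ((hK.aestronglyMeasurable hf).norm.aemeasurable.div_const 4) hp0
  calc ∫⁻ x, ‖T f x‖ₑ ^ p = ofReal (4 ^ p) * ∫⁻ x, ofReal ((‖T f x‖ / 4) ^ p) := by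
        rw [← lintegral_const_mul' _ _ ofReal_ne_top]
        refine lintegral_congr fun x => ?_
        rw [← ofReal_mul (by positivity), ← mul_rpow (by norm_num) (by positivity), mul_div_cancel₀ _ (by norm_num), hsp]
    _ ≤ ofReal (4 ^ p) * (ofReal p * (ofReal 6 * (ofReal (1 / (p - 1)) * ∫⁻ x, ‖f x‖ₑ ^ p) + ofReal (1 / (2 - p)) * ∫⁻ x, ‖f x‖ₑ ^ p)) := by
        have mh' : Measurable fun t => ∫⁻ x, ofReal (t ^ (p - 3)) * hi t x := mh.lintegral_prod_right'
        rw [hlc, ← s1, ← s2, ← lintegral_const_mul' (ofReal 6) _ ofReal_ne_top, ← lintegral_add_right _ mh']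
        exact mul_le_mul_right (mul_le_mul_right (setLIntegral_mono' measurableSet_Ioi fun t ht => dist t ht) _) _
    _ = _ := by
        have q1 : 0 ≤ 1 / (p - 1) := one_div_nonneg.2 (by linarith)
        have q2 : 0 ≤ 1 / (2 - p) := one_div_nonneg.2 (by linarith)
        rw [← mul_assoc (ofReal 6), ← add_mul, ← mul_assoc, ← mul_assoc, ← ofReal_mul (by norm_num : (0 : ℝ) ≤ 6),
          ← ofReal_add (by positivity) q2, ← ofReal_mul (by positivity : (0 : ℝ) ≤ 4 ^ p),
          ← ofReal_mul (by positivity : (0 : ℝ) ≤ 4 ^ p * p)]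
        congr 2; ring

/-! ### Duality between L^p norms and pairings with Schwartz functions. -/

lemma exists_schwartz_approx {w : ℝ → ℂ} (hw : AEStronglyMeasurable w) {B R : ℝ} (hB : ∀ x, ‖w x‖ ≤ B)
    (hR : ∀ x, R < |x| → w x = 0) : ∃ φ : ℕ → 𝒮, (∀ n x, ‖φ n x‖ ≤ B) ∧
      (∀ n x, R + 1 < |x| → φ n x = 0) ∧ ∀ᵐ x, Tendsto (fun n => φ n x) atTop (𝓝 (w x)) := by
  have hB0 : 0 ≤ B := (norm_nonneg _).trans (hB 0)
  have hwi : Integrable w := by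
    rw [← integrableOn_iff_integrable_of_support_subset (s := Icc (-R) R)]
    · exact Measure.integrableOn_of_bounded (M := B) (by simp) hw (.of_forall hB)
    · intro x hx
      by_contra h
      exact hx (hR x (not_le.1 fun h' => h (abs_le.1 h')))
  -- Bumps of radius at most one: the mollified functions inherit the bound B and vanish for |x| > R
  -- + 1, so dominated convergence applies to them.
  set b : ℕ → ContDiffBump (0 : ℝ) := fun n => ⟨1 / (n + 1) / 2, 1 / (n + 1), by positivity, by
    have : (0 : ℝ) < 1 / (n + 1) := by positivity
    linarith⟩ with hb
  set F : ℕ → ℝ → ℂ := fun n => convolution ((b n).normed volume) w (ContinuousLinearMap.lsmul ℝ ℝ) volume with hF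
  have hout : ∀ n, (b n).rOut ≤ 1 := fun n => by
    simp only [hb]; rw [div_le_one (by positivity)]; linarith [(Nat.cast_nonneg n : (0 : ℝ) ≤ n)]
  have hsm : ∀ n, ContDiff ℝ (⊤ : ℕ∞) (F n) := fun n =>
    (b n).hasCompactSupport_normed.contDiff_convolution_left _ (b n).contDiff_normed hwi.locallyIntegrable
  have hzero : ∀ n x, R + 1 < |x| → F n x = 0 := fun n x hx => by
    refine integral_eq_zero_of_ae (.of_forall fun t => ?_)
    by_cases ht : t ∈ ball (0 : ℝ) (b n).rOut
    · have h1 : |t| < 1 := by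
        rw [mem_ball, dist_zero_right, norm_eq_abs] at ht
        exact ht.trans_le (hout n)
      have h2 : w (x - t) = 0 := hR _ (by linarith [abs_sub_abs_le_abs_sub x t])
      simp [h2]
    · rw [← (b n).support_normed_eq (μ := volume), Function.notMem_support] at ht
      simp [ht]
  have hcs : ∀ n, HasCompactSupport (F n) := fun n =>
    HasCompactSupport.intro (isCompact_Icc (a := -(R + 1)) (b := R + 1)) fun x hx =>
      hzero n x (not_le.1 fun h' => hx (abs_le.1 h'))
  refine ⟨fun n => (hcs n).toSchwartzMap (hsm n), fun n x => ?_, hzero, ?_⟩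
  · change ‖F n x‖ ≤ B
    have hi : Integrable fun t => (b n).normed volume t * B :=
      ((b n).continuous_normed.integrable_of_hasCompactSupport (b n).hasCompactSupport_normed).mul_const _
    refine (norm_integral_le_of_norm_le hi (.of_forall fun t => ?_)).trans_eq ?_
    · simp only [ContinuousLinearMap.lsmul_apply, norm_smul, norm_of_nonneg ((b n).nonneg_normed t)]
      exact mul_le_mul_of_nonneg_left (hB _) ((b n).nonneg_normed t)
    · rw [integral_mul_const, (b n).integral_normed, one_mul]
  · refine ContDiffBump.ae_convolution_tendsto_right_of_locallyIntegrable (K := 2) ?_ ?_ hwi.locallyIntegrable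
    · exact tendsto_one_div_add_atTop_nhds_zero_nat
    · exact .of_forall fun n => by simp only [hb]; linarith

/-- The `L^p` norm of a locally integrable function is determined by its action on Schwartz functions. -/
lemma lintegral_rpow_le_of_pairing {p q : ℝ} (hpq : p.HolderConjugate q) {v : ℝ → ℂ} (hv : LocallyIntegrable v)
    {M : ℝ≥0∞} (hM : M ≠ ∞)
    (h : ∀ φ : 𝒮, ‖∫ x, v x * φ x‖ₑ ≤ M * (∫⁻ x, ‖φ x‖ₑ ^ q) ^ (1 / q)) :
    (∫⁻ x, ‖v x‖ₑ ^ p) ^ (1 / p) ≤ M := by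
  have hp : 0 < p := hpq.pos
  have hq : 0 < q := hpq.symm.pos
  set v' := hv.aestronglyMeasurable.mk v with hv'
  have hve : v =ᵐ[volume] v' := hv.aestronglyMeasurable.ae_eq_mk
  have hvm : Measurable v' := hv.aestronglyMeasurable.stronglyMeasurable_mk.measurable
  have hvl : LocallyIntegrable v' := (locallyIntegrable_congr hve).1 hv
  have h' : ∀ φ : 𝒮, ‖∫ x, v' x * φ x‖ₑ ≤ M * (∫⁻ x, ‖φ x‖ₑ ^ q) ^ (1 / q) := fun φ => by
    rw [← integral_congr_ae (f := fun x => v x * φ x) (by filter_upwards [hve] with x hx; rw [hx])]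
    exact h φ
  rw [lintegral_congr_ae (g := fun x => ‖v' x‖ₑ ^ p) (by filter_upwards [hve] with x hx; rw [hx])]
  -- On these sets the function is bounded and the domain too, so all integrals are finite although
  -- membership in L^p is not yet known.
  set E : ℕ → Set ℝ := fun n => {x | |x| ≤ n ∧ ‖v' x‖ ≤ n} with hE
  have hEm : ∀ n, MeasurableSet (E n) := fun n =>
    (measurableSet_le continuous_abs.measurable measurable_const).inter
      (measurableSet_le hvm.norm measurable_const)
  have hmono : Monotone E := fun a b hab x hx =>
    ⟨hx.1.trans (by exact_mod_cast hab), hx.2.trans (by exact_mod_cast hab)⟩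
  have hU : ⋃ n, E n = univ := by
    refine eq_univ_of_forall fun x => mem_iUnion.2 ?_
    obtain ⟨n, hn⟩ := exists_nat_ge (max |x| ‖v' x‖)
    exact ⟨n, (le_max_left _ _).trans hn, (le_max_right _ _).trans hn⟩
  have key : ∀ n, (∫⁻ x in E n, ‖v' x‖ₑ ^ p) ^ (1 / p) ≤ M := fun n => by
    -- The extremal dual function |v|^(p-2) times the conjugate of v: on the truncation set both v w
    -- and |w|^q equal |v|^p.
    set w : ℝ → ℂ := (E n).indicator fun x => ((‖v' x‖ ^ (p - 2) : ℝ) : ℂ) * (starRingEnd ℂ) (v' x) with hw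
    have hwm : Measurable w := by
      refine Measurable.indicator ?_ (hEm n)
      have m1 : Measurable fun x => ‖v' x‖ ^ (p - 2) := hvm.norm.pow_const _
      exact (Complex.measurable_ofReal.comp m1).mul (Complex.continuous_conj.measurable.comp hvm)
    have hnorm : ∀ x ∈ E n, ‖w x‖ = ‖v' x‖ ^ (p - 1) := fun x hx => by
      rw [hw, indicator_of_mem hx, norm_mul, norm_real, norm_of_nonneg (by positivity), RCLike.norm_conj]
      rcases (norm_nonneg (v' x)).eq_or_lt with h0 | h0
      · rw [← h0, mul_zero, zero_rpow (by linarith [hpq.lt])]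
      · rw [← rpow_add_one h0.ne']; congr 1; ring
    have hB : ∀ x, ‖w x‖ ≤ (n : ℝ) ^ (p - 1) := fun x => by
      by_cases hx : x ∈ E n
      · rw [hnorm x hx]; exact rpow_le_rpow (norm_nonneg _) hx.2 (by linarith [hpq.lt])
      · rw [hw, indicator_of_notMem hx, norm_zero]; positivity
    have hR : ∀ x, (n : ℝ) < |x| → w x = 0 := fun x hx => indicator_of_notMem (fun h => hx.not_ge h.1) _
    obtain ⟨φ, f1, f2, f3⟩ := exists_schwartz_approx hwm.aestronglyMeasurable hB hR
    have t1 : Tendsto (fun k => ‖∫ x, v' x * φ k x‖ₑ) atTop (𝓝 ‖∫ x, v' x * w x‖ₑ) := by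
      refine (tendsto_integral_of_dominated_convergence (F := fun k x => v' x * φ k x)
        (fun x => (Icc (-(n + 1 : ℝ)) (n + 1)).indicator (fun x => ‖v' x‖ * (n : ℝ) ^ (p - 1)) x)
        (fun k => hvm.aestronglyMeasurable.mul (φ k).continuous.aestronglyMeasurable) ?_ (fun k => ?_) ?_).enorm
      · rw [integrable_indicator_iff measurableSet_Icc]
        exact (hvl.integrableOn_isCompact isCompact_Icc).norm.mul_const _
      · refine .of_forall fun x => ?_
        by_cases hx : x ∈ Icc (-(n + 1 : ℝ)) (n + 1)
        · rw [indicator_of_mem hx, norm_mul]; gcongr; exact f1 k x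
        · rw [indicator_of_notMem hx, f2 k x (not_le.1 fun h' => hx (abs_le.1 h')), mul_zero, norm_zero]
      · filter_upwards [f3] with x hx using hx.const_mul _
    have t2 : Tendsto (fun k => ∫⁻ x, ‖φ k x‖ₑ ^ q) atTop (𝓝 (∫⁻ x, ‖w x‖ₑ ^ q)) := by
      refine tendsto_lintegral_of_dominated_convergence
        (fun x => (Icc (-(n + 1 : ℝ)) (n + 1)).indicator (fun _ => ofReal ((n : ℝ) ^ (p - 1)) ^ q) x)
        (fun k => (φ k).continuous.measurable.enorm.pow_const q) (fun k => ?_) ?_ ?_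
      · refine .of_forall fun x => ?_
        beta_reduce
        by_cases hx : x ∈ Icc (-(n + 1 : ℝ)) (n + 1)
        · rw [indicator_of_mem hx, ← ofReal_norm]
          exact ENNReal.rpow_le_rpow (ofReal_le_ofReal (f1 k x)) hq.le
        · rw [indicator_of_notMem hx, f2 k x (not_le.1 fun h' => hx (abs_le.1 h')), enorm_zero, ENNReal.zero_rpow_of_pos hq]
      · rw [lintegral_indicator measurableSet_Icc, setLIntegral_const]
        exact mul_ne_top (ENNReal.rpow_ne_top_of_nonneg hq.le ofReal_ne_top) (by simp)
      · filter_upwards [f3] with x hx using (ENNReal.continuous_rpow_const.tendsto _).comp hx.enorm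
    set I := ∫⁻ x in E n, ‖v' x‖ₑ ^ p with hI
    have hIw : ∫⁻ x, ‖w x‖ₑ ^ q = I := by
      rw [hI, ← lintegral_indicator (hEm n)]
      refine lintegral_congr fun x => ?_
      by_cases hx : x ∈ E n
      · rw [indicator_of_mem hx, ← ofReal_norm, hnorm x hx, ← ofReal_norm,
          ofReal_rpow_of_nonneg (by positivity) hq.le, ofReal_rpow_of_nonneg (by positivity) hp.le,
          ← rpow_mul (norm_nonneg _), hpq.sub_one_mul_conj]
      · rw [indicator_of_notMem hx, hw, indicator_of_notMem hx, enorm_zero, ENNReal.zero_rpow_of_pos hq]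
    have hle : ∀ x ∈ E n, ‖v' x‖ ^ p ≤ (n : ℝ) ^ p := fun x hx => rpow_le_rpow (norm_nonneg _) hx.2 hp.le
    have hvE : volume (E n) < ∞ := by
      have hsub : E n ⊆ Icc (-(n : ℝ)) n := fun x hx => abs_le.1 hx.1
      exact (measure_mono hsub).trans_lt (by simp)
    have hIv : ‖∫ x, v' x * w x‖ₑ = I := by
      have e1 : ∫ x, v' x * w x = ((∫ x in E n, ‖v' x‖ ^ p : ℝ) : ℂ) := by
        rw [← integral_complex_ofReal, ← integral_indicator (hEm n)]
        refine integral_congr_ae (.of_forall fun x => ?_)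
        by_cases hx : x ∈ E n
        · simp only [hw, indicator_of_mem hx]
          rw [mul_left_comm, Complex.mul_conj, Complex.normSq_eq_norm_sq, ← Complex.ofReal_mul]
          congr 1
          rcases (norm_nonneg (v' x)).eq_or_lt with h0 | h0
          · rw [← h0, zero_rpow hp.ne']; simp
          · rw [← Real.rpow_natCast, ← rpow_add h0]; congr 1; push_cast; ring
        · simp only [hw, indicator_of_notMem hx, mul_zero]
      have hint : IntegrableOn (fun x => ‖v' x‖ ^ p) (E n) :=
        Measure.integrableOn_of_bounded (M := (n : ℝ) ^ p) hvE.ne (hvm.norm.pow_const p).aestronglyMeasurable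
          (by filter_upwards [ae_restrict_mem (hEm n)] with x hx
              rw [norm_of_nonneg (by positivity)]; exact hle x hx)
      rw [e1, ← ofReal_norm, norm_real, norm_of_nonneg (integral_nonneg fun x => by positivity),
        ofReal_integral_eq_lintegral_ofReal hint (.of_forall fun x => by positivity)]
      exact lintegral_congr fun x => by rw [← ofReal_rpow_of_nonneg (norm_nonneg _) hp.le, ofReal_norm]
    have hItop : I ≠ ∞ := by
      refine ne_top_of_le_ne_top (mul_ne_top (ofReal_ne_top (r := (n : ℝ) ^ p)) hvE.ne) ?_
      rw [← setLIntegral_const]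
      refine setLIntegral_mono' (hEm n) fun x hx => ?_
      rw [← ofReal_norm, ofReal_rpow_of_nonneg (norm_nonneg _) hp.le]
      exact ofReal_le_ofReal (hle x hx)
    have fin := le_of_tendsto_of_tendsto' t1 (ENNReal.Tendsto.const_mul
      ((ENNReal.continuous_rpow_const (y := 1 / q)).tendsto _ |>.comp t2) (Or.inr hM)) fun k => h' (φ k)
    rw [hIv, hIw] at fin
    by_cases hI0 : I = 0
    · rw [hI0, ENNReal.zero_rpow_of_pos (by positivity)]; exact zero_le
    have e2 : I = I ^ (1 / p) * I ^ (1 / q) := by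
      rw [← ENNReal.rpow_add _ _ hI0 hItop, one_div, one_div, hpq.inv_add_inv_eq_one, ENNReal.rpow_one]
    have hpos : I ^ (1 / q) ≠ 0 := by
      rw [Ne, ENNReal.rpow_eq_zero_iff]; push Not; exact ⟨fun h => (hI0 h).elim, fun h => (hItop h).elim⟩
    have fin2 : I ^ (1 / p) * I ^ (1 / q) ≤ M * I ^ (1 / q) := by
      rw [← e2]; exact fin
    exact (ENNReal.mul_le_mul_iff_left hpos (ENNReal.rpow_ne_top_of_nonneg (by positivity) hItop)).1 fin2
  have hlim : ∫⁻ x, ‖v' x‖ₑ ^ p = ⨆ n, ∫⁻ x in E n, ‖v' x‖ₑ ^ p := by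
    rw [← setLIntegral_univ, ← hU, setLIntegral_iUnion_of_directed _ hmono.directed_le]
  have hM' : ∀ n, ∫⁻ x in E n, ‖v' x‖ₑ ^ p ≤ M ^ p := fun n => by
    have := ENNReal.rpow_le_rpow (key n) hp.le
    rwa [← ENNReal.rpow_mul, one_div_mul_cancel hp.ne', ENNReal.rpow_one] at this
  calc _ ≤ (M ^ p) ^ (1 / p) := ENNReal.rpow_le_rpow (hlim ▸ iSup_le hM') (by positivity)
    _ = M := by rw [← ENNReal.rpow_mul, mul_one_div_cancel hp.ne', ENNReal.rpow_one]

/-! ### Size and smoothness of the truncated kernels; the Hörmander condition. -/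

/-- The truncated convolution kernel `∫_a^b r^{-1-α/2} hk r z dr` of `D^α`. -/
noncomputable def truncKernel (α a b z : ℝ) : ℝ := ∫ r in Icc a b, r ^ (-(1 + α / 2)) * hk r z

lemma continuousOn_hk_time (z : ℝ) : ContinuousOn (fun r => hk r z) (Ioi 0) := by
  unfold hk
  refine ContinuousOn.mul (ContinuousOn.inv₀ (by fun_prop) fun r (hr : 0 < r) => by positivity) ?_
  exact (continuousOn_const.div (by fun_prop) fun r (hr : 0 < r) => by positivity).neg.rexp

lemma integrableOn_rpow_mul_hk {a b : ℝ} (ha : 0 < a) (γ z : ℝ) : IntegrableOn (fun r => r ^ (-γ) * hk r z) (Icc a b) := by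
  refine ContinuousOn.integrableOn_Icc (ContinuousOn.mul ?_ ?_)
  · exact ContinuousOn.rpow_const continuousOn_id fun r hr => Or.inl (ha.trans_le hr.1).ne'
  · exact (continuousOn_hk_time z).mono fun r hr => ha.trans_le hr.1

lemma integral_rpow_mul_hk_le {γ : ℝ} (hγ : 1 < γ) {a b : ℝ} (ha : 0 < a) {z : ℝ} (hz : z ≠ 0) :
    ∫ r in Icc a b, r ^ (-γ) * hk r z ≤ |z| ^ (1 - 2 * γ) * (hkPowConst γ).toReal := by
  have hpos : ∀ r ∈ Icc a b, 0 ≤ r ^ (-γ) * hk r z := fun r hr =>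
    mul_nonneg (rpow_nonneg (ha.le.trans hr.1) _) (hk_nonneg _ _)
  rw [integral_eq_lintegral_of_nonneg_ae (by filter_upwards [ae_restrict_mem measurableSet_Icc] with r hr using hpos r hr)
    (integrableOn_rpow_mul_hk ha γ z).1]
  refine ENNReal.toReal_le_of_le_ofReal (by positivity) ?_
  rw [ofReal_mul (by positivity), ofReal_toReal (hkPowConst_ne_top hγ), ← lintegral_hk_rpow γ hz]
  exact lintegral_mono_set fun r hr => ha.trans_le hr.1

/-- Every point ζ between z and z' satisfies |ζ| ≥ |z|/2. The argument z/3 covers this loss and the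
doubled time of the derivative bound, since ζ²/8 ≥ z²/32 ≥ z²/36. -/
lemma abs_hk_sub_le {r : ℝ} (hr : 0 < r) {z z' : ℝ} (h : 2 * |z - z'| ≤ |z|) :
    |hk r z' - hk r z| ≤ |z - z'| * (3 * (r ^ (-(1 / 2) : ℝ) * hk r (z / 3))) := by
  have hbd : ∀ ζ ∈ uIcc z z', ‖hk1 r ζ‖ ≤ 3 * (r ^ (-(1 / 2) : ℝ) * hk r (z / 3)) := fun ζ hζ => by
    rw [norm_eq_abs, rpow_neg hr.le, ← sqrt_eq_rpow, ← mul_assoc]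
    refine (abs_hk1_le hr ζ).trans (mul_le_mul_of_nonneg_left ?_ (by positivity))
    have h1 : |ζ - z| ≤ |z' - z| := Set.abs_sub_left_of_mem_uIcc hζ
    have h2 : |z| / 2 ≤ |ζ| := by
      rw [abs_sub_comm z'] at h1
      linarith [abs_sub_abs_le_abs_sub z ζ, abs_sub_comm z ζ]
    have h3 : z ^ 2 ≤ 4 * ζ ^ 2 := by
      rw [← sq_abs z, ← sq_abs ζ]; nlinarith [abs_nonneg z]
    unfold hk
    refine mul_le_mul (inv_anti₀ (by positivity) (sqrt_le_sqrt (by nlinarith [Real.pi_pos])))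
      (exp_le_exp.2 (neg_le_neg ?_)) (by positivity) (by positivity)
    rw [div_le_div_iff₀ (by positivity) (by positivity)]
    nlinarith [mul_nonneg hr.le (sq_nonneg z)]
  have := (convex_uIcc z z').norm_image_sub_le_of_norm_hasDerivWithin_le
    (fun ζ _ => (hasDerivAt_hk hr ζ).hasDerivWithinAt) hbd left_mem_uIcc right_mem_uIcc
  rw [norm_eq_abs, norm_eq_abs, abs_sub_comm z'] at this
  linarith

/-- A space derivative costs r^(-1/2), which raises the exponent of r to 1 + α/2 + 1/2 and hence the
decay to |z|^(-2-α), uniformly in the truncation. -/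
lemma abs_truncKernel_sub_le {α a b : ℝ} (h0 : 0 < α) (ha : 0 < a) {z z' : ℝ} (hz : z ≠ 0)
    (h : 2 * |z - z'| ≤ |z|) : |truncKernel α a b z' - truncKernel α a b z| ≤
      (3 * 3 ^ (2 + α) * (hkPowConst (1 + α / 2 + 1 / 2)).toReal) * (|z - z'| * |z| ^ (-(2 + α))) := by
  rw [truncKernel, truncKernel, ← integral_sub (integrableOn_rpow_mul_hk ha _ _) (integrableOn_rpow_mul_hk ha _ _), ← norm_eq_abs]
  have hi := (integrableOn_rpow_mul_hk (b := b) ha (1 + α / 2 + 1 / 2) (z / 3)).const_mul (3 * |z - z'|)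
  calc _ ≤ ∫ r in Icc a b, (3 * |z - z'|) * (r ^ (-(1 + α / 2 + 1 / 2)) * hk r (z / 3)) := by
        refine norm_integral_le_of_norm_le hi ?_
        filter_upwards [ae_restrict_mem measurableSet_Icc] with r hr
        have hr0 : 0 < r := ha.trans_le hr.1
        rw [← mul_sub, norm_mul, norm_of_nonneg (by positivity), norm_eq_abs,
          show -(1 + α / 2 + 1 / 2) = -(1 + α / 2) + -(1 / 2) by ring, rpow_add hr0]
        calc _ ≤ r ^ (-(1 + α / 2)) * (|z - z'| * (3 * (r ^ (-(1 / 2) : ℝ) * hk r (z / 3)))) := by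
              gcongr; exact abs_hk_sub_le hr0 h
          _ = _ := by ring
    _ ≤ (3 * |z - z'|) * (|z / 3| ^ (1 - 2 * (1 + α / 2 + 1 / 2)) * (hkPowConst (1 + α / 2 + 1 / 2)).toReal) := by
        rw [integral_const_mul]
        exact mul_le_mul_of_nonneg_left (integral_rpow_mul_hk_le (by linarith) ha (by simpa using hz)) (by positivity)
    _ = _ := by
        rw [show 1 - 2 * (1 + α / 2 + 1 / 2) = -(2 + α) by ring, abs_div, div_rpow (abs_nonneg _) (abs_nonneg _),
          abs_of_pos (by norm_num : (0 : ℝ) < 3), rpow_neg (by norm_num : (0 : ℝ) ≤ 3), div_inv_eq_mul]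
        ring

lemma truncKernel_nonneg {α a b : ℝ} (ha : 0 < a) (z : ℝ) : 0 ≤ truncKernel α a b z :=
  setIntegral_nonneg measurableSet_Icc fun _ hr => mul_nonneg (rpow_nonneg (ha.le.trans hr.1) _) (hk_nonneg _ _)

lemma truncKernel_decay (α : ℝ) {a b : ℝ} (ha : 0 < a) (k : ℕ) : ∃ C : ℝ, 0 ≤ C ∧ ∀ z, truncKernel α a b z ≤ C * ((1 + |z|) ^ k)⁻¹ := by
  obtain ⟨C, hC, h⟩ := hk_le_of_mem k (a := a) (b := b) ha
  have hi : IntegrableOn (fun r : ℝ => r ^ (-(1 + α / 2))) (Icc a b) :=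
    (ContinuousOn.rpow_const continuousOn_id fun _ hr => Or.inl (ha.trans_le hr.1).ne').integrableOn_Icc
  refine ⟨(∫ r in Icc a b, r ^ (-(1 + α / 2))) * C, mul_nonneg (setIntegral_nonneg measurableSet_Icc fun _ hr =>
    rpow_nonneg (ha.le.trans hr.1) _) hC, fun z => ?_⟩
  rw [mul_assoc, ← integral_mul_const]
  refine setIntegral_mono_on (integrableOn_rpow_mul_hk ha _ z) (hi.mul_const _) measurableSet_Icc fun r hr => ?_
  exact mul_le_mul_of_nonneg_left (h r hr z) (rpow_nonneg (ha.le.trans hr.1) _)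

lemma measurable_truncKernel (α a b : ℝ) : Measurable (truncKernel α a b) := by
  have h : Measurable fun p : ℝ × ℝ => p.2 ^ (-(1 + α / 2)) * hk p.2 p.1 := by
    have := measurable_hk_prod.comp (f := fun p : ℝ × ℝ => (p.2, p.1)) (by fun_prop)
    exact Measurable.mul (by fun_prop) this
  exact (h.stronglyMeasurable.integral_prod_right (ν := volume.restrict (Icc a b))).measurable

lemma lintegral_rpow_abs_ge_le {γ : ℝ} (hγ : 0 < γ) (c : ℝ) {R : ℝ} (hR : 0 < R) :
    ∫⁻ x in {x | R ≤ |x - c|}, ofReal (|x - c| ^ (-(1 + γ))) ≤ ofReal (2 / γ * R ^ (-γ)) := by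
  have half : ∫⁻ x in Ici R, ofReal (|x| ^ (-(1 + γ))) = ofReal (1 / γ * R ^ (-γ)) := by
    rw [setLIntegral_congr_fun (g := fun x => ofReal (x ^ (-(1 + γ)))) measurableSet_Ici
      (fun x (hx : R ≤ x) => by rw [abs_of_pos (hR.trans_le hx)]), Measure.restrict_congr_set Ioi_ae_eq_Ici.symm,
      ← ofReal_integral_eq_lintegral_ofReal (integrableOn_Ioi_rpow_of_lt (by linarith) hR) (by
        filter_upwards [ae_restrict_mem measurableSet_Ioi] with t (ht : R < t) using
          rpow_nonneg (hR.trans ht).le _), integral_Ioi_rpow_of_lt (by linarith) hR]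
    congr 1
    rw [show -(1 + γ) + 1 = -γ by ring, neg_div_neg_eq]; ring
  have neg : ∫⁻ x in Iic (-R), ofReal (|x| ^ (-(1 + γ))) = ∫⁻ x in Ici R, ofReal (|x| ^ (-(1 + γ))) := by
    rw [← lintegral_indicator measurableSet_Iic, ← lintegral_indicator measurableSet_Ici, ← lintegral_neg_eq_self]
    refine lintegral_congr fun x => ?_
    simp only [indicator, mem_Iic, mem_Ici, neg_le_neg_iff, abs_neg]
  have hm : MeasurableSet {x : ℝ | R ≤ |x|} := measurableSet_le measurable_const continuous_abs.measurable
  have tr : ∫⁻ x in {x | R ≤ |x - c|}, ofReal (|x - c| ^ (-(1 + γ))) = ∫⁻ x in {x | R ≤ |x|}, ofReal (|x| ^ (-(1 + γ))) := by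
    have hm' : MeasurableSet {x : ℝ | R ≤ |x - c|} := measurableSet_le measurable_const (by fun_prop)
    rw [← lintegral_indicator hm, ← lintegral_indicator hm']
    exact lintegral_sub_right_eq_self ({x | R ≤ |x|}.indicator fun x => ofReal (|x| ^ (-(1 + γ)))) c
  have hsub : {x : ℝ | R ≤ |x|} ⊆ Ici R ∪ Iic (-R) := fun x (hx : R ≤ |x|) => by
    rcases le_abs.1 hx with h | h
    · exact Or.inl h
    · exact Or.inr (by rw [mem_Iic]; linarith)
  rw [tr]
  refine (lintegral_mono_set hsub).trans ((lintegral_union_le _ _ _).trans_eq ?_)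
  rw [neg, half, ← ofReal_add (by positivity) (by positivity)]
  congr 1; ring

/-- Write k for the truncated kernel and d = |y - c|. The difference is (g(x) - g(y))(k(x-y) -
k(x-c)) - (g(y) - g(c)) k(x-c). Hölder continuity bounds the two terms by multiples of A d
|x-c|^(-2) and A d^α |x-c|^(-1-α), and each integrates to O(A) over |x-c| ≥ 2d. -/
lemma exists_hormander {α : ℝ} (h0 : 0 < α) (h1 : α < 1) : ∃ C : ℝ, 0 < C ∧
    ∀ (g h : ℝ → ℂ) (A : ℝ), BddFracDeriv α A g h → ∀ a b : ℝ, 0 < a → ∀ y c : ℝ,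
      ∫⁻ x in {x | 2 * |y - c| ≤ |x - c|}, ‖(g x - g y) * (truncKernel α a b (x - y) : ℂ) -
        (g x - g c) * (truncKernel α a b (x - c) : ℂ)‖ₑ ≤ ofReal (C * A) := by
  obtain ⟨Cr, hCr, hr⟩ := exists_regularity_bound h0 h1
  set P2 := 3 * 3 ^ (2 + α) * (hkPowConst (1 + α / 2 + 1 / 2)).toReal
  set P1 := (hkPowConst (1 + α / 2)).toReal
  have hP2 : 0 ≤ P2 := by positivity
  have hP1 : 0 ≤ P1 := by positivity
  refine ⟨Cr * (4 * P2 + 2 * P1 / α) + 1, by positivity, fun g h A hg a b ha y c => ?_⟩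
  have hA := hg.nonneg
  obtain ⟨-, -, -, r4⟩ := hr g h A hg
  rcases eq_or_ne y c with rfl | hyc
  · simp
  set d := |y - c| with hd
  have hd0 : 0 < d := abs_pos.2 (sub_ne_zero.2 hyc)
  have hpt : ∀ x ∈ {x | 2 * d ≤ |x - c|}, ‖(g x - g y) * (truncKernel α a b (x - y) : ℂ) -
      (g x - g c) * (truncKernel α a b (x - c) : ℂ)‖ₑ ≤
      ofReal (Cr * A * (2 * P2) * d) * ofReal (|x - c| ^ (-(1 + 1) : ℝ)) +
      ofReal (Cr * A * P1 * d ^ α) * ofReal (|x - c| ^ (-(1 + α))) := fun x (hx : 2 * d ≤ |x - c|) => by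
    have hz : 0 < |x - c| := by linarith
    have e : (x - c) - (x - y) = y - c := by ring
    have k1 := abs_truncKernel_sub_le (b := b) h0 ha (z := x - c) (z' := x - y) (abs_pos.1 hz) (by rw [e]; exact hx)
    rw [e, ← hd] at k1
    have k2 : truncKernel α a b (x - c) ≤ |x - c| ^ (-(1 + α)) * P1 := by
      have := integral_rpow_mul_hk_le (by linarith : 1 < 1 + α / 2) (b := b) ha (abs_pos.1 hz)
      rwa [show 1 - 2 * (1 + α / 2) = -(1 + α) by ring] at this
    have k3 : ‖g x - g y‖ ≤ Cr * A * (2 * |x - c| ^ α) := by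
      refine (r4 x y).trans (mul_le_mul_of_nonneg_left ?_ (by positivity))
      have h2 : |x - y| ≤ 2 * |x - c| := by
        calc |x - y| = |(x - c) - (y - c)| := by congr 1; ring
          _ ≤ |x - c| + |y - c| := abs_sub _ _
          _ ≤ _ := by linarith
      calc |x - y| ^ α ≤ (2 * |x - c|) ^ α := rpow_le_rpow (abs_nonneg _) h2 h0.le
        _ = 2 ^ α * |x - c| ^ α := mul_rpow (by norm_num) hz.le
        _ ≤ 2 ^ (1 : ℝ) * |x - c| ^ α := by gcongr; norm_num
        _ = _ := by rw [rpow_one]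
    have k4 := r4 y c
    rw [← ofReal_norm, ← ofReal_mul (by positivity), ← ofReal_mul (by positivity), ← ofReal_add (by positivity) (by positivity)]
    refine ofReal_le_ofReal ?_
    calc _ = ‖(g x - g y) * ((truncKernel α a b (x - y) - truncKernel α a b (x - c) : ℝ) : ℂ) -
          (g y - g c) * (truncKernel α a b (x - c) : ℂ)‖ := by congr 1; push_cast; ring
      _ ≤ ‖g x - g y‖ * |truncKernel α a b (x - y) - truncKernel α a b (x - c)| + ‖g y - g c‖ * truncKernel α a b (x - c) := by
          refine (norm_sub_le _ _).trans_eq ?_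
          rw [norm_mul, norm_mul, norm_real, norm_real, norm_eq_abs, norm_of_nonneg (truncKernel_nonneg ha _)]
      _ ≤ Cr * A * (2 * |x - c| ^ α) * (P2 * (d * |x - c| ^ (-(2 + α)))) + Cr * A * d ^ α * (|x - c| ^ (-(1 + α)) * P1) := by
          gcongr
          exact truncKernel_nonneg ha _
      _ = Cr * A * (2 * P2) * d * (|x - c| ^ α * |x - c| ^ (-(2 + α))) + Cr * A * P1 * d ^ α * |x - c| ^ (-(1 + α)) := by ring
      _ = _ := by rw [← rpow_add hz]; ring_nf
  have hm : MeasurableSet {x : ℝ | 2 * d ≤ |x - c|} := measurableSet_le measurable_const (by fun_prop)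
  have mm : Measurable fun x : ℝ => ofReal (Cr * A * (2 * P2) * d) * ofReal (|x - c| ^ (-(1 + 1) : ℝ)) :=
    Measurable.const_mul (Measurable.ennreal_ofReal (by fun_prop)) _
  refine (setLIntegral_mono' hm hpt).trans ?_
  rw [lintegral_add_left mm, lintegral_const_mul' _ _ ofReal_ne_top, lintegral_const_mul' _ _ ofReal_ne_top]
  refine (add_le_add (mul_le_mul_right (lintegral_rpow_abs_ge_le one_pos c (by positivity)) _)
    (mul_le_mul_right (lintegral_rpow_abs_ge_le h0 c (by positivity)) _)).trans ?_
  rw [← ofReal_mul (by positivity), ← ofReal_mul (by positivity), ← ofReal_add (by positivity) (by positivity)]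
  refine ofReal_le_ofReal ?_
  have e1 : d * (2 * d) ^ (-1 : ℝ) ≤ 1 := by
    rw [rpow_neg_one, ← div_eq_mul_inv, div_le_one (by positivity)]; linarith
  have e2 : d ^ α * (2 * d) ^ (-α) ≤ 1 := by
    rw [rpow_neg (by positivity), ← div_eq_mul_inv, div_le_one (by positivity)]
    exact rpow_le_rpow hd0.le (by linarith) h0.le
  calc _ = Cr * A * (4 * P2) * (d * (2 * d) ^ (-1 : ℝ)) + Cr * A * (2 * P1 / α) * (d ^ α * (2 * d) ^ (-α)) := by ring
    _ ≤ Cr * A * (4 * P2) * 1 + Cr * A * (2 * P1 / α) * 1 := by gcongr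
    _ ≤ _ := by nlinarith [mul_nonneg hCr.le (mul_nonneg hA hP2)]

/-! ### The truncated commutators as Calderón-Zygmund operators. -/

/-- The antisymmetric form `∫ g (f_r u - f u_r)`. -/
noncomputable def heatForm (g : ℝ → ℂ) (f u : 𝒮) (r : ℝ) : ℂ := ∫ x, g x * (heat r f x * u x - f x * heat r u x)

lemma measurable_heatForm {g : ℝ → ℂ} (hg : Continuous g) (f u : 𝒮) : Measurable (heatForm g f u) := by
  have m1 := measurable_heat (schwartz_tempered f).aestronglyMeasurable
  have m2 := measurable_heat (schwartz_tempered u).aestronglyMeasurable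
  have m : Measurable fun p : ℝ × ℝ => g p.2 * (heat p.1 f p.2 * u p.2 - f p.2 * heat p.1 u p.2) :=
    (hg.measurable.comp measurable_snd).mul ((m1.mul (u.continuous.measurable.comp measurable_snd)).sub
      ((f.continuous.measurable.comp measurable_snd).mul m2))
  exact (m.stronglyMeasurable.integral_prod_right (ν := volume)).measurable

lemma integrable_one_add_abs_mul (f : 𝒮) : Integrable fun x => (1 + |x|) * ‖f x‖ :=
  integrable_mul_schwartz (m := fun x => 1 + |x|) (by fun_prop) (C := 1) 1
    (fun ζ => by rw [abs_of_nonneg (by positivity), one_mul, pow_one]) f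

lemma integral_heat_commutator {α A : ℝ} (h0 : 0 < α) (h1 : α < 1) {g h : ℝ → ℂ} (hg : BddFracDeriv α A g h)
    (f u : 𝒮) {r : ℝ} (hr : 0 < r) :
    ∫ x, (∫ y, (g x - g y) * (hk r (x - y) : ℂ) * f y) * u x = heatForm g f u r := by
  obtain ⟨K, hK, kg, -, -, -, -⟩ := hg.growth h0 h1
  have hgm := hg.cont.aestronglyMeasurable (μ := volume)
  have hgf : Integrable fun y => g y * f y := integrable_growth_mul hgm kg f
  have hgfT : Tempered fun y => g y * f y := ⟨0, by simpa using hgf⟩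
  have e1 : ∀ x, ∫ y, (g x - g y) * (hk r (x - y) : ℂ) * f y = g x * heat r f x - heat r (fun y => g y * f y) x := fun x => by
    rw [heat, heat, ← integral_const_mul, ← integral_sub
      ((integrable_hkernels_smul (schwartz_tempered f) hr x).1.const_mul _) (integrable_hkernels_smul hgfT hr x).1]
    refine integral_congr_ae (.of_forall fun y => ?_)
    simp only [real_smul]; ring
  have i1 : Integrable fun x => g x * (heat r f x * u x) := (integrable_growth_mul hgm kg (mulS (heatS r hr f) u)).congr
      (.of_forall fun x => by simp only [mulS_apply, heatS_apply])
  have i2 : Integrable fun x => g x * (f x * heat r u x) := (integrable_growth_mul hgm kg (mulS f (heatS r hr u))).congr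
      (.of_forall fun x => by simp only [mulS_apply, heatS_apply])
  have i3 : Integrable fun x => heat r (fun y => g y * f y) x * u x :=
    u.integrable.bdd_mul (measurable_heat_space hgf.1 r).aestronglyMeasurable
      (.of_forall fun x => norm_heat_le_sqrt hgf hr x)
  have e2 := integral_heat_mul hgfT u hr
  simp only [e1, heatForm]
  calc _ = ∫ x, (g x * (heat r f x * u x) - heat r (fun y => g y * f y) x * u x) := integral_congr_ae (.of_forall fun x => by ring)
    _ = (∫ x, g x * (heat r f x * u x)) - ∫ x, g x * (f x * heat r u x) := by
        rw [integral_sub i1 i3, e2]; simp only [mul_assoc]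
    _ = _ := by
        rw [← integral_sub i1 i2]
        exact integral_congr_ae (.of_forall fun x => by ring)

/-- The bilinear form of the truncated commutator as an integral of antisymmetric heat forms. -/
lemma integral_truncKernel_mul {α A : ℝ} (h0 : 0 < α) (h1 : α < 1) {g h : ℝ → ℂ} (hg : BddFracDeriv α A g h)
    {a b : ℝ} (ha : 0 < a) (f u : 𝒮) :
    ∫ x, (∫ y, (g x - g y) * (truncKernel α a b (x - y) : ℂ) * f y) * u x =
      ∫ r in Icc a b, (r ^ (-(1 + α / 2)) : ℝ) • heatForm g f u r := by
  obtain ⟨K, hK, kg, -, -, -, -⟩ := hg.growth h0 h1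
  obtain ⟨C, hC, hk0⟩ := hk_le_of_mem 0 (a := a) (b := b) ha
  simp only [pow_zero, inv_one, mul_one] at hk0
  set F : (ℝ × ℝ) × ℝ → ℂ := fun w => ((w.2 ^ (-(1 + α / 2)) : ℝ) : ℂ) *
    ((g w.1.1 - g w.1.2) * (hk w.2 (w.1.1 - w.1.2) : ℂ) * f w.1.2 * u w.1.1) with hF
  have hi : IntegrableOn (fun r : ℝ => 2 * K * C * r ^ (-(1 + α / 2))) (Icc a b) := (continuousOn_const.mul
      (ContinuousOn.rpow_const continuousOn_id fun _ hr => Or.inl (ha.trans_le hr.1).ne')).integrableOn_Icc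
  have hFm : Measurable F := by
    have m0 : Measurable fun w : (ℝ × ℝ) × ℝ => hk w.2 (w.1.1 - w.1.2) :=
      measurable_hk_prod.comp (f := fun w : (ℝ × ℝ) × ℝ => (w.2, w.1.1 - w.1.2)) (by fun_prop)
    have m1 := Complex.measurable_ofReal.comp m0
    have m2 := hg.cont.measurable
    have m3 := f.continuous.measurable
    have m4 := u.continuous.measurable
    exact Measurable.mul (by fun_prop) (((Measurable.sub (by fun_prop) (by fun_prop)).mul m1).mul (by fun_prop) |>.mul
      (by fun_prop))
  have hFi : Integrable F ((volume.prod volume).prod (volume.restrict (Icc a b))) := by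
    refine (((integrable_one_add_abs_mul u).mul_prod (integrable_one_add_abs_mul f)).mul_prod hi).mono
      hFm.aestronglyMeasurable ?_
    have hmem : ∀ᵐ w ∂((volume : Measure (ℝ × ℝ)).prod (volume.restrict (Icc a b))), w.2 ∈ Icc a b :=
      Measure.quasiMeasurePreserving_snd.ae (ae_restrict_mem measurableSet_Icc)
    filter_upwards [hmem] with w hw
    have hr0 : 0 < w.2 := ha.trans_le hw.1
    have hgg : ‖g w.1.1 - g w.1.2‖ ≤ 2 * K * ((1 + |w.1.1|) * (1 + |w.1.2|)) := by
      refine (norm_sub_le _ _).trans ((add_le_add (kg _) (kg _)).trans ?_)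
      have := mul_nonneg (abs_nonneg w.1.1) (abs_nonneg w.1.2)
      nlinarith [mul_nonneg hK this, abs_nonneg w.1.1, abs_nonneg w.1.2]
    rw [hF]
    simp only [norm_mul, norm_real]
    rw [norm_of_nonneg (hk_nonneg _ _), norm_of_nonneg (by positivity : 0 ≤ w.2 ^ (-(1 + α / 2))),
      norm_of_nonneg (by positivity : 0 ≤ 1 + |w.1.1|), norm_of_nonneg (by positivity : 0 ≤ 1 + |w.1.2|),
      norm_of_nonneg hK, norm_of_nonneg hC, norm_norm, norm_norm, norm_of_nonneg zero_le_two]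
    calc _ ≤ w.2 ^ (-(1 + α / 2)) * (2 * K * ((1 + |w.1.1|) * (1 + |w.1.2|)) * C * ‖f w.1.2‖ * ‖u w.1.1‖) := by
          gcongr
          · exact hk_nonneg _ _
          · exact hk0 _ hw _
      _ = _ := by ring
  have e0 : ∀ x, (∫ y, (g x - g y) * (truncKernel α a b (x - y) : ℂ) * f y) * u x = ∫ y, ∫ r in Icc a b, F ((x, y), r) := fun x => by
    rw [← integral_mul_const]
    refine integral_congr_ae (.of_forall fun y => ?_)
    beta_reduce
    rw [truncKernel, ← integral_complex_ofReal, ← integral_const_mul, ← integral_mul_const, ← integral_mul_const]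
    refine integral_congr_ae (.of_forall fun r => ?_)
    simp only [hF]; push_cast; ring
  simp only [e0]
  rw [← integral_prod (fun z : ℝ × ℝ => ∫ r in Icc a b, F (z, r)) hFi.integral_prod_left,
    integral_integral_swap (f := fun z r => F (z, r)) hFi]
  refine integral_congr_ae ?_
  filter_upwards [hFi.prod_left_ae, ae_restrict_mem measurableSet_Icc] with r hr hmem
  rw [integral_prod _ hr, ← integral_heat_commutator h0 h1 hg f u (ha.trans_le hmem.1), real_smul, ← integral_const_mul]
  refine integral_congr_ae (.of_forall fun x => ?_)
  beta_reduce
  rw [← integral_mul_const, ← integral_const_mul]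

lemma eLpNorm_ofReal {p : ℝ} (hp : 0 < p) (f : ℝ → ℂ) : eLpNorm f (ofReal p) = (∫⁻ x, ‖f x‖ₑ ^ p) ^ (1 / p) := by
  rw [eLpNorm_eq_lintegral_rpow_enorm_toReal (by simpa using hp) ofReal_ne_top, toReal_ofReal hp.le]

lemma eLpNorm_two (f : ℝ → ℂ) : eLpNorm f 2 = (∫⁻ x, ‖f x‖ₑ ^ 2) ^ (1 / 2 : ℝ) := by
  rw [← ofReal_ofNat 2, eLpNorm_ofReal two_pos]
  simp only [ENNReal.rpow_ofNat]

lemma enorm_integral_mul_le {p q : ℝ} (hpq : p.HolderConjugate q) {f g : ℝ → ℂ} (hf : AEStronglyMeasurable f)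
    (hg : AEStronglyMeasurable g) : ‖∫ x, f x * g x‖ₑ ≤ eLpNorm f (ofReal p) * eLpNorm g (ofReal q) := by
  rw [eLpNorm_ofReal hpq.pos, eLpNorm_ofReal hpq.symm.pos]
  refine (enorm_integral_le_lintegral_enorm _).trans ?_
  simp only [enorm_mul]
  exact ENNReal.lintegral_mul_le_Lp_mul_Lq volume hpq hf.enorm hg.enorm

lemma eLpNorm_le_of_pairing {p q : ℝ} (hpq : p.HolderConjugate q) {v : ℝ → ℂ} (hv : LocallyIntegrable v)
    {M : ℝ≥0∞} (hM : M ≠ ∞)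
    (h : ∀ φ : 𝒮, ‖∫ x, v x * φ x‖ₑ ≤ M * eLpNorm φ (ofReal q)) :
    eLpNorm v (ofReal p) ≤ M := by
  rw [eLpNorm_ofReal hpq.pos]
  simp only [eLpNorm_ofReal hpq.symm.pos] at h
  exact lintegral_rpow_le_of_pairing hpq hv hM h

lemma exists_schwartz_seq {p : ℝ≥0∞} (hp : p ≠ ∞) (hp1 : 1 ≤ p) {f : ℝ → ℂ} (hf : MemLp f p) :
    ∃ φ : ℕ → 𝒮, Tendsto (fun n => eLpNorm (fun x => f x - φ n x) p) atTop (𝓝 0) := by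
  have : ∀ n : ℕ, ∃ φ : 𝒮, eLpNorm (fun x => f x - φ x) p ≤ ofReal (1 / (n + 1)) := fun n => by
    obtain ⟨g, h1, h2, h3⟩ := hf.exist_eLpNorm_sub_le hp hp1 (by positivity : (0 : ℝ) < 1 / (n + 1))
    exact ⟨h1.toSchwartzMap h2, h3⟩
  choose φ hφ using this
  refine ⟨φ, tendsto_of_tendsto_of_tendsto_of_le_of_le tendsto_const_nhds ?_ (fun _ => zero_le) hφ⟩
  simpa using tendsto_ofReal tendsto_one_div_add_atTop_nhds_zero_nat

lemma eLpNorm_schwartz_ne_top (f : 𝒮) (p : ℝ≥0∞) : eLpNorm f p ≠ ∞ := (f.memLp p volume).2.ne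

/-- The normalized truncated commutators are Calderón–Zygmund operators. -/
lemma exists_isCZKernel {α : ℝ} (h0 : 0 < α) (h1 : α < 1) : ∃ C : ℝ, 0 < C ∧
    ∀ (g h : ℝ → ℂ) (A : ℝ), BddFracDeriv α A g h → 0 < A → ∀ a b : ℝ, 0 < a →
      ∃ M : ℝ, IsCZKernel (fun x y => (((C * A)⁻¹ : ℝ) : ℂ) * ((g x - g y) * (truncKernel α a b (x - y) : ℂ))) M := by
  obtain ⟨C1, hC1, hsq⟩ := exists_commutator_sq_bound h0 h1
  obtain ⟨C2, hC2, hho⟩ := exists_hormander h0 h1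
  obtain ⟨Cr, hCr, hr⟩ := exists_regularity_bound h0 h1
  -- Dividing by (C1 + C2) A normalises the L² bound and the Hörmander constant at once.
  refine ⟨C1 + C2, by positivity, fun g h A hg hA a b ha => ?_⟩
  set l : ℝ := ((C1 + C2) * A)⁻¹ with hl
  have hl0 : 0 < l := by positivity
  have hl1 : l * (C1 * A) ≤ 1 := by
    rw [hl, inv_mul_le_iff₀ (by positivity)]; nlinarith
  have hl2 : l * (C2 * A) ≤ 1 := by
    rw [hl, inv_mul_le_iff₀ (by positivity)]; nlinarith
  obtain ⟨Ck, hCk, hk⟩ := truncKernel_decay α (b := b) ha 3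
  set K : ℝ → ℝ → ℂ := fun x y => (l : ℂ) * ((g x - g y) * (truncKernel α a b (x - y) : ℂ)) with hK
  set M := l * (Cr * A) * Ck with hM
  have hM0 : 0 ≤ M := by positivity
  have hKb : ∀ x y, ‖K x y‖ ≤ M * ((1 + |x - y|) ^ 2)⁻¹ := fun x y => by
    have h2 := (hr g h A hg).2.2.2 x y
    have h3 : |x - y| ^ α ≤ 1 + |x - y| := rpow_le_one_add (abs_nonneg _) h0.le h1.le
    rw [hK]
    simp only [norm_mul, norm_real]
    rw [norm_of_nonneg hl0.le, norm_of_nonneg (truncKernel_nonneg ha _)]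
    calc _ ≤ l * ((Cr * A * (1 + |x - y|)) * (Ck * ((1 + |x - y|) ^ 3)⁻¹)) := by
          gcongr
          · exact truncKernel_nonneg ha _
          · exact h2.trans (by gcongr)
          · exact hk _
      _ = _ := by rw [hM]; field_simp
  have hw1 : ∀ z : ℝ, ((1 + |z|) ^ 2)⁻¹ ≤ 1 := fun z => inv_le_one_of_one_le₀ (one_le_pow₀ (by linarith [abs_nonneg z]))
  have hKM : ∀ x y, ‖K x y‖ ≤ M := fun x y => (hKb x y).trans (mul_le_of_le_one_right hM0 (hw1 _))
  have hKm : Measurable (uncurry K) := by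
    have m1 := Complex.measurable_ofReal.comp ((measurable_truncKernel α a b).comp
      (f := fun p : ℝ × ℝ => p.1 - p.2) (by fun_prop))
    have m2 := hg.cont.measurable
    exact (Measurable.mul (by fun_prop) m1).const_mul _
  have hT : ∀ {f : ℝ → ℂ}, Integrable f → AEStronglyMeasurable fun x => ∫ y, K x y * f y := fun {f} hf => by
    have e : (fun x => ∫ y, K x y * f y) = fun x => ∫ y, K x y * hf.1.mk f y := funext fun x =>
      integral_congr_ae (by filter_upwards [hf.1.ae_eq_mk] with y hy; rw [hy])
    rw [e]
    exact (hKm.stronglyMeasurable.mul (hf.1.stronglyMeasurable_mk.comp_measurable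
      measurable_snd)).integral_prod_right.aestronglyMeasurable
  have hKi : ∀ {f : ℝ → ℂ}, Integrable f → ∀ x, Integrable fun y => K x y * f y := fun {f} hf x => by
    have : Measurable fun y => K x y := hKm.comp (f := fun y => (x, y)) (by fun_prop)
    exact hf.bdd_mul this.aestronglyMeasurable (.of_forall fun y => hKM x y)
  -- The L² bound on Schwartz functions, by duality from the bilinear estimate. Since that estimate
  -- has absolute values inside the r-integral, restricting r to [a, b] costs nothing.
  have hS : ∀ f : 𝒮, eLpNorm (fun x => ∫ y, K x y * f y) 2 ≤ eLpNorm f 2 := fun f => by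
    have hle : ∀ x, ‖∫ y, K x y * f y‖ ≤ M * ∫ y, ‖f y‖ := fun x => by
      rw [← integral_const_mul]
      refine norm_integral_le_of_norm_le (f.integrable.norm.const_mul M) (.of_forall fun y => ?_)
      rw [norm_mul]; gcongr; exact hKM x y
    have hloc := (tempered_of_bounded (hT f.integrable) (.of_forall hle)).locallyIntegrable
    have := eLpNorm_le_of_pairing HolderConjugate.two_two hloc (eLpNorm_schwartz_ne_top f 2) fun u => by
      have e : ∫ x, (∫ y, K x y * f y) * u x = (l : ℂ) * ∫ r in Icc a b, (r ^ (-(1 + α / 2)) : ℝ) • heatForm g f u r := by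
        rw [← integral_truncKernel_mul h0 h1 hg ha f u, ← integral_const_mul]
        refine integral_congr_ae (.of_forall fun x => ?_)
        beta_reduce
        rw [← mul_assoc, ← integral_const_mul]
        simp only [hK, mul_assoc]
      rw [e, enorm_mul, ← ofReal_norm, norm_real, norm_of_nonneg hl0.le, ofReal_ofNat]
      calc _ ≤ ofReal l * (ofReal (C1 * A) * (eLpNorm f 2 * eLpNorm u 2)) := by
            refine mul_le_mul_right ((enorm_integral_le_lintegral_enorm _).trans ?_) _
            rw [eLpNorm_two, eLpNorm_two]
            refine le_trans ?_ (hsq g h A hg f u)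
            refine (setLIntegral_mono' measurableSet_Icc fun r hr => ?_).trans
              (lintegral_mono_set fun r (hr : r ∈ Icc a b) => (ha.trans_le hr.1 : r ∈ Ioi 0))
            rw [enorm_smul, enorm_eq_ofReal (rpow_nonneg (ha.le.trans hr.1) _)]
            rfl
        _ ≤ _ := by
            rw [← mul_assoc, ← ofReal_mul hl0.le]
            exact mul_le_of_le_one_left' (ofReal_le_one.2 hl1)
    simpa using this
  refine ⟨M, hKm, hKM, fun y c => ?_, fun f hf => ?_⟩
  · simp only [hK, ← mul_sub, enorm_mul]
    rw [lintegral_const_mul' _ _ (by simp), ← ofReal_norm, norm_real, norm_of_nonneg hl0.le]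
    refine (mul_le_mul_right (hho g h A hg a b ha y c) _).trans ?_
    rw [← ofReal_mul hl0.le]
    exact ofReal_le_one.2 hl2
  -- If f is in L², approximate it there: each row of the kernel is in L², so the images converge
  -- pointwise, and Fatou's lemma passes the bound to the limit. Otherwise the right side is
  -- infinite.
  · by_cases hfin : eLpNorm f 2 = ∞
    · rw [eLpNorm_two, ENNReal.rpow_eq_top_iff] at hfin
      rcases hfin with h | h
      · linarith [h.2]
      · rw [h.1]; exact le_top
    obtain ⟨φ, hφ⟩ := exists_schwartz_seq (by norm_num) (by norm_num) ⟨hf.1, lt_top_iff_ne_top.2 hfin⟩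
    have hptw : ∀ x, Tendsto (fun n => ∫ y, K x y * φ n y) atTop (𝓝 (∫ y, K x y * f y)) := fun x => by
      have hKx : Measurable fun y => K x y := hKm.comp (f := fun y => (x, y)) (by fun_prop)
      have hKL : eLpNorm (K x) 2 volume ≠ ∞ := by
        refine (MemLp.of_le (g := fun y => M * ((1 + |x - y|) ^ 2)⁻¹) ?_ hKx.aestronglyMeasurable
          (.of_forall fun y => (hKb x y).trans (le_abs_self _))).2.ne
        have hi : Integrable fun y => M * ((1 + |x - y|) ^ 2)⁻¹ := (integrable_weight_two.comp_sub_left x).const_mul M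
        refine (memLp_two_iff_integrable_sq hi.1).2 ((hi.const_mul M).mono (hi.1.pow 2) (.of_forall fun y => ?_))
        rw [norm_of_nonneg (by positivity), norm_of_nonneg (by positivity), sq]
        gcongr
        exact mul_le_of_le_one_right hM0 (hw1 _)
      rw [tendsto_iff_edist_tendsto_0]
      refine tendsto_of_tendsto_of_tendsto_of_le_of_le tendsto_const_nhds
        (h := fun n => eLpNorm (K x) 2 volume * eLpNorm (fun y => f y - φ n y) 2 volume) ?_ (fun _ => zero_le)
        fun n => ?_
      · simpa using ENNReal.Tendsto.const_mul hφ (Or.inr hKL)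
      · beta_reduce
        rw [edist_comm, edist_eq_enorm_sub, ← integral_sub (hKi hf x) (hKi (φ n).integrable x)]
        simp only [← mul_sub]
        have := enorm_integral_mul_le HolderConjugate.two_two hKx.aestronglyMeasurable
          (hf.1.sub (φ n).continuous.aestronglyMeasurable)
        rwa [ofReal_ofNat] at this
    have h2 := Lp.eLpNorm_lim_le_liminf_eLpNorm (p := 2) (fun n => hT (φ n).integrable) _ (.of_forall hptw)
    have h3 : Tendsto (fun n => eLpNorm f 2 + eLpNorm (fun y => f y - φ n y) 2 volume) atTop
        (𝓝 (eLpNorm f 2 + 0)) := hφ.const_add _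
    have h4 : ∀ n, eLpNorm (fun x => ∫ y, K x y * φ n y) 2 ≤ eLpNorm f 2 + eLpNorm (fun y => f y - φ n y) 2 volume := fun n => by
      refine (hS (φ n)).trans ?_
      have e : (φ n : ℝ → ℂ) = f - fun y => f y - φ n y := by ext y; simp
      calc _ = eLpNorm (f - fun y => f y - φ n y) 2 volume := by rw [← e]
        _ ≤ _ := eLpNorm_sub_le hf.1 (hf.1.sub (φ n).continuous.aestronglyMeasurable) (by norm_num)
    have h5 := h2.trans ((liminf_le_liminf (.of_forall h4)).trans_eq h3.liminf_eq)
    rw [add_zero, eLpNorm_two, eLpNorm_two] at h5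
    exact (ENNReal.rpow_le_rpow_iff (by norm_num)).1 h5

/-! ### L^p bounds for the full commutator form on Schwartz functions. -/

lemma heatForm_swap (g : ℝ → ℂ) (f u : 𝒮) (r : ℝ) : heatForm g f u r = -heatForm g u f r := by
  rw [heatForm, heatForm, ← integral_neg]
  exact integral_congr_ae (.of_forall fun x => by ring)

lemma integrableOn_heatForm {α A : ℝ} (h0 : 0 < α) (h1 : α < 1) {g h : ℝ → ℂ} (hg : BddFracDeriv α A g h)
    (f u : 𝒮) : IntegrableOn (fun r : ℝ => (r ^ (-(1 + α / 2)) : ℝ) • heatForm g f u r) (Ioi 0) := by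
  obtain ⟨C, hC, hsq⟩ := exists_commutator_sq_bound h0 h1
  have m0 : Measurable fun r : ℝ => (r ^ (-(1 + α / 2)) : ℝ) := by fun_prop
  have hm : Measurable fun r : ℝ => (r ^ (-(1 + α / 2)) : ℝ) • heatForm g f u r := m0.smul (measurable_heatForm hg.cont f u)
  refine ⟨hm.aestronglyMeasurable, lt_of_le_of_lt ?_ (mul_lt_top (ofReal_lt_top (r := C * A))
    (mul_lt_top (eLpNorm_schwartz_ne_top f 2).lt_top (eLpNorm_schwartz_ne_top u 2).lt_top))⟩
  rw [eLpNorm_two, eLpNorm_two]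
  refine le_trans (setLIntegral_mono' measurableSet_Ioi fun r (hr : 0 < r) => ?_) (hsq g h A hg f u)
  rw [enorm_smul, enorm_eq_ofReal (by positivity)]
  rfl

lemma tendsto_integral_Icc {F : ℝ → ℂ} (hF : IntegrableOn F (Ioi 0)) :
    Tendsto (fun n : ℕ => ∫ r in Icc (1 / (n + 1 : ℝ)) (n + 1), F r) atTop (𝓝 (∫ r in ℝ₊, F r)) := by
  have hsub : ∀ n : ℕ, Icc (1 / (n + 1 : ℝ)) (n + 1) ⊆ Ioi 0 := fun n r hr =>
    (by positivity : (0 : ℝ) < 1 / (n + 1)).trans_le hr.1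
  have e : ∀ n : ℕ, ∫ r in Icc (1 / (n + 1 : ℝ)) (n + 1), F r =
      ∫ r in ℝ₊, (Icc (1 / (n + 1 : ℝ)) (n + 1)).indicator F r := fun n => by
    rw [integral_indicator measurableSet_Icc, Measure.restrict_restrict measurableSet_Icc, inter_eq_left.2 (hsub n)]
  simp only [e]
  refine tendsto_integral_of_dominated_convergence (fun r => ‖F r‖) (fun n => hF.1.indicator measurableSet_Icc)
    hF.norm (fun n => .of_forall fun r => norm_indicator_le_norm_self _ _) ?_
  filter_upwards [ae_restrict_mem measurableSet_Ioi] with r (hr : 0 < r)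
  refine tendsto_const_nhds.congr' ?_
  have t1 : Tendsto (fun n : ℕ => 1 / (n + 1 : ℝ)) atTop (𝓝 0) := tendsto_one_div_add_atTop_nhds_zero_nat
  have t2 : Tendsto (fun n : ℕ => (n + 1 : ℝ)) atTop atTop := tendsto_natCast_atTop_atTop.atTop_add tendsto_const_nhds
  filter_upwards [t1.eventually (gt_mem_nhds hr), t2.eventually (eventually_ge_atTop r)] with n h2 h3
  have hmem : r ∈ Icc (1 / (n + 1 : ℝ)) (n + 1) := ⟨h2.le, h3⟩
  rw [indicator_of_mem hmem]

/-- The `L^p` bound for the full antisymmetric form. -/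
lemma exists_form_bound_of_pos {α : ℝ} (h0 : 0 < α) (h1 : α < 1) {p q : ℝ} (hpq : p.HolderConjugate q) (hp2 : p < 2) :
    ∃ C : ℝ, 0 < C ∧ ∀ (g h : ℝ → ℂ) (A : ℝ), BddFracDeriv α A g h → 0 < A → ∀ f u : 𝒮,
      ‖∫ r in ℝ₊, (r ^ (-(1 + α / 2)) : ℝ) • heatForm g f u r‖ₑ ≤
        ofReal (C * A) * (eLpNorm f (ofReal p) * eLpNorm u (ofReal q)) := by
  obtain ⟨C0, hC0, hcz⟩ := exists_isCZKernel h0 h1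
  have hp := hpq.pos
  have hp1 := hpq.lt
  set Cp := 4 ^ p * p * (6 / (p - 1) + 1 / (2 - p)) with hCp
  have hCp0 : 0 < Cp := by
    have : 0 < p - 1 := by linarith
    have : 0 < 2 - p := by linarith
    positivity
  refine ⟨C0 * Cp ^ (1 / p), by positivity, fun g h A hg hA f u => ?_⟩
  refine le_of_tendsto (tendsto_integral_Icc (integrableOn_heatForm h0 h1 hg f u)).enorm (.of_forall fun n => ?_)
  obtain ⟨M, hK⟩ := hcz g h A hg hA (1 / (n + 1)) (n + 1) (by positivity)
  set l := (C0 * A)⁻¹ with hl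
  set T : ℝ → ℂ := fun x => ∫ y, ((l : ℂ) * ((g x - g y) * (truncKernel α (1 / (n + 1)) (n + 1) (x - y) : ℂ))) * f y
  have e : ∫ r in Icc (1 / (n + 1 : ℝ)) (n + 1), (r ^ (-(1 + α / 2)) : ℝ) • heatForm g f u r = ((C0 * A : ℝ) : ℂ) * ∫ x, T x * u x := by
    rw [← integral_truncKernel_mul h0 h1 hg (by positivity) f u, ← integral_const_mul]
    refine integral_congr_ae (.of_forall fun x => ?_)
    beta_reduce
    rw [← mul_assoc, ← integral_const_mul]
    congr 1
    refine integral_congr_ae (.of_forall fun y => ?_)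
    beta_reduce
    rw [← mul_assoc, ← mul_assoc, ← Complex.ofReal_mul, hl, mul_inv_cancel₀ (by positivity), ofReal_one, one_mul]
  have hTp : eLpNorm T (ofReal p) ≤ ofReal (Cp ^ (1 / p)) * eLpNorm f (ofReal p) := by
    rw [eLpNorm_ofReal hp, eLpNorm_ofReal hp, ← ofReal_rpow_of_nonneg hCp0.le (by positivity),
      ← ENNReal.mul_rpow_of_nonneg _ _ (by positivity)]
    exact ENNReal.rpow_le_rpow (hK.lintegral_rpow_le hp1 hp2 f.integrable f.continuous.measurable) (by positivity)
  rw [e, enorm_mul, ← ofReal_norm, norm_real, norm_of_nonneg (by positivity)]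
  refine (mul_le_mul_right ((enorm_integral_mul_le hpq (hK.aestronglyMeasurable f.integrable)
    u.continuous.aestronglyMeasurable).trans (mul_le_mul_left hTp _)) _).trans_eq ?_
  rw [mul_assoc, ← mul_assoc, ← ofReal_mul (by positivity)]
  congr 2; ring

lemma BddFracDeriv.mono {α A B : ℝ} {g h : ℝ → ℂ} (hg : BddFracDeriv α A g h) (hAB : A ≤ B) : BddFracDeriv α B g h :=
  ⟨hg.fd, hg.bound.mono fun _ hy => hy.trans hAB, hg.cont⟩

lemma exists_form_bound {α : ℝ} (h0 : 0 < α) (h1 : α < 1) {p q : ℝ} (hpq : p.HolderConjugate q) :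
    ∃ C : ℝ, 0 < C ∧ ∀ (g h : ℝ → ℂ) (A : ℝ), BddFracDeriv α A g h → ∀ f u : 𝒮,
      ‖∫ r in ℝ₊, (r ^ (-(1 + α / 2)) : ℝ) • heatForm g f u r‖ₑ ≤
        ofReal (C * A) * (eLpNorm f (ofReal p) * eLpNorm u (ofReal q)) := by
  -- The normalisation of the kernels requires A > 0; the case A = 0 follows by letting a larger
  -- bound decrease to A.
  suffices H : ∃ C : ℝ, 0 < C ∧ ∀ (g h : ℝ → ℂ) (A : ℝ), BddFracDeriv α A g h → 0 < A → ∀ f u : 𝒮,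
      ‖∫ r in ℝ₊, (r ^ (-(1 + α / 2)) : ℝ) • heatForm g f u r‖ₑ ≤ ofReal (C * A) * (eLpNorm f (ofReal p) * eLpNorm u (ofReal q)) by
    obtain ⟨C, hC, H⟩ := H
    refine ⟨C, hC, fun g h A hg f u => ?_⟩
    have ht : Tendsto (fun B => ofReal (C * B) * (eLpNorm f (ofReal p) * eLpNorm u (ofReal q))) (𝓝[>] A) (𝓝 (ofReal (C * A) *
        (eLpNorm f (ofReal p) * eLpNorm u (ofReal q)))) :=
      ENNReal.Tendsto.mul_const (tendsto_ofReal ((tendsto_id.mono_left nhdsWithin_le_nhds).const_mul C))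
        (Or.inr (mul_ne_top (eLpNorm_schwartz_ne_top f _) (eLpNorm_schwartz_ne_top u _)))
    refine ge_of_tendsto ht ?_
    filter_upwards [self_mem_nhdsWithin] with B (hB : A < B)
    exact H g h B (hg.mono hB.le) (hg.nonneg.trans_lt hB) f u
  rcases lt_trichotomy p 2 with hp | rfl | hp
  · exact exists_form_bound_of_pos h0 h1 hpq hp
  · obtain ⟨C, hC, hsq⟩ := exists_commutator_sq_bound h0 h1
    have hq : q = 2 := by
      have := hpq.inv_add_inv_eq_one
      have : q⁻¹ = 2⁻¹ := by linarith
      exact inv_inj.1 this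
    subst hq
    refine ⟨C, hC, fun g h A hg _ f u => ?_⟩
    rw [ofReal_ofNat, eLpNorm_two, eLpNorm_two]
    refine (enorm_integral_le_lintegral_enorm _).trans (le_trans (setLIntegral_mono' measurableSet_Ioi
      fun r (hr : 0 < r) => ?_) (hsq g h A hg f u))
    rw [enorm_smul, enorm_eq_ofReal (by positivity)]
    rfl
  · have hq : q < 2 := by
      have h3 := hpq.inv_add_inv_eq_one
      have h4 : p⁻¹ < 2⁻¹ := inv_strictAnti₀ two_pos hp
      by_contra! h5
      have : q⁻¹ ≤ 2⁻¹ := inv_anti₀ two_pos h5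
      linarith
    obtain ⟨C, hC, H⟩ := exists_form_bound_of_pos h0 h1 hpq.symm hq
    refine ⟨C, hC, fun g h A hg hA f u => ?_⟩
    -- Antisymmetry exchanges f and u and hence the two exponents, so that p > 2 reduces to its
    -- conjugate q < 2.
    simp only [heatForm_swap g f u, smul_neg, integral_neg, enorm_neg]
    rw [mul_comm (eLpNorm f _ _)]
    exact H g h A hg hA u f

/-- The commutator form `∫ g (f D^α u - u D^α f)`. -/
lemma integral_heatForm_eq {α A : ℝ} (h0 : 0 < α) (h1 : α < 1) {g h : ℝ → ℂ} (hg : BddFracDeriv α A g h)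
    (f u : 𝒮) : ∫ r in ℝ₊, (r ^ (-(1 + α / 2)) : ℝ) • heatForm g f u r =
      fracConst α * ∫ x, g x * (f x * 𝒟 α u x - u x * 𝒟 α f x) := by
  obtain ⟨K, hK, kg, -, -, -, -⟩ := hg.growth h0 h1
  set D : 𝒮 → ℝ → ℝ → ℂ := fun φ x r => (r ^ (-(1 + α / 2)) : ℝ) • (φ x - heat r φ x) with hD
  have hDm : ∀ φ, Measurable (uncurry (D φ)) := fun φ => by
    have m1 := (measurable_heat (schwartz_tempered φ).aestronglyMeasurable).comp
      (f := fun p : ℝ × ℝ => (p.2, p.1)) (by fun_prop)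
    have m0 : Measurable fun p : ℝ × ℝ => (p.2 ^ (-(1 + α / 2)) : ℝ) := by fun_prop
    exact m0.smul ((φ.continuous.measurable.comp measurable_fst).sub m1)
  have hDi : ∀ φ x, IntegrableOn (D φ x) (Ioi 0) := fun φ x => by
    obtain ⟨C, hC, hb⟩ := lintegral_frac_le h0 h1 φ
    exact ⟨((hDm φ).comp (f := fun r => (x, r)) (by fun_prop)).aestronglyMeasurable, (hb x).trans_lt ofReal_lt_top⟩
  have hprod : ∀ φ ψ : 𝒮, Integrable (uncurry fun x r => g x * (ψ x * D φ x r))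
      (volume.prod (volume.restrict (Ioi 0))) := fun φ ψ => by
    obtain ⟨C, hC, hb⟩ := lintegral_frac_le h0 h1 φ
    have hm : Measurable (uncurry fun x r => g x * (ψ x * D φ x r)) :=
      (hg.cont.measurable.comp measurable_fst).mul ((ψ.continuous.measurable.comp measurable_fst).mul (hDm φ))
    refine ⟨hm.aestronglyMeasurable, ?_⟩
    rw [hasFiniteIntegral_iff_enorm, lintegral_prod _ hm.enorm.aemeasurable]
    have hgi := integrable_growth_mul (hg.cont.aestronglyMeasurable) kg ψ
    refine lt_of_le_of_lt ?_ (mul_lt_top hgi.2 (ofReal_lt_top (r := C)))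
    rw [← lintegral_mul_const' _ _ ofReal_ne_top]
    refine lintegral_mono fun x => ?_
    simp only [uncurry_apply_pair, ← mul_assoc, enorm_mul (g x * ψ x)]
    rw [lintegral_const_mul' _ _ enorm_ne_top]
    refine mul_le_mul_right ((hb x).trans (ofReal_le_ofReal (mul_le_of_le_one_right hC ?_))) _
    exact rpow_le_one_of_one_le_of_nonpos (by linarith [abs_nonneg x]) (by linarith)
  rw [← integral_const_mul]
  calc _ = ∫ r in ℝ₊, ∫ x, (g x * (f x * D u x r) - g x * (u x * D f x r)) := by
        refine integral_congr_ae (.of_forall fun r => ?_)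
        simp only [heatForm]
        rw [← integral_smul]
        refine integral_congr_ae (.of_forall fun x => ?_)
        simp only [hD, real_smul]; ring
    _ = ∫ x, ∫ r in ℝ₊, (g x * (f x * D u x r) - g x * (u x * D f x r)) :=
        (integral_integral_swap ((hprod u f).sub (hprod f u))).symm
    _ = _ := by
        refine integral_congr_ae (.of_forall fun x => ?_)
        beta_reduce
        rw [integral_sub (((hDi u x).const_mul _).const_mul _) (((hDi f x).const_mul _).const_mul _)]
        have eD : ∀ φ : 𝒮, ∫ r in ℝ₊, D φ x r = fracConst α * 𝒟 α φ x := fun φ => by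
          rw [← real_smul, fracConst_smul_fracDeriv h0 h1]
        simp only [integral_const_mul, eD]
        ring

/-- The `L^p` bound for the commutator form. -/
lemma exists_commutator_bound {α : ℝ} (h0 : 0 < α) (h1 : α < 1) {p q : ℝ} (hpq : p.HolderConjugate q) :
    ∃ C : ℝ, 0 < C ∧ ∀ (g h : ℝ → ℂ) (A : ℝ), BddFracDeriv α A g h → ∀ f u : 𝒮, ‖∫ x, g x * (f x * 𝒟 α u x - u x * 𝒟 α f x)‖ₑ ≤
        ofReal (C * A) * (eLpNorm f (ofReal p) * eLpNorm u (ofReal q)) := by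
  obtain ⟨C, hC, H⟩ := exists_form_bound h0 h1 hpq
  have hc := fracConst_pos h0 h1
  refine ⟨C / fracConst α, by positivity, fun g h A hg f u => ?_⟩
  have := H g h A hg f u
  rw [integral_heatForm_eq h0 h1 hg, enorm_mul, ← ofReal_norm, norm_real, norm_of_nonneg hc.le] at this
  rw [← ENNReal.mul_le_mul_iff_right (ENNReal.ofReal_pos.2 hc).ne' ofReal_ne_top]
  refine this.trans_eq ?_
  rw [← mul_assoc (ofReal (fracConst α)), ← ofReal_mul hc.le]
  congr 2; field_simp

/-! ### Mollification. -/

lemma iteratedDeriv_smooth_compact {k : ℝ → ℝ} (hk : ContDiff ℝ (⊤ : ℕ∞) k) (hc : HasCompactSupport k) (n : ℕ) :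
    ContDiff ℝ (⊤ : ℕ∞) (iteratedDeriv n k) ∧ HasCompactSupport (iteratedDeriv n k) := by
  induction n with
  | zero => rw [iteratedDeriv_zero]; exact ⟨hk, hc⟩
  | succ n ih =>
    rw [iteratedDeriv_succ]
    exact ⟨ih.1.deriv', ih.2.deriv⟩

/-- The convolution of `v` with a real kernel. -/
noncomputable def mollify (k : ℝ → ℝ) (v : ℝ → ℂ) (x : ℝ) : ℂ := ∫ t, k t • v (x - t)

lemma mollify_eq_convolution (k : ℝ → ℝ) (v : ℝ → ℂ) : mollify k v = convolution k v (ContinuousLinearMap.lsmul ℝ ℝ) volume := rfl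

lemma iteratedDeriv_mollify {k : ℝ → ℝ} (hk : ContDiff ℝ (⊤ : ℕ∞) k) (hc : HasCompactSupport k) {v : ℝ → ℂ}
    (hv : Continuous v) (n : ℕ) : iteratedDeriv n (mollify k v) = mollify (iteratedDeriv n k) v := by
  induction n with
  | zero => simp [iteratedDeriv_zero]
  | succ n ih =>
    have h := iteratedDeriv_smooth_compact hk hc n
    ext x
    rw [iteratedDeriv_succ, iteratedDeriv_succ, ih, mollify_eq_convolution, mollify_eq_convolution]
    exact (h.2.hasDerivAt_convolution_left _ (h.1.of_le (by simp)) hv.locallyIntegrable x).deriv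

lemma norm_mollify_le {k : ℝ → ℝ} (hk : Continuous k) (hc : HasCompactSupport k) {v : ℝ → ℂ} {K : ℝ} (hK : 0 ≤ K)
    (hb : ∀ x, ‖v x‖ ≤ K * (1 + |x|)) (x : ℝ) :
    ‖mollify k v x‖ ≤ (K * ∫ t, |k t| * (1 + |t|)) * (1 + |x|) := by
  have hi : Integrable fun t => |k t| * (1 + |t|) := Continuous.integrable_of_hasCompactSupport (by fun_prop) (hc.abs.mul_right)
  have e : (K * ∫ t, |k t| * (1 + |t|)) * (1 + |x|) = ∫ t, K * (1 + |x|) * (|k t| * (1 + |t|)) := by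
    rw [integral_const_mul]; ring
  rw [e]
  refine norm_integral_le_of_norm_le (hi.const_mul _) (.of_forall fun t => ?_)
  rw [norm_smul, norm_eq_abs]
  have h1 := abs_sub x t
  have : 1 + |x - t| ≤ (1 + |x|) * (1 + |t|) := by nlinarith [abs_nonneg x, abs_nonneg t]
  calc |k t| * ‖v (x - t)‖ ≤ |k t| * (K * ((1 + |x|) * (1 + |t|))) := by
        gcongr; exact (hb _).trans (by gcongr)
    _ = _ := by ring

/-- All derivatives fall on the compactly supported kernel, so each of them grows at most linearly.
Multiplication by the mollified function then preserves Schwartz functions. -/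
lemma hasTemperateGrowth_mollify {k : ℝ → ℝ} (hk : ContDiff ℝ (⊤ : ℕ∞) k) (hc : HasCompactSupport k) {v : ℝ → ℂ}
    (hv : Continuous v) {K : ℝ} (hK : 0 ≤ K) (hb : ∀ x, ‖v x‖ ≤ K * (1 + |x|)) :
    Function.HasTemperateGrowth (mollify k v) := by
  refine ⟨?_, fun n => ?_⟩
  · rw [mollify_eq_convolution]; exact hc.contDiff_convolution_left _ hk hv.locallyIntegrable
  have h := iteratedDeriv_smooth_compact hk hc n
  refine ⟨1, K * ∫ t, |iteratedDeriv n k t| * (1 + |t|), fun x => ?_⟩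
  rw [norm_iteratedFDeriv_eq_norm_iteratedDeriv, iteratedDeriv_mollify hk hc hv, pow_one, norm_eq_abs]
  exact norm_mollify_le h.1.continuous h.2 hK hb x

lemma aestronglyMeasurable_of_wt {α : ℝ} {v : ℝ → ℂ} (hv : AEStronglyMeasurable fun x => wt α x • v x) : AEStronglyMeasurable v := by
  have := ((continuous_wt α).inv₀ fun x => (wt_pos α x).ne').aestronglyMeasurable.smul hv
  refine this.congr (.of_forall fun x => ?_)
  rw [Pi.smul_apply', Pi.inv_apply, smul_smul, inv_mul_cancel₀ (wt_pos α x).ne', one_smul]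

lemma integrable_wt {α : ℝ} (h0 : 0 < α) : Integrable (wt α) :=
  integrable_one_add_norm (E := ℝ) (μ := volume) (r := 1 + α) (by simpa using h0)

/-- Fubini's theorem for the pairing with a mollified function. -/
lemma integral_mollify_mul {α : ℝ} (h0 : 0 < α) {k : ℝ → ℝ} (hk : Continuous k) (hc : HasCompactSupport k)
    {v w : ℝ → ℂ} (hv : Integrable fun x => wt α x • v x) (hw : Continuous w) {C : ℝ} (hC : 0 ≤ C)
    (hb : ∀ x, ‖w x‖ ≤ C * wt α x) :
    Integrable (fun x => mollify k v x * w x) ∧ ∫ x, mollify k v x * w x = ∫ t, k t • ∫ x, v x * w (x + t) := by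
  have hvm := aestronglyMeasurable_of_wt hv.1
  have hki : Integrable fun t => C * |k t| * (wt α t)⁻¹ := Continuous.integrable_of_hasCompactSupport
      ((continuous_const.mul hk.abs).mul ((continuous_wt α).inv₀ fun x => (wt_pos α x).ne'))
      (hc.abs.mul_left.mul_right)
  have hdom := hki.convolution_integrand (ContinuousLinearMap.lsmul ℝ ℝ) hv.norm
  have hm : AEStronglyMeasurable (fun p : ℝ × ℝ => (k p.2 • v (p.1 - p.2)) * w p.1) (volume.prod volume) :=
    (AEStronglyMeasurable.convolution_integrand (ContinuousLinearMap.lsmul ℝ ℝ) hk.aestronglyMeasurable hvm).mul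
      (hw.comp continuous_fst).aestronglyMeasurable
  have hi : Integrable (fun p : ℝ × ℝ => (k p.2 • v (p.1 - p.2)) * w p.1) (volume.prod volume) := by
    refine hdom.mono hm (.of_forall fun p => ?_)
    have h2 := wt_sub' h0 (p.1 - p.2) (-p.2)
    rw [sub_neg_eq_add, sub_add_cancel] at h2
    have h3 : wt α (-p.2) = wt α p.2 := by simp [wt]
    rw [h3] at h2
    have := wt_pos α p.2
    have := wt_pos α (p.1 - p.2)
    have e : ‖ContinuousLinearMap.lsmul ℝ ℝ (C * |k p.2| * (wt α p.2)⁻¹) ‖wt α (p.1 - p.2) • v (p.1 - p.2)‖‖ =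
        C * |k p.2| * (wt α p.2)⁻¹ * (wt α (p.1 - p.2) * ‖v (p.1 - p.2)‖) := by
      rw [ContinuousLinearMap.lsmul_apply, norm_smul, norm_norm, norm_smul, norm_of_nonneg (wt_pos α _).le,
        norm_of_nonneg (by positivity : 0 ≤ C * |k p.2| * (wt α p.2)⁻¹)]
    rw [e, norm_mul, norm_smul, norm_eq_abs]
    calc |k p.2| * ‖v (p.1 - p.2)‖ * ‖w p.1‖ ≤ |k p.2| * ‖v (p.1 - p.2)‖ * (C * ((wt α p.2)⁻¹ * wt α (p.1 - p.2))) := by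
          gcongr; exact (hb _).trans (by gcongr)
      _ = _ := by ring
  have e : ∀ x, mollify k v x * w x = ∫ t, (k t • v (x - t)) * w x := fun x => by
    rw [integral_mul_const]; rfl
  simp only [e]
  refine ⟨hi.integral_prod_left, ?_⟩
  rw [integral_integral_swap hi]
  refine integral_congr_ae (.of_forall fun t => ?_)
  beta_reduce
  rw [← integral_smul, ← integral_add_right_eq_self _ t]
  simp only [add_sub_cancel_right, smul_mul_assoc]

/-- D^α commutes with translations, so averaging translates with a probability density preserves
both the relation h = D^α g and the bound A. -/
lemma BddFracDeriv.mollify {α A : ℝ} (h0 : 0 < α) (h1 : α < 1) {g h : ℝ → ℂ} (hg : BddFracDeriv α A g h) {k : ℝ → ℝ}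
    (hk : ContDiff ℝ (⊤ : ℕ∞) k) (hc : HasCompactSupport k) (hk0 : ∀ t, 0 ≤ k t) (hk1 : ∫ t, k t = 1) :
    BddFracDeriv α A (mollify k g) (mollify k h) := by
  have hhw : Integrable fun x => wt α x • h x := by
    obtain ⟨j, hj⟩ := hg.fd.tempered
    exact (integrable_wt h0).smul_bdd A (aestronglyMeasurable_of_weight hj) hg.bound
  have hkc := hk.continuous
  have hgi := hg.fd.integrable_weight
  have hcont : Continuous (_root_.mollify k g) := by
    rw [mollify_eq_convolution]
    exact hc.continuous_convolution_left _ hkc hg.cont.locallyIntegrable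
  have hbd : ∀ x, ‖_root_.mollify k h x‖ ≤ A := fun x => by
    have hki : Integrable fun t => k t * A := (hkc.integrable_of_hasCompactSupport hc).mul_const A
    have e : A = ∫ t, k t * A := by rw [integral_mul_const, hk1, one_mul]
    rw [e]
    refine norm_integral_le_of_norm_le hki ?_
    have hq : ∀ᵐ t, ‖h (x - t)‖ ≤ A := (Measure.measurePreserving_sub_left volume x).quasiMeasurePreserving.ae hg.bound
    filter_upwards [hq] with t ht
    rw [norm_smul, norm_of_nonneg (hk0 t)]
    exact mul_le_mul_of_nonneg_left ht (hk0 t)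
  have hmm : AEStronglyMeasurable (_root_.mollify k h) := by
    have := (integral_mollify_mul h0 hkc hc hhw (w := fun x => (wt α x : ℂ)) (by have := continuous_wt α; fun_prop) zero_le_one
      (fun x => by simp [abs_of_pos (wt_pos α x)])).1.1
    refine aestronglyMeasurable_of_wt (α := α) (this.congr (.of_forall fun x => ?_))
    beta_reduce
    rw [real_smul]; exact mul_comm _ _
  refine ⟨⟨?_, tempered_of_bounded hmm (.of_forall hbd), fun φ => ?_⟩, .of_forall hbd, hcont⟩
  · have := (integral_mollify_mul h0 hkc hc hgi (w := fun x => (wt α x : ℂ)) (by have := continuous_wt α; fun_prop) zero_le_one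
      (fun x => by simp [abs_of_pos (wt_pos α x)])).1
    refine this.congr (.of_forall fun x => ?_)
    simp only [real_smul]; rw [mul_comm]; rfl
  · obtain ⟨C, hC, hφ⟩ := schwartz_decay φ 2
    obtain ⟨D, hD, hDφ⟩ := norm_fracDeriv_le h0 h1 φ
    rw [(integral_mollify_mul h0 hkc hc hhw φ.continuous hC fun x => (hφ x).trans
        (mul_le_mul_of_nonneg_left (wt_ge h1 x) hC)).2,
      (integral_mollify_mul h0 hkc hc hgi (continuous_fracDeriv h0 h1 φ) hD hDφ).2]
    refine integral_congr_ae (.of_forall fun t => ?_)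
    beta_reduce
    have e1 : ∀ x, φ (x + t) = reflS 0 (reflS t φ) x := fun x => by
      rw [reflS_apply, reflS_apply]; congr 1; ring
    have e2 : ∀ x, 𝒟 α φ (x + t) = 𝒟 α (reflS 0 (reflS t φ)) x := fun x => by
      rw [fracDeriv_reflS h0 h1, fracDeriv_reflS h0 h1]; congr 1; ring
    simp only [e1, e2, hg.fd.pairing]

/-! ### Symmetry of D^α on Schwartz functions. -/

lemma integrable_fracDeriv {α : ℝ} (h0 : 0 < α) (h1 : α < 1) (φ : 𝒮) : Integrable (𝒟 α φ) := by
  obtain ⟨C, hC, hb⟩ := norm_fracDeriv_le h0 h1 φ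
  exact ((integrable_wt h0).const_mul C).mono' (continuous_fracDeriv h0 h1 φ).aestronglyMeasurable
    (.of_forall hb)

/-- The integral is the Fourier transform at frequency zero, where the symbol vanishes. -/
lemma integral_fracDeriv {α : ℝ} (h0 : 0 < α) (h1 : α < 1) (φ : 𝒮) : ∫ x, 𝒟 α φ x = 0 := by
  set F : ℝ → ℂ := fun ζ => ((|2 * π * ζ| ^ α : ℝ) : ℂ) * 𝓕 (φ : ℝ → ℂ) ζ with hF
  have hFc : Continuous F := (continuous_ofReal.comp (continuous_symbol h0)).mul (𝓕 φ).continuous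
  have hFi : Integrable F := by
    refine (integrable_mul_schwartz (continuous_symbol h0) 1 (abs_two_pi_rpow_le h0 h1) (𝓕 φ)).mono'
      hFc.aestronglyMeasurable (.of_forall fun ζ => ?_)
    rw [hF, norm_mul, norm_real, norm_of_nonneg (by positivity)]
    rfl
  have hi : Integrable (𝓕 F) := by
    have := (integrable_fracDeriv h0 h1 φ).comp_neg
    refine this.congr (.of_forall fun x => ?_)
    simp only [fracDerivSchwartz]
    rw [Real.fourierInv_eq_fourier_neg, neg_neg]
  have key := congrFun (hFc.fourier_fourierInv_eq hFi hi) 0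
  rw [Real.fourier_eq] at key
  simpa [hF, h0.ne', fracDerivSchwartz] using key

/-- Constants have vanishing fractional derivative. With the bound A = 0, the commutator estimate
for g = 1 says exactly that D^α is symmetric. -/
lemma bddFracDeriv_one {α : ℝ} (h0 : 0 < α) (h1 : α < 1) : BddFracDeriv α 0 (fun _ => 1) fun _ => 0 := by
  refine ⟨⟨?_, ⟨0, by simp⟩, fun φ => ?_⟩, by simp, continuous_const⟩
  · exact (integrable_wt h0).smul_const (1 : ℂ)
  · simp [integral_fracDeriv h0 h1]

/-- `D^α` is symmetric. -/
lemma integral_mul_fracDeriv_comm {α : ℝ} (h0 : 0 < α) (h1 : α < 1) (φ ψ : 𝒮) : ∫ x, 𝒟 α φ x * ψ x = ∫ x, φ x * 𝒟 α ψ x := by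
  obtain ⟨C, -, H⟩ := exists_commutator_bound h0 h1 HolderConjugate.two_two
  have := H _ _ 0 (bddFracDeriv_one h0 h1) φ ψ
  simp only [mul_zero, ENNReal.ofReal_zero, zero_mul, nonpos_iff_eq_zero, enorm_eq_zero, one_mul] at this
  have hi : ∀ a b : 𝒮, Integrable fun x => a x * 𝒟 α b x := fun a b => by
    obtain ⟨B, hB, hb⟩ := schwartz_bounded a
    exact (integrable_fracDeriv h0 h1 b).bdd_mul a.continuous.aestronglyMeasurable (.of_forall hb)
  rw [integral_sub (hi φ ψ) (hi ψ φ), sub_eq_zero] at this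
  rw [this]
  exact integral_congr_ae (.of_forall fun x => mul_comm _ _)

lemma isFracDeriv_schwartz {α : ℝ} (h0 : 0 < α) (h1 : α < 1) (φ : 𝒮) : IsFracDeriv α φ (𝒟 α φ) := by
  refine ⟨?_, ⟨0, by simpa using integrable_fracDeriv h0 h1 φ⟩, integral_mul_fracDeriv_comm h0 h1 φ⟩
  obtain ⟨B, hB, hb⟩ := schwartz_bounded φ
  exact (integrable_wt h0).smul_bdd B φ.continuous.aestronglyMeasurable (.of_forall hb)

/-! ### The commutator form for general f in L^p. -/

lemma Tempered.integrable_mul {v : ℝ → ℂ} (hv : Tempered v) {g : ℝ → ℂ} (hg : AEStronglyMeasurable g) {K : ℝ} (hK : 0 ≤ K)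
    (hb : ∀ x, ‖g x‖ ≤ K * (1 + |x|)) (u : 𝒮) : Integrable fun x => v x * (g x * u x) := by
  have hvm := hv.aestronglyMeasurable
  obtain ⟨k, hk⟩ := hv
  obtain ⟨C, hC, hu⟩ := schwartz_decay u (k + 1)
  refine (hk.norm.const_mul (K * C)).mono' (hvm.mul (hg.mul u.continuous.aestronglyMeasurable))
    (.of_forall fun x => ?_)
  rw [norm_mul, norm_mul, norm_smul, norm_of_nonneg (by positivity : 0 ≤ ((1 + |x|) ^ k)⁻¹)]
  calc ‖v x‖ * (‖g x‖ * ‖u x‖) ≤ ‖v x‖ * ((K * (1 + |x|)) * (C * ((1 + |x|) ^ (k + 1))⁻¹)) := by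
        gcongr
        exacts [hb x, hu x]
    _ = _ := by rw [pow_succ]; field_simp

lemma Tempered.integrable_mul_schwartz {v : ℝ → ℂ} (hv : Tempered v) (u : 𝒮) : Integrable fun x => v x * u x := by
  simpa using hv.integrable_mul (g := fun _ => 1) aestronglyMeasurable_const zero_le_one
    (fun x => by simp) u

lemma integrable_mul_of_wt {α : ℝ} {f w : ℝ → ℂ} (hf : Integrable fun x => wt α x • f x)
    (hw : Continuous w) {C : ℝ} (hb : ∀ x, ‖w x‖ ≤ C * wt α x) : Integrable fun x => f x * w x := by
  refine (hf.norm.const_mul C).mono' ((aestronglyMeasurable_of_wt hf.1).mul hw.aestronglyMeasurable)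
    (.of_forall fun x => ?_)
  rw [norm_mul, norm_smul, norm_of_nonneg (wt_pos α x).le]
  nlinarith [mul_le_mul_of_nonneg_left (hb x) (norm_nonneg (f x))]

lemma IsFracDeriv.sub {α : ℝ} (h0 : 0 < α) (h1 : α < 1) {f f' v v' : ℝ → ℂ} (hf : IsFracDeriv α f v)
    (hf' : IsFracDeriv α f' v') : IsFracDeriv α (fun x => f x - f' x) fun x => v x - v' x := by
  refine ⟨?_, ?_, fun φ => ?_⟩
  · simp only [smul_sub]; exact hf.integrable_weight.sub hf'.integrable_weight
  · obtain ⟨k, hk⟩ := hf.tempered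
    obtain ⟨l, hl⟩ := hf'.tempered
    have aux : ∀ {m n : ℕ} {v : ℝ → ℂ}, m ≤ n → Integrable (fun x : ℝ => ((1 + |x|) ^ m)⁻¹ • v x) →
        Integrable fun x : ℝ => ((1 + |x|) ^ n)⁻¹ • v x := fun hmn h => by
      refine h.mono ((continuous_weight _).aestronglyMeasurable.smul (aestronglyMeasurable_of_weight h))
        (.of_forall fun x => ?_)
      rw [norm_smul, norm_smul, norm_of_nonneg (by positivity), norm_of_nonneg (by positivity)]
      gcongr
      linarith [abs_nonneg x]
    refine ⟨max k l, ?_⟩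
    simp only [smul_sub]; exact (aux (le_max_left k l) hk).sub (aux (le_max_right k l) hl)
  · obtain ⟨C, hC, hb⟩ := norm_fracDeriv_le h0 h1 φ
    have hc := continuous_fracDeriv h0 h1 φ
    simp only [sub_mul]
    rw [integral_sub (Tempered.integrable_mul_schwartz hf.tempered φ) (Tempered.integrable_mul_schwartz hf'.tempered φ),
      integral_sub (integrable_mul_of_wt hf.integrable_weight hc hb) (integrable_mul_of_wt hf'.integrable_weight hc hb),
      hf.pairing, hf'.pairing]

/-- Hölder continuity limits g to growth |x|^α, which leaves (1 + |x|)^(-1) of the weight. This is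
in L^q for every q > 1 and can be paired with f in L^p; hence D^α(fg) is defined. -/
lemma BddFracDeriv.norm_mul_wt_le {α A : ℝ} (h0 : 0 < α) (h1 : α < 1) {g h : ℝ → ℂ} (hg : BddFracDeriv α A g h) :
    ∃ K : ℝ, 0 ≤ K ∧ ∀ x, ‖g x‖ * wt α x ≤ K * (1 + |x|)⁻¹ := by
  obtain ⟨C, hC, hr⟩ := exists_regularity_bound h0 h1
  obtain ⟨-, -, -, hh⟩ := hr g h A hg
  have hA := hg.nonneg
  refine ⟨‖g 0‖ + C * A, by positivity, fun x => ?_⟩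
  have hx : 0 < 1 + |x| := by positivity
  have e : (1 + |x|)⁻¹ = (1 + |x|) ^ α * wt α x := by
    rw [wt, ← rpow_add hx, ← rpow_neg_one]; congr 1; ring
  rw [e, ← mul_assoc]
  refine mul_le_mul_of_nonneg_right ?_ (wt_pos α x).le
  have h2 : ‖g x‖ ≤ ‖g 0‖ + C * A * |x| ^ α := by
    have := hh x 0
    rw [sub_zero] at this
    linarith [norm_le_norm_add_norm_sub' (g x) (g 0)]
  have h3 : |x| ^ α ≤ (1 + |x|) ^ α := rpow_le_rpow (abs_nonneg x) (by linarith) h0.le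
  have h4 : 1 ≤ (1 + |x|) ^ α := one_le_rpow (by linarith [abs_nonneg x]) h0.le
  calc ‖g x‖ ≤ ‖g 0‖ * (1 + |x|) ^ α + C * A * (1 + |x|) ^ α := by
        refine h2.trans (add_le_add (le_mul_of_one_le_right (norm_nonneg _) h4) (by gcongr))
    _ = _ := by ring

lemma memLp_inv_one_add_abs {q : ℝ} (hq1 : 1 < q) : MemLp (fun x : ℝ => (1 + |x|)⁻¹) (ofReal q) volume := by
  have hq : 0 < q := by linarith
  have hc : Continuous fun x : ℝ => (1 + |x|)⁻¹ := Continuous.inv₀ (by fun_prop) fun x => by positivity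
  rw [← integrable_norm_rpow_iff hc.aestronglyMeasurable (by simpa using hq) ofReal_ne_top, toReal_ofReal hq.le]
  refine (integrable_one_add_norm (E := ℝ) (μ := volume) (r := q) (by simpa using hq1)).congr
    (.of_forall fun x => ?_)
  have hx : 0 < 1 + |x| := by positivity
  beta_reduce
  rw [norm_of_nonneg (inv_nonneg.2 hx.le), inv_rpow hx.le, rpow_neg (by positivity), norm_eq_abs]

/-- `f g` is integrable against the weight when `f ∈ L^p`. -/
lemma BddFracDeriv.integrable_wt_mul {α A : ℝ} (h0 : 0 < α) (h1 : α < 1) {g h : ℝ → ℂ} (hg : BddFracDeriv α A g h)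
    {p q : ℝ} (hpq : p.HolderConjugate q) {f : ℝ → ℂ} (hf : MemLp f (ofReal p)) :
    Integrable fun x => wt α x • (f x * g x) := by
  obtain ⟨K, hK, hb⟩ := hg.norm_mul_wt_le h0 h1
  have hi := memLp_inv_one_add_abs hpq.symm.lt
  have := hpq.ennrealOfReal
  have hfi := (hf.norm.integrable_mul hi).const_mul K
  refine hfi.mono' ((continuous_wt α).aestronglyMeasurable.smul (hf.1.mul hg.cont.aestronglyMeasurable))
    (.of_forall fun x => ?_)
  rw [norm_smul, norm_mul, norm_of_nonneg (wt_pos α x).le, Pi.mul_apply]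
  nlinarith [mul_le_mul_of_nonneg_left (hb x) (norm_nonneg (f x))]

lemma BddFracDeriv.integrable_mul_fracDeriv {α A : ℝ} (h0 : 0 < α) (h1 : α < 1) {g h : ℝ → ℂ} (hg : BddFracDeriv α A g h)
    {p q : ℝ} (hpq : p.HolderConjugate q) {f : ℝ → ℂ} (hf : MemLp f (ofReal p)) (u : 𝒮) :
    Integrable fun x => f x * (g x * 𝒟 α u x) := by
  obtain ⟨D, hD0, hDu⟩ := norm_fracDeriv_le h0 h1 u
  exact (integrable_mul_of_wt (hg.integrable_wt_mul h0 h1 hpq hf) (continuous_fracDeriv h0 h1 u) hDu).congr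
    (.of_forall fun x => mul_assoc _ _ _)

/-- When g has temperate growth, g u is a Schwartz function, and the expression equals ∫ f F with F
= g D^α u - D^α(g u). The estimate for Schwartz φ says ‖F‖_q ≤ M by duality, and Hölder's inequality
extends it to all f in L^p. -/
lemma enorm_commutator_le_of_smooth {α : ℝ} (h0 : 0 < α) (h1 : α < 1) {p q : ℝ} (hpq : p.HolderConjugate q)
    {g h : ℝ → ℂ} {A : ℝ} (hg : BddFracDeriv α A g h) (hT : g.HasTemperateGrowth) (u : 𝒮) {M : ℝ≥0∞} (hM : M ≠ ∞)
    (H : ∀ φ : 𝒮, ‖∫ x, g x * (φ x * 𝒟 α u x - u x * 𝒟 α φ x)‖ₑ ≤ M * eLpNorm φ (ofReal p))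
    {f Df : ℝ → ℂ} (hf : MemLp f (ofReal p)) (hD : IsFracDeriv α f Df) :
    ‖(∫ x, f x * (g x * 𝒟 α u x)) - ∫ x, Df x * (g x * u x)‖ₑ ≤ eLpNorm f (ofReal p) * M := by
  obtain ⟨K, hK, kg, -⟩ := hg.growth h0 h1
  obtain ⟨C, hC, hb⟩ := norm_fracDeriv_le h0 h1 u
  have hcu := continuous_fracDeriv h0 h1 u
  set w : 𝒮 := SchwartzMap.smulLeftCLM ℂ g u with hw
  have hwa : ∀ x, w x = g x * u x := fun x => by rw [hw, SchwartzMap.smulLeftCLM_apply_apply hT, smul_eq_mul]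
  have hcw := continuous_fracDeriv h0 h1 w
  obtain ⟨C', hC', hb'⟩ := norm_fracDeriv_le h0 h1 w
  set F : ℝ → ℂ := fun x => g x * 𝒟 α u x - 𝒟 α w x with hF
  have hFc : Continuous F := (hg.cont.mul hcu).sub hcw
  have i1 : ∀ {f : ℝ → ℂ}, MemLp f (ofReal p) → Integrable fun x => f x * (g x * 𝒟 α u x) :=
    fun hf => hg.integrable_mul_fracDeriv h0 h1 hpq hf u
  have e : ∀ {f Df : ℝ → ℂ}, MemLp f (ofReal p) → IsFracDeriv α f Df →
      (∫ x, f x * (g x * 𝒟 α u x)) - ∫ x, Df x * (g x * u x) = ∫ x, f x * F x := fun hf hD => by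
    simp only [← hwa]
    rw [hD.pairing, ← integral_sub (i1 hf) (integrable_mul_of_wt hD.integrable_weight hcw hb')]
    exact integral_congr_ae (.of_forall fun x => (mul_sub _ _ _).symm)
  have hFq : eLpNorm F (ofReal q) ≤ M := by
    refine eLpNorm_le_of_pairing hpq.symm hFc.locallyIntegrable hM fun φ => le_of_eq_of_le ?_ (H φ)
    have hφ := φ.memLp (ofReal p) volume
    have hDφ := isFracDeriv_schwartz h0 h1 φ
    have i2 := Tempered.integrable_mul hDφ.tempered hg.cont.aestronglyMeasurable hK kg u
    simp only [mul_comm (F _)]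
    rw [← e hφ hDφ, ← integral_sub (i1 hφ) i2]
    congr 1
    exact integral_congr_ae (.of_forall fun x => by ring)
  rw [e hf hD]
  exact (enorm_integral_mul_le hpq hf.1 hFc.aestronglyMeasurable).trans (mul_le_mul_right hFq _)

/-- A smooth approximation of the identity. -/
lemma exists_mollifiers : ∃ k : ℕ → ℝ → ℝ, (∀ n, ContDiff ℝ (⊤ : ℕ∞) (k n) ∧ HasCompactSupport (k n) ∧ (∀ t, 0 ≤ k n t) ∧
      ∫ t, k n t = 1) ∧ (∀ {v : ℝ → ℂ}, LocallyIntegrable v → ∀ᵐ x, Tendsto (fun n => mollify (k n) v x) atTop (𝓝 (v x))) ∧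
      ∀ {g : ℝ → ℂ}, Continuous g → (∀ x, Tendsto (fun n => mollify (k n) g x) atTop (𝓝 (g x))) ∧
      ∀ {B : ℝ}, (∀ x y, |x - y| ≤ 2 → ‖g x - g y‖ ≤ B) → ∀ n x, ‖mollify (k n) g x - g x‖ ≤ B := by
  have hpos : ∀ n : ℕ, (0 : ℝ) < 1 / (n + 1) := fun n => by positivity
  let φ : ℕ → ContDiffBump (0 : ℝ) := fun n => ⟨1 / (n + 1), 2 * (1 / (n + 1)), hpos n, by linarith [hpos n]⟩
  have hr : Tendsto (fun n => (φ n).rOut) atTop (𝓝 0) := by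
    have : Tendsto (fun n : ℕ => 2 * (1 / (n + 1 : ℝ))) atTop (𝓝 (2 * 0)) := tendsto_one_div_add_atTop_nhds_zero_nat.const_mul 2
    rwa [mul_zero] at this
  refine ⟨fun n => (φ n).normed volume, fun n => ⟨(φ n).contDiff_normed, (φ n).hasCompactSupport_normed,
    (φ n).nonneg_normed, (φ n).integral_normed⟩,
    fun hv => ContDiffBump.ae_convolution_tendsto_right_of_locallyIntegrable hr (K := 2)
      (.of_forall fun n => le_rfl) hv, fun {g} hg => ⟨fun x => ?_, fun {B} hB n x => ?_⟩⟩
  · exact ContDiffBump.convolution_tendsto_right_of_continuous hr hg x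
  · have := (φ n).dist_normed_convolution_le (μ := volume) (x₀ := x) (ε := B) hg.aestronglyMeasurable fun y hy => by
      rw [dist_eq_norm]
      refine hB y x ?_
      rw [mem_ball, dist_eq] at hy
      refine hy.le.trans ?_
      change 2 * (1 / (n + 1 : ℝ)) ≤ 2
      have : 1 / (n + 1 : ℝ) ≤ 1 := (div_le_one (by positivity)).2 (by linarith [n.cast_nonneg (α := ℝ)])
      linarith
    rwa [dist_eq_norm] at this

/-- The `L^p` bound for the commutator form, for general `f ∈ L^p`. -/
lemma exists_commutator_bound_memLp {α : ℝ} (h0 : 0 < α) (h1 : α < 1) {p q : ℝ} (hpq : p.HolderConjugate q) :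
    ∃ C : ℝ, 0 < C ∧ ∀ (g h : ℝ → ℂ) (A : ℝ), BddFracDeriv α A g h → ∀ (f Df : ℝ → ℂ),
      MemLp f (ofReal p) → IsFracDeriv α f Df → ∀ u : 𝒮,
      ‖(∫ x, f x * (g x * 𝒟 α u x)) - ∫ x, Df x * (g x * u x)‖ₑ ≤ ofReal (C * A) * (eLpNorm f (ofReal p) * eLpNorm u (ofReal q)) := by
  obtain ⟨C, hC, H⟩ := exists_commutator_bound h0 h1 hpq
  obtain ⟨Cr, hCr, hreg⟩ := exists_regularity_bound h0 h1
  refine ⟨C, hC, fun g h A hg f Df hf hD u => ?_⟩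
  obtain ⟨k, hk, -, hlim⟩ := exists_mollifiers
  obtain ⟨hpt, hbd⟩ := hlim hg.cont
  obtain ⟨K, hK, kg, -⟩ := hg.growth h0 h1
  have hA := hg.nonneg
  -- The mollifiers move points by at most 2, and |x - y|^α ≤ 1 + |x - y| ≤ 3; so mollification
  -- changes g by at most B, uniformly in n, and dominated convergence applies.
  set B := Cr * A * 3 with hB
  have hgB : ∀ n x, ‖mollify (k n) g x‖ ≤ ‖g x‖ + B := fun n x => by
    have := hbd (B := B) (fun x y hxy => ((hreg g h A hg).2.2.2 x y).trans (by
      rw [hB]; gcongr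
      linarith [rpow_le_one_add (abs_nonneg (x - y)) h0.le h1.le])) n x
    linarith [norm_le_norm_add_norm_sub' (mollify (k n) g x) (g x)]
  have hgn := fun n => hg.mollify h0 h1 (hk n).1 (hk n).2.1 (hk n).2.2.1 (hk n).2.2.2
  have hmain : ∀ n, ‖(∫ x, f x * (mollify (k n) g x * 𝒟 α u x)) -
      ∫ x, Df x * (mollify (k n) g x * u x)‖ₑ ≤ ofReal (C * A) * (eLpNorm f (ofReal p) * eLpNorm u (ofReal q)) := fun n => by
    refine (enorm_commutator_le_of_smooth h0 h1 hpq (hgn n)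
      (hasTemperateGrowth_mollify (hk n).1 (hk n).2.1 hg.cont hK kg) u
      (mul_ne_top (ofReal_ne_top (r := C * A)) (eLpNorm_schwartz_ne_top u (ofReal q)))
      (fun φ => (H _ _ A (hgn n) φ u).trans_eq (by ring)) hf hD).trans_eq (by ring)
  obtain ⟨D, hD0, hDu⟩ := norm_fracDeriv_le h0 h1 u
  have hcu := continuous_fracDeriv h0 h1 u
  have hDm := Tempered.aestronglyMeasurable hD.tempered
  have t1 : Tendsto (fun n => ∫ x, f x * (mollify (k n) g x * 𝒟 α u x)) atTop
      (𝓝 (∫ x, f x * (g x * 𝒟 α u x))) := by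
    have i1 := (integrable_mul_of_wt (hg.integrable_wt_mul h0 h1 hpq hf) hcu hDu).norm
    have i2 := ((integrable_mul_of_wt hD.integrable_weight hcu hDu).norm.const_mul B)
    refine tendsto_integral_of_dominated_convergence _ (fun n => hf.1.mul
      ((hgn n).cont.mul hcu).aestronglyMeasurable) (i1.add i2)
      (fun n => .of_forall fun x => ?_) (.of_forall fun x =>
        ((hpt x).mul_const _).const_mul _)
    simp only [norm_mul, Pi.add_apply]
    calc ‖f x‖ * (‖mollify (k n) g x‖ * ‖𝒟 α u x‖) ≤ ‖f x‖ * ((‖g x‖ + B) * ‖𝒟 α u x‖) := by gcongr; exact hgB n x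
      _ = _ := by ring
  have t2 : Tendsto (fun n => ∫ x, Df x * (mollify (k n) g x * u x)) atTop (𝓝 (∫ x, Df x * (g x * u x))) := by
    have i1 := (Tempered.integrable_mul hD.tempered hg.cont.aestronglyMeasurable hK kg u).norm
    have i2 := (Tempered.integrable_mul_schwartz hD.tempered u).norm.const_mul B
    refine tendsto_integral_of_dominated_convergence _ (fun n => hDm.mul
      ((hgn n).cont.mul u.continuous).aestronglyMeasurable) (i1.add i2)
      (fun n => .of_forall fun x => ?_) (.of_forall fun x =>
        ((hpt x).mul_const _).const_mul _)
    simp only [norm_mul, Pi.add_apply]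
    calc ‖Df x‖ * (‖mollify (k n) g x‖ * ‖u x‖) ≤ ‖Df x‖ * ((‖g x‖ + B) * ‖u x‖) := by gcongr; exact hgB n x
      _ = _ := by ring
  exact le_of_tendsto (t1.sub t2).enorm (.of_forall hmain)

/-! ### The commutator as an L^p function. -/

/-- Riesz representation for functionals on Schwartz functions that are bounded in `L²`. -/
lemma exists_riesz (L : 𝒮 →ₗ[ℂ] ℂ) {M : ℝ} (hL : ∀ u, ‖L u‖ ≤ M * ‖u.toLp 2‖) :
    ∃ v : ℝ → ℂ, MemLp v 2 ∧ ∀ u : 𝒮, ∫ x, v x * u x = L u := by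
  have hd : DenseRange (SchwartzMap.toLpCLM ℂ ℂ 2 (volume : Measure ℝ)).toLinearMap := SchwartzMap.denseRange_toLpCLM (F := ℂ) (by simp)
  set T := L.extendOfNorm (SchwartzMap.toLpCLM ℂ ℂ 2 (volume : Measure ℝ)).toLinearMap with hT
  have hTu : ∀ u : 𝒮, T (u.toLp 2) = L u := LinearMap.extendOfNorm_eq hd ⟨M, hL⟩
  set w := (InnerProductSpace.toDual ℂ (Lp ℂ 2 (volume : Measure ℝ))).symm T with hw
  -- Conjugation turns the sesquilinear representation into the bilinear pairing without conjugate.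
  refine ⟨fun x => starRingEnd ℂ (w x), (Lp.memLp w).star, fun u => ?_⟩
  rw [← hTu, ← InnerProductSpace.toDual_symm_apply, ← hw, L2.inner_def]
  refine integral_congr_ae ?_
  filter_upwards [u.coeFn_toLp 2 volume] with x hx
  rw [hx, RCLike.inner_apply']

/-- For Schwartz `φ`, the commutator of `D^α` and `g` applied to `φ`, as a function. -/
lemma exists_commutator_schwartz {α : ℝ} (h0 : 0 < α) (h1 : α < 1) {g h : ℝ → ℂ} {A : ℝ} (hg : BddFracDeriv α A g h)
    (φ : 𝒮) : ∃ v : ℝ → ℂ, MemLp v 2 ∧ ∀ u : 𝒮, ∫ x, v x * u x = (∫ x, φ x * (g x * 𝒟 α u x)) - ∫ x, 𝒟 α φ x * (g x * u x) := by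
  obtain ⟨C, hC, H⟩ := exists_commutator_bound_memLp h0 h1 HolderConjugate.two_two
  have hφ := φ.memLp (ofReal 2) volume
  have hDφ := isFracDeriv_schwartz h0 h1 φ
  obtain ⟨K, hK, kg, -⟩ := hg.growth h0 h1
  have i1 := hg.integrable_mul_fracDeriv h0 h1 HolderConjugate.two_two hφ
  have i2 : ∀ u : 𝒮, Integrable fun x => 𝒟 α φ x * (g x * u x) := fun u =>
    Tempered.integrable_mul hDφ.tempered hg.cont.aestronglyMeasurable hK kg u
  have hDadd : ∀ (a b : ℂ) (u v : 𝒮) x, 𝒟 α (a • u + b • v) x = a * 𝒟 α u x + b * 𝒟 α v x := fun a b u v x => by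
    have hi : ∀ u : 𝒮, Integrable fun ζ : ℝ => Complex.exp ((2 * π * (ζ * x) : ℝ) * I) *
        (((|2 * π * ζ| ^ α : ℝ) : ℂ) * 𝓕 u ζ) := fun u => by
      have hc : Continuous fun ζ : ℝ => (((|2 * π * ζ| ^ α : ℝ) : ℂ)) := continuous_ofReal.comp (continuous_symbol h0)
      refine (integrable_mul_schwartz (continuous_symbol h0) 1 (abs_two_pi_rpow_le h0 h1) (𝓕 u)).mono'
        ((by fun_prop : Continuous fun ζ : ℝ => Complex.exp ((2 * π * (ζ * x) : ℝ) * I)).mul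
          (hc.mul (𝓕 u).continuous)).aestronglyMeasurable (.of_forall fun ζ => ?_)
      rw [norm_mul, norm_exp_ofReal_mul_I, one_mul, norm_mul, norm_real, norm_of_nonneg (by positivity)]
    have e : ∀ u : 𝒮, 𝒟 α u x = ∫ ζ : ℝ, Complex.exp ((2 * π * (ζ * x) : ℝ) * I) *
        (((|2 * π * ζ| ^ α : ℝ) : ℂ) * 𝓕 u ζ) := fun u => by rw [fracDerivSchwartz, fourierInv_real]; rfl
    rw [e, e, e, ← integral_const_mul, ← integral_const_mul, ← integral_add ((hi u).const_mul a) ((hi v).const_mul b)]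
    refine integral_congr_ae (.of_forall fun ζ => ?_)
    have : 𝓕 (a • u + b • v) ζ = a * 𝓕 u ζ + b * 𝓕 v ζ := by
      rw [FourierTransform.fourier_add, FourierTransform.fourier_smul, FourierTransform.fourier_smul]; rfl
    beta_reduce
    rw [this]; ring
  have hlin : ∀ (a b : ℂ) (u v : 𝒮), (∫ x, φ x * (g x * 𝒟 α (a • u + b • v) x)) -
      ∫ x, 𝒟 α φ x * (g x * (a • u + b • v) x) =
      a * ((∫ x, φ x * (g x * 𝒟 α u x)) - ∫ x, 𝒟 α φ x * (g x * u x)) +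
      b * ((∫ x, φ x * (g x * 𝒟 α v x)) - ∫ x, 𝒟 α φ x * (g x * v x)) := fun a b u v => by
    have e1 : ∫ x, φ x * (g x * 𝒟 α (a • u + b • v) x) = a * (∫ x, φ x * (g x * 𝒟 α u x)) + b * ∫ x, φ x * (g x * 𝒟 α v x) := by
      rw [← integral_const_mul, ← integral_const_mul, ← integral_add ((i1 u).const_mul a) ((i1 v).const_mul b)]
      exact integral_congr_ae (.of_forall fun x => by beta_reduce; rw [hDadd]; ring)
    have e2 : ∫ x, 𝒟 α φ x * (g x * (a • u + b • v) x) = a * (∫ x, 𝒟 α φ x * (g x * u x)) + b * ∫ x, 𝒟 α φ x * (g x * v x) := by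
      rw [← integral_const_mul, ← integral_const_mul, ← integral_add ((i2 u).const_mul a) ((i2 v).const_mul b)]
      exact integral_congr_ae (.of_forall fun x => by
        change _ * (_ * (a * u x + b * v x)) = _; ring)
    rw [e1, e2]; ring
  refine exists_riesz ⟨⟨fun u => (∫ x, φ x * (g x * 𝒟 α u x)) -
      ∫ x, 𝒟 α φ x * (g x * u x), fun u v => by simpa using hlin 1 1 u v⟩,
      fun a u => by simpa using hlin a 0 u 0⟩ (M := C * A * (eLpNorm φ 2).toReal) fun u => ?_
  have hfin := eLpNorm_schwartz_ne_top φ 2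
  have h2 := H g h A hg φ _ hφ hDφ u
  rw [ofReal_ofNat] at h2
  have h3 := toReal_mono (mul_ne_top ofReal_ne_top
    (mul_ne_top hfin (eLpNorm_schwartz_ne_top u 2))) h2
  rw [toReal_enorm, ENNReal.toReal_mul, ENNReal.toReal_mul, toReal_ofReal
    (mul_nonneg hC.le hg.nonneg), ← mul_assoc] at h3
  rw [SchwartzMap.norm_toLp]
  exact h3

/-- The differences of the v n are controlled by those of the φ n, which form a Cauchy sequence in
L^p because they converge to f; completeness supplies the limit. -/
lemma exists_lim_of_edist_le {p : ℝ≥0∞} (hp1 : 1 ≤ p) {f : ℝ → ℂ} (hf : MemLp f p) {φ v : ℕ → ℝ → ℂ}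
    (hφ : ∀ n, MemLp (φ n) p volume) (hv : ∀ n, MemLp (v n) p volume) {M : ℝ≥0∞} (hM : M ≠ ∞)
    (h : ∀ n m, eLpNorm (fun x => v n x - v m x) p ≤ M * eLpNorm (fun x => φ n x - φ m x) p)
    (hlim : Tendsto (fun n => eLpNorm (fun x => f x - φ n x) p) atTop (𝓝 0)) :
    ∃ V : ℝ → ℂ, MemLp V p ∧ Tendsto (fun n => eLpNorm (fun x => V x - v n x) p) atTop (𝓝 0) := by
  have : Fact (1 ≤ p) := ⟨hp1⟩
  have hφc : CauchySeq fun n => (hφ n).toLp := by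
    refine Tendsto.cauchySeq (x := hf.toLp) (tendsto_iff_edist_tendsto_0.2 ?_)
    simp only [edist_comm _ hf.toLp, Lp.edist_toLp_toLp]
    exact hlim
  have hvc : CauchySeq fun n => (hv n).toLp := by
    rw [EMetric.cauchySeq_iff] at hφc ⊢
    intro ε hε
    obtain ⟨N, hN⟩ := hφc (ε / (M + 1)) (ENNReal.div_pos hε.ne' (by simp [hM]))
    refine ⟨N, fun m hm n hn => ?_⟩
    have h2 := hN m hm n hn
    rw [Lp.edist_toLp_toLp] at h2 ⊢
    rw [ENNReal.lt_div_iff_mul_lt (by simp) (by simp [hM])] at h2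
    refine ((h m n).trans ?_).trans_lt h2
    rw [mul_comm]
    exact mul_le_mul_right le_self_add _
  obtain ⟨V, hV⟩ := cauchySeq_tendsto_of_complete hvc
  refine ⟨V, Lp.memLp V, ?_⟩
  rw [tendsto_iff_edist_tendsto_0] at hV
  refine hV.congr fun n => ?_
  rw [edist_comm, Lp.edist_def]
  refine eLpNorm_congr_ae ?_
  filter_upwards [(hv n).coeFn_toLp] with x hx
  rw [Pi.sub_apply, hx]

/-- The commutator of `D^α` with multiplication by `g` is bounded on `L^p`. -/
lemma exists_commutator {α : ℝ} (h0 : 0 < α) (h1 : α < 1) {p q : ℝ} (hpq : p.HolderConjugate q) :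
    ∃ C : ℝ, 0 < C ∧ ∀ (g h : ℝ → ℂ) (A : ℝ), BddFracDeriv α A g h → ∀ (f Df : ℝ → ℂ),
      MemLp f (ofReal p) → IsFracDeriv α f Df → ∃ V : ℝ → ℂ, AEStronglyMeasurable V ∧
      eLpNorm V (ofReal p) ≤ ofReal (C * A) * eLpNorm f (ofReal p) ∧
      IsFracDeriv α (fun x => f x * g x) fun x => g x * Df x + V x := by
  obtain ⟨C, hC, H⟩ := exists_commutator_bound_memLp h0 h1 hpq
  have hp1 : 1 ≤ ofReal p := by simpa using hpq.lt.le
  refine ⟨C, hC, fun g h A hg f Df hf hD => ?_⟩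
  obtain ⟨K, hK, kg, -⟩ := hg.growth h0 h1
  choose v hv2 hv using exists_commutator_schwartz h0 h1 hg
  obtain ⟨φ, hφ⟩ := exists_schwartz_seq ofReal_ne_top hp1 hf
  -- The functional u ↦ ⟨D^α(fg) - g D^α f, u⟩, for which a representing function in L^p is sought.
  set Λ : (ℝ → ℂ) → (ℝ → ℂ) → 𝒮 → ℂ := fun f Df u =>
    (∫ x, f x * (g x * 𝒟 α u x)) - ∫ x, Df x * (g x * u x) with hΛ
  have i1 : ∀ {f : ℝ → ℂ}, MemLp f (ofReal p) → ∀ u : 𝒮, Integrable fun x => f x * (g x * 𝒟 α u x) :=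
    fun hf u => hg.integrable_mul_fracDeriv h0 h1 hpq hf u
  have i2 : ∀ {f Df : ℝ → ℂ}, IsFracDeriv α f Df → ∀ u : 𝒮, Integrable fun x => Df x * (g x * u x) := fun hD u =>
    Tempered.integrable_mul hD.tempered hg.cont.aestronglyMeasurable hK kg u
  -- Only the distance of f and f' in L^p enters. The Schwartz approximations of f need not have
  -- fractional derivatives that approximate that of f.
  have hsub : ∀ {f Df f' Df' : ℝ → ℂ}, MemLp f (ofReal p) → IsFracDeriv α f Df →
      MemLp f' (ofReal p) volume → IsFracDeriv α f' Df' → ∀ u,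
      ‖Λ f Df u - Λ f' Df' u‖ₑ ≤ ofReal (C * A) * (eLpNorm (fun x => f x - f' x) (ofReal p) * eLpNorm u (ofReal q)) := by
    intro f Df f' Df' hf hD hf' hD' u
    refine le_of_eq_of_le ?_ (H g h A hg _ _ (hf.sub hf') (hD.sub h0 h1 hD') u)
    have e1 : (∫ x, (f x - f' x) * (g x * 𝒟 α u x)) = (∫ x, f x * (g x * 𝒟 α u x)) - ∫ x, f' x * (g x * 𝒟 α u x) := by
      rw [← integral_sub (i1 hf u) (i1 hf' u)]; simp only [sub_mul]
    have e2 : (∫ x, (Df x - Df' x) * (g x * u x)) = (∫ x, Df x * (g x * u x)) - ∫ x, Df' x * (g x * u x) := by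
      rw [← integral_sub (i2 hD u) (i2 hD' u)]; simp only [sub_mul]
    simp only [Pi.sub_apply, e1, e2, hΛ]
    congr 1; ring
  have hφp := fun n => (φ n).memLp (ofReal p) volume
  have hDφ := fun n => isFracDeriv_schwartz h0 h1 (φ n)
  have hvloc : ∀ φ, LocallyIntegrable (v φ) := fun φ => (hv2 φ).locallyIntegrable (by norm_num)
  have hvu : ∀ φ (u : 𝒮), Integrable fun x => v φ x * u x := fun φ u =>
    (hv2 φ).integrable_mul (u.memLp 2 volume)
  -- Riesz' theorem placed this function in L²; duality with the bilinear estimate shows that it is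
  -- also in L^p.
  have hvp : ∀ φ, MemLp (v φ) (ofReal p) volume := fun φ => by
    have hM : ofReal (C * A) * eLpNorm φ (ofReal p) ≠ ∞ := mul_ne_top ofReal_ne_top (eLpNorm_schwartz_ne_top φ _)
    refine ⟨(hv2 φ).1, (eLpNorm_le_of_pairing hpq (hvloc φ) hM fun u => ?_).trans_lt hM.lt_top⟩
    rw [hv, mul_assoc]
    exact H g h A hg _ _ (φ.memLp _ volume) (isFracDeriv_schwartz h0 h1 φ) u
  obtain ⟨V, hVp, hV⟩ := exists_lim_of_edist_le hp1 hf hφp (fun n => hvp (φ n)) (M := ofReal (C * A))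
    ofReal_ne_top (fun n m => by
      refine eLpNorm_le_of_pairing hpq ((hvloc _).sub (hvloc _)) (mul_ne_top ofReal_ne_top
        ((hφp n).sub (hφp m)).2.ne) fun u => ?_
      simp only [Pi.sub_apply, sub_mul]
      rw [integral_sub (hvu _ u) (hvu _ u), hv, hv, mul_assoc]
      exact hsub (hφp n) (hDφ n) (hφp m) (hDφ m) u) hφ
  have := hpq.ennrealOfReal
  have hVu : ∀ u : 𝒮, Integrable fun x => V x * u x := fun u =>
    hVp.integrable_mul (u.memLp (ofReal q) volume)
  have hpair : ∀ u : 𝒮, ∫ x, V x * u x = Λ f Df u := fun u => by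
    have hu := eLpNorm_schwartz_ne_top u (ofReal q)
    have t1 : Tendsto (fun n => ∫ x, v (φ n) x * u x) atTop (𝓝 (∫ x, V x * u x)) := by
      rw [tendsto_iff_edist_tendsto_0]
      refine tendsto_of_tendsto_of_tendsto_of_le_of_le tendsto_const_nhds
        (by simpa using ENNReal.Tendsto.mul_const hV (Or.inr hu)) (fun _ => zero_le) fun n => ?_
      rw [edist_comm, edist_eq_enorm_sub, ← integral_sub (hVu u) (hvu _ u)]
      simp only [← sub_mul]
      exact enorm_integral_mul_le hpq (hVp.1.sub (hvp _).1) u.continuous.aestronglyMeasurable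
    have t2 : Tendsto (fun n => ∫ x, v (φ n) x * u x) atTop (𝓝 (Λ f Df u)) := by
      rw [tendsto_iff_edist_tendsto_0]
      have h3 := ENNReal.Tendsto.const_mul (ENNReal.Tendsto.mul_const hφ (Or.inr hu)) (Or.inr (ofReal_ne_top (r := C * A)))
      refine tendsto_of_tendsto_of_tendsto_of_le_of_le tendsto_const_nhds
        (by simpa using h3) (fun _ => zero_le) fun n => ?_
      rw [edist_comm, edist_eq_enorm_sub, hv]
      exact hsub hf hD (hφp n) (hDφ n) u
    exact tendsto_nhds_unique t1 t2
  refine ⟨V, hVp.1, ?_, hg.integrable_wt_mul h0 h1 hpq hf, ?_, fun u => ?_⟩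
  · refine eLpNorm_le_of_pairing hpq (hVp.locallyIntegrable hp1)
      (mul_ne_top ofReal_ne_top hf.2.ne) fun u => ?_
    rw [hpair, mul_assoc]
    exact H g h A hg f Df hf hD u
  · obtain ⟨k, hk⟩ := hD.tempered
    have hkm := aestronglyMeasurable_of_weight hk
    refine ⟨k + 1, ?_⟩
    simp only [smul_add]
    refine Integrable.add ?_ ?_
    · refine (hk.norm.const_mul K).mono' ((continuous_weight _).aestronglyMeasurable.smul
        (hg.cont.aestronglyMeasurable.mul hkm)) (.of_forall fun x => ?_)
      have hx : 1 ≤ 1 + |x| := by linarith [abs_nonneg x]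
      rw [norm_smul, norm_smul, norm_mul, norm_of_nonneg (by positivity : 0 ≤ ((1 + |x|) ^ k)⁻¹),
        norm_of_nonneg (by positivity : 0 ≤ ((1 + |x|) ^ (k + 1))⁻¹)]
      calc ((1 + |x|) ^ (k + 1))⁻¹ * (‖g x‖ * ‖Df x‖) ≤ ((1 + |x|) ^ (k + 1))⁻¹ * ((K * (1 + |x|)) * ‖Df x‖) := by
            gcongr
            exact kg x
        _ = _ := by rw [pow_succ]; field_simp
    · refine (hVp.norm.integrable_mul (memLp_inv_one_add_abs hpq.symm.lt)).mono'
        ((continuous_weight _).aestronglyMeasurable.smul hVp.1) (.of_forall fun x => ?_)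
      have hx : 1 ≤ 1 + |x| := by linarith [abs_nonneg x]
      rw [norm_smul, norm_of_nonneg (by positivity : 0 ≤ ((1 + |x|) ^ (k + 1))⁻¹), mul_comm, Pi.mul_apply]
      gcongr
      exact le_self_pow₀ hx (by simp)
  · have i3 := i2 hD u
    have e : ∀ x, (g x * Df x + V x) * u x = Df x * (g x * u x) + V x * u x := fun x => by ring
    simp only [e, mul_assoc]
    rw [integral_add i3 (hVu u), hpair]
    simp only [hΛ]
    ring

/-- The bounded derivative provides a continuous representative of g, to which the commutator bound
applies; the change on a null set affects neither the product as a distribution nor the norm. -/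
lemma exists_fracDeriv_mul {α : ℝ} (h0 : 0 < α) (h1 : α < 1) {p : ℝ≥0∞} (hp : 1 < p) (hp' : p < ∞) :
    ∃ C : ℝ≥0, ∀ f g Df Dg : ℝ → ℂ, MemLp f p → IsFracDeriv α f Df → IsFracDeriv α g Dg →
      ∀ A : ℝ, (∀ᵐ y, ‖Dg y‖ ≤ A) → ∃ Dfg : ℝ → ℂ, IsFracDeriv α (fun x => f x * g x) Dfg ∧
        AEStronglyMeasurable (fun x => Dfg x - g x * Df x) ∧
        eLpNorm (fun x => Dfg x - g x * Df x) p ≤ C * ofReal A * eLpNorm f p := by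
  have e : ofReal p.toReal = p := ofReal_toReal hp'.ne
  have hp1 : 1 < p.toReal := by rwa [← ENNReal.toReal_one, ENNReal.toReal_lt_toReal ENNReal.one_ne_top hp'.ne]
  obtain ⟨C, hC, H⟩ := exists_commutator h0 h1 (HolderConjugate.conjExponent hp1)
  rw [e] at H
  refine ⟨C.toNNReal, fun f g Df Dg hf hD hg A hA => ?_⟩
  obtain ⟨g₀, hgg, hg₀⟩ := hg.exists_bddFracDeriv h0 h1 hA
  obtain ⟨V, hVm, hV, hfd⟩ := H g₀ Dg A hg₀ f Df hf hD
  have ev : V =ᵐ[volume] fun x => (g₀ x * Df x + V x) - g x * Df x := by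
    filter_upwards [hgg] with x hx
    rw [hx]; ring
  refine ⟨_, hfd.congr ?_, hVm.congr ev, ?_⟩
  · filter_upwards [hgg] with x hx
    rw [hx]
  · rw [← eLpNorm_congr_ae ev]
    rwa [ofReal_mul hC.le] at hV

/-- The fractional Leibniz rule for bounded `D^α g`. -/
lemma exists_fracDeriv_leibniz {α : ℝ} (h0 : 0 < α) (h1 : α < 1) {p : ℝ≥0∞} (hp : 1 < p) (hp' : p < ∞) :
    ∃ C : ℝ≥0, ∀ f g Df Dg : ℝ → ℂ, MemLp f p → IsFracDeriv α f Df → IsFracDeriv α g Dg →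
      eLpNorm Dg ∞ < ∞ → ∃ Dfg : ℝ → ℂ, IsFracDeriv α (fun x => f x * g x) Dfg ∧
        eLpNorm (fun x => Dfg x - g x * Df x - f x * Dg x) p ≤ C * eLpNorm Dg ∞ * eLpNorm f p := by
  obtain ⟨C, H⟩ := exists_fracDeriv_mul h0 h1 hp hp'
  refine ⟨C + 1, fun f g Df Dg hf hD hg hb => ?_⟩
  have hA : ∀ᵐ y, ‖Dg y‖ ≤ (eLpNorm Dg ∞).toReal := by
    filter_upwards [ae_le_eLpNormEssSup (f := Dg) (μ := volume)] with y hy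
    rw [← eLpNorm_exponent_top] at hy
    rw [← toReal_enorm]
    exact toReal_mono hb.ne hy
  obtain ⟨Dfg, hfd, hm, hle⟩ := H f g Df Dg hf hD hg _ hA
  rw [ofReal_toReal hb.ne] at hle
  refine ⟨Dfg, hfd, (eLpNorm_sub_le hm (hf.1.mul (Tempered.aestronglyMeasurable hg.tempered)) hp.le).trans ?_⟩
  have h2 : eLpNorm (fun x => f x * Dg x) p ≤ eLpNorm Dg ∞ * eLpNorm f p := by
    have := eLpNorm_le_mul_eLpNorm_of_ae_le_mul (f := fun x => f x * Dg x) (g := f) (p := p) (μ := volume)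
      (c := (eLpNorm Dg ∞).toReal) (by
        filter_upwards [hA] with x hx
        rw [norm_mul, mul_comm]; gcongr)
    rwa [ofReal_toReal hb.ne] at this
  refine (add_le_add hle h2).trans_eq ?_
  push_cast; ring

/-! ### Low-pass kernels and the bound of D^α g by its Littlewood-Paley pieces. -/

/-- The low-pass symbol associated with a Littlewood-Paley decomposition. -/
lemma IsDyadicBump.exists_low_pass {η : ℝ → ℂ} (hη : IsDyadicBump η) : ∃ χ : ℝ → ℂ, ContDiff ℝ (⊤ : ℕ∞) χ ∧
    HasCompactSupport χ ∧ χ 0 = 1 ∧ ∀ ξ, η ξ + η (-ξ) = χ ξ - χ (2 * ξ) := by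
  set m : ℝ → ℂ := fun ξ => η ξ + η (-ξ) with hm
  have hη0 : ∀ ξ, (ξ < 1 / 2 ∨ 2 < ξ) → η ξ = 0 := fun ξ h => by
    refine image_eq_zero_of_notMem_tsupport fun hmem => ?_
    have := hη.support_subset hmem
    rcases h with h | h <;> linarith [this.1, this.2]
  have hm0 : ∀ ξ, (|ξ| < 1 / 2 ∨ 2 < |ξ|) → m ξ = 0 := fun ξ h => by
    rw [hm]
    beta_reduce
    rcases le_total 0 ξ with h1 | h1
    · rw [abs_of_nonneg h1] at h
      rw [hη0 ξ h, hη0 (-ξ) (Or.inl (by linarith)), add_zero]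
    · rw [abs_of_nonpos h1] at h
      rw [hη0 (-ξ) h, hη0 ξ (Or.inl (by linarith)), add_zero]
  have hmc : ContDiff ℝ (⊤ : ℕ∞) m := hη.contDiff.add (hη.contDiff.comp contDiff_neg)
  -- In this range of |ξ| only the scales N = 0, 1, 2 can contribute to the partition of unity.
  have hsum : ∀ ξ, 1 < |ξ| → |ξ| < 4 → m ξ + m (ξ / 2) + m (ξ / 4) = 1 := fun ξ h1 h4 => by
    have hs := hη.hasSum_one ξ (by rintro rfl; simp at h1; linarith)
    have h3 : HasSum (fun N : ℤ => m (ξ / 2 ^ N)) (∑ N ∈ ({0, 1, 2} : Finset ℤ), m (ξ / 2 ^ N)) := by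
      refine hasSum_sum_of_ne_finset_zero fun N hN => hm0 _ ?_
      rw [abs_div, abs_of_pos (by positivity : (0 : ℝ) < 2 ^ N)]
      simp only [Finset.mem_insert, Finset.mem_singleton, not_or] at hN
      rcases lt_or_ge N 0 with h | h
      · right
        have : (2 : ℝ) ^ N ≤ 2 ^ (-1 : ℤ) := zpow_le_zpow_right₀ one_le_two (by omega)
        rw [zpow_neg_one] at this
        rw [lt_div_iff₀ (by positivity)]
        linarith
      · left
        have : (2 : ℝ) ^ (3 : ℤ) ≤ 2 ^ N := zpow_le_zpow_right₀ one_le_two (by omega)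
        rw [div_lt_iff₀ (by positivity)]
        norm_num at this ⊢
        linarith
    have := hs.unique h3
    rw [Finset.sum_insert (by simp), Finset.sum_insert (by simp), Finset.sum_singleton] at this
    norm_num at this
    rw [this]; ring
  let κ : ContDiffBump (0 : ℝ) := ⟨3, 4, by norm_num, by norm_num⟩
  -- The low-pass symbol is the sum of m(ξ/2^N) over N ≤ 0, that is, 1 minus the sum over N ≥ 1. For
  -- |ξ| < 4 only N = 1 and N = 2 remain in the latter, so this finite formula shows smoothness at
  -- zero; the cutoff removes the region |ξ| ≥ 4.
  set χ : ℝ → ℂ := fun ξ => (κ ξ : ℂ) * (1 - m (ξ / 2) - m (ξ / 4)) with hχ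
  have hκ1 : ∀ ξ, |ξ| ≤ 3 → χ ξ = 1 - m (ξ / 2) - m (ξ / 4) := fun ξ h => by
    rw [hχ]
    beta_reduce
    rw [κ.one_of_mem_closedBall (by simpa using h), ofReal_one, one_mul]
  have hχ0 : ∀ ξ, 2 < |ξ| → χ ξ = 0 := fun ξ h => by
    rw [hχ]
    beta_reduce
    rcases lt_or_ge |ξ| 4 with h4 | h4
    · have := hsum ξ (by linarith) h4
      rw [hm0 ξ (Or.inr h), zero_add] at this
      rw [sub_sub, this, sub_self, mul_zero]
    · rw [κ.zero_of_le_dist (by simpa using h4), Complex.ofReal_zero, zero_mul]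
  refine ⟨χ, ?_, ?_, ?_, fun ξ => ?_⟩
  · exact (ofRealCLM.contDiff.comp κ.contDiff).mul ((contDiff_const.sub (hmc.comp (contDiff_id.div_const 2))).sub
      (hmc.comp (contDiff_id.div_const 4)))
  · exact (κ.hasCompactSupport.comp_left (g := fun r : ℝ => (r : ℂ)) (by simp)).mul_right
  · rw [hκ1 0 (by simp), zero_div, zero_div, hm0 0 (Or.inl (by simp)), sub_zero, sub_zero]
  · change m ξ = _
    have e2 : 2 * ξ / 2 = ξ := by ring
    have e4 : 2 * ξ / 4 = ξ / 2 := by ring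
    have a2 : |2 * ξ| = 2 * |ξ| := by rw [abs_mul, abs_two]
    have a4 : |ξ / 4| = |ξ| / 4 := by rw [abs_div]; norm_num
    rcases le_or_gt |ξ| 1 with h1 | h1
    · rw [hκ1 ξ (by linarith), hκ1 (2 * ξ) (by linarith), e2, e4, hm0 (ξ / 4) (Or.inl (by linarith))]; ring
    · rw [hχ0 (2 * ξ) (by linarith)]
      rcases le_or_gt |ξ| 2 with h2 | h2
      · rw [hκ1 ξ (by linarith), ← hsum ξ h1 (by linarith)]; ring
      · rw [hχ0 ξ h2, hm0 ξ (Or.inr h2), sub_zero]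

/-- The `L¹`-normalised dilation `c φ(c x)`. -/
noncomputable def dilS (c : ℝ) (hc : 0 < c) (φ : 𝒮) : 𝒮 :=
  c • SchwartzMap.compCLMOfContinuousLinearEquiv ℂ (ContinuousLinearEquiv.unitsEquivAut ℝ (Units.mk0 c hc.ne')) φ

lemma dilS_apply (c : ℝ) (hc : 0 < c) (φ : 𝒮) (x : ℝ) : dilS c hc φ x = c • φ (c * x) := by
  rw [mul_comm]; rfl

/-- The kernel of `Q_N` is the difference of two consecutive dilations of a low-pass kernel. -/
lemma IsDyadicBump.exists_low_pass_kernel {η : ℝ → ℂ} (hη : IsDyadicBump η) : ∃ Θ : 𝒮, ∫ x, Θ x = 1 ∧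
    ∀ (N : ℤ) x, lpKernel η N x = dilS (2 ^ N) (by positivity) Θ x - dilS (2 ^ (N - 1)) (by positivity) Θ x := by
  obtain ⟨χ, hχ, hχc, hχ1, hχm⟩ := hη.exists_low_pass
  have hcs : HasCompactSupport fun ζ : ℝ => χ (2 * π * ζ) := hχc.comp_homeomorph (Homeomorph.mulLeft₀ (2 * π) (by positivity))
  have hsm : ContDiff ℝ (⊤ : ℕ∞) fun ζ : ℝ => χ (2 * π * ζ) := hχ.comp (contDiff_const.mul contDiff_id)
  set X : 𝒮 := hcs.toSchwartzMap hsm with hX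
  have hXa : ∀ ζ, X ζ = χ (2 * π * ζ) := fun ζ => rfl
  have e : ∀ x, (𝓕⁻ X) x = ∫ ζ, Complex.exp ((2 * π * (ζ * x) : ℝ) * I) * X ζ := fun x => by
    rw [SchwartzMap.fourierInv_coe, fourierInv_real]
  have hdil : ∀ (c : ℝ) (hc : 0 < c) x, dilS c hc (𝓕⁻ X) x = ∫ ζ, Complex.exp ((2 * π * (ζ * x) : ℝ) * I) * X (ζ / c) := fun c hc x => by
    have := Measure.integral_comp_div (fun ζ => Complex.exp ((2 * π * (ζ * (c * x)) : ℝ) * I) * X ζ) c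
    rw [abs_of_pos hc] at this
    rw [dilS_apply, e, ← this]
    refine integral_congr_ae (.of_forall fun ζ => ?_)
    beta_reduce
    rw [← mul_assoc (ζ / c), div_mul_cancel₀ _ hc.ne']
  refine ⟨𝓕⁻ X, ?_, fun N x => ?_⟩
  · have h1 : 𝓕 (𝓕⁻ X) = X := FourierTransform.fourier_fourierInv_eq X
    have h2 := congrArg (fun φ : 𝒮 => φ 0) h1
    simp only [SchwartzMap.fourier_coe, Real.fourier_eq] at h2
    simpa [hXa, hχ1] using h2
  · have hi : ∀ c : ℝ, 0 < c → Integrable fun ζ => Complex.exp ((2 * π * (ζ * x) : ℝ) * I) * X (ζ / c) := fun c hc => by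
      refine (X.integrable.comp_div hc.ne').bdd_mul (c := 1) (Continuous.aestronglyMeasurable (by fun_prop))
        (.of_forall fun ζ => ?_)
      rw [norm_exp_ofReal_mul_I]
    rw [hdil, hdil, ← integral_sub (hi _ (by positivity)) (hi _ (by positivity)), lpKernel, fourierInv_real]
    refine integral_congr_ae (.of_forall fun ζ => ?_)
    beta_reduce
    rw [hχm, hXa, hXa, ← mul_sub]
    have e1 : 2 * π * (ζ / 2 ^ N) = 2 * π * ζ / 2 ^ N := by ring
    have e2 : 2 * π * (ζ / 2 ^ (N - 1)) = 2 * (2 * π * ζ / 2 ^ N) := by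
      rw [zpow_sub_one₀ two_ne_zero]; field_simp
    rw [e1, e2]

/-- Convolution with a dilated low-pass kernel. -/
noncomputable def lowPass (Θ : 𝒮) (c : ℝ) (v : ℝ → ℂ) (x : ℝ) : ℂ := ∫ y, (c • Θ (c * (x - y))) * v y

lemma lowPass_eq (Θ : 𝒮) {c : ℝ} (hc : 0 < c) (v : ℝ → ℂ) (x : ℝ) : lowPass Θ c v x = ∫ y, v y * reflS x (dilS c hc Θ) y :=
  integral_congr_ae (.of_forall fun y => by beta_reduce; rw [reflS_apply, dilS_apply, mul_comm])

lemma lpProj_eq {η : ℝ → ℂ} {Θ : 𝒮}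
    (hΘ : ∀ (N : ℤ) x, lpKernel η N x = dilS (2 ^ N) (by positivity) Θ x - dilS (2 ^ (N - 1)) (by positivity) Θ x)
    {v : ℝ → ℂ} (hv : Tempered v) (N : ℤ) (x : ℝ) :
    lpProj η N v x = lowPass Θ (2 ^ N) v x - lowPass Θ (2 ^ (N - 1)) v x := by
  rw [lowPass_eq Θ (by positivity), lowPass_eq Θ (by positivity),
    ← integral_sub (hv.integrable_mul_schwartz _) (hv.integrable_mul_schwartz _)]
  refine integral_congr_ae (.of_forall fun y => ?_)
  beta_reduce
  rw [hΘ, reflS_apply, reflS_apply]; ring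

/-- Telescoping: the difference of two dyadic low-pass operators is a finite sum of distinct pieces
Q_N. -/
lemma enorm_lowPass_sub_le {η : ℝ → ℂ} {Θ : 𝒮}
    (hΘ : ∀ (N : ℤ) x, lpKernel η N x = dilS (2 ^ N) (by positivity) Θ x - dilS (2 ^ (N - 1)) (by positivity) Θ x)
    {v : ℝ → ℂ} (hv : Tempered v) (M : ℤ) (n : ℕ) (x : ℝ) :
    ‖lowPass Θ (2 ^ M) v x - lowPass Θ (2 ^ (M - n)) v x‖ₑ ≤ ∑' N : ℤ, ‖lpProj η N v x‖ₑ := by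
  have e : lowPass Θ (2 ^ M) v x - lowPass Θ (2 ^ (M - n)) v x = ∑ i ∈ Finset.range n, lpProj η (M - i) v x := by
    have := Finset.sum_range_sub' (fun i : ℕ => lowPass Θ (2 ^ (M - i)) v x) n
    simp only [Nat.cast_zero, sub_zero] at this
    rw [← this]
    refine Finset.sum_congr rfl fun i _ => ?_
    rw [lpProj_eq hΘ hv]
    push_cast; rw [sub_sub]
  rw [e]
  refine (enorm_sum_le _ _).trans ((ENNReal.sum_le_tsum _).trans ?_)
  exact ENNReal.tsum_comp_le_tsum_of_injective (f := fun i : ℕ => M - i) (fun i j h => by simpa using h)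
    fun N => ‖lpProj η N v x‖ₑ

/-- A function with a primitive `g` of order `α` has no mass at frequency zero. -/
lemma IsFracDeriv.tendsto_lowPass_zero {α : ℝ} (h0 : 0 < α) (h1 : α < 1) {g h : ℝ → ℂ} (hg : IsFracDeriv α g h)
    (Θ : 𝒮) (x : ℝ) : Tendsto (fun c => lowPass Θ c h x) (𝓝[>] 0) (𝓝 0) := by
  obtain ⟨C, hC, hb⟩ := norm_fracDeriv_le h0 h1 Θ
  have hcont := continuous_fracDeriv h0 h1 Θ
  -- Moving D^α to the dilated kernel gains the factor c^α in addition to the normalisation c; this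
  -- is what forces the limit to vanish.
  have e : ∀ c, 0 < c → lowPass Θ c h x = ∫ y, g y * ((c ^ α * c : ℝ) • 𝒟 α Θ (c * (x - y))) := fun c hc => by
    rw [lowPass_eq Θ hc, hg.pairing]
    refine integral_congr_ae (.of_forall fun y => ?_)
    beta_reduce
    rw [fracDeriv_reflS h0 h1, fracDeriv_dilate h0 h1 (inv_pos.2 hc) (φ := Θ) (a := c)
      (fun z => by rw [dilS_apply, div_inv_eq_mul, mul_comm z]), div_inv_eq_mul, inv_rpow hc.le,
      rpow_neg hc.le, inv_inv, mul_comm (x - y) c]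
  have hm : ∀ c : ℝ, AEStronglyMeasurable fun y => g y * ((c ^ α * c : ℝ) • 𝒟 α Θ (c * (x - y))) := fun c =>
    (aestronglyMeasurable_of_wt hg.integrable_weight.1).mul
      (by fun_prop : Continuous fun y => (c ^ α * c : ℝ) • 𝒟 α Θ (c * (x - y))).aestronglyMeasurable
  have ht : Tendsto (fun c => ∫ y, g y * ((c ^ α * c : ℝ) • 𝒟 α Θ (c * (x - y)))) (𝓝[>] 0)
      (𝓝 (∫ _y : ℝ, (0 : ℂ))) := by
    refine tendsto_integral_filter_of_dominated_convergence (fun y => C * (wt α x)⁻¹ * ‖wt α y • g y‖)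
      (.of_forall hm) ?_ (hg.integrable_weight.norm.const_mul _) (.of_forall fun y => ?_)
    · filter_upwards [self_mem_nhdsWithin, mem_nhdsWithin_of_mem_nhds (Iio_mem_nhds one_pos)] with c (hc : 0 < c) (hc1 : c < 1)
      refine .of_forall fun y => ?_
      -- With z = x - y the left side is (1/c + |z|)^(-1-α), which is at most (1 + |z|)^(-1-α) for c
      -- < 1.
      have hw : c ^ α * c * wt α (c * (x - y)) ≤ wt α (x - y) := by
        have e1 : c ^ α * c = (c⁻¹) ^ (-(1 + α)) := by
          rw [inv_rpow hc.le, ← rpow_neg hc.le, neg_neg, rpow_add hc, rpow_one, mul_comm]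
        rw [wt, wt, e1, ← mul_rpow (by positivity) (by positivity)]
        refine rpow_le_rpow_of_nonpos (by positivity) ?_ (by linarith)
        rw [abs_mul, abs_of_pos hc, mul_add, inv_mul_cancel_left₀ hc.ne', mul_one]
        linarith [(one_le_inv₀ hc).2 hc1.le]
      rw [norm_mul, norm_smul, norm_smul, norm_of_nonneg (wt_pos α y).le, norm_of_nonneg (by positivity)]
      calc ‖g y‖ * (c ^ α * c * ‖𝒟 α Θ (c * (x - y))‖)
          ≤ ‖g y‖ * (c ^ α * c * (C * wt α (c * (x - y)))) := by gcongr; exact hb _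
        _ = C * ‖g y‖ * (c ^ α * c * wt α (c * (x - y))) := by ring
        _ ≤ C * ‖g y‖ * ((wt α x)⁻¹ * wt α y) := mul_le_mul_of_nonneg_left (hw.trans (wt_sub h0 x y)) (by positivity)
        _ = _ := by ring
    · have h3 : Continuous fun c : ℝ => g y * ((c ^ α * c : ℝ) • 𝒟 α Θ (c * (x - y))) := by
        have : Continuous fun c : ℝ => c ^ α := Real.continuous_rpow_const h0.le
        fun_prop
      have h4 := (h3.tendsto 0).mono_left (nhdsWithin_le_nhds (s := Ioi 0))
      simpa using h4
  rw [integral_zero] at ht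
  exact ht.congr' (by filter_upwards [self_mem_nhdsWithin] with c hc using (e c hc).symm)

lemma integral_lowPass_mul (Θ φ : 𝒮) {c : ℝ} (hc : 0 < c) {v : ℝ → ℂ} (hv : Tempered v) : Integrable (fun x => lowPass Θ c v x * φ x) ∧
    ∫ x, lowPass Θ c v x * φ x = ∫ y, v y * ∫ s, Θ s * φ (y + s / c) := by
  have hvm := hv.aestronglyMeasurable
  obtain ⟨k, hk⟩ := hv
  obtain ⟨C, hC, hΘ⟩ := schwartz_decay (dilS c hc Θ) k
  obtain ⟨D, hD, hφ⟩ := schwartz_decay φ (k + 2)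
  have hi : Integrable (uncurry fun x y => ((c • Θ (c * (x - y))) * v y) * φ x) (volume.prod volume) := by
    have hdom := (integrable_weight_two.const_mul (C * D)).mul_prod hk.norm
    have hm : AEStronglyMeasurable (uncurry fun x y => ((c • Θ (c * (x - y))) * v y) * φ x)
        ((volume : Measure ℝ).prod volume) :=
      ((by fun_prop : Continuous fun p : ℝ × ℝ => c • Θ (c * (p.1 - p.2))).aestronglyMeasurable.mul hvm.comp_snd).mul
        (φ.continuous.comp continuous_fst).aestronglyMeasurable
    refine hdom.mono' hm (.of_forall fun p => ?_)
    obtain ⟨x, y⟩ := p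
    simp only [uncurry_apply_pair]
    have h2 : (1 + |y|) ≤ (1 + |x - y|) * (1 + |x|) := by
      have : |y| ≤ |x - y| + |x| := by
        have := abs_sub_abs_le_abs_sub y x
        rw [abs_sub_comm] at this; linarith
      nlinarith [abs_nonneg (x - y), abs_nonneg x]
    have h3 : ((1 + |x - y|) ^ k)⁻¹ * ((1 + |x|) ^ k)⁻¹ ≤ ((1 + |y|) ^ k)⁻¹ := by
      rw [← mul_inv, ← mul_pow]
      gcongr
    rw [norm_mul, norm_mul, norm_smul _ (v y), norm_of_nonneg (by positivity : 0 ≤ ((1 + |y|) ^ k)⁻¹), ← dilS_apply c hc]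
    calc ‖dilS c hc Θ (x - y)‖ * ‖v y‖ * ‖φ x‖
        ≤ (C * ((1 + |x - y|) ^ k)⁻¹) * ‖v y‖ * (D * ((1 + |x|) ^ (k + 2))⁻¹) := by
          gcongr
          exacts [hΘ _, hφ _]
      _ = C * D * ((1 + |x|) ^ 2)⁻¹ * (((1 + |x - y|) ^ k)⁻¹ * ((1 + |x|) ^ k)⁻¹ * ‖v y‖) := by
          rw [pow_add, mul_inv]; ring
      _ ≤ C * D * ((1 + |x|) ^ 2)⁻¹ * (((1 + |y|) ^ k)⁻¹ * ‖v y‖) := by gcongr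
  have e1 : ∀ x, lowPass Θ c v x * φ x = ∫ y, ((c • Θ (c * (x - y))) * v y) * φ x := fun x => by
    rw [integral_mul_const]; rfl
  simp only [e1]
  refine ⟨hi.integral_prod_left, ?_⟩
  rw [integral_integral_swap hi]
  refine integral_congr_ae (.of_forall fun y => ?_)
  beta_reduce
  have h4 := Measure.integral_comp_mul_left (fun s => Θ s * φ (y + s / c)) c
  rw [abs_of_pos (inv_pos.2 hc)] at h4
  have h5 : ∫ s, Θ s * φ (y + s / c) = c • ∫ x, Θ (c * x) * φ (y + c * x / c) := by
    rw [h4, smul_smul, mul_inv_cancel₀ hc.ne', one_smul]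
  rw [h5, ← integral_smul, ← integral_const_mul, ← integral_add_right_eq_self _ y]
  refine integral_congr_ae (.of_forall fun x => ?_)
  beta_reduce
  rw [mul_div_cancel_left₀ _ hc.ne', add_sub_cancel_right, add_comm x y]
  simp only [real_smul]; ring

/-- The approximate identity acts on the test function, where Peetre's inequality supplies a
majorant independent of n. -/
lemma tendsto_integral_lowPass_mul {Θ : 𝒮} (hΘ : ∫ x, Θ x = 1) (φ : 𝒮) {v : ℝ → ℂ} (hv : Tempered v) :
    Tendsto (fun n : ℕ => ∫ x, lowPass Θ (2 ^ (n : ℤ)) v x * φ x) atTop (𝓝 (∫ x, v x * φ x)) := by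
  simp only [fun n : ℕ => (integral_lowPass_mul Θ φ (c := 2 ^ (n : ℤ)) (by positivity) hv).2]
  have hvm := hv.aestronglyMeasurable
  obtain ⟨k, hk⟩ := hv
  obtain ⟨D, hD, hφ⟩ := schwartz_decay φ k
  have hΘi : Integrable fun s => (1 + |s|) ^ k * ‖Θ s‖ := integrable_mul_schwartz (m := fun x => (1 + |x|) ^ k) (by fun_prop) (C := 1) k
      (fun ζ => by rw [abs_of_nonneg (by positivity), one_mul]) Θ
  have hc1 : ∀ n : ℕ, (1 : ℝ) ≤ 2 ^ (n : ℤ) := fun n => by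
    rw [zpow_natCast]; exact one_le_pow₀ one_le_two
  have hpt : ∀ (n : ℕ) y s, ‖Θ s * φ (y + s / 2 ^ (n : ℤ))‖ ≤ D * ((1 + |y|) ^ k)⁻¹ * ((1 + |s|) ^ k * ‖Θ s‖) := fun n y s => by
    have h2 : (1 + |y|) ≤ (1 + |y + s / 2 ^ (n : ℤ)|) * (1 + |s|) := by
      have h3 : |s / 2 ^ (n : ℤ)| ≤ |s| := by
        rw [abs_div, abs_of_pos (by positivity : (0 : ℝ) < 2 ^ (n : ℤ))]
        exact div_le_self (abs_nonneg s) (hc1 n)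
      have : |y| ≤ |y + s / 2 ^ (n : ℤ)| + |s / 2 ^ (n : ℤ)| := by
        have := abs_sub (y + s / 2 ^ (n : ℤ)) (s / 2 ^ (n : ℤ))
        rwa [add_sub_cancel_right] at this
      nlinarith [abs_nonneg (y + s / 2 ^ (n : ℤ)), abs_nonneg s]
    have h4 : ((1 + |y + s / 2 ^ (n : ℤ)|) ^ k)⁻¹ ≤ ((1 + |y|) ^ k)⁻¹ * (1 + |s|) ^ k := by
      rw [inv_mul_eq_div, le_div_iff₀ (by positivity), inv_mul_le_iff₀ (by positivity), ← mul_pow]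
      gcongr
    rw [norm_mul]
    calc ‖Θ s‖ * ‖φ (y + s / 2 ^ (n : ℤ))‖ ≤ ‖Θ s‖ * (D * (((1 + |y|) ^ k)⁻¹ * (1 + |s|) ^ k)) := by
          gcongr; exact (hφ _).trans (by gcongr)
      _ = _ := by ring
  have hlim : Tendsto (fun n : ℕ => (2 ^ (n : ℤ) : ℝ)) atTop atTop := by
    simp only [zpow_natCast]; exact tendsto_pow_atTop_atTop_of_one_lt one_lt_two
  refine tendsto_integral_of_dominated_convergence
    (fun y => D * (∫ s, (1 + |s|) ^ k * ‖Θ s‖) * ‖((1 + |y|) ^ k)⁻¹ • v y‖) (fun n => hvm.mul ?_) (hk.norm.const_mul _)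
    (fun n => .of_forall fun y => ?_) (.of_forall fun y => ?_)
  · exact (by fun_prop : Continuous fun p : ℝ × ℝ => Θ p.2 * φ (p.1 + p.2 / 2 ^ (n : ℤ))).stronglyMeasurable.integral_prod_right.aestronglyMeasurable
  · have h2 := norm_integral_le_of_norm_le (hΘi.const_mul (D * ((1 + |y|) ^ k)⁻¹)) (.of_forall (hpt n y))
    rw [integral_const_mul] at h2
    rw [norm_mul, norm_smul, norm_of_nonneg (by positivity : 0 ≤ ((1 + |y|) ^ k)⁻¹)]
    nlinarith [mul_le_mul_of_nonneg_left h2 (norm_nonneg (v y))]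
  · have e : φ y = ∫ s, Θ s * φ y := by rw [integral_mul_const, hΘ, one_mul]
    rw [e]
    refine (tendsto_integral_of_dominated_convergence _ (fun n => ?_) (hΘi.const_mul (D * ((1 + |y|) ^ k)⁻¹))
      (fun n => .of_forall (hpt n y)) (.of_forall fun s => ?_)).const_mul (v y)
    · exact (by fun_prop : Continuous fun s => Θ s * φ (y + s / 2 ^ (n : ℤ))).aestronglyMeasurable
    · have h3 : Tendsto (fun n : ℕ => y + s / 2 ^ (n : ℤ)) atTop (𝓝 (y + 0)) := (hlim.const_div_atTop s).const_add y
      rw [add_zero] at h3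
      exact ((φ.continuous.tendsto y).comp h3).const_mul _

/-- Test against translated mollifiers, which have L¹ norm one and recover v almost everywhere. -/
lemma norm_le_of_integral_schwartz {v : ℝ → ℂ} (hv : LocallyIntegrable v) {B : ℝ}
    (h : ∀ φ : 𝒮, ‖∫ x, v x * φ x‖ ≤ B * ∫ x, ‖φ x‖) : ∀ᵐ x, ‖v x‖ ≤ B := by
  obtain ⟨k, hk, hae, -⟩ := exists_mollifiers
  filter_upwards [hae hv] with x hx
  refine le_of_tendsto hx.norm (.of_forall fun n => ?_)
  have hk' : ContDiff ℝ (⊤ : ℕ∞) fun t => (k n t : ℂ) := ofRealCLM.contDiff.comp (hk n).1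
  have hc' : HasCompactSupport fun t => (k n t : ℂ) := (hk n).2.1.comp_left (g := fun r : ℝ => (r : ℂ)) (by simp)
  set φ := reflS x (hc'.toSchwartzMap hk') with hφ
  have e : ∀ y, φ y = (k n (x - y) : ℂ) := fun y => reflS_apply _ _ _
  have e1 : mollify (k n) v x = ∫ y, v y * φ y := by
    rw [mollify, ← integral_sub_left_eq_self _ volume x]
    refine integral_congr_ae (.of_forall fun y => ?_)
    beta_reduce
    rw [e, sub_sub_cancel, real_smul, mul_comm]
  have e2 : ∫ y, ‖φ y‖ = 1 := by
    simp only [e, norm_real, norm_of_nonneg ((hk n).2.2.1 _)]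
    rw [integral_sub_left_eq_self (k n) volume x, (hk n).2.2.2]
  rw [e1]
  simpa [e2] using h φ

/-- `L^∞ l¹` control of the Littlewood-Paley pieces of `D^α g` bounds `D^α g` itself. -/
lemma IsFracDeriv.ae_norm_le_normLinftyLr {α : ℝ} (h0 : 0 < α) (h1 : α < 1) {η : ℝ → ℂ} (hη : IsDyadicBump η) {g h : ℝ → ℂ}
    (hg : IsFracDeriv α g h) (hB : normLinftyLr 1 (fun N => lpProj η N h) < ∞) :
    ∀ᵐ x, ‖h x‖ ≤ (normLinftyLr 1 fun N => lpProj η N h).toReal := by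
  obtain ⟨Θ, hΘ1, hΘ⟩ := hη.exists_low_pass_kernel
  set B := normLinftyLr 1 fun N => lpProj η N h with hBdef
  have hT : Tempered h := hg.tempered
  have hsum : ∀ᵐ x, ∑' N : ℤ, ‖lpProj η N h x‖ₑ ≤ B := by
    have := ENNReal.ae_le_essSup (μ := (volume : Measure ℝ)) fun x => (∑' N : ℤ, ‖lpProj η N h x‖ₑ ^ (1 : ℝ)) ^ (1 / (1 : ℝ))
    simpa [normLinftyLr, hBdef] using this
  -- Since low-pass parts of D^α g vanish in the limit of frequency zero, the part below 2^M is the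
  -- sum of the Q_N with N ≤ M, at most the full l¹ sum at the point. Letting M tend to infinity in
  -- the weak sense then recovers D^α g.
  have hlow : ∀ᵐ x, ∀ M : ℤ, ‖lowPass Θ (2 ^ M) h x‖ ≤ B.toReal := by
    filter_upwards [hsum] with x hx M
    have hc : Tendsto (fun n : ℕ => (2 : ℝ) ^ (M - n)) atTop (𝓝[>] 0) := by
      refine tendsto_nhdsWithin_iff.2 ⟨?_, .of_forall fun n => (by positivity : (0 : ℝ) < 2 ^ (M - n))⟩
      have := (tendsto_pow_atTop_nhds_zero_of_lt_one (by norm_num : (0 : ℝ) ≤ 2⁻¹) (by norm_num)).const_mul ((2 : ℝ) ^ M)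
      rw [mul_zero] at this
      refine this.congr fun n => ?_
      rw [zpow_sub₀ two_ne_zero, zpow_natCast, inv_pow]; rfl
    have ht := ((hg.tendsto_lowPass_zero h0 h1 Θ x).comp hc).const_sub (lowPass Θ (2 ^ M) h x)
    rw [sub_zero] at ht
    refine le_of_tendsto ht.norm (.of_forall fun n => ?_)
    rw [← toReal_enorm]
    exact toReal_mono hB.ne ((enorm_lowPass_sub_le hΘ hT M n x).trans hx)
  refine norm_le_of_integral_schwartz hT.locallyIntegrable fun φ => ?_
  refine le_of_tendsto (tendsto_integral_lowPass_mul hΘ1 φ hT).norm (.of_forall fun n => ?_)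
  rw [← integral_const_mul]
  refine norm_integral_le_of_norm_le (φ.integrable.norm.const_mul _) ?_
  filter_upwards [hlow] with x hx
  rw [norm_mul]
  exact mul_le_mul_of_nonneg_right (hx n) (norm_nonneg _)

theorem lemma4p2 (η : ℝ → ℂ) (hη : IsDyadicBump η) (α : ℝ) (hα0 : 0 < α) (hα1 : α < 1) :
    (∀ p : ℝ≥0∞, 1 < p → p < ⊤ → ∃ C : ℝ≥0, ∀ f g Df Dg : ℝ → ℂ,
      MemLp f p volume → IsFracDeriv α f Df → IsFracDeriv α g Dg →
      normLinftyLr 2 (fun N => lpProj η N Dg) < ⊤ → eLpNorm Dg ⊤ volume < ⊤ →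
      ∃ Dfg : ℝ → ℂ, IsFracDeriv α (fun x => f x * g x) Dfg ∧
        eLpNorm (fun x => Dfg x - g x * Df x - f x * Dg x) p volume ≤
          C * (normLinftyLr 2 (fun N => lpProj η N Dg) + eLpNorm Dg ⊤ volume) *
            eLpNorm f p volume) ∧
    (∃ C : ℝ≥0, ∀ f g Df Dg : ℝ → ℂ,
      MemLp f 2 volume → IsFracDeriv α f Df → IsFracDeriv α g Dg →
      normLinftyLr 1 (fun N => lpProj η N Dg) < ⊤ →
      ∃ Dfg : ℝ → ℂ, IsFracDeriv α (fun x => f x * g x) Dfg ∧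
        eLpNorm (fun x => Dfg x - g x * Df x) 2 volume ≤
          C * normLinftyLr 1 (fun N => lpProj η N Dg) * eLpNorm f 2 volume) := by
  refine ⟨fun p hp hp' => ?_, ?_⟩
  · obtain ⟨C, H⟩ := exists_fracDeriv_leibniz hα0 hα1 hp hp'
    refine ⟨C, fun f g Df Dg hf hD hg _ hb => ?_⟩
    obtain ⟨Dfg, hfd, hle⟩ := H f g Df Dg hf hD hg hb
    refine ⟨Dfg, hfd, hle.trans ?_⟩
    gcongr
    exact le_add_self
  · obtain ⟨C, H⟩ := exists_fracDeriv_mul hα0 hα1 (p := 2) (by norm_num) (by norm_num)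
    refine ⟨C, fun f g Df Dg hf hD hg hB => ?_⟩
    -- The l¹ norm dominates ‖D^α g‖_∞ and serves as the bound A in the commutator estimate; no term
    -- f D^α g has to be subtracted.
    obtain ⟨Dfg, hfd, -, hle⟩ := H f g Df Dg hf hD hg _ (hg.ae_norm_le_normLinftyLr hα0 hα1 hη hB)
    rw [ENNReal.ofReal_toReal hB.ne] at hle
    exact ⟨Dfg, hfd, hle⟩
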